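/- Conventions. Locally compact groups and spaces are Hausdorff; $ds,dt,\dots$ denote left Haar measures and $\Delta$ the modular function, normalized by $\int f(sr)\,ds=\Delta(r)^{-1}\int f(s)\,ds$. For a $C^*$-algebra $A$, $\operatorname{Aut}A$ is its group of $*$-automorphisms with the topology of pointwise norm convergence. For a strongly continuous action $\alpha$ of $G$ on $B$, $B\rtimes_\alpha G$ is the full crossed product, a completion of $C_c(G,B)$. Symmetric imprimitivity data $({}_KP_L,A,\sigma,\eta)$ consist of locally compact groups $K,L$, a locally compact space $P$ with commuting continuous free and proper actions of $K$ on the left and $L$ on the right, and commuting strongly continuous actions $\sigma:K\to\operatorname{Aut}A$, $\eta:L\to\operatorname{Aut}A$ on a $C^*$-algebra $A$. The induced algebra $\operatorname{Ind}_L^P\eta$ consists of the $f\in C_b(P,A)$ with $f(p\cdot t)=\eta_t^{-1}(f(p))$ and $(pL\mapsto\|f(p)\|)\in C_0(P/L)$; $\operatorname{Ind}_K^P\sigma$ consists of the $f\in C_b(P,A)$ with $f(s\cdot p)=\sigma_s(f(p))$ and $(Kp\mapsto\|f(p)\|)\in C_0(K\backslash P)$. They carry the actions $(\sigma\otimes\mathrm{lt})_s(f)(p)=\sigma_s(f(s^{-1}\cdot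 p))$ of $K$ and $(\eta\otimes\mathrm{rt})_t(f)(p)=\eta_t(f(p\cdot t))$ of $L$. The bimodule $W(P)=W({}_KP_L,A,\sigma,\eta)$ is the $(\operatorname{Ind}_L^P\eta\rtimes_{\sigma\otimes\mathrm{lt}}K)$--$(\operatorname{Ind}_K^P\sigma\rtimes_{\eta\otimes\mathrm{rt}}L)$ imprimitivity bimodule obtained by completing $C_c(P,A)$ for \begin{align*} (c\cdot x)(p)&=\int_K c(s,p)\,\sigma_s(x(s^{-1}\cdot p))\,\Delta_K(s)^{1/2}\,ds,\\ (x\cdot b)(p)&=\int_L\eta_t\bigl(x(p\cdot t)\,b(t^{-1},p\cdot t)\bigr)\Delta_L(t)^{-1/2}\,dt,\\ {}_*\langle x,y\rangle(s,p)&=\Delta_K(s)^{-1/2}\int_L\eta_t\bigl(x(p\cdot t)\,\sigma_s(y(s^{-1}\cdot p\cdot t)^*)\bigr)\,dt,\\ \langle x,y\rangle_*(t,p)&=\Delta_L(t)^{-1/2}\int_K\sigma_s\bigl(x(s^{-1}\cdot p)^*\,\eta_t(y(s^{-1}\cdot p\cdot t))\bigr)\,ds \end{align*} for $x,y\in C_c(P,A)$,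 $c\in C_c(K,\operatorname{Ind}_L^P\eta)$, $b\in C_c(L,\operatorname{Ind}_K^P\sigma)$. If $X$ and $Y$ are imprimitivity bimodules and $\Phi$ is an isomorphism of the right coefficient algebra of $X$ onto the left coefficient algebra of $Y$, then $X\otimes_\Phi Y$ is their internal tensor product balanced over $\Phi$, so that $\langle x\otimes y,x'\otimes y'\rangle_*=\langle y,\Phi(\langle x,x'\rangle_*)\cdot y'\rangle_*$ and ${}_*\langle x\otimes y,x'\otimes y'\rangle={}_*\langle x\cdot\Phi^{-1}({}_*\langle y,y'\rangle),x'\rangle$. Theorem. Let $({}_KP_L,A,\sigma,\eta)$ and $({}_LQ_G,A,\zeta,\tau)$ be symmetric imprimitivity data. Let $\phi:K\backslash P\to Q/G$ be a homeomorphism with $\phi(K\cdot p\cdot t)=t^{-1}\cdot\phi(K\cdot p)$ for all $t\in L$, $p\in P$, and let $\widetilde\sigma:P\to\operatorname{Aut}A$ and $\widetilde\tau:Q\to\operatorname{Aut}A$ be continuous maps such that, for all $p\in P$, $q\in Q$, $k\in K$, $m\in G$, $t\in L$, \[ \widetilde\sigma_{k\cdot p\cdot t}=\sigma_k\widetilde\sigma_p\zeta_t,\qquad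 \widetilde\tau_{t\cdot q\cdot m}=\eta_t\widetilde\tau_q\tau_m, \] and such that each of $\zeta$, $\sigma$, $\widetilde\sigma$ commutes with each of $\eta$, $\widetilde\tau$, $\tau$. Let $P\times_\phi Q=\{(p,q)\in P\times Q:\phi(K\cdot p)=q\cdot G\}$ and $P\#Q=(P\times_\phi Q)/L$, where $(p,q)\cdot t=(p\cdot t,t^{-1}\cdot q)$, and write $[p,q]$ for the class of $(p,q)$. Then: (1) $P\#Q$ is a locally compact Hausdorff space, and $k\cdot[p,q]=[k\cdot p,q]$ and $[p,q]\cdot m=[p,q\cdot m]$ define commuting continuous, free and proper actions of $K$ and $G$ on it; thus $({}_K(P\#Q)_G,A,\sigma,\tau)$ is symmetric imprimitivity data. (2) There are equivariant isomorphisms $T:\operatorname{Ind}_K^P\sigma\to\operatorname{Ind}_G^Q\tau$, $\phi_\sigma:\operatorname{Ind}_K^{P\#Q}\sigma\to\operatorname{Ind}_L^Q\zeta$ and $\phi_\tau:\operatorname{Ind}_G^{P\#Q}\tau\to\operatorname{Ind}_L^P\eta$ given, whenever $\phi(K\cdot p)=q\cdot G$, by \[ T(f)(q)=\widetilde\tau_q^{-1}\widetilde\sigma_p^{-1}(f(p)),\quad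 \phi_\sigma(f)(q)=\widetilde\sigma_p^{-1}(f([p,q])),\quad \phi_\tau(f)(p)=\widetilde\tau_q(f([p,q])), \] and they induce isomorphisms of crossed products \begin{gather*} \Phi=T\rtimes L:\operatorname{Ind}_K^P\sigma\rtimes_{\eta\otimes\mathrm{rt}}L\to\operatorname{Ind}_G^Q\tau\rtimes_{\zeta\otimes\mathrm{lt}}L,\\ \Phi_\sigma=\phi_\sigma\rtimes G:\operatorname{Ind}_K^{P\#Q}\sigma\rtimes_{\tau\otimes\mathrm{rt}}G\to\operatorname{Ind}_L^Q\zeta\rtimes_{\tau\otimes\mathrm{rt}}G,\\ \Phi_\tau=\phi_\tau\rtimes K:\operatorname{Ind}_G^{P\#Q}\tau\rtimes_{\sigma\otimes\mathrm{lt}}K\to\operatorname{Ind}_L^P\eta\rtimes_{\sigma\otimes\mathrm{lt}}K. \end{gather*} (3) The imprimitivity bimodules $W(P)$, $W(Q)$, $W(P\#Q)$ and $W(P)\otimes_\Phi W(Q)$ exist, and there is an isomorphism of imprimitivity bimodules from $W(P\#Q)$ onto $W(P)\otimes_\Phi W(Q)$ with coefficient maps $\Phi_\tau$ (left) and $\Phi_\sigma$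 (right): a linear bijection that intertwines both actions and both inner products by way of $\Phi_\tau$ and $\Phi_\sigma$. -/

import Mathlib

open MeasureTheory
open scoped CompactlySupported BoundedContinuousFunction ZeroAtInfty ENNReal

universe u

noncomputable section

namespace SymImp

/-! Right actions.  A right action of a group `L` on a space is recorded throughout by the
equivalent left action `t • p = p · t⁻¹`; thus `p · t` is written `t⁻¹ • p`. -/

/-- The automorphism group `Aut A` of a C⋆-algebra, under composition. -/
abbrev Aut (A : Type u) [NonUnitalCStarAlgebra A] : Type u := A ≃⋆ₐ[ℂ] A

/-- The orbit space of a group action, with the quotient topology. -/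
abbrev OrbitSpace (H X : Type u) [Group H] [MulAction H X] : Type u :=
  Quotient (MulAction.orbitRel H X)

/-- The orbit of a point. -/
abbrev orb (H : Type u) {X : Type u} [Group H] [MulAction H X] (x : X) : OrbitSpace H X :=
  Quotient.mk (MulAction.orbitRel H X) x

theorem orb_smul (H : Type u) {X : Type u} [Group H] [MulAction H X] (h : H) (x : X) :
    orb H (h • x) = orb H x :=
  Quotient.sound ⟨h, rfl⟩

theorem orb_eq_iff {H X : Type u} [Group H] [MulAction H X] {x y : X} :
    orb H x = orb H y ↔ ∃ h : H, h • y = x := by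
  constructor
  · intro h
    exact Quotient.exact h
  · rintro ⟨h, rfl⟩
    exact orb_smul H h y

theorem norm_aut {A : Type u} [NonUnitalCStarAlgebra A] (θ : Aut A) (a : A) : ‖θ a‖ = ‖a‖ :=
  NonUnitalStarAlgHom.norm_map θ θ.injective a

/-! ### Crossed products -/

section CrossedProduct

variable {B G : Type u} [NonUnitalCStarAlgebra B] [Group G] [TopologicalSpace G]

/-- A covariant representation `(π, U)` of `(B, G, α)` on a Hilbert space: a
⋆-representation `π` of `B` (possibly degenerate) and a strongly continuous unitary
representation `U` of `G` with `π (α_s b) = U_s π(b) U_s^*`. -/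
structure CovariantRep (α : G →* Aut B) : Type (u + 1) where
  H : Type u
  [normedAddCommGroup : NormedAddCommGroup H]
  [innerProductSpace : InnerProductSpace ℂ H]
  [completeSpace : CompleteSpace H]
  π : B →⋆ₙₐ[ℂ] (H →L[ℂ] H)
  U : G →* unitary (H →L[ℂ] H)
  continuous_U : ∀ ξ : H, Continuous fun s => (U s : H →L[ℂ] H) ξ
  covariant : ∀ (s : G) (b : B),
    π (α s b) = (U s : H →L[ℂ] H) * π b * star (U s : H →L[ℂ] H)

attribute [instance] CovariantRep.normedAddCommGroup CovariantRep.innerProductSpace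
  CovariantRep.completeSpace

namespace CovariantRep

variable {α : G →* Aut B}

theorem norm_integrand_le (ρ : CovariantRep α) (f : C_c(G, B)) (ξ : ρ.H) (s : G) :
    ‖ρ.π (f s) ((ρ.U s : ρ.H →L[ℂ] ρ.H) ξ)‖ ≤ ‖f s‖ * ‖ξ‖ := by
  have h1 : ‖ρ.π (f s)‖ ≤ ‖f s‖ := NonUnitalStarAlgHom.norm_apply_le ρ.π (f s)
  have h2 : ‖(ρ.U s : ρ.H →L[ℂ] ρ.H) ξ‖ = ‖ξ‖ := Unitary.norm_map (ρ.U s) ξ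
  calc _ ≤ ‖ρ.π (f s)‖ * ‖(ρ.U s : ρ.H →L[ℂ] ρ.H) ξ‖ := ContinuousLinearMap.le_opNorm _ _
    _ ≤ _ := by rw [h2]; gcongr

variable [IsTopologicalGroup G] [LocallyCompactSpace G] [MeasurableSpace G] [BorelSpace G]

theorem integrable_integrand (ρ : CovariantRep α) (f : C_c(G, B)) (ξ : ρ.H) :
    Integrable (fun s => ρ.π (f s) ((ρ.U s : ρ.H →L[ℂ] ρ.H) ξ)) Measure.haar := by
  have hπ : Continuous ρ.π :=
    AddMonoidHomClass.continuous_of_bound ρ.π 1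
      (fun b => by simpa using NonUnitalStarAlgHom.norm_apply_le ρ.π b)
  refine Continuous.integrable_of_hasCompactSupport
    ((hπ.comp f.continuous).clm_apply (ρ.continuous_U ξ)) ?_
  refine f.hasCompactSupport.mono fun s hs => ?_
  contrapose! hs
  simp only [Function.mem_support, not_not] at hs ⊢
  simp [hs]

/-- The integrated form `(π ⋊ U)(f) = ∫_G π(f(s)) U_s ds`, as a strong integral. -/
def integrated (ρ : CovariantRep α) (f : C_c(G, B)) : ρ.H →L[ℂ] ρ.H :=
  LinearMap.mkContinuous
    { toFun := fun ξ => ∫ s, ρ.π (f s) ((ρ.U s : ρ.H →L[ℂ] ρ.H) ξ) ∂Measure.haar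
      map_add' := fun ξ ζ => by
        simp only [map_add]
        exact integral_add (ρ.integrable_integrand f ξ) (ρ.integrable_integrand f ζ)
      map_smul' := fun c ξ => by
        simp only [map_smul, RingHom.id_apply]
        exact integral_smul c _ }
    (∫ s, ‖f s‖ ∂Measure.haar)
    (fun ξ => by
      have hf : Integrable (fun s => ‖f s‖ * ‖ξ‖) (Measure.haar (G := G)) :=
        (f.continuous.integrable_of_hasCompactSupport f.hasCompactSupport).norm.mul_const _
      calc _ ≤ ∫ s, ‖f s‖ * ‖ξ‖ ∂Measure.haar :=
            norm_integral_le_of_norm_le hf (Filter.Eventually.of_forall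
              fun s => ρ.norm_integrand_le f ξ s)
        _ = _ := integral_mul_const _ _)

theorem norm_integrated_le (ρ : CovariantRep α) (f : C_c(G, B)) :
    ‖ρ.integrated f‖ ≤ ∫ s, ‖f s‖ ∂Measure.haar :=
  LinearMap.mkContinuous_norm_le _ (integral_nonneg fun _ => norm_nonneg _) _

end CovariantRep

variable [IsTopologicalGroup G] [LocallyCompactSpace G] [MeasurableSpace G] [BorelSpace G]

/-- The direct sum of the integrated forms of all covariant representations. -/
def universalRep (α : G →* Aut B) (f : C_c(G, B)) :
    lp (fun ρ : CovariantRep α => ρ.H →L[ℂ] ρ.H) ∞ :=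
  ⟨fun ρ => ρ.integrated f, memℓp_infty
    ⟨∫ s, ‖f s‖ ∂Measure.haar, by rintro _ ⟨ρ, rfl⟩; exact ρ.norm_integrated_le f⟩⟩

/-- The closed ⋆-subalgebra generated by the universal representation of `C_c(G, B)`. -/
def crossedProductSubalgebra (α : G →* Aut B) :
    NonUnitalStarSubalgebra ℂ (lp (fun ρ : CovariantRep α => ρ.H →L[ℂ] ρ.H) ∞) :=
  (NonUnitalStarAlgebra.adjoin ℂ (Set.range (universalRep α))).topologicalClosure

theorem isClosed_crossedProductSubalgebra (α : G →* Aut B) :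
    IsClosed (crossedProductSubalgebra α :
      Set (lp (fun ρ : CovariantRep α => ρ.H →L[ℂ] ρ.H) ∞)) :=
  NonUnitalStarSubalgebra.isClosed_topologicalClosure _

/-- The full crossed product `B ⋊_α G`: the completion of `C_c(G, B)` in the norm
`‖f‖ = sup ‖(π ⋊ U)(f)‖` over all covariant representations.  As every covariant representation
is a direct sum of a degenerate part and of cyclic ones, Hilbert spaces in the universe of `B`
and `G` suffice. -/
def CrossedProduct (α : G →* Aut B) : Type (u + 1) := crossedProductSubalgebra α

instance (α : G →* Aut B) : NonUnitalCStarAlgebra (CrossedProduct α) :=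
  haveI := isClosed_crossedProductSubalgebra α
  inferInstanceAs (NonUnitalCStarAlgebra (crossedProductSubalgebra α))

/-- The canonical map `C_c(G, B) → B ⋊_α G`. -/
def toCrossedProduct (α : G →* Aut B) (f : C_c(G, B)) : CrossedProduct α :=
  (⟨universalRep α f, NonUnitalStarSubalgebra.le_topologicalClosure _
    (NonUnitalStarAlgebra.subset_adjoin ℂ _ ⟨f, rfl⟩)⟩ : crossedProductSubalgebra α)

/-- `Ψ = ψ ⋊ G`: the isomorphism `ψ : B → B'` is equivariant and `Ψ` is the isomorphism of crossed
products that it induces, `Ψ(f) = ψ ∘ f` for `f ∈ C_c(G, B)`. -/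
def IsCrossedIso {B' : Type u} [NonUnitalCStarAlgebra B'] {α : G →* Aut B} {β : G →* Aut B'}
    (ψ : B ≃⋆ₐ[ℂ] B') (Ψ : CrossedProduct α ≃⋆ₐ[ℂ] CrossedProduct β) : Prop :=
  (∀ (s : G) (b : B), ψ (α s b) = β s (ψ b)) ∧
    ∀ f : C_c(G, B), ∃ g : C_c(G, B'),
      (∀ s, g s = ψ (f s)) ∧ Ψ (toCrossedProduct α f) = toCrossedProduct β g

end CrossedProduct

/-! ### Induced algebras -/

section Induced

variable {H X A : Type u} [Group H] [TopologicalSpace X] [MulAction H X]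
  [NonUnitalCStarAlgebra A]

/-- Membership in the induced algebra `Ind_H^X β`: `f(h • x) = β_h(f(x))` and
`(H • x ↦ ‖f(x)‖) ∈ C₀(H \ X)`. -/
def IsInduced (β : H →* Aut A) (f : X →ᵇ A) : Prop :=
  (∀ (h : H) (x : X), f (h • x) = β h (f x)) ∧
    ∃ g : C₀(OrbitSpace H X, ℝ), ∀ x, g (orb H x) = ‖f x‖

theorem isInduced_iff {β : H →* Aut A} {f : X →ᵇ A} :
    IsInduced β f ↔ (∀ (h : H) (x : X), f (h • x) = β h (f x)) ∧
      ∀ ε > 0, ∃ C : Set (OrbitSpace H X), IsCompact C ∧ ∀ x, orb H x ∉ C → ‖f x‖ < ε := by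
  refine and_congr_right fun hf => ⟨?_, fun h => ?_⟩
  · rintro ⟨g, hg⟩ ε hε
    have h1 := g.zero_at_infty'.eventually (Metric.ball_mem_nhds (0 : ℝ) hε)
    obtain ⟨C, hC, hCs⟩ := Filter.mem_cocompact.1 h1
    refine ⟨C, hC, fun x hx => ?_⟩
    have h2 : g (orb H x) ∈ Metric.ball (0 : ℝ) ε := hCs hx
    simpa [hg] using h2
  · let g0 : OrbitSpace H X → ℝ := Quotient.lift (fun x => ‖f x‖) (by
      rintro x y ⟨k, rfl⟩
      simp [hf, norm_aut])
    have hg0 : Continuous g0 := Continuous.quotient_lift f.continuous.norm _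
    refine ⟨⟨⟨g0, hg0⟩, ?_⟩, fun x => rfl⟩
    rw [Metric.tendsto_nhds]
    intro ε hε
    obtain ⟨C, hC, hCs⟩ := h ε hε
    refine Filter.mem_cocompact.2 ⟨C, hC, fun z hz => ?_⟩
    induction z using Quotient.inductionOn with
    | h x =>
      have h3 : ‖f x‖ < ε := hCs x hz
      change dist ‖f x‖ 0 < ε
      simpa using h3

/-- The induced algebra `Ind_H^X β`, a C⋆-subalgebra of `C_b(X, A)`. -/
def inducedSubalgebra (X : Type u) [TopologicalSpace X] [MulAction H X] (β : H →* Aut A) :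
    NonUnitalStarSubalgebra ℂ (X →ᵇ A) where
  carrier := {f | IsInduced β f}
  zero_mem' := isInduced_iff.2 ⟨by simp, fun ε hε => ⟨∅, isCompact_empty, fun _ _ => by simpa using hε⟩⟩
  add_mem' {f g} hf hg := by
    rw [Set.mem_ofPred_eq, isInduced_iff] at *
    refine ⟨fun h x => by simp [hf.1, hg.1], fun ε hε => ?_⟩
    obtain ⟨C, hC, hC'⟩ := hf.2 (ε / 2) (half_pos hε)
    obtain ⟨D, hD, hD'⟩ := hg.2 (ε / 2) (half_pos hε)
    refine ⟨C ∪ D, hC.union hD, fun x hx => ?_⟩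
    have h1 := hC' x fun h => hx (Or.inl h)
    have h2 := hD' x fun h => hx (Or.inr h)
    have h3 := norm_add_le (f x) (g x)
    rw [BoundedContinuousFunction.add_apply]
    linarith
  mul_mem' {f g} hf hg := by
    rw [Set.mem_ofPred_eq, isInduced_iff] at *
    refine ⟨fun h x => by simp [hf.1, hg.1], fun ε hε => ?_⟩
    have hM : 0 < ‖g‖ + 1 := by positivity
    obtain ⟨C, hC, hC'⟩ := hf.2 (ε / (‖g‖ + 1)) (div_pos hε hM)
    refine ⟨C, hC, fun x hx => ?_⟩
    have h1 := hC' x hx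
    have h2 : ‖g x‖ ≤ ‖g‖ + 1 := (g.norm_coe_le_norm x).trans (by linarith)
    calc ‖(f * g) x‖ ≤ ‖f x‖ * ‖g x‖ := norm_mul_le _ _
      _ ≤ ‖f x‖ * (‖g‖ + 1) := by gcongr
      _ < ε / (‖g‖ + 1) * (‖g‖ + 1) := by gcongr
      _ = ε := by field_simp
  smul_mem' c f hf := by
    rw [Set.mem_ofPred_eq, isInduced_iff] at *
    refine ⟨fun h x => by simp [hf.1], fun ε hε => ?_⟩
    have hM : 0 < ‖c‖ + 1 := by positivity
    obtain ⟨C, hC, hC'⟩ := hf.2 (ε / (‖c‖ + 1)) (div_pos hε hM)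
    refine ⟨C, hC, fun x hx => ?_⟩
    have h1 := hC' x hx
    calc ‖(c • f) x‖ = ‖c‖ * ‖f x‖ := norm_smul _ _
      _ ≤ (‖c‖ + 1) * ‖f x‖ := by gcongr; linarith
      _ < (‖c‖ + 1) * (ε / (‖c‖ + 1)) := by gcongr
      _ = ε := by field_simp
  star_mem' {f} hf := by
    rw [Set.mem_ofPred_eq, isInduced_iff] at *
    refine ⟨fun h x => by simp [hf.1, map_star], fun ε hε => ?_⟩
    obtain ⟨C, hC, hC'⟩ := hf.2 ε hε
    exact ⟨C, hC, fun x hx => by simpa using hC' x hx⟩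

theorem isClosed_inducedSubalgebra (X : Type u) [TopologicalSpace X] [MulAction H X]
    (β : H →* Aut A) : IsClosed (inducedSubalgebra X β : Set (X →ᵇ A)) := by
  refine isClosed_of_closure_subset fun f hf => ?_
  have key : ∀ ε > 0, ∃ g : X →ᵇ A, IsInduced β g ∧ ∀ x, ‖f x - g x‖ < ε := by
    intro ε hε
    obtain ⟨g, hg, hfg⟩ := Metric.mem_closure_iff.1 hf ε hε
    refine ⟨g, hg, fun x => ?_⟩
    rw [← dist_eq_norm]
    exact (BoundedContinuousFunction.dist_coe_le_dist x).trans_lt hfg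
  change IsInduced β f
  rw [isInduced_iff]
  constructor
  · intro h x
    refine eq_of_forall_dist_le fun ε hε => ?_
    obtain ⟨g, hg, hfg⟩ := key (ε / 2) (half_pos hε)
    have h1 := hfg (h • x)
    have h2 : ‖g (h • x) - β h (f x)‖ < ε / 2 := by
      rw [hg.1, ← map_sub, norm_aut, norm_sub_rev]
      exact hfg x
    rw [dist_eq_norm]
    have h3 := norm_sub_le_norm_sub_add_norm_sub (f (h • x)) (g (h • x)) (β h (f x))
    linarith
  · intro ε hε
    obtain ⟨g, hg, hfg⟩ := key (ε / 2) (half_pos hε)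
    obtain ⟨C, hC, hC'⟩ := (isInduced_iff.1 hg).2 (ε / 2) (half_pos hε)
    refine ⟨C, hC, fun x hx => ?_⟩
    have h1 := hC' x hx
    have h2 := hfg x
    have h3 := norm_le_norm_sub_add (f x) (g x)
    linarith

/-- The induced algebra `Ind_H^X β` as a type. -/
def Induced (X : Type u) [TopologicalSpace X] [MulAction H X] (β : H →* Aut A) : Type u :=
  inducedSubalgebra X β

instance (β : H →* Aut A) : NonUnitalCStarAlgebra (Induced X β) :=
  haveI := isClosed_inducedSubalgebra X β
  inferInstanceAs (NonUnitalCStarAlgebra (inducedSubalgebra X β))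

instance (β : H →* Aut A) : FunLike (Induced X β) X A where
  coe f := (f.1 : X →ᵇ A)
  coe_injective _ _ h := Subtype.ext (DFunLike.coe_injective h)

end Induced

/-! ### Commuting actions and the diagonal action on an induced algebra -/

/-- Actions `σ` of `K` and `η` of `L` on `A` that commute, over commuting actions of `K` and `L`
on a space `P`. -/
structure CommutingSystem (K L P A : Type u) [Group K] [Group L] [MulAction K P] [MulAction L P]
    [NonUnitalCStarAlgebra A] where
  σ : K →* Aut A
  η : L →* Aut A
  smul_comm : ∀ (s : K) (t : L) (p : P), s • t • p = t • s • p
  commute : ∀ (s : K) (t : L), Commute (σ s) (η t)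

namespace CommutingSystem

section

variable {K L P A : Type u} [Group K] [Group L] [MulAction K P] [MulAction L P]
  [NonUnitalCStarAlgebra A]

/-- Interchange the two groups. -/
def swap (D : CommutingSystem K L P A) : CommutingSystem L K P A where
  σ := D.η
  η := D.σ
  smul_comm t s p := (D.smul_comm s t p).symm
  commute t s := (D.commute s t).symm

variable [TopologicalSpace P]

/-- The induced algebra `Ind_L^P η`. -/
abbrev Ind (D : CommutingSystem K L P A) : Type u := Induced P D.η

variable [ContinuousConstSMul K P]

/-- `σ_s ⊗ lt_s` on functions: `p ↦ σ_s(f(s⁻¹ • p))`. -/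
def diagFun (D : CommutingSystem K L P A) (s : K) (f : P →ᵇ A) : P →ᵇ A :=
  BoundedContinuousFunction.ofNormedAddCommGroup (fun p => D.σ s (f (s⁻¹ • p)))
    ((AddMonoidHomClass.isometry_of_norm (D.σ s) (norm_aut (D.σ s))).continuous.comp
      (f.continuous.comp (continuous_const_smul s⁻¹)))
    ‖f‖ (fun p => by rw [norm_aut]; exact f.norm_coe_le_norm _)

theorem diagFun_apply (D : CommutingSystem K L P A) (s : K) (f : P →ᵇ A) (p : P) :
    D.diagFun s f p = D.σ s (f (s⁻¹ • p)) := rfl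

theorem isInduced_diagFun (D : CommutingSystem K L P A) (s : K) {f : P →ᵇ A}
    (hf : IsInduced D.η f) : IsInduced D.η (D.diagFun s f) := by
  rw [isInduced_iff] at *
  constructor
  · intro t p
    simp only [diagFun_apply]
    rw [D.smul_comm, hf.1]
    exact DFunLike.congr_fun (D.commute s t).eq _
  · intro ε hε
    obtain ⟨C, hC, hC'⟩ := hf.2 ε hε
    let m : OrbitSpace L P → OrbitSpace L P :=
      Quotient.map (fun p => s • p) (by
        rintro p q ⟨t, rfl⟩
        exact ⟨t, (D.smul_comm s t q).symm⟩)
    have hm : Continuous m := (continuous_const_smul s).quotient_map' _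
    refine ⟨m '' C, hC.image hm, fun p hp => ?_⟩
    rw [diagFun_apply, norm_aut]
    refine hC' _ fun hmem => hp ⟨_, hmem, ?_⟩
    change orb L (s • s⁻¹ • p) = orb L p
    rw [smul_inv_smul]

/-- The diagonal action `σ ⊗ lt` of `K` on `Ind_L^P η`. -/
def diag (D : CommutingSystem K L P A) : K →* Aut D.Ind where
  toFun s :=
    { toFun := fun f => (⟨D.diagFun s f.1, D.isInduced_diagFun s f.2⟩ : inducedSubalgebra P D.η)
      invFun := fun f =>
        (⟨D.diagFun s⁻¹ f.1, D.isInduced_diagFun s⁻¹ f.2⟩ : inducedSubalgebra P D.η)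
      left_inv := fun f => by
        refine Subtype.ext (BoundedContinuousFunction.ext fun p => ?_)
        change D.σ s⁻¹ (D.σ s (f.1 (s⁻¹ • s⁻¹⁻¹ • p))) = f.1 p
        rw [inv_inv, inv_smul_smul, map_inv]
        exact (D.σ s).symm_apply_apply _
      right_inv := fun f => by
        refine Subtype.ext (BoundedContinuousFunction.ext fun p => ?_)
        change D.σ s (D.σ s⁻¹ (f.1 (s⁻¹⁻¹ • s⁻¹ • p))) = f.1 p
        rw [inv_inv, smul_inv_smul, map_inv]
        exact (D.σ s).apply_symm_apply _
      map_mul' := fun f g => Subtype.ext (BoundedContinuousFunction.ext fun p =>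
        map_mul (D.σ s) (f.1 (s⁻¹ • p)) (g.1 (s⁻¹ • p)))
      map_add' := fun f g => Subtype.ext (BoundedContinuousFunction.ext fun p =>
        map_add (D.σ s) (f.1 (s⁻¹ • p)) (g.1 (s⁻¹ • p)))
      map_star' := fun f => Subtype.ext (BoundedContinuousFunction.ext fun p =>
        map_star (D.σ s) (f.1 (s⁻¹ • p)))
      map_smul' := fun c f => Subtype.ext (BoundedContinuousFunction.ext fun p =>
        map_smul (D.σ s) c (f.1 (s⁻¹ • p))) }
  map_one' := by
    refine StarAlgEquiv.ext fun f => Subtype.ext (BoundedContinuousFunction.ext fun p => ?_)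
    change D.σ 1 (f.1 ((1 : K)⁻¹ • p)) = f.1 p
    simp
  map_mul' s r := by
    refine StarAlgEquiv.ext fun f => Subtype.ext (BoundedContinuousFunction.ext fun p => ?_)
    change D.σ (s * r) (f.1 ((s * r)⁻¹ • p)) = D.σ s (D.σ r (f.1 (r⁻¹ • s⁻¹ • p)))
    rw [map_mul, mul_inv_rev, mul_smul]
    rfl

end

/-- `(_K P_L, A, σ, η)` is symmetric imprimitivity data: `P` is a locally compact Hausdorff space,
the commuting actions of `K` and `L` on `P` are continuous, free and proper, and `σ`, `η` are
(commuting) strongly continuous actions on the C⋆-algebra `A`. -/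
structure IsSymmetricImprimitivityData {K L P A : Type u} [Group K] [TopologicalSpace K]
    [Group L] [TopologicalSpace L] [TopologicalSpace P] [MulAction K P] [MulAction L P]
    [NonUnitalCStarAlgebra A] (D : CommutingSystem K L P A) : Prop where
  t2Space : T2Space P
  locallyCompactSpace : LocallyCompactSpace P
  continuous_left : ContinuousSMul K P
  continuous_right : ContinuousSMul L P
  free_left : IsCancelSMul K P
  free_right : IsCancelSMul L P
  proper_left : ProperSMul K P
  proper_right : ProperSMul L P
  continuous_σ : ∀ a : A, Continuous fun s => D.σ s a
  continuous_η : ∀ a : A, Continuous fun t => D.η t a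

end CommutingSystem

/-! ### Imprimitivity bimodules -/

/-- An `E`–`B` imprimitivity bimodule: a full left Hilbert `E`-module and full right Hilbert
`B`-module, complete in the common norm, with
`⟨a x, y⟩_B = ⟨x, a^* y⟩_B`, `_E⟨x b, y⟩ = _E⟨x, y b^*⟩` and `_E⟨x, y⟩ z = x ⟨y, z⟩_B`.
Here `lsmul a x = a x`, `rsmul x b = x b`, `linner x y = _E⟨x, y⟩` and `rinner x y = ⟨x, y⟩_B`. -/
structure ImprimitivityBimodule (E B : Type (u + 1)) [NonUnitalCStarAlgebra E]
    [NonUnitalCStarAlgebra B] : Type (u + 1) where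
  carrier : Type u
  [normedAddCommGroup : NormedAddCommGroup carrier]
  [normedSpace : NormedSpace ℂ carrier]
  [completeSpace : CompleteSpace carrier]
  lsmul : E →ₗ[ℂ] carrier →ₗ[ℂ] carrier
  rsmul : carrier →ₗ[ℂ] B →ₗ[ℂ] carrier
  linner : carrier →ₗ[ℂ] carrier →ₗ⋆[ℂ] E
  rinner : carrier →ₗ⋆[ℂ] carrier →ₗ[ℂ] B
  lsmul_mul : ∀ a a' x, lsmul (a * a') x = lsmul a (lsmul a' x)
  rsmul_mul : ∀ x b b', rsmul x (b * b') = rsmul (rsmul x b) b'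
  lsmul_rsmul : ∀ a x b, lsmul a (rsmul x b) = rsmul (lsmul a x) b
  linner_lsmul : ∀ a x y, linner (lsmul a x) y = a * linner x y
  rinner_rsmul : ∀ x y b, rinner x (rsmul y b) = rinner x y * b
  star_linner : ∀ x y, star (linner x y) = linner y x
  star_rinner : ∀ x y, star (rinner x y) = rinner y x
  linner_nonneg : ∀ x, ∃ a, linner x x = star a * a
  rinner_nonneg : ∀ x, ∃ b, rinner x x = star b * b
  norm_sq_eq_linner : ∀ x, ‖x‖ ^ 2 = ‖linner x x‖
  norm_sq_eq_rinner : ∀ x, ‖x‖ ^ 2 = ‖rinner x x‖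
  linner_full : Dense (Submodule.span ℂ {a | ∃ x y, a = linner x y} : Set E)
  rinner_full : Dense (Submodule.span ℂ {b | ∃ x y, b = rinner x y} : Set B)
  rinner_lsmul : ∀ a x y, rinner (lsmul a x) y = rinner x (lsmul (star a) y)
  linner_rsmul : ∀ x b y, linner (rsmul x b) y = linner x (rsmul y (star b))
  linner_lsmul_eq : ∀ x y z, lsmul (linner x y) z = rsmul x (rinner y z)

attribute [instance] ImprimitivityBimodule.normedAddCommGroup ImprimitivityBimodule.normedSpace
  ImprimitivityBimodule.completeSpace

namespace ImprimitivityBimodule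

variable {E E' B B' C : Type (u + 1)} [NonUnitalCStarAlgebra E] [NonUnitalCStarAlgebra E']
  [NonUnitalCStarAlgebra B] [NonUnitalCStarAlgebra B'] [NonUnitalCStarAlgebra C]

/-- An isomorphism of imprimitivity bimodules over isomorphisms `θ`, `ψ` of the coefficient
algebras.  Its existence says that the square with sides `X`, `θ`, `Y`, `ψ` commutes. -/
structure Iso (θ : E ≃⋆ₐ[ℂ] E') (ψ : B ≃⋆ₐ[ℂ] B') (X : ImprimitivityBimodule.{u} E B)
    (Y : ImprimitivityBimodule.{u} E' B') where
  toEquiv : X.carrier ≃ₗ[ℂ] Y.carrier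
  map_lsmul : ∀ a x, toEquiv (X.lsmul a x) = Y.lsmul (θ a) (toEquiv x)
  map_rsmul : ∀ x b, toEquiv (X.rsmul x b) = Y.rsmul (toEquiv x) (ψ b)
  map_linner : ∀ x y, Y.linner (toEquiv x) (toEquiv y) = θ (X.linner x y)
  map_rinner : ∀ x y, Y.rinner (toEquiv x) (toEquiv y) = ψ (X.rinner x y)

/-- `Z`, with the bilinear map `(x, y) ↦ x ⊗ y`, is the balanced tensor product `X ⊗_Φ Y` of an
`E`–`B` bimodule `X` and a `C`–`B'` bimodule `Y` along `Φ : B ≅ C`, that is, the completion of the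
algebraic tensor product in the usual inner products.  This determines `Z` up to isomorphism. -/
structure IsBalancedTensorProduct (Φ : B ≃⋆ₐ[ℂ] C) (X : ImprimitivityBimodule.{u} E B)
    (Y : ImprimitivityBimodule.{u} C B') (Z : ImprimitivityBimodule.{u} E B')
    (m : X.carrier →ₗ[ℂ] Y.carrier →ₗ[ℂ] Z.carrier) : Prop where
  dense : Dense (Submodule.span ℂ {z | ∃ x y, z = m x y} : Set Z.carrier)
  balanced : ∀ x b y, m (X.rsmul x b) y = m x (Y.lsmul (Φ b) y)
  lsmul : ∀ a x y, Z.lsmul a (m x y) = m (X.lsmul a x) y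
  rsmul : ∀ x y b, Z.rsmul (m x y) b = m x (Y.rsmul y b)
  linner : ∀ x y x' y',
    Z.linner (m x y) (m x' y') = X.linner (X.rsmul x (Φ.symm (Y.linner y y'))) x'
  rinner : ∀ x y x' y',
    Z.rinner (m x y) (m x' y') = Y.rinner y (Y.lsmul (Φ (X.rinner x x')) y')

end ImprimitivityBimodule

/-! ### Symmetric-imprimitivity bimodules -/

/-- The modular function with the usual normalization `∫ f(s r) ds = Δ(r)⁻¹ ∫ f(s) ds` for the left
Haar measure `ds`; it is the reciprocal of the one in Mathlib. -/
def modular {G : Type u} [Group G] [TopologicalSpace G] [IsTopologicalGroup G]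
    [LocallyCompactSpace G] (s : G) : ℝ :=
  ((Measure.modularCharacterFun s : NNReal) : ℝ)⁻¹

namespace CommutingSystem

variable {K L P A : Type u}
  [Group K] [TopologicalSpace K] [IsTopologicalGroup K] [LocallyCompactSpace K]
  [MeasurableSpace K] [BorelSpace K]
  [Group L] [TopologicalSpace L] [IsTopologicalGroup L] [LocallyCompactSpace L]
  [MeasurableSpace L] [BorelSpace L]
  [TopologicalSpace P] [MulAction K P] [MulAction L P]
  [NonUnitalCStarAlgebra A]

/-- `Ind_L^P η ⋊_{σ ⊗ lt} K`. -/
abbrev LeftAlg [ContinuousConstSMul K P] (D : CommutingSystem K L P A) : Type (u + 1) :=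
  CrossedProduct D.diag

/-- `Ind_K^P σ ⋊_{η ⊗ rt} L`. -/
abbrev RightAlg [ContinuousConstSMul L P] (D : CommutingSystem K L P A) : Type (u + 1) :=
  CrossedProduct D.swap.diag

/-- `W`, with `ι : C_c(P, A) → W`, is the symmetric-imprimitivity bimodule `W(_K P_L, A, σ, η)`:
the completion of `C_c(P, A)` for the actions and inner products
* `(c x)(p) = ∫_K c(s, p) σ_s(x(s⁻¹ · p)) Δ_K(s)^{1/2} ds`,
* `(x b)(p) = ∫_L η_t(x(p · t) b(t⁻¹, p · t)) Δ_L(t)^{-1/2} dt`,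
* `⟨x, y⟩_left (s, p) = Δ_K(s)^{-1/2} ∫_L η_t(x(p · t) σ_s(y(s⁻¹ · p · t)^*)) dt`,
* `⟨x, y⟩_right (t, p) = Δ_L(t)^{-1/2} ∫_K σ_s(x(s⁻¹ · p)^* η_t(y(s⁻¹ · p · t))) ds`.
This determines `W` up to isomorphism. -/
structure IsW [ContinuousConstSMul K P] [ContinuousConstSMul L P] (D : CommutingSystem K L P A)
    (W : ImprimitivityBimodule.{u} D.LeftAlg D.RightAlg) (ι : C_c(P, A) →ₗ[ℂ] W.carrier) :
    Prop where
  denseRange : DenseRange ι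
  lsmul : ∀ (c : C_c(K, D.Ind)) (x : C_c(P, A)), ∃ z : C_c(P, A),
    (∀ p, z p = ∫ s, modular s ^ (1 / 2 : ℝ) • (c s p * D.σ s (x (s⁻¹ • p))) ∂Measure.haar) ∧
    W.lsmul (toCrossedProduct D.diag c) (ι x) = ι z
  rsmul : ∀ (x : C_c(P, A)) (b : C_c(L, D.swap.Ind)), ∃ z : C_c(P, A),
    (∀ p, z p = ∫ t, modular t ^ (-(1 / 2) : ℝ) •
      D.η t (x (t⁻¹ • p) * b t⁻¹ (t⁻¹ • p)) ∂Measure.haar) ∧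
    W.rsmul (ι x) (toCrossedProduct D.swap.diag b) = ι z
  linner : ∀ x y : C_c(P, A), ∃ c : C_c(K, D.Ind),
    (∀ s p, c s p = modular s ^ (-(1 / 2) : ℝ) •
      ∫ t, D.η t (x (t⁻¹ • p) * D.σ s (star (y (s⁻¹ • t⁻¹ • p)))) ∂Measure.haar) ∧
    W.linner (ι x) (ι y) = toCrossedProduct D.diag c
  rinner : ∀ x y : C_c(P, A), ∃ b : C_c(L, D.swap.Ind),
    (∀ t p, b t p = modular t ^ (-(1 / 2) : ℝ) •
      ∫ s, D.σ s (star (x (s⁻¹ • p)) * D.η t (y (s⁻¹ • t⁻¹ • p))) ∂Measure.haar) ∧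
    W.rinner (ι x) (ι y) = toCrossedProduct D.swap.diag b

end CommutingSystem

/-! ### The space `P #_φ Q` -/

/-- An `L`-equivariant homeomorphism `φ : K \ P → Q / G`, that is, `φ(K · p · t) = t⁻¹ · φ(K · p)`:
if `φ(K · p) = q · G`, then `φ(K · (t • p)) = (t • q) · G`. -/
structure EquivariantHomeo (K L G P Q : Type u) [Group K] [Group L] [Group G]
    [TopologicalSpace P] [TopologicalSpace Q] [MulAction K P] [MulAction L P] [MulAction L Q]
    [MulAction G Q] where
  toHomeo : OrbitSpace K P ≃ₜ OrbitSpace G Q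
  equivariant : ∀ (t : L) (p : P) (q : Q),
    toHomeo (orb K p) = orb G q → toHomeo (orb K (t • p)) = orb G (t • q)

namespace EquivariantHomeo

variable {K L G P Q : Type u} [Group K] [Group L] [Group G]
  [TopologicalSpace P] [TopologicalSpace Q] [MulAction K P] [MulAction L P] [MulAction L Q]
  [MulAction G Q]

/-- The fibred product `P ×_φ Q = {(p, q) : φ(K · p) = q · G}`. -/
def FibreProduct (φ : EquivariantHomeo K L G P Q) : Type u :=
  {z : P × Q // φ.toHomeo (orb K z.1) = orb G z.2}

instance (φ : EquivariantHomeo K L G P Q) : TopologicalSpace φ.FibreProduct :=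
  inferInstanceAs (TopologicalSpace {z : P × Q // φ.toHomeo (orb K z.1) = orb G z.2})

/-- The diagonal action of `L`; as a right action it is `(p, q) · t = (p · t, t⁻¹ · q)`. -/
instance (φ : EquivariantHomeo K L G P Q) : MulAction L φ.FibreProduct where
  smul t z := ⟨(t • z.1.1, t • z.1.2), φ.equivariant t z.1.1 z.1.2 z.2⟩
  one_smul z := Subtype.ext (Prod.ext (one_smul L z.1.1) (one_smul L z.1.2))
  mul_smul s t z := Subtype.ext (Prod.ext (mul_smul s t z.1.1) (mul_smul s t z.1.2))

/-- `P #_φ Q = (P ×_φ Q) / L`, with the quotient topology. -/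
def Hash (φ : EquivariantHomeo K L G P Q) : Type u := OrbitSpace L φ.FibreProduct

instance (φ : EquivariantHomeo K L G P Q) : TopologicalSpace φ.Hash :=
  inferInstanceAs (TopologicalSpace (OrbitSpace L φ.FibreProduct))

/-- The class `[p, q]` in `P #_φ Q`. -/
def cls (φ : EquivariantHomeo K L G P Q) (p : P) (q : Q)
    (h : φ.toHomeo (orb K p) = orb G q) : φ.Hash :=
  orb L (⟨(p, q), h⟩ : φ.FibreProduct)

/-- `k · (p, q) = (k · p, q)` on `P ×_φ Q`. -/
def leftMap (φ : EquivariantHomeo K L G P Q) (k : K) (z : φ.FibreProduct) : φ.FibreProduct :=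
  ⟨(k • z.1.1, z.1.2), by rw [orb_smul]; exact z.2⟩

/-- `m • (p, q) = (p, m • q)` on `P ×_φ Q`. -/
def rightMap (φ : EquivariantHomeo K L G P Q) (m : G) (z : φ.FibreProduct) : φ.FibreProduct :=
  ⟨(z.1.1, m • z.1.2), by rw [orb_smul]; exact z.2⟩

/-- The action `k · [p, q] = [k · p, q]` of `K` on `P #_φ Q`. -/
instance instMulActionLeft [SMulCommClass K L P] (φ : EquivariantHomeo K L G P Q) :
    MulAction K φ.Hash where
  smul k := Quotient.map (φ.leftMap k) (by
    rintro z w ⟨t, rfl⟩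
    exact ⟨t, Subtype.ext (Prod.ext (smul_comm k t w.1.1).symm rfl)⟩)
  one_smul := by
    intro z
    induction z using Quotient.inductionOn with
    | h z => exact congrArg (orb L) (Subtype.ext (Prod.ext (one_smul K z.1.1) rfl))
  mul_smul := by
    intro k k' z
    induction z using Quotient.inductionOn with
    | h z => exact congrArg (orb L) (Subtype.ext (Prod.ext (mul_smul k k' z.1.1) rfl))

/-- The action `[p, q] · m = [p, q · m]` of `G` on `P #_φ Q`. -/
instance instMulActionRight [SMulCommClass L G Q] (φ : EquivariantHomeo K L G P Q) :
    MulAction G φ.Hash where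
  smul m := Quotient.map (φ.rightMap m) (by
    rintro z w ⟨t, rfl⟩
    exact ⟨t, Subtype.ext (Prod.ext rfl (smul_comm t m w.1.2))⟩)
  one_smul := by
    intro z
    induction z using Quotient.inductionOn with
    | h z => exact congrArg (orb L) (Subtype.ext (Prod.ext rfl (one_smul G z.1.2)))
  mul_smul := by
    intro m m' z
    induction z using Quotient.inductionOn with
    | h z => exact congrArg (orb L) (Subtype.ext (Prod.ext rfl (mul_smul m m' z.1.2)))

instance [SMulCommClass K L P] [ContinuousConstSMul K P] (φ : EquivariantHomeo K L G P Q) :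
    ContinuousConstSMul K φ.Hash where
  continuous_const_smul k := by
    have h : Continuous (φ.leftMap k) := by
      refine Continuous.subtype_mk ?_ _
      have h1 : Continuous fun z : φ.FibreProduct => z.1 := continuous_subtype_val
      fun_prop
    exact h.quotient_map' (s := MulAction.orbitRel L φ.FibreProduct)
      (t := MulAction.orbitRel L φ.FibreProduct) (by
        rintro z w ⟨t, rfl⟩
        exact ⟨t, Subtype.ext (Prod.ext (smul_comm k t w.1.1).symm rfl)⟩)

instance [SMulCommClass L G Q] [ContinuousConstSMul G Q] (φ : EquivariantHomeo K L G P Q) :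
    ContinuousConstSMul G φ.Hash where
  continuous_const_smul m := by
    have h : Continuous (φ.rightMap m) := by
      refine Continuous.subtype_mk ?_ _
      have h1 : Continuous fun z : φ.FibreProduct => z.1 := continuous_subtype_val
      fun_prop
    exact h.quotient_map' (s := MulAction.orbitRel L φ.FibreProduct)
      (t := MulAction.orbitRel L φ.FibreProduct) (by
        rintro z w ⟨t, rfl⟩
        exact ⟨t, Subtype.ext (Prod.ext rfl (smul_comm t m w.1.2))⟩)

end EquivariantHomeo

/-- The system `(_K (P #_φ Q)_G, A, σ, τ)` built from `(_K P_L, A, σ, η)` and `(_L Q_G, A, ζ, τ)`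
when `σ` and `τ` commute. -/
def CommutingSystem.hash {K L G P Q A : Type u} [Group K] [Group L] [Group G]
    [TopologicalSpace P] [TopologicalSpace Q] [MulAction K P] [MulAction L P] [MulAction L Q]
    [MulAction G Q] [SMulCommClass K L P] [SMulCommClass L G Q] [NonUnitalCStarAlgebra A]
    (D : CommutingSystem K L P A) (E : CommutingSystem L G Q A) (φ : EquivariantHomeo K L G P Q)
    (hστ : ∀ (k : K) (m : G), Commute (D.σ k) (E.η m)) : CommutingSystem K G φ.Hash A where
  σ := D.σ
  η := E.η
  smul_comm k m z := by
    induction z using Quotient.inductionOn with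
    | h z => rfl
  commute := hστ

end SymImp

end

open SymImp SymImp.ImprimitivityBimodule

open MeasureTheory
open scoped CompactlySupported BoundedContinuousFunction ZeroAtInfty ENNReal

set_option linter.unusedSectionVars false

noncomputable section

namespace SymImp

/-! ### Automorphisms: continuity and integrals -/

section Aut

variable {A : Type u} [NonUnitalCStarAlgebra A]

/-! The isomorphism is induced by the pairing of `x ∈ C_c(P, A)` with `y ∈ C_c(Q, A)` that sends
`[p, q]` to `∫_L τ'_{t⁻¹q}⁻¹(x(t⁻¹p)) σ'_{t⁻¹p}(y(t⁻¹q)) dt` (`Linking.pairing`), which plays the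
part of `x ⊗ y`. Two identities have to be computed. The pairing intertwines the left actions
(`pairing_lact`). It also carries the right inner product `⟨y, Φ(⟨x, x'⟩) y'⟩` of the tensor product
to the one of `W(P # Q)` (`yinn_pairing`, `rinn_pairing`). Both are Fubini arguments on compactly
supported functions.

Everything else is formal. If a bilinear map `m` into a bimodule `Z` satisfies these two identities,
the closed span `N` of its range is invariant under the left action, so `z ⟨m(x, y), m(x', y')⟩ =
⟨z, m(x, y)⟩ m(x', y')` lies in `N` for every `z`. Fullness of `X` and `Y` and nondegeneracy then
give `N = Z` (`dense_span_of_rinner`), and the remaining axioms of a balanced tensor product follow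
by testing on the range of `m`. Thus `W(P # Q)`, with coefficients transported along `Φ_τ` and
`Φ_σ`, is itself a balanced tensor product, and such products are unique
(`IsBalancedTensorProduct.nonempty_iso`).

The existence of `W(P)` is the analytic half. The map `x ↦ x^*` exchanges left and right, so only
the right inner product needs study. Its positivity in the full crossed product is shown in each
covariant representation `(π, U)`. The fixed-point-valued form `yinn x y = ∫_K σ_s((x^* y)(s⁻¹ p))
ds` is positive, so `π(yinn x y)` is the Gram kernel of maps `v x` into a Hilbert space. Since `L`
acts properly there is a cutoff `w` with `∫ Δ(r)⁻¹ w(r p)² dr = 1` on a given compact set, and the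
vectors `∫ Δ(r)^{-1/2} v(w · r x) U_r ξ dr` have Gram kernel `⟨ξ, (π ⋊ U)(⟨x, y⟩) ζ⟩`
(`inner_integral_localVec`). Representations can therefore be induced through `C_c(P, A)`:
multiplication by `Ind_L^P η` and the translation action of `K` become a covariant pair whose
integrated form is the left action (`exists_left_rep`). This yields positivity, the Cauchy–Schwarz
inequality, adjointness and boundedness together.

Fullness uses freeness: `(t, p) ↦ (p, t⁻¹ p)` is injective, so a module form of Stone–Weierstrass
makes the functions `x(p)^* η_t(y(t⁻¹ p))` span densely before averaging over `K` (`dense_rinnCP`).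
The axioms survive completion (`PreBimodule.exists_completion`).

The topology of `P # Q` and the maps `T`, `φ_σ`, `φ_τ` all come from the fibre product, which maps
to `P`, `Q` and `P # Q` by open quotient maps. Each of the three algebra isomorphisms is an instance
of `IndCorrespondence`. -/

theorem isometry_aut (θ : Aut A) : Isometry θ :=
  AddMonoidHomClass.isometry_of_norm θ (norm_aut θ)

theorem continuous_aut (θ : Aut A) : Continuous θ := (isometry_aut θ).continuous

theorem aut_inv_apply_self (θ : Aut A) (a : A) : θ⁻¹ (θ a) = a := θ.symm_apply_apply a

theorem aut_apply_inv_self (θ : Aut A) (a : A) : θ (θ⁻¹ a) = a := θ.apply_symm_apply a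

theorem aut_mul_apply (θ θ' : Aut A) (a : A) : (θ * θ') a = θ (θ' a) := rfl

theorem aut_comm {θ θ' : Aut A} (h : Commute θ θ') (a : A) : θ (θ' a) = θ' (θ a) :=
  DFunLike.congr_fun h.eq a

/-- Automorphisms are isometric, so `‖θ_y(f y) - θ_y(f x)‖ = ‖f y - f x‖`, and strong continuity of
`θ` is automatically joint continuity. -/
theorem continuous_aut_apply {X : Type*} [TopologicalSpace X] {θ : X → Aut A}
    (hθ : ∀ a, Continuous fun x => θ x a) {f : X → A} (hf : Continuous f) :
    Continuous fun x => θ x (f x) := by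
  rw [continuous_iff_continuousAt]
  intro x
  have h1 : Filter.Tendsto (fun y => θ y (f y - f x)) (nhds x) (nhds 0) := by
    rw [tendsto_zero_iff_norm_tendsto_zero]
    simp only [norm_aut]
    rw [← tendsto_zero_iff_norm_tendsto_zero]
    simpa using (hf.tendsto x).sub_const (f x)
  have h2 := h1.add ((hθ (f x)).tendsto x)
  simpa [ContinuousAt] using h2

/-- Isometry gives `‖θ_y⁻¹ a - θ_x⁻¹ a‖ = ‖a - θ_y(θ_x⁻¹ a)‖`, so inversion preserves strong
continuity. -/
theorem continuous_aut_inv {X : Type*} [TopologicalSpace X] {θ : X → Aut A}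
    (hθ : ∀ a, Continuous fun x => θ x a) (a : A) : Continuous fun x => (θ x)⁻¹ a := by
  rw [continuous_iff_continuousAt]
  intro x
  rw [ContinuousAt, tendsto_iff_norm_sub_tendsto_zero]
  have h1 : ∀ y, ‖(θ y)⁻¹ a - (θ x)⁻¹ a‖ = ‖a - θ y ((θ x)⁻¹ a)‖ := fun y => by
    rw [← norm_aut (θ y), map_sub, aut_apply_inv_self]
  simp only [h1]
  have h2 := ((hθ ((θ x)⁻¹ a)).tendsto x).const_sub a
  rw [aut_apply_inv_self, sub_self] at h2
  simpa using h2.norm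

/-- An automorphism as a continuous linear equivalence. -/
def autCLE (θ : Aut A) : A ≃L[ℂ] A where
  toFun := θ
  map_add' := map_add θ
  map_smul' := map_smul θ
  invFun := (θ⁻¹ : Aut A)
  left_inv := aut_inv_apply_self θ
  right_inv := aut_apply_inv_self θ
  continuous_toFun := continuous_aut θ
  continuous_invFun := continuous_aut (θ⁻¹ : Aut A)

theorem integral_aut {X : Type*} [MeasurableSpace X] {μ : Measure X} (θ : Aut A) (f : X → A) :
    ∫ x, θ (f x) ∂μ = θ (∫ x, f x ∂μ) :=
  (autCLE θ).integral_comp_comm f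

theorem integral_star' {X : Type*} [MeasurableSpace X] {μ : Measure X} (f : X → A) :
    ∫ x, star (f x) ∂μ = star (∫ x, f x ∂μ) :=
  (starL' ℝ : A ≃L[ℝ] A).integral_comp_comm f

theorem aut_real_smul (θ : Aut A) (r : ℝ) (a : A) : θ (r • a) = r • θ a := by
  have h := map_smul θ (r : ℂ) a
  simpa using h

end Aut

/-! ### Integrals of compactly supported continuous functions -/

section Integrals

variable {E : Type*} [NormedAddCommGroup E]

theorem integrable_of_compact {X : Type*} [TopologicalSpace X] [T2Space X] [MeasurableSpace X]
    [OpensMeasurableSpace X] {μ : Measure X} [IsFiniteMeasureOnCompacts μ] {f : X → E}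
    (hf : Continuous f) {C : Set X} (hC : IsCompact C) (h : ∀ x, x ∉ C → f x = 0) :
    Integrable f μ :=
  hf.integrable_of_hasCompactSupport (HasCompactSupport.intro hC (fun x hx => h x hx))

variable [NormedSpace ℝ E]

/-- The groups are not assumed σ-compact, so Fubini is applied only to jointly continuous integrands
that vanish off a product of compact sets. -/
theorem integral_swap_of_compact {X Y : Type*} [TopologicalSpace X] [T2Space X]
    [MeasurableSpace X] [OpensMeasurableSpace X] [TopologicalSpace Y] [T2Space Y]
    [MeasurableSpace Y] [OpensMeasurableSpace Y] {μ : Measure X} [IsFiniteMeasureOnCompacts μ]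
    {ν : Measure Y} [IsFiniteMeasureOnCompacts ν] {f : X → Y → E}
    (hf : Continuous fun z : X × Y => f z.1 z.2) {C : Set X} (hC : IsCompact C) {C' : Set Y}
    (hC' : IsCompact C') (h : ∀ x y, f x y ≠ 0 → x ∈ C ∧ y ∈ C') :
    ∫ x, ∫ y, f x y ∂ν ∂μ = ∫ y, ∫ x, f x y ∂μ ∂ν := by
  refine integral_integral_swap_of_hasCompactSupport hf
    (HasCompactSupport.intro (hC.prod hC') fun z hz => ?_)
  by_contra h0
  exact hz (h z.1 z.2 h0)

theorem continuous_integral_of_compact {X Y : Type*} [TopologicalSpace X]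
    [TopologicalSpace Y] [MeasurableSpace Y] [OpensMeasurableSpace Y]
    {ν : Measure Y} [IsFiniteMeasureOnCompacts ν] {f : X → Y → E}
    (hf : Continuous fun z : X × Y => f z.1 z.2)
    (h : ∀ x₀, ∃ N ∈ nhds x₀, ∃ C : Set Y, IsCompact C ∧ ∀ x ∈ N, ∀ y, y ∉ C → f x y = 0) :
    Continuous fun x => ∫ y, f x y ∂ν := by
  rw [continuous_iff_continuousAt]
  intro x₀
  obtain ⟨N, hN, C, hC, hz⟩ := h x₀
  exact (continuousOn_integral_of_compact_support (s := N) hC hf.continuousOn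
    (fun x y hx hy => hz x hx y hy)).continuousAt hN

end Integrals

/-! ### The modular function -/

section Modular

variable {G : Type u} [Group G] [TopologicalSpace G] [IsTopologicalGroup G]
  [LocallyCompactSpace G]

theorem modular_pos (s : G) : 0 < modular s :=
  inv_pos.2 (NNReal.coe_pos.2 (Measure.modularCharacterFun_pos s))

@[simp] theorem modular_one : modular (1 : G) = 1 := by
  simp [modular, Measure.modularCharacterFun_map_one]

@[simp] theorem modular_mul (s t : G) : modular (s * t) = modular s * modular t := by
  simp [modular, Measure.modularCharacterFun_map_mul, mul_comm]

@[simp] theorem modular_inv (s : G) : modular s⁻¹ = (modular s)⁻¹ := by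
  have h := modular_mul s s⁻¹
  rw [mul_inv_cancel, modular_one] at h
  exact eq_inv_of_mul_eq_one_right h.symm

theorem modular_rpow_mul_self (s : G) : modular s ^ (1 / 2 : ℝ) * modular s ^ (1 / 2 : ℝ) =
    modular s := by
  rw [← Real.rpow_add (modular_pos s)]; norm_num

variable [T2Space G] [MeasurableSpace G] [BorelSpace G]
  {E : Type*} [NormedAddCommGroup E] [NormedSpace ℝ E] [CompleteSpace E]

/-- For real functions this is uniqueness of Haar measure: the right translate of `ds` is left
invariant, hence a multiple of `ds`. Continuous functionals separate points and reduce the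
vector-valued case to it. -/
theorem integral_mul_right {f : G → E} (hf : Continuous f) {C : Set G} (hC : IsCompact C)
    (h : ∀ s, s ∉ C → f s = 0) (r : G) :
    ∫ s, f (s * r) ∂Measure.haar = (modular r)⁻¹ • ∫ s, f s ∂Measure.haar := by
  have key : ∀ g : G → ℝ, Continuous g → (∀ s, s ∉ C → g s = 0) →
      ∫ s, g (s * r) ∂Measure.haar = (modular r)⁻¹ • ∫ s, g s ∂Measure.haar := by
    intro g hg hgC
    have hgc : HasCompactSupport g := HasCompactSupport.intro hC (fun x hx => hgC x hx)
    have h1 := Measure.integral_isMulLeftInvariant_eq_smul_of_hasCompactSupport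
      (Measure.map (· * r) (Measure.haar (G := G))) Measure.haar hg hgc
    rw [integral_map (by fun_prop) hg.aestronglyMeasurable, integral_smul_nnreal_measure,
      ← Measure.modularCharacterFun_eq_haarScalarFactor] at h1
    rw [h1, modular, inv_inv]
    rfl
  have hi : Integrable f Measure.haar := integrable_of_compact hf hC h
  have hi' : Integrable (fun s => f (s * r)) Measure.haar := by
    refine integrable_of_compact (C := (· * r⁻¹) '' C) (by fun_prop)
      (hC.image (by fun_prop)) fun s hs => h _ fun hm => hs ⟨_, hm, by simp⟩
  refine (SeparatingDual.eq_iff_forall_dual_eq (R := ℝ)).2 fun ℓ => ?_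
  have h2 := key (fun s => ℓ (f s)) (by fun_prop) (fun s hs => by simp [h s hs])
  rw [map_smul, ← ContinuousLinearMap.integral_comp_comm _ hi,
    ← ContinuousLinearMap.integral_comp_comm _ hi']
  exact h2

end Modular

section ModularContinuity

variable {G : Type u} [Group G] [TopologicalSpace G] [IsTopologicalGroup G]
  [LocallyCompactSpace G] [T2Space G]

-- The modular function is a quotient of integrals: for a bump `g`, `∫ g(s r) ds = Δ(r)⁻¹ ∫ g`, and
-- the left side depends continuously on `r`.
@[fun_prop]
theorem continuous_modular : Continuous (modular : G → ℝ) := by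
  borelize G
  obtain ⟨g, hgc, hg0, hg1⟩ := exists_continuous_nonneg_pos (1 : G)
  have hpos : 0 < ∫ s, g s ∂Measure.haar :=
    g.continuous.integral_pos_of_hasCompactSupport_nonneg_nonzero hgc hg0 hg1
  have hz : ∀ s, s ∉ tsupport g → g s = 0 := fun s hs => image_eq_zero_of_notMem_tsupport hs
  have h1 : (modular : G → ℝ) =
      fun r => (∫ s, g (s * r) ∂Measure.haar)⁻¹ * ∫ s, g s ∂Measure.haar := by
    funext r
    rw [integral_mul_right g.continuous hgc.isCompact hz, smul_eq_mul, mul_inv, inv_inv,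
      mul_assoc, inv_mul_cancel₀ hpos.ne', mul_one]
  have h2 : Continuous fun r : G => ∫ s, g (s * r) ∂Measure.haar := by
    refine continuous_integral_of_compact (by fun_prop) fun r₀ => ?_
    obtain ⟨N, hN, hN'⟩ := exists_compact_mem_nhds r₀
    refine ⟨N, hN', (fun z : G × G => z.1 * z.2⁻¹) '' (tsupport g ×ˢ N),
      (hgc.isCompact.prod hN).image (by fun_prop), fun r hr s hs => hz _ fun hm => hs ?_⟩
    exact ⟨(s * r, r), ⟨hm, hr⟩, by simp⟩
  rw [h1]
  refine (h2.inv₀ fun r => ?_).mul continuous_const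
  rw [integral_mul_right g.continuous hgc.isCompact hz]
  exact smul_ne_zero (inv_pos.2 (modular_pos r)).ne' hpos.ne'

@[fun_prop]
theorem continuous_modular_inv : Continuous fun s : G => (modular s)⁻¹ :=
  continuous_modular.inv₀ fun s => (modular_pos s).ne'

@[fun_prop]
theorem continuous_modular_rpow (e : ℝ) : Continuous fun s : G => modular s ^ e :=
  continuous_modular.rpow_const fun s => Or.inl (modular_pos s).ne'

variable [MeasurableSpace G] [BorelSpace G]
  {E : Type*} [NormedAddCommGroup E] [NormedSpace ℝ E] [CompleteSpace E]

/-- Inversion is reduced to right translation. After multiplying by `∫ g`, the substitutions `s ↦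
t⁻¹ s` and `t ↦ s t`, each combined with an exchange of the integrals, bring out `∫ g(s t) ds =
Δ(t)⁻¹ ∫ g`, which absorbs the remaining `Δ(t)`. -/
theorem integral_inv_modular {f : G → E} (hf : Continuous f) {C : Set G} (hC : IsCompact C)
    (h : ∀ s, s ∉ C → f s = 0) :
    ∫ s, (modular s)⁻¹ • f s⁻¹ ∂Measure.haar = ∫ s, f s ∂Measure.haar := by
  obtain ⟨g, hgc, hg0, hg1⟩ := exists_continuous_nonneg_pos (1 : G)
  have hpos : 0 < ∫ s, g s ∂Measure.haar :=
    g.continuous.integral_pos_of_hasCompactSupport_nonneg_nonzero hgc hg0 hg1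
  have hz : ∀ s, s ∉ tsupport g → g s = 0 := fun s hs => image_eq_zero_of_notMem_tsupport hs
  -- An auxiliary function of nonzero integral turns the single integral into a double one, to which
  -- Fubini applies.
  refine smul_right_injective E hpos.ne' ?_
  change (∫ s, g s ∂Measure.haar) • _ = (∫ s, g s ∂Measure.haar) • _
  calc _ = ∫ t, g t • ∫ s, (modular s)⁻¹ • f s⁻¹ ∂Measure.haar ∂Measure.haar :=
        (integral_smul_const _ _).symm
    _ = ∫ t, ∫ s, g t • (modular (t⁻¹ * s))⁻¹ • f (t⁻¹ * s)⁻¹ ∂Measure.haar ∂Measure.haar := by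
        refine integral_congr_ae (Filter.Eventually.of_forall fun t => ?_)
        change g t • ∫ s, (modular s)⁻¹ • f s⁻¹ ∂Measure.haar = _
        rw [← integral_smul,
          ← integral_mul_left_eq_self (fun s => g t • (modular s)⁻¹ • f s⁻¹) t⁻¹]
    _ = ∫ s, ∫ t, g t • (modular (t⁻¹ * s))⁻¹ • f (t⁻¹ * s)⁻¹ ∂Measure.haar ∂Measure.haar := by
        refine integral_swap_of_compact (Continuous.smul (by fun_prop)
            (Continuous.smul (continuous_modular_inv.comp (by fun_prop)) (by fun_prop)))
          (C := tsupport g) hgc.isCompact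
          (C' := (fun z : G × G => z.1 * z.2⁻¹) '' (tsupport g ×ˢ C))
          ((hgc.isCompact.prod hC).image (by fun_prop)) fun t s hts => ?_
        have h1 : t ∈ tsupport g := by
          by_contra h1
          simp [hz t h1] at hts
        refine ⟨h1, (t, (t⁻¹ * s)⁻¹), ⟨h1, ?_⟩, by simp⟩
        by_contra h2
        rw [h _ h2] at hts
        simp at hts
    _ = ∫ s, ∫ t, g (s * t) • modular t • f t ∂Measure.haar ∂Measure.haar := by
        refine integral_congr_ae (Filter.Eventually.of_forall fun s => ?_)
        change ∫ t, g t • (modular (t⁻¹ * s))⁻¹ • f (t⁻¹ * s)⁻¹ ∂Measure.haar = _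
        rw [← integral_mul_left_eq_self _ s]
        simp
    _ = ∫ t, ∫ s, g (s * t) • modular t • f t ∂Measure.haar ∂Measure.haar := by
        refine integral_swap_of_compact (by fun_prop)
          (C := (fun z : G × G => z.1 * z.2⁻¹) '' (tsupport g ×ˢ C))
          ((hgc.isCompact.prod hC).image (by fun_prop)) hC fun s t hts => ?_
        have h2 : t ∈ C := by
          by_contra h2
          simp [h _ h2] at hts
        refine ⟨⟨(s * t, t), ⟨?_, h2⟩, by simp⟩, h2⟩
        by_contra h1
        simp [hz _ h1] at hts
    _ = ∫ t, (∫ s, g s ∂Measure.haar) • f t ∂Measure.haar := by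
        refine integral_congr_ae (Filter.Eventually.of_forall fun t => ?_)
        change ∫ s, g (s * t) • modular t • f t ∂Measure.haar = _
        rw [integral_smul_const, integral_mul_right g.continuous hgc.isCompact hz, smul_smul,
          smul_eq_mul, mul_right_comm, inv_mul_cancel₀ (modular_pos t).ne', one_mul]
    _ = _ := integral_smul _ _

end ModularContinuity

/-! ### Convolution and involution on `C_c(G, B)` -/

/-- A compactly supported continuous function from a function vanishing off a compact set. -/
def mkCc {X E : Type*} [TopologicalSpace X] [T2Space X] [TopologicalSpace E] [Zero E]
    (f : X → E) (hf : Continuous f) (C : Set X) (hC : IsCompact C) (h : ∀ x, x ∉ C → f x = 0) :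
    C_c(X, E) :=
  ⟨⟨f, hf⟩, HasCompactSupport.intro hC (fun x hx => h x hx)⟩

@[simp] theorem mkCc_apply {X E : Type*} [TopologicalSpace X] [T2Space X] [TopologicalSpace E]
    [Zero E] (f : X → E) (hf : Continuous f) (C : Set X) (hC : IsCompact C)
    (h : ∀ x, x ∉ C → f x = 0) (x : X) : mkCc f hf C hC h x = f x := rfl

theorem cc_eq_zero {X E : Type*} [TopologicalSpace X] [TopologicalSpace E] [Zero E]
    (f : C_c(X, E)) {x : X} (hx : x ∉ tsupport f) : f x = 0 :=
  image_eq_zero_of_notMem_tsupport hx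

theorem cc_mem {X E : Type*} [TopologicalSpace X] [TopologicalSpace E] [Zero E]
    (f : C_c(X, E)) {x : X} (hx : f x ≠ 0) : x ∈ tsupport f :=
  subset_tsupport _ hx

theorem isCompact_tsupport {X E : Type*} [TopologicalSpace X] [TopologicalSpace E] [Zero E]
    (f : C_c(X, E)) : IsCompact (tsupport f) := f.hasCompactSupport

theorem inner_real_smul_left {H : Type*} [NormedAddCommGroup H] [InnerProductSpace ℂ H] (r : ℝ)
    (x y : H) : inner ℂ (r • x) y = r * inner ℂ x y := by
  rw [← Complex.coe_smul, inner_smul_left, Complex.conj_ofReal]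

theorem inner_real_smul_right {H : Type*} [NormedAddCommGroup H] [InnerProductSpace ℂ H] (r : ℝ)
    (x y : H) : inner ℂ x (r • y) = r * inner ℂ x y := by
  rw [← Complex.coe_smul, inner_smul_right]

section CrossedProductAlgebra

variable {B G : Type u} [NonUnitalCStarAlgebra B] [Group G] [TopologicalSpace G]
  [IsTopologicalGroup G] [LocallyCompactSpace G] [T2Space G] [MeasurableSpace G] [BorelSpace G]
  {α : G →* Aut B}

/-- The involution `f^*(s) = Δ(s)⁻¹ α_s(f(s⁻¹)^*)` on `C_c(G, B)`. -/
def ccStar (hα : ∀ b, Continuous fun s => α s b) (f : C_c(G, B)) : C_c(G, B) :=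
  mkCc (fun s => (modular s)⁻¹ • α s (star (f s⁻¹)))
    (continuous_modular_inv.smul (continuous_aut_apply hα
      ((f.continuous.comp continuous_inv).star)))
    (Inv.inv '' tsupport f) ((isCompact_tsupport f).image continuous_inv)
    (fun s hs => by
      rw [cc_eq_zero f fun hm => hs ⟨_, hm, inv_inv s⟩]
      simp)

theorem ccStar_apply (hα : ∀ b, Continuous fun s => α s b) (f : C_c(G, B)) (s : G) :
    ccStar hα f s = (modular s)⁻¹ • α s (star (f s⁻¹)) := rfl

theorem ccStar_ccStar (hα : ∀ b, Continuous fun s => α s b) (f : C_c(G, B)) :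
    ccStar hα (ccStar hα f) = f := by
  ext s
  rw [ccStar_apply, ccStar_apply, star_smul, aut_real_smul, smul_smul, ← map_star, star_star,
    ← aut_mul_apply, ← map_mul]
  simp [(modular_pos s).ne']

theorem continuous_conv_integrand (hα : ∀ b, Continuous fun s => α s b) (f g : C_c(G, B)) :
    Continuous fun z : G × G => f z.2 * α z.2 (g (z.2⁻¹ * z.1)) := by
  refine Continuous.mul (by fun_prop) (continuous_aut_apply (θ := fun z : G × G => α z.2)
    (fun a => (hα a).comp continuous_snd) (by fun_prop))

/-- The convolution `(f * g)(s) = ∫ f(r) α_r(g(r⁻¹ s)) dr` on `C_c(G, B)`. -/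
def conv (hα : ∀ b, Continuous fun s => α s b) (f g : C_c(G, B)) : C_c(G, B) :=
  mkCc (fun s => ∫ r, f r * α r (g (r⁻¹ * s)) ∂Measure.haar)
    (continuous_integral_of_compact (continuous_conv_integrand hα f g) fun s₀ =>
      ⟨Set.univ, Filter.univ_mem, tsupport f, isCompact_tsupport f, fun s _ r hr => by
        simp [cc_eq_zero f hr]⟩)
    ((fun z : G × G => z.1 * z.2) '' (tsupport f ×ˢ tsupport g))
    (((isCompact_tsupport f).prod (isCompact_tsupport g)).image continuous_mul)
    (fun s hs => by
      rw [← integral_zero G B (μ := Measure.haar)]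
      refine integral_congr_ae (Filter.Eventually.of_forall fun r => ?_)
      by_cases hr : r ∈ tsupport f
      · have h1 : g (r⁻¹ * s) = 0 := cc_eq_zero g fun hm => hs ⟨(r, r⁻¹ * s), ⟨hr, hm⟩, by simp⟩
        simp [h1]
      · simp [cc_eq_zero f hr])

theorem conv_apply (hα : ∀ b, Continuous fun s => α s b) (f g : C_c(G, B)) (s : G) :
    conv hα f g s = ∫ r, f r * α r (g (r⁻¹ * s)) ∂Measure.haar := rfl

namespace CovariantRep

theorem integrated_apply (ρ : CovariantRep α) (f : C_c(G, B)) (ξ : ρ.H) :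
    ρ.integrated f ξ = ∫ s, ρ.π (f s) ((ρ.U s : ρ.H →L[ℂ] ρ.H) ξ) ∂Measure.haar := rfl

/-- The representation `π` of a covariant representation as a continuous linear map. -/
def πL (ρ : CovariantRep α) : B →L[ℂ] (ρ.H →L[ℂ] ρ.H) :=
  LinearMap.mkContinuous
    { toFun := ρ.π
      map_add' := map_add ρ.π
      map_smul' := map_smul ρ.π } 1
    (fun b => by simpa using NonUnitalStarAlgHom.norm_apply_le ρ.π b)

theorem continuous_π (ρ : CovariantRep α) : Continuous ρ.π := ρ.πL.continuous

theorem π_integral (ρ : CovariantRep α) {X : Type*} [MeasurableSpace X] {μ : Measure X}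
    {f : X → B} (hf : Integrable f μ) (ξ : ρ.H) :
    ρ.π (∫ x, f x ∂μ) ξ = ∫ x, ρ.π (f x) ξ ∂μ :=
  (((ContinuousLinearMap.apply ℂ ρ.H ξ).comp ρ.πL).integral_comp_comm hf).symm

theorem coe_U_mul (ρ : CovariantRep α) (s t : G) (ξ : ρ.H) :
    (ρ.U (s * t) : ρ.H →L[ℂ] ρ.H) ξ = (ρ.U s : ρ.H →L[ℂ] ρ.H) ((ρ.U t : ρ.H →L[ℂ] ρ.H) ξ) := by
  rw [map_mul]; rfl

theorem coe_U_inv (ρ : CovariantRep α) (s : G) :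
    (ρ.U s⁻¹ : ρ.H →L[ℂ] ρ.H) = star (ρ.U s : ρ.H →L[ℂ] ρ.H) := by
  rw [map_inv]; rfl

theorem U_inv_apply_U (ρ : CovariantRep α) (s : G) (ξ : ρ.H) :
    (ρ.U s⁻¹ : ρ.H →L[ℂ] ρ.H) ((ρ.U s : ρ.H →L[ℂ] ρ.H) ξ) = ξ := by
  rw [← coe_U_mul, inv_mul_cancel, map_one]; rfl

theorem inner_U_left (ρ : CovariantRep α) (s : G) (ξ ζ : ρ.H) :
    inner ℂ ((ρ.U s : ρ.H →L[ℂ] ρ.H) ξ) ζ = inner ℂ ξ ((ρ.U s⁻¹ : ρ.H →L[ℂ] ρ.H) ζ) := by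
  rw [coe_U_inv, ContinuousLinearMap.star_eq_adjoint, ContinuousLinearMap.adjoint_inner_right]

theorem π_act (ρ : CovariantRep α) (s : G) (b : B) (ξ : ρ.H) :
    ρ.π (α s b) ξ =
      (ρ.U s : ρ.H →L[ℂ] ρ.H) (ρ.π b ((ρ.U s⁻¹ : ρ.H →L[ℂ] ρ.H) ξ)) := by
  rw [ρ.covariant, coe_U_inv]; rfl

theorem inner_π_left (ρ : CovariantRep α) (b : B) (ξ ζ : ρ.H) :
    inner ℂ (ρ.π b ξ) ζ = inner ℂ ξ (ρ.π (star b) ζ) := by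
  rw [map_star, ContinuousLinearMap.star_eq_adjoint, ContinuousLinearMap.adjoint_inner_right]

theorem continuous_joint (ρ : CovariantRep α) {X : Type*} [TopologicalSpace X] {f : X → G}
    (hf : Continuous f) {v : X → ρ.H} (hv : Continuous v) :
    Continuous fun x => (ρ.U (f x) : ρ.H →L[ℂ] ρ.H) (v x) := by
  rw [continuous_iff_continuousAt]
  intro x
  have h1 : Filter.Tendsto (fun y => (ρ.U (f y) : ρ.H →L[ℂ] ρ.H) (v y - v x)) (nhds x)
      (nhds 0) := by
    rw [tendsto_zero_iff_norm_tendsto_zero]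
    have : ∀ y, ‖(ρ.U (f y) : ρ.H →L[ℂ] ρ.H) (v y - v x)‖ = ‖v y - v x‖ :=
      fun y => Unitary.norm_map (ρ.U (f y)) _
    simp only [this]
    rw [← tendsto_zero_iff_norm_tendsto_zero]
    simpa using (hv.tendsto x).sub_const (v x)
  have h2 := h1.add (((ρ.continuous_U (v x)).comp hf).tendsto x)
  simpa [ContinuousAt] using h2

theorem continuous_π_apply (ρ : CovariantRep α) {X : Type*} [TopologicalSpace X] {f : X → B}
    (hf : Continuous f) {v : X → ρ.H} (hv : Continuous v) :
    Continuous fun x => ρ.π (f x) (v x) :=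
  (ρ.continuous_π.comp hf).clm_apply hv

/-- Exchange the integrals, substitute `s ↦ r s`, and use `π(α_r b) = U_r π(b) U_r^*` to split the
integrand. -/
theorem integrated_conv (ρ : CovariantRep α) (hα : ∀ b, Continuous fun s => α s b)
    (f g : C_c(G, B)) : ρ.integrated (conv hα f g) = ρ.integrated f * ρ.integrated g := by
  ext ξ
  rw [mul_apply_eq_comp, integrated_apply, integrated_apply ρ f]
  have hint : ∀ s, Integrable (fun r => f r * α r (g (r⁻¹ * s))) Measure.haar := fun s =>
    integrable_of_compact ((continuous_conv_integrand hα f g).comp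
      (Continuous.prodMk_right s)) (isCompact_tsupport f) fun r hr => by simp [cc_eq_zero f hr]
  calc _ = ∫ s, ∫ r, ρ.π (f r * α r (g (r⁻¹ * s))) ((ρ.U s : ρ.H →L[ℂ] ρ.H) ξ)
        ∂Measure.haar ∂Measure.haar := by
        simp only [conv_apply, ρ.π_integral (hint _)]
    _ = ∫ r, ∫ s, ρ.π (f r * α r (g (r⁻¹ * s))) ((ρ.U s : ρ.H →L[ℂ] ρ.H) ξ)
        ∂Measure.haar ∂Measure.haar := by
        refine integral_swap_of_compact (ρ.continuous_π_apply (continuous_conv_integrand hα f g)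
          (ρ.continuous_joint continuous_fst continuous_const))
          (C := (fun z : G × G => z.1 * z.2) '' (tsupport f ×ˢ tsupport g))
          (((isCompact_tsupport f).prod (isCompact_tsupport g)).image continuous_mul)
          (isCompact_tsupport f) fun s r hsr => ?_
        have h1 : f r ≠ 0 := fun h => by simp [h] at hsr
        have h2 : g (r⁻¹ * s) ≠ 0 := fun h => by simp [h] at hsr
        exact ⟨⟨(r, r⁻¹ * s), ⟨cc_mem f h1, cc_mem g h2⟩, by simp⟩, cc_mem f h1⟩
    _ = _ := by
        refine integral_congr_ae (Filter.Eventually.of_forall fun r => ?_)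
        change ∫ s, ρ.π (f r * α r (g (r⁻¹ * s))) ((ρ.U s : ρ.H →L[ℂ] ρ.H) ξ) ∂Measure.haar = _
        rw [← integral_mul_left_eq_self _ r]
        simp only [map_mul ρ.π, mul_apply_eq_comp, π_act, coe_U_mul,
          U_inv_apply_U, inv_mul_cancel_left]
        have h3 := ((ρ.π (f r)).comp (ρ.U r : ρ.H →L[ℂ] ρ.H)).integral_comp_comm
          (ρ.integrable_integrand g ξ)
        exact h3

/-- The factor `Δ(s)⁻¹` in the involution is the Jacobian of `s ↦ s⁻¹`. -/
theorem integrated_ccStar (ρ : CovariantRep α) (hα : ∀ b, Continuous fun s => α s b)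
    (f : C_c(G, B)) : ρ.integrated (ccStar hα f) = star (ρ.integrated f) := by
  rw [ContinuousLinearMap.star_eq_adjoint, ContinuousLinearMap.eq_adjoint_iff]
  intro ξ ζ
  have h0 : Continuous fun s => ρ.π (f s) ((ρ.U s : ρ.H →L[ℂ] ρ.H) ζ) :=
    ρ.continuous_π_apply f.continuous (ρ.continuous_U ζ)
  have h1 : ρ.integrated f ζ =
      ∫ s, (modular s)⁻¹ • ρ.π (f s⁻¹) ((ρ.U s⁻¹ : ρ.H →L[ℂ] ρ.H) ζ) ∂Measure.haar :=
    (integral_inv_modular h0 (isCompact_tsupport f) fun s hs => by simp [cc_eq_zero f hs]).symm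
  have h2 : Integrable (fun s => (modular s)⁻¹ • ρ.π (f s⁻¹) ((ρ.U s⁻¹ : ρ.H →L[ℂ] ρ.H) ζ))
      Measure.haar := by
    refine integrable_of_compact (continuous_modular_inv.smul (h0.comp continuous_inv))
      ((isCompact_tsupport f).image continuous_inv) fun s hs => ?_
    rw [cc_eq_zero f fun hm => hs ⟨_, hm, inv_inv s⟩]
    simp
  rw [h1, ← integral_inner h2, ← inner_conj_symm, integrated_apply,
    ← integral_inner (ρ.integrable_integrand _ ξ), ← integral_conj]
  refine integral_congr_ae (Filter.Eventually.of_forall fun s => ?_)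
  change (starRingEnd ℂ) (inner ℂ ζ (ρ.π ((modular s)⁻¹ • α s (star (f s⁻¹)))
    ((ρ.U s : ρ.H →L[ℂ] ρ.H) ξ))) = _
  rw [inner_conj_symm]
  have h3 : ρ.π ((modular s)⁻¹ • α s (star (f s⁻¹))) =
      (modular s)⁻¹ • ρ.π (α s (star (f s⁻¹))) := by
    have := map_smul ρ.π (((modular s)⁻¹ : ℝ) : ℂ) (α s (star (f s⁻¹)))
    simpa only [Complex.coe_smul] using this
  rw [h3, smul_apply, π_act, U_inv_apply_U, inner_real_smul_left, inner_U_left, inner_π_left, star_star]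
  exact (inner_real_smul_right _ _ _).symm

theorem integrated_add (ρ : CovariantRep α) (f g : C_c(G, B)) :
    ρ.integrated (f + g) = ρ.integrated f + ρ.integrated g := by
  ext ξ
  rw [add_apply, integrated_apply, integrated_apply, integrated_apply,
    ← integral_add (ρ.integrable_integrand f ξ) (ρ.integrable_integrand g ξ)]
  simp

theorem integrated_smul (ρ : CovariantRep α) (c : ℂ) (f : C_c(G, B)) :
    ρ.integrated (c • f) = c • ρ.integrated f := by
  ext ξ
  rw [smul_apply, integrated_apply, integrated_apply, ← integral_smul]
  simp

end CovariantRep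

/-- The canonical map `C_c(G, B) → B ⋊_α G` as a linear map. -/
def toCP (α : G →* Aut B) : C_c(G, B) →ₗ[ℂ] CrossedProduct α where
  toFun := toCrossedProduct α
  map_add' f g := Subtype.ext (Subtype.ext (funext fun ρ => ρ.integrated_add f g))
  map_smul' c f := Subtype.ext (Subtype.ext (funext fun ρ => ρ.integrated_smul c f))

/-- The representation of the crossed product extending the integrated form of a covariant
representation. -/
def CovariantRep.rep (ρ : CovariantRep α) : CrossedProduct α →⋆ₙₐ[ℂ] (ρ.H →L[ℂ] ρ.H) where
  toFun a := (a.1 : lp (fun ρ : CovariantRep α => ρ.H →L[ℂ] ρ.H) ∞) ρ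
  map_smul' _ _ := rfl
  map_zero' := rfl
  map_add' _ _ := rfl
  map_mul' _ _ := rfl
  map_star' _ := rfl

theorem CovariantRep.rep_toCP (ρ : CovariantRep α) (f : C_c(G, B)) :
    ρ.rep (toCP α f) = ρ.integrated f := rfl

theorem CovariantRep.norm_rep_le (ρ : CovariantRep α) (a : CrossedProduct α) :
    ‖ρ.rep a‖ ≤ ‖a‖ := NonUnitalStarAlgHom.norm_apply_le ρ.rep a

/-- The crossed product sits inside the bounded product of all covariant representations, so
identities and norm bounds are checked one representation at a time. -/
theorem crossedProduct_ext {a b : CrossedProduct α} (h : ∀ ρ : CovariantRep α, ρ.rep a = ρ.rep b) :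
    a = b :=
  Subtype.ext (Subtype.ext (funext h))

theorem crossedProduct_norm_le {a : CrossedProduct α} {C : ℝ} (hC : 0 ≤ C)
    (h : ∀ ρ : CovariantRep α, ‖ρ.rep a‖ ≤ C) : ‖a‖ ≤ C :=
  lp.norm_le_of_forall_le hC h

theorem norm_toCP_le (f : C_c(G, B)) : ‖toCP α f‖ ≤ ∫ s, ‖f s‖ ∂Measure.haar :=
  crossedProduct_norm_le (integral_nonneg fun _ => norm_nonneg _) fun ρ => ρ.norm_integrated_le f

theorem toCP_conv (hα : ∀ b, Continuous fun s => α s b) (f g : C_c(G, B)) :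
    toCP α (conv hα f g) = toCP α f * toCP α g :=
  crossedProduct_ext fun ρ => by
    rw [map_mul]
    exact ρ.integrated_conv hα f g

theorem toCP_ccStar (hα : ∀ b, Continuous fun s => α s b) (f : C_c(G, B)) :
    toCP α (ccStar hα f) = star (toCP α f) :=
  crossedProduct_ext fun ρ => by
    rw [map_star]
    exact ρ.integrated_ccStar hα f

/-- Convolution and involution keep the image of `C_c(G, B)` stable under products and adjoints, so
the ⋆-algebra that it generates is the image itself. -/
theorem denseRange_toCP (hα : ∀ b, Continuous fun s => α s b) : DenseRange (toCP α) := by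
  let S : NonUnitalStarSubalgebra ℂ (lp (fun ρ : CovariantRep α => ρ.H →L[ℂ] ρ.H) ∞) :=
    { carrier := Set.range (universalRep α)
      zero_mem' := ⟨0, congrArg Subtype.val (map_zero (toCP α))⟩
      add_mem' := by
        rintro _ _ ⟨f, rfl⟩ ⟨g, rfl⟩
        exact ⟨f + g, congrArg Subtype.val (map_add (toCP α) f g)⟩
      mul_mem' := by
        rintro _ _ ⟨f, rfl⟩ ⟨g, rfl⟩
        exact ⟨conv hα f g, congrArg Subtype.val (toCP_conv hα f g)⟩
      smul_mem' := by
        rintro c _ ⟨f, rfl⟩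
        exact ⟨c • f, congrArg Subtype.val (map_smul (toCP α) c f)⟩
      star_mem' := by
        rintro _ ⟨f, rfl⟩
        exact ⟨ccStar hα f, congrArg Subtype.val (toCP_ccStar hα f)⟩ }
  have hS : NonUnitalStarAlgebra.adjoin ℂ (Set.range (universalRep α)) ≤ S :=
    NonUnitalStarAlgebra.adjoin_le subset_rfl
  intro a
  have ha : a.1 ∈ closure (Set.range (universalRep α)) := closure_mono hS a.2
  refine closure_subtype.2 (?_ : a.1 ∈ closure (Subtype.val '' _))
  refine closure_mono ?_ ha
  rintro _ ⟨f, rfl⟩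
  exact ⟨toCP α f, ⟨f, rfl⟩, rfl⟩

end CrossedProductAlgebra

/-! ### Positivity -/

section Positivity

variable {B : Type*} [NonUnitalCStarAlgebra B]

/-- In the spectral order every term is nonnegative, and a sum of nonnegative terms that is also
nonpositive has all its terms zero. -/
theorem eq_zero_of_sum_star_mul_self {ι : Type*} (s : Finset ι) (e : B) (d : ι → B)
    (h : star e * e + ∑ i ∈ s, star (d i) * d i = 0) : ∀ i ∈ s, d i = 0 := by
  let _ := CStarAlgebra.spectralOrder B
  have := CStarAlgebra.spectralOrderedRing B
  have h1 : ∀ i ∈ s, 0 ≤ star (d i) * d i := fun i _ => star_mul_self_nonneg _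
  have h2 : ∑ i ∈ s, star (d i) * d i = 0 := by
    refine le_antisymm ?_ (Finset.sum_nonneg h1)
    rw [eq_neg_of_add_eq_zero_right h]
    exact neg_nonpos.2 (star_mul_self_nonneg e)
  intro i hi
  exact CStarRing.star_mul_self_eq_zero_iff _ |>.1 ((Finset.sum_eq_zero_iff_of_nonneg h1).1 h2 i hi)

/-- A selfadjoint `a` is of the form `b^* b` if `c^* a c = - d^* d` forces `d = 0`. -/
theorem exists_star_mul_self {a : B} (ha : star a = a)
    (h : ∀ c d : B, star c * a * c = -(star d * d) → d = 0) : ∃ b, a = star b * b := by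
  let _ := CStarAlgebra.spectralOrder B
  have := CStarAlgebra.spectralOrderedRing B
  have hsa : IsSelfAdjoint a := ha
  have hn : 0 ≤ a⁻ := CFC.negPart_nonneg a
  obtain ⟨m, hm⟩ := CStarAlgebra.nonneg_iff_eq_star_mul_self.1 hn
  have hs : star a⁻ = a⁻ := hn.isSelfAdjoint
  -- Test the hypothesis with `c = a⁻`: since `a⁻ a = -(a⁻)²` and `a⁻ = m^* m`, one gets `a⁻ a a⁻ =
  -- -(m a⁻)^* (m a⁻)`.
  have h1 : m * a⁻ = 0 := by
    refine h a⁻ _ ?_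
    have h2 : a⁻ * a = -(a⁻ * a⁻) := by
      calc a⁻ * a = a⁻ * (a⁺ - a⁻) := by rw [CFC.posPart_sub_negPart a hsa]
        _ = _ := by rw [mul_sub, CFC.negPart_mul_posPart, zero_sub]
    rw [hs, h2, star_mul, hs, neg_mul]
    congr 1
    rw [mul_assoc (a⁻) (star m), ← mul_assoc (star m), ← hm, mul_assoc]
  have h3 : a⁻ * a⁻ = 0 := by
    conv_lhs => lhs; rw [hm]
    rw [mul_assoc, h1, mul_zero]
  have h4 : a⁻ = 0 := by
    rw [← CStarRing.star_mul_self_eq_zero_iff, hs, h3]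
  have h5 : a = a⁺ := by
    have h6 := CFC.posPart_sub_negPart a hsa
    rw [h4, sub_zero] at h6
    exact h6.symm
  rw [h5]
  exact CStarAlgebra.nonneg_iff_eq_star_mul_self.1 (CFC.posPart_nonneg a)

/-- A matrix over a C⋆-algebra that is positive on columns is a sum of rank-one squares. -/
theorem exists_matrix_factor {n : Type*} [Fintype n] (T : n → n → B)
    (hT : ∀ i j, star (T i j) = T j i)
    (h : ∀ c : n → B, ∃ b, ∑ i, ∑ j, star (c i) * T i j * c j = star b * b) :
    ∃ S : n → n → B, ∀ i j, T i j = ∑ k, star (S k i) * S k j := by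
  let _ := CStarAlgebra.spectralOrder B
  have := CStarAlgebra.spectralOrderedRing B
  have hsq : ∀ (S : CStarMatrix n n B) (i j : n),
      (star S * S) i j = ∑ k, star (S k i) * S k j := fun S i j => rfl
  -- The criterion is applied in the C⋆-algebra of matrices. If `c^* T c = -d^* d`, the `k`-th
  -- diagonal entry equates a square supplied by `h` with minus the sum of the squares of the `k`-th
  -- column of `d`, so that column vanishes.
  have key : ∃ S : CStarMatrix n n B, (CStarMatrix.ofMatrix (Matrix.of T)) = star S * S := by
    refine exists_star_mul_self ?_ fun c d hcd => ?_
    · ext i j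
      exact hT j i
    · ext i k
      obtain ⟨b, hb⟩ := h fun i => c i k
      have h1 := congrFun (congrFun hcd k) k
      have h2 : (star c * (CStarMatrix.ofMatrix (Matrix.of T)) * c) k k =
          ∑ i, ∑ j, star (c i k) * T i j * c j k := by
        have : (star c * (CStarMatrix.ofMatrix (Matrix.of T)) * c) k k =
          ∑ j, (∑ i, star (c i k) * T i j) * c j k := rfl
        rw [this, Finset.sum_comm]
        simp only [Finset.sum_mul]
      have h3 : (-(star d * d)) k k = -∑ i, star (d i k) * d i k := rfl
      rw [h2, hb, h3] at h1
      exact eq_zero_of_sum_star_mul_self Finset.univ b (fun i => d i k)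
        (by rw [h1, neg_add_cancel]) i (Finset.mem_univ i)
  obtain ⟨S, hS⟩ := key
  exact ⟨S, fun i j => congrFun (congrFun hS i) j⟩

/-- With `T i j = ∑ k, S_{ki}^* S_{kj}` the form becomes `∑ k, ‖∑ i, π(S_{ki}) ξ_i‖²`. -/
theorem gram_nonneg_of_positive {H : Type*} [NormedAddCommGroup H] [InnerProductSpace ℂ H]
    [CompleteSpace H] (π : B →⋆ₙₐ[ℂ] (H →L[ℂ] H)) {n : Type*} [Fintype n] (T : n → n → B)
    (hT : ∀ i j, star (T i j) = T j i)
    (h : ∀ c : n → B, ∃ b, ∑ i, ∑ j, star (c i) * T i j * c j = star b * b) (ξ : n → H) :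
    0 ≤ (∑ i, ∑ j, inner ℂ (ξ i) (π (T i j) (ξ j))).re := by
  obtain ⟨S, hS⟩ := exists_matrix_factor T hT h
  have h1 : ∑ i, ∑ j, inner ℂ (ξ i) (π (T i j) (ξ j)) =
      ∑ k, inner ℂ (∑ i, π (S k i) (ξ i)) (∑ j, π (S k j) (ξ j)) := by
    simp only [sum_inner, inner_sum, hS, map_sum, sum_apply, map_mul,
      mul_apply_eq_comp, map_star, ContinuousLinearMap.star_eq_adjoint,
      ContinuousLinearMap.adjoint_inner_right]
    rw [Finset.sum_comm]
    conv_rhs => rw [Finset.sum_comm]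
    exact Finset.sum_congr rfl fun i _ => Finset.sum_comm
  rw [h1, Complex.re_sum]
  exact Finset.sum_nonneg fun k _ => inner_self_nonneg (𝕜 := ℂ)

end Positivity

/-! ### Positivity in crossed products, and functoriality for equivariant isomorphisms -/

section CrossedPositivity

variable {B G : Type u} [NonUnitalCStarAlgebra B] [Group G] [TopologicalSpace G]
  [IsTopologicalGroup G] [LocallyCompactSpace G] [T2Space G] [MeasurableSpace G] [BorelSpace G]
  {α : G →* Aut B}

/-- If `c^* a c = -d^* d`, then `‖ρ(d) ξ‖² = -⟨ρ(c) ξ, ρ(a) ρ(c) ξ⟩ ≤ 0` in every covariant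
representation, so `d = 0` and `exists_star_mul_self` applies. -/
theorem crossedProduct_exists_star_mul_self {a : CrossedProduct α} (ha : star a = a)
    (h : ∀ (ρ : CovariantRep α) (ξ : ρ.H), 0 ≤ (inner ℂ ξ (ρ.rep a ξ)).re) :
    ∃ b, a = star b * b := by
  refine exists_star_mul_self ha fun c d hcd => crossedProduct_ext fun ρ => ?_
  ext ξ
  have h1 := h ρ (ρ.rep c ξ)
  have h2 : inner ℂ (ρ.rep c ξ) (ρ.rep a (ρ.rep c ξ)) = - inner ℂ (ρ.rep d ξ) (ρ.rep d ξ) := by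
    have h3 := congrArg (fun T : ρ.H →L[ℂ] ρ.H => inner ℂ ξ (T ξ)) (congrArg ρ.rep hcd)
    simpa [map_star, ContinuousLinearMap.star_eq_adjoint,
      ContinuousLinearMap.adjoint_inner_right, mul_apply_eq_comp] using h3
  rw [h2, Complex.neg_re] at h1
  have h4 : (inner ℂ (ρ.rep d ξ) (ρ.rep d ξ) : ℂ).re = 0 :=
    le_antisymm (by linarith) (inner_self_nonneg (𝕜 := ℂ))
  have h5 : ρ.rep d ξ = 0 := by
    rw [← norm_eq_zero, ← sq_eq_zero_iff, @norm_sq_eq_re_inner ℂ]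
    exact h4
  rw [h5, map_zero]
  rfl

/-! ### Isomorphisms of crossed products -/

variable {B' : Type u} [NonUnitalCStarAlgebra B'] {β : G →* Aut B'}

/-- The covariant representation obtained by composing with an equivariant isomorphism. -/
def CovariantRep.pullback (ψ : B ≃⋆ₐ[ℂ] B') (hψ : ∀ s b, ψ (α s b) = β s (ψ b))
    (ρ : CovariantRep β) : CovariantRep α where
  H := ρ.H
  π := ρ.π.comp (ψ : B →⋆ₙₐ[ℂ] B')
  U := ρ.U
  continuous_U := ρ.continuous_U
  covariant s b := by
    change ρ.π (ψ (α s b)) = _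
    rw [hψ, ρ.covariant]
    rfl

theorem continuous_starAlgEquiv (ψ : B ≃⋆ₐ[ℂ] B') : Continuous ψ :=
  (AddMonoidHomClass.isometry_of_norm ψ
    (fun b => NonUnitalStarAlgHom.norm_map ψ ψ.injective b)).continuous

/-- Composition of `f ∈ C_c(G, B)` with an isomorphism `B → B'`. -/
def ccMap (ψ : B ≃⋆ₐ[ℂ] B') (f : C_c(G, B)) : C_c(G, B') :=
  mkCc (fun s => ψ (f s)) ((continuous_starAlgEquiv ψ).comp f.continuous) (tsupport f)
    (isCompact_tsupport f) (fun s hs => by rw [cc_eq_zero f hs, map_zero])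

/-- The ⋆-homomorphism of ambient algebras induced by an equivariant isomorphism. -/
def pullbackHom (ψ : B ≃⋆ₐ[ℂ] B') (hψ : ∀ s b, ψ (α s b) = β s (ψ b)) :
    lp (fun ρ : CovariantRep α => ρ.H →L[ℂ] ρ.H) ∞ →⋆ₙₐ[ℂ]
      lp (fun ρ : CovariantRep β => ρ.H →L[ℂ] ρ.H) ∞ where
  toFun a := ⟨fun ρ => a (ρ.pullback ψ hψ), memℓp_infty ⟨‖a‖, by
    rintro _ ⟨ρ, rfl⟩
    exact lp.norm_apply_le_norm (by simp) a (ρ.pullback ψ hψ)⟩⟩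
  map_smul' _ _ := rfl
  map_zero' := rfl
  map_add' _ _ := rfl
  map_mul' _ _ := rfl
  map_star' _ := rfl

theorem pullbackHom_mem (ψ : B ≃⋆ₐ[ℂ] B') (hψ : ∀ s b, ψ (α s b) = β s (ψ b))
    (a : CrossedProduct α) : pullbackHom ψ hψ a.1 ∈ crossedProductSubalgebra β := by
  have hc : Continuous (pullbackHom ψ hψ) :=
    AddMonoidHomClass.continuous_of_bound (pullbackHom ψ hψ) 1 (fun a => by
      simpa using NonUnitalStarAlgHom.norm_apply_le (pullbackHom ψ hψ) a)
  refine closure_minimal (s := (NonUnitalStarAlgebra.adjoin ℂ (Set.range (universalRep α)) :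
    Set (lp (fun ρ : CovariantRep α => ρ.H →L[ℂ] ρ.H) ∞))) ?_
    ((isClosed_crossedProductSubalgebra β).preimage hc) a.2
  change _ ≤ (crossedProductSubalgebra β).comap (pullbackHom ψ hψ)
  refine NonUnitalStarAlgebra.adjoin_le ?_
  rintro _ ⟨f, rfl⟩
  exact (toCP β (ccMap ψ f)).2

/-- The homomorphism of crossed products induced by an equivariant isomorphism. -/
def crossedHom (ψ : B ≃⋆ₐ[ℂ] B') (hψ : ∀ s b, ψ (α s b) = β s (ψ b)) :
    CrossedProduct α →⋆ₙₐ[ℂ] CrossedProduct β where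
  toFun a := (⟨pullbackHom ψ hψ a.1, pullbackHom_mem ψ hψ a⟩ : crossedProductSubalgebra β)
  map_smul' _ _ := rfl
  map_zero' := rfl
  map_add' _ _ := rfl
  map_mul' _ _ := rfl
  map_star' _ := rfl

theorem crossedHom_toCP (ψ : B ≃⋆ₐ[ℂ] B') (hψ : ∀ s b, ψ (α s b) = β s (ψ b)) (f : C_c(G, B)) :
    crossedHom ψ hψ (toCP α f) = toCP β (ccMap ψ f) := rfl

theorem continuous_crossedHom (ψ : B ≃⋆ₐ[ℂ] B') (hψ : ∀ s b, ψ (α s b) = β s (ψ b)) :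
    Continuous (crossedHom ψ hψ) :=
  AddMonoidHomClass.continuous_of_bound (crossedHom ψ hψ) 1 (fun a => by
      simpa using NonUnitalStarAlgHom.norm_apply_le (crossedHom ψ hψ) a)

theorem crossedHom_crossedHom (hα : ∀ b, Continuous fun s => α s b) (ψ : B ≃⋆ₐ[ℂ] B')
    (hψ : ∀ s b, ψ (α s b) = β s (ψ b)) (ψ' : B' ≃⋆ₐ[ℂ] B)
    (hψ' : ∀ s b, ψ' (β s b) = α s (ψ' b)) (h : ∀ b, ψ' (ψ b) = b) (a : CrossedProduct α) :
    crossedHom ψ' hψ' (crossedHom ψ hψ a) = a := by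
  refine (denseRange_toCP hα).induction_on a (isClosed_eq
    ((continuous_crossedHom ψ' hψ').comp (continuous_crossedHom ψ hψ)) continuous_id) fun f => ?_
  rw [crossedHom_toCP, crossedHom_toCP]
  congr 1
  ext s
  exact h (f s)

/-- The isomorphism of crossed products induced by an equivariant isomorphism. -/
def crossedIso (hα : ∀ b, Continuous fun s => α s b) (hβ : ∀ b, Continuous fun s => β s b)
    (ψ : B ≃⋆ₐ[ℂ] B') (hψ : ∀ s b, ψ (α s b) = β s (ψ b)) :
    CrossedProduct α ≃⋆ₐ[ℂ] CrossedProduct β :=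
  have hψ' : ∀ s b, ψ.symm (β s b) = α s (ψ.symm b) := fun s b => by
    rw [← ψ.symm_apply_apply (α s (ψ.symm b)), hψ, ψ.apply_symm_apply]
  { crossedHom ψ hψ with
    invFun := crossedHom ψ.symm hψ'
    left_inv := crossedHom_crossedHom hα ψ hψ ψ.symm hψ' ψ.symm_apply_apply
    right_inv := crossedHom_crossedHom hβ ψ.symm hψ' ψ hψ ψ.apply_symm_apply
    map_smul' := (crossedHom ψ hψ).map_smul'
    map_star' := (crossedHom ψ hψ).map_star' }

theorem isCrossedIso_crossedIso (hα : ∀ b, Continuous fun s => α s b)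
    (hβ : ∀ b, Continuous fun s => β s b) (ψ : B ≃⋆ₐ[ℂ] B')
    (hψ : ∀ s b, ψ (α s b) = β s (ψ b)) : IsCrossedIso ψ (crossedIso hα hβ ψ hψ) :=
  ⟨hψ, fun f => ⟨ccMap ψ f, fun _ => rfl, rfl⟩⟩

end CrossedPositivity

/-! ### Hilbert spaces from operator-valued kernels -/

section Kernel

variable {X V : Type u} [NormedAddCommGroup V] [InnerProductSpace ℂ V] [CompleteSpace V]

/-- This is the Kolmogorov decomposition, realized in the reproducing kernel Hilbert space of `Θ`.
It replaces interior tensor products: `v x ξ` stands for `x ⊗ ξ`, with no quotient of an algebraic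
tensor product to form. -/
theorem exists_kernel_space (Θ : X → X → (V →L[ℂ] V)) (hΘ : ∀ x y, star (Θ x y) = Θ y x)
    (hpos : ∀ f : X →₀ V, 0 ≤ (f.sum fun x ξ => f.sum fun y ζ => inner ℂ ξ (Θ x y ζ)).re) :
    ∃ (H : Type u) (_ : NormedAddCommGroup H) (_ : InnerProductSpace ℂ H) (_ : CompleteSpace H)
      (v : X → (V →L[ℂ] H)), (∀ x y ξ ζ, inner ℂ (v x ξ) (v y ζ) = inner ℂ ξ (Θ x y ζ)) ∧
        Dense (Submodule.span ℂ {z | ∃ x ξ, v x ξ = z} : Set H) := by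
  have hK : (Matrix.of Θ).PosSemidef := by
    have htf := (RKHS.posSemidef_tfae (K := Matrix.of Θ)).out 0 2
    refine htf.2 ⟨?_, fun f => ?_⟩
    · ext1 x y
      exact hΘ y x
    · have h := hpos f
      refine h.trans_eq ?_
      change (f.sum fun x ξ => f.sum fun y ζ => inner ℂ ξ (Θ x y ζ)).re =
        (f.sum fun x w => f.sum fun x' w' => inner ℂ (Θ x' x w) w').re
      congr 1
      refine Finsupp.sum_congr fun x _ => Finsupp.sum_congr fun y _ => ?_
      rw [← hΘ, ContinuousLinearMap.star_eq_adjoint, ContinuousLinearMap.adjoint_inner_right]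
  have : Fact (Matrix.of Θ).PosSemidef := ⟨hK⟩
  refine ⟨RKHS.OfKernel (Matrix.of Θ), inferInstance, inferInstance, inferInstance,
    fun x => RKHS.kerFun (RKHS.OfKernel (Matrix.of Θ)) x, fun x y ξ ζ => ?_, ?_⟩
  · rw [← ContinuousLinearMap.adjoint_inner_right, ← ContinuousLinearMap.comp_apply,
      ← RKHS.kernel_apply, RKHS.OfKernel.kernel_ofKernel]
    rfl
  · have h := RKHS.kerFun_dense (RKHS.OfKernel (Matrix.of Θ)) (𝕜 := ℂ) (X := X) (V := V)
    rw [← Submodule.dense_iff_topologicalClosure_eq_top] at h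
    exact h

variable {H H' : Type*} [NormedAddCommGroup H] [InnerProductSpace ℂ H]
  [NormedAddCommGroup H'] [NormedSpace ℂ H']

theorem dense_ext {v : X → (V →L[ℂ] H)}
    (hv : Dense (Submodule.span ℂ {z | ∃ x ξ, v x ξ = z} : Set H)) {S T : H →L[ℂ] H'}
    (h : ∀ x ξ, S (v x ξ) = T (v x ξ)) : S = T := by
  refine ContinuousLinearMap.ext_on hv ?_
  rintro _ ⟨x, ξ, rfl⟩
  exact h x ξ

theorem dense_eq_zero {v : X → (V →L[ℂ] H)}
    (hv : Dense (Submodule.span ℂ {z | ∃ x ξ, v x ξ = z} : Set H)) {z : H}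
    (h : ∀ x ξ, inner ℂ (v x ξ) z = 0) : z = 0 := by
  refine hv.eq_zero_of_inner_right ℂ fun w hw => ?_
  induction hw using Submodule.span_induction with
  | mem w hw => obtain ⟨x, ξ, rfl⟩ := hw; exact h x ξ
  | zero => simp
  | add a b _ _ ha hb => rw [inner_add_left, ha, hb, add_zero]
  | smul c a _ ha => rw [inner_smul_left, ha, mul_zero]

/-- A single inequality over finitely supported families gives both well-definedness on the span and
boundedness. -/
theorem exists_extension [CompleteSpace H'] {v : X → (V →L[ℂ] H)}
    (hv : Dense (Submodule.span ℂ {z | ∃ x ξ, v x ξ = z} : Set H)) (w : X → (V →L[ℂ] H')) (C : ℝ)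
    (h : ∀ f : X →₀ V, ‖f.sum fun x ξ => w x ξ‖ ≤ C * ‖f.sum fun x ξ => v x ξ‖) :
    ∃ T : H →L[ℂ] H', ∀ x ξ, T (v x ξ) = w x ξ := by
  let e : (X →₀ V) →ₗ[ℂ] H := Finsupp.lsum ℂ fun x => (v x).toLinearMap
  let g : (X →₀ V) →ₗ[ℂ] H' := Finsupp.lsum ℂ fun x => (w x).toLinearMap
  have he : DenseRange e := by
    refine hv.mono ?_
    have : Submodule.span ℂ {z | ∃ x ξ, v x ξ = z} ≤ LinearMap.range e := by
      rw [Submodule.span_le]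
      rintro _ ⟨x, ξ, rfl⟩
      exact ⟨Finsupp.single x ξ, by simp [e]⟩
    exact this
  refine ⟨g.extendOfNorm e, fun x ξ => ?_⟩
  have h1 := LinearMap.extendOfNorm_eq (f := g) he ⟨C, h⟩ (Finsupp.single x ξ)
  simpa [e, g] using h1

end Kernel

/-! ### Representations induced through a Hilbert bimodule -/

section Induced

variable {X V : Type u} [NormedAddCommGroup V] [InnerProductSpace ℂ V] [CompleteSpace V]
  [AddCommGroup X] [Module ℂ X]
  {B G : Type u} [NonUnitalCStarAlgebra B] [Group G] [TopologicalSpace G]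

/-- The action of the unitization extending an action of `B` by linear maps. -/
def unitizationAct (act : B →ₗ[ℂ] X →ₗ[ℂ] X) (b : Unitization ℂ B) (x : X) : X :=
  b.fst • x + act b.snd x

theorem unitizationAct_mul (act : B →ₗ[ℂ] X →ₗ[ℂ] X)
    (hmul : ∀ a b x, act (a * b) x = act a (act b x)) (a b : Unitization ℂ B) (x : X) :
    unitizationAct act (a * b) x = unitizationAct act a (unitizationAct act b x) := by
  simp only [unitizationAct, Unitization.fst_mul, Unitization.snd_mul, map_add, map_smul,
    LinearMap.add_apply, LinearMap.smul_apply, hmul, smul_add, mul_smul]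
  abel

variable (Θ : X → X →ₗ[ℂ] (V →L[ℂ] V))

theorem unitizationAct_adjoint (hΘ : ∀ x y, star (Θ x y) = Θ y x) (act : B →ₗ[ℂ] X →ₗ[ℂ] X)
    (hadj : ∀ b x y, Θ (act b x) y = Θ x (act (star b) y)) (b : Unitization ℂ B) (x y : X) :
    Θ (unitizationAct act b x) y = Θ x (unitizationAct act (star b) y) := by
  have h1 : ∀ x y, Θ (unitizationAct act b x) y = star (Θ y (unitizationAct act b x)) :=
    fun x y => (hΘ _ _).symm
  rw [h1, unitizationAct, unitizationAct, map_add, map_smul, star_add, star_smul, hΘ, hΘ, hadj,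
    map_add, map_smul]
  simp

/-- In the unitization `‖b‖² - b^* b = c^* c`, and positivity of the kernel on the vectors `c x` is
exactly the claimed inequality. An adjointable algebraic action is therefore automatically bounded
by `‖b‖`. -/
theorem norm_act_sq_le (hΘ : ∀ x y, star (Θ x y) = Θ y x)
    (hpos : ∀ f : X →₀ V, 0 ≤ (f.sum fun x ξ => f.sum fun y ζ => inner ℂ ξ (Θ x y ζ)).re)
    (act : B →ₗ[ℂ] X →ₗ[ℂ] X) (hmul : ∀ a b x, act (a * b) x = act a (act b x))
    (hadj : ∀ b x y, Θ (act b x) y = Θ x (act (star b) y)) (b : B) (f : X →₀ V) :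
    (f.sum fun x ξ => f.sum fun y ζ => inner ℂ ξ (Θ (act b x) (act b y) ζ)).re ≤
      ‖b‖ ^ 2 * (f.sum fun x ξ => f.sum fun y ζ => inner ℂ ξ (Θ x y ζ)).re := by
  let _ := CStarAlgebra.spectralOrder (Unitization ℂ B)
  have := CStarAlgebra.spectralOrderedRing (Unitization ℂ B)
  obtain ⟨c, hc⟩ : ∃ c : Unitization ℂ B,
      algebraMap ℝ (Unitization ℂ B) (‖b‖ ^ 2) - star (b : Unitization ℂ B) * b = star c * c := by
    rw [← CStarAlgebra.nonneg_iff_eq_star_mul_self, sub_nonneg]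
    have h := CStarAlgebra.star_mul_le_algebraMap_norm_sq (a := (b : Unitization ℂ B))
    rwa [Unitization.norm_inr] at h
  have hkey : ∀ x y, Θ (unitizationAct act c x) (unitizationAct act c y) =
      ((‖b‖ ^ 2 : ℝ) : ℂ) • Θ x y - Θ (act b x) (act b y) := by
    intro x y
    rw [unitizationAct_adjoint Θ hΘ act hadj, ← unitizationAct_mul act hmul, ← hc, hadj, ← hmul,
      ← map_smul, ← map_sub]
    congr 1
    have hr : algebraMap ℝ (Unitization ℂ B) (‖b‖ ^ 2) =
        Unitization.inl ((‖b‖ ^ 2 : ℝ) : ℂ) := rfl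
    have h1 : (algebraMap ℝ (Unitization ℂ B) (‖b‖ ^ 2) -
        star (b : Unitization ℂ B) * b).fst = ((‖b‖ ^ 2 : ℝ) : ℂ) := by
      rw [hr, ← Unitization.inr_star, ← Unitization.inr_mul]
      exact sub_zero _
    have h2 : (algebraMap ℝ (Unitization ℂ B) (‖b‖ ^ 2) -
        star (b : Unitization ℂ B) * b).snd = - (star b * b) := by
      rw [hr, ← Unitization.inr_star, ← Unitization.inr_mul]
      exact zero_sub _
    rw [unitizationAct, h1, h2, map_neg, LinearMap.neg_apply, sub_eq_add_neg]
  have h0 : 0 ≤ (f.sum fun x ξ => f.sum fun y ζ =>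
      inner ℂ ξ (Θ (unitizationAct act c x) (unitizationAct act c y) ζ)).re := by
    -- Different `x` may have the same image `c x`; `mapDomain` adds their coefficients, which
    -- leaves the form unchanged because it is additive in them.
    have h3 := hpos (f.mapDomain (unitizationAct act c))
    rw [Finsupp.sum_mapDomain_index (by simp) (by
      intro x ξ ξ'
      simp [Finsupp.sum_add])] at h3
    convert h3 using 2
    refine Finsupp.sum_congr fun x _ => ?_
    rw [Finsupp.sum_mapDomain_index (by simp) (by simp)]
  simp only [hkey, sub_apply, smul_apply, inner_sub_right, inner_smul_right, Finsupp.sum_sub] at h0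
  simp only [Finsupp.sum, ← Finset.mul_sum, Complex.sub_re, Complex.re_ofReal_mul] at h0 ⊢
  linarith

/-- The action of `B` is bounded by `norm_act_sq_le`, and `u s` preserves the kernel, so both pass
to the kernel space. On the total vectors `‖U_s v - U_{s₀} v‖² = 2‖v‖² - 2 Re ⟨U_{s₀} v, U_s v⟩`, so
weak continuity of the kernel gives strong continuity there; an `ε/3` argument extends it to all
vectors. -/
theorem exists_induced_rep (α : G →* Aut B) (hΘ : ∀ x y, star (Θ x y) = Θ y x)
    (hpos : ∀ f : X →₀ V, 0 ≤ (f.sum fun x ξ => f.sum fun y ζ => inner ℂ ξ (Θ x y ζ)).re)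
    (act : B →ₗ[ℂ] X →ₗ[ℂ] X) (hmul : ∀ a b x, act (a * b) x = act a (act b x))
    (hadj : ∀ b x y, Θ (act b x) y = Θ x (act (star b) y))
    (u : G → X → X) (hone : ∀ x, u 1 x = x) (humul : ∀ s t x, u (s * t) x = u s (u t x))
    (hu : ∀ s x y, Θ (u s x) (u s y) = Θ x y)
    (hcov : ∀ s b x, u s (act b x) = act (α s b) (u s x))
    (hcont : ∀ x y ξ ζ, Continuous fun s => inner ℂ ξ (Θ x (u s y) ζ)) :
    ∃ (ρ : CovariantRep α) (v : X → (V →L[ℂ] ρ.H)),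
      (∀ x y ξ ζ, inner ℂ (v x ξ) (v y ζ) = inner ℂ ξ (Θ x y ζ)) ∧
      Dense (Submodule.span ℂ {z | ∃ x ξ, v x ξ = z} : Set ρ.H) ∧
      (∀ b x ξ, ρ.π b (v x ξ) = v (act b x) ξ) ∧
      ∀ s x ξ, (ρ.U s : ρ.H →L[ℂ] ρ.H) (v x ξ) = v (u s x) ξ := by
  obtain ⟨H, iN, iI, iC, v, hv, hd⟩ := exists_kernel_space (fun x y => Θ x y) hΘ hpos
  have hsum : ∀ (w : X → X) (f : X →₀ V), ‖f.sum fun x ξ => v (w x) ξ‖ ^ 2 =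
      (f.sum fun x ξ => f.sum fun y ζ => inner ℂ ξ (Θ (w x) (w y) ζ)).re := by
    intro w f
    rw [@norm_sq_eq_re_inner ℂ, Finsupp.sum_inner]
    simp only [Finsupp.inner_sum, hv]
    rfl
  -- The kernel space sees `X` only as a set. Linearity in `x` is recovered because the difference
  -- is orthogonal to every `v z ζ`.
  have hlin : ∀ (c : ℂ) x y, v (x + c • y) = v x + c • v y := by
    intro c x y
    ext ξ
    rw [← sub_eq_zero]
    refine dense_eq_zero hd fun z ζ => ?_
    simp only [add_apply, smul_apply, inner_sub_right, inner_add_right, inner_smul_right, hv,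
      map_add, map_smul]
    ring
  have hzero : v 0 = 0 := by simpa using hlin (-1) 0 0
  have hadd : ∀ x y, v (x + y) = v x + v y := fun x y => by simpa using hlin 1 x y
  have hsmul : ∀ (c : ℂ) x, v (c • x) = c • v x := fun c x => by simpa [hzero] using hlin c 0 x
  have hπ : ∀ b, ∃ T : H →L[ℂ] H, ∀ x ξ, T (v x ξ) = v (act b x) ξ := fun b => by
    refine exists_extension hd (fun x => v (act b x)) ‖b‖ fun f => ?_
    rw [← abs_of_nonneg (norm_nonneg (f.sum fun x ξ => v (act b x) ξ)),
      ← abs_of_nonneg (mul_nonneg (norm_nonneg b) (norm_nonneg (f.sum fun x ξ => v x ξ))),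
      ← sq_le_sq, mul_pow, hsum, hsum fun x => x]
    exact norm_act_sq_le Θ hΘ hpos act hmul hadj b f
  have hU : ∀ s, ∃ T : H →L[ℂ] H, ∀ x ξ, T (v x ξ) = v (u s x) ξ := fun s => by
    refine exists_extension hd (fun x => v (u s x)) 1 fun f => ?_
    rw [one_mul, ← abs_of_nonneg (norm_nonneg (f.sum fun x ξ => v (u s x) ξ)),
      ← abs_of_nonneg (norm_nonneg (f.sum fun x ξ => v x ξ)), ← sq_le_sq, hsum, hsum fun x => x]
    simp only [hu, le_refl]
  choose π hπ using hπ
  choose U hU using hU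
  have hUinv : ∀ s x y, Θ x (u s y) = Θ (u s⁻¹ x) y := fun s x y => by
    rw [← hu s⁻¹, ← humul, inv_mul_cancel, hone]
  have hUstar : ∀ s, star (U s) = U s⁻¹ := fun s => by
    refine dense_ext hd fun x ξ => ?_
    rw [← sub_eq_zero]
    refine dense_eq_zero hd fun y ζ => ?_
    rw [inner_sub_right, ContinuousLinearMap.star_eq_adjoint,
      ContinuousLinearMap.adjoint_inner_right, hU, hU, hv, hv, hUinv, inv_inv, sub_self]
  have hUone : U 1 = 1 := dense_ext hd fun x ξ => by rw [hU, hone]; rfl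
  have hUmul : ∀ s t, U (s * t) = U s * U t := fun s t => dense_ext hd fun x ξ => by
    rw [mul_apply_eq_comp, hU, hU, hU, humul]
  have hUmem : ∀ s, U s ∈ unitary (H →L[ℂ] H) := fun s => by
    rw [Unitary.mem_iff, hUstar, ← hUmul, ← hUmul, inv_mul_cancel, mul_inv_cancel, hUone]
    exact ⟨rfl, rfl⟩
  have hUnorm : ∀ s ξ, ‖U s ξ‖ = ‖ξ‖ := fun s ξ => Unitary.norm_map (⟨U s, hUmem s⟩ : unitary _) ξ
  have hUcont : ∀ ξ : H, Continuous fun s => U s ξ := by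
    have h1 : ∀ x ξ, Continuous fun s => U s (v x ξ) := by
      intro x ξ
      rw [continuous_iff_continuousAt]
      intro s₀
      rw [ContinuousAt, tendsto_iff_norm_sub_tendsto_zero]
      have h2 : Filter.Tendsto (fun s => ‖U s (v x ξ) - U s₀ (v x ξ)‖ ^ 2) (nhds s₀)
          (nhds 0) := by
        have h3 : ∀ s, ‖U s (v x ξ) - U s₀ (v x ξ)‖ ^ 2 =
            2 * ‖v x ξ‖ ^ 2 - 2 * (inner ℂ ξ (Θ (u s₀ x) (u s x) ξ)).re := by
          intro s
          rw [← norm_neg, neg_sub, @norm_sub_sq ℂ, hUnorm, hUnorm, hU, hU, hv]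
          simp only [RCLike.re_to_complex]
          ring
        simp only [h3]
        have h4 := (Complex.continuous_re.comp (hcont (u s₀ x) x ξ ξ)).tendsto s₀
        have h5 := (h4.const_mul 2).const_sub (2 * ‖v x ξ‖ ^ 2)
        have h7 : 2 * ‖v x ξ‖ ^ 2 -
            2 * (Complex.re ∘ fun s => inner ℂ ξ (Θ (u s₀ x) (u s x) ξ)) s₀ = 0 := by
          rw [Function.comp_apply, hu, @norm_sq_eq_re_inner ℂ, hv]
          simp
        rw [h7] at h5
        exact h5
      have h6 := h2.sqrt
      simpa using h6
    intro ξ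
    have h2 : ∀ ζ ∈ Submodule.span ℂ {z | ∃ x ξ, v x ξ = z}, Continuous fun s => U s ζ := by
      intro ζ hζ
      induction hζ using Submodule.span_induction with
      | mem w hw => obtain ⟨x, ξ, rfl⟩ := hw; exact h1 x ξ
      | zero => simpa using continuous_const
      | add a b _ _ ha hb => simpa only [map_add] using! ha.add hb
      | smul c a _ ha => simpa only [map_smul] using! ha.const_smul c
    rw [Metric.continuous_iff']
    intro s ε hε
    obtain ⟨ζ, hζ, hd'⟩ := Metric.mem_closure_iff.1 (hd ξ) (ε / 3) (by positivity)
    filter_upwards [Metric.continuous_iff'.1 (h2 ζ hζ) s (ε / 3) (by positivity)] with t ht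
    have e1 : ∀ r, dist (U r ξ) (U r ζ) < ε / 3 := fun r => by
      rw [dist_eq_norm, ← map_sub, hUnorm, ← dist_eq_norm]; exact hd'
    have e2 := e1 s
    rw [dist_comm] at e2
    linarith [dist_triangle4 (U t ξ) (U t ζ) (U s ζ) (U s ξ), e1 t]
  let π' : B →⋆ₙₐ[ℂ] (H →L[ℂ] H) :=
    { toFun := π
      map_smul' := fun c b => dense_ext hd fun x ξ => by
        simp [hπ, hsmul]
      map_zero' := dense_ext hd fun x ξ => by simp [hπ, hzero]
      map_add' := fun a b => dense_ext hd fun x ξ => by simp [hπ, hadd]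
      map_mul' := fun a b => dense_ext hd fun x ξ => by
        rw [mul_apply_eq_comp, hπ, hπ, hπ, hmul]
      map_star' := fun b => dense_ext hd fun x ξ => by
        rw [← sub_eq_zero]
        refine dense_eq_zero hd fun y ζ => ?_
        rw [inner_sub_right, ContinuousLinearMap.star_eq_adjoint,
          ContinuousLinearMap.adjoint_inner_right, hπ, hπ, hv, hv, hadj, sub_self] }
  let U' : G →* unitary (H →L[ℂ] H) :=
    { toFun := fun s => ⟨U s, hUmem s⟩
      map_one' := Subtype.ext hUone
      map_mul' := fun s t => Subtype.ext (hUmul s t) }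
  refine ⟨⟨H, π', U', hUcont, fun s b => dense_ext hd fun x ξ => ?_⟩, v, hv, hd, hπ, hU⟩
  change π (α s b) (v x ξ) = U s (π b (star (U s) (v x ξ)))
  rw [hUstar, hU, hπ, hπ, hU, hcov, ← humul, mul_inv_cancel, hone]

end Induced

/-- Images of interiors of compact neighbourhoods are open, and finitely many of them cover `C`. -/
theorem exists_compact_lift_of_isOpenQuotientMap {F Y : Type*} [TopologicalSpace F]
    [TopologicalSpace Y] [LocallyCompactSpace F] {π : F → Y} (hπ : IsOpenQuotientMap π) {C : Set Y}
    (hC : IsCompact C) : ∃ S : Set F, IsCompact S ∧ C ⊆ π '' S := by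
  choose N hN hNx using fun x : F => exists_compact_mem_nhds x
  obtain ⟨t, ht⟩ := hC.elim_finite_subcover (fun x : F => π '' interior (N x))
    (fun x => hπ.isOpenMap _ isOpen_interior) (fun y _ => by
      obtain ⟨x, rfl⟩ := hπ.surjective y
      exact Set.mem_iUnion.2 ⟨x, x, mem_interior_iff_mem_nhds.2 (hNx x), rfl⟩)
  refine ⟨⋃ x ∈ t, N x, t.isCompact_biUnion fun x _ => hN x, fun y hy => ?_⟩
  obtain ⟨x, hx, z, hz, rfl⟩ := Set.mem_iUnion₂.1 (ht hy)
  exact ⟨z, Set.mem_iUnion₂.2 ⟨x, hx, interior_subset hz⟩, rfl⟩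

/-! ### Elements of induced algebras -/

section InducedBasic

variable {H X A : Type u} [Group H] [TopologicalSpace X] [MulAction H X]
  [NonUnitalCStarAlgebra A] {β : H →* Aut A}

namespace Induced

theorem isInduced (f : Induced X β) : IsInduced β f.1 := f.2

theorem apply_smul (f : Induced X β) (h : H) (x : X) : f (h • x) = β h (f x) := f.isInduced.1 h x

@[fun_prop]
theorem continuous (f : Induced X β) : Continuous f := f.1.continuous

@[simp] theorem zero_apply (x : X) : (0 : Induced X β) x = 0 := rfl

@[simp] theorem add_apply (f g : Induced X β) (x : X) : (f + g) x = f x + g x := rfl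

@[simp] theorem sub_apply (f g : Induced X β) (x : X) : (f - g) x = f x - g x := rfl

@[simp] theorem neg_apply (f : Induced X β) (x : X) : (-f) x = -f x := rfl

@[simp] theorem mul_apply (f g : Induced X β) (x : X) : (f * g) x = f x * g x := rfl

@[simp] theorem star_apply (f : Induced X β) (x : X) : (star f) x = star (f x) := rfl

@[simp] theorem smul_apply (c : ℂ) (f : Induced X β) (x : X) : (c • f) x = c • f x := rfl

@[simp] theorem real_smul_apply (c : ℝ) (f : Induced X β) (x : X) : (c • f) x = c • f x := by
  rw [← Complex.coe_smul, smul_apply, Complex.coe_smul]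

theorem norm_apply_le (f : Induced X β) (x : X) : ‖f x‖ ≤ ‖f‖ := f.1.norm_coe_le_norm x

theorem norm_le {f : Induced X β} {C : ℝ} (hC : 0 ≤ C) (h : ∀ x, ‖f x‖ ≤ C) : ‖f‖ ≤ C :=
  (BoundedContinuousFunction.norm_le hC).2 h

theorem exists_compact_norm_lt (f : Induced X β) {ε : ℝ} (hε : 0 < ε) :
    ∃ C : Set (OrbitSpace H X), IsCompact C ∧ ∀ x, orb H x ∉ C → ‖f x‖ < ε :=
  (isInduced_iff.1 f.isInduced).2 ε hε

theorem ext {f g : Induced X β} (h : ∀ x, f x = g x) : f = g := DFunLike.ext _ _ h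

/-- Evaluation at a point. -/
def evalCLM (β : H →* Aut A) (x : X) : Induced X β →L[ℂ] A :=
  LinearMap.mkContinuous
    { toFun := fun f => f x
      map_add' := fun _ _ => rfl
      map_smul' := fun _ _ => rfl } 1 (fun f => (f.norm_apply_le x).trans_eq (one_mul _).symm)

theorem integral_apply {M : Type*} [MeasurableSpace M] {μ : Measure M} {F : M → Induced X β}
    (hF : Integrable F μ) (x : X) : (∫ m, F m ∂μ) x = ∫ m, F m x ∂μ :=
  ((evalCLM β x).integral_comp_comm hF).symm

theorem continuous_apply₂ {M : Type*} [TopologicalSpace M] {F : M → Induced X β}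
    (hF : Continuous F) : Continuous fun z : M × X => F z.1 z.2 := by
  have h1 : Continuous fun z : M × X => ((F z.1).1 : X →ᵇ A) :=
    continuous_subtype_val.comp (hF.comp continuous_fst)
  exact h1.eval continuous_snd

/-- Joint continuity is uniform on the compact set `C`, equivariance carries the estimate to the
saturation of `C`, and `hdecay` covers the rest of the space. -/
theorem continuous_of_forall {M : Type*} [TopologicalSpace M] {F : M → Induced X β}
    (hF : Continuous fun z : M × X => F z.1 z.2)
    (hdecay : ∀ m₀, ∀ ε > 0, ∃ C : Set X, IsCompact C ∧
      ∀ᶠ m in nhds m₀, ∀ x, (∀ h : H, h • x ∉ C) → ‖F m x - F m₀ x‖ ≤ ε) : Continuous F := by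
  rw [continuous_iff_continuousAt]
  intro m₀
  rw [ContinuousAt, Metric.tendsto_nhds]
  intro ε hε
  obtain ⟨C, hC, hCm⟩ := hdecay m₀ (ε / 2) (half_pos hε)
  have h1 : ∀ᶠ m in nhds m₀, ∀ x ∈ C, ‖F m x - F m₀ x‖ < ε / 2 := by
    refine hC.eventually_forall_of_forall_eventually fun x _ => ?_
    have h2 : Continuous fun z : M × X => ‖F z.1 z.2 - F m₀ z.2‖ :=
      (hF.sub ((F m₀).continuous.comp continuous_snd)).norm
    exact h2.continuousAt.eventually (gt_mem_nhds (by simpa using half_pos hε))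
  filter_upwards [hCm, h1] with m hm hm'
  rw [dist_eq_norm]
  refine lt_of_le_of_lt (norm_le (half_pos hε).le fun x => ?_) (half_lt_self hε)
  by_cases hx : ∃ h : H, h • x ∈ C
  · obtain ⟨h, hx⟩ := hx
    have h3 := hm' _ hx
    rw [apply_smul, apply_smul, ← map_sub, norm_aut] at h3
    exact h3.le
  · push Not at hx
    exact hm x hx

end Induced

variable [TopologicalSpace H] [ContinuousSMul H X] [T2Space X] [LocallyCompactSpace X]

theorem exists_compact_lift {C : Set (OrbitSpace H X)} (hC : IsCompact C) :
    ∃ C' : Set X, IsCompact C' ∧ C ⊆ orb H '' C' :=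
  exists_compact_lift_of_isOpenQuotientMap MulAction.isOpenQuotientMap_quotientMk hC

theorem Induced.exists_compact_norm_lt' (f : Induced X β) {ε : ℝ} (hε : 0 < ε) :
    ∃ C : Set X, IsCompact C ∧ ∀ x, (∀ h : H, h • x ∉ C) → ‖f x‖ < ε := by
  obtain ⟨C, hC, hCx⟩ := f.exists_compact_norm_lt hε
  obtain ⟨C', hC', hCC'⟩ := exists_compact_lift hC
  refine ⟨C', hC', fun x hx => hCx x fun hm => ?_⟩
  obtain ⟨y, hy, hyx⟩ := hCC' hm
  obtain ⟨h, rfl⟩ := orb_eq_iff.1 hyx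
  exact hx h hy

end InducedBasic

/-! ### Averaging over a proper action -/

section Averaging

variable {H X A : Type u} [Group H] [TopologicalSpace H] [TopologicalSpace X] [MulAction H X]
  [NonUnitalCStarAlgebra A]

/-- The induced element defined by an equivariant continuous function which vanishes off the
saturation of a compact set. -/
def mkInd (β : H →* Aut A) (f : X → A) (hf : Continuous f) (hβ : ∀ h x, f (h • x) = β h (f x))
    (C : Set X) (hC : IsCompact C) (hCf : ∀ x, f x ≠ 0 → ∃ h : H, h • x ∈ C) : Induced X β :=
  have hb : ∃ M, ∀ x, ‖f x‖ ≤ M := by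
    obtain ⟨M, hM⟩ := hC.exists_bound_of_continuousOn hf.continuousOn
    refine ⟨max M 0, fun x => ?_⟩
    by_cases hx : f x = 0
    · simp [hx]
    · obtain ⟨h, hh⟩ := hCf x hx
      have := hM _ hh
      rw [hβ, norm_aut] at this
      exact this.trans (le_max_left _ _)
  (⟨BoundedContinuousFunction.ofNormedAddCommGroup f hf hb.choose hb.choose_spec,
    isInduced_iff.2 ⟨hβ, fun ε hε => ⟨orb H '' C, hC.image continuous_quotient_mk', fun x hx => by
      by_contra hne
      have h0 : f x ≠ 0 := fun h0 => hne (by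
        change ‖f x‖ < ε
        simpa [h0] using hε)
      obtain ⟨h, hh⟩ := hCf x h0
      exact hx ⟨_, hh, orb_smul H h x⟩⟩⟩⟩ : inducedSubalgebra X β)

/-- The translate `p ↦ β_h(x(h⁻¹ p))`. -/
def transl [ContinuousConstSMul H X] [T2Space X] (β : H →* Aut A) (h : H) :
    C_c(X, A) →ₗ[ℂ] C_c(X, A) where
  toFun x := mkCc (fun p => β h (x (h⁻¹ • p)))
    ((continuous_aut (β h)).comp (x.continuous.comp (continuous_const_smul h⁻¹)))
    ((h • ·) '' tsupport x) ((isCompact_tsupport x).image (continuous_const_smul h))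
    (fun p hp => by
      rw [cc_eq_zero x fun hm => hp ⟨_, hm, smul_inv_smul h p⟩, map_zero])
  map_add' x y := by ext p; simp
  map_smul' c x := by ext p; simp

section transl

variable [ContinuousConstSMul H X] [T2Space X] (β : H →* Aut A)

theorem transl_apply (h : H) (x : C_c(X, A)) (p : X) :
    transl β h x p = β h (x (h⁻¹ • p)) := rfl

theorem transl_one (x : C_c(X, A)) : transl β 1 x = x := by
  ext p; simp [transl_apply]

theorem transl_mul (h k : H) (x : C_c(X, A)) : transl β (h * k) x = transl β h (transl β k x) := by
  ext p
  rw [transl_apply, transl_apply, transl_apply, map_mul, aut_mul_apply, mul_inv_rev, mul_smul]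

theorem transl_star (h : H) (x : C_c(X, A)) : transl β h (star x) = star (transl β h x) := by
  ext p
  exact map_star (β h) _

theorem transl_cc_mul (h : H) (x y : C_c(X, A)) :
    transl β h (x * y) = transl β h x * transl β h y := by
  ext p
  exact map_mul (β h) _ _

end transl

/-- Pointwise left multiplication of `C_c(X, A)` by an induced algebra. -/
def indMul [T2Space X] {β : H →* Aut A} : Induced X β →ₗ[ℂ] C_c(X, A) →ₗ[ℂ] C_c(X, A) :=
  LinearMap.mk₂ ℂ (fun f x => mkCc (fun p => f p * x p) (f.continuous.mul x.continuous)
    (tsupport x) (isCompact_tsupport x) (fun p hp => by rw [cc_eq_zero x hp, mul_zero]))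
    (fun f g x => by ext p; exact add_mul _ _ _)
    (fun c f x => by ext p; exact smul_mul_assoc _ _ _)
    (fun f x y => by ext p; exact mul_add _ _ _)
    (fun c f x => by ext p; exact mul_smul_comm _ _ _)

/-- Pointwise right multiplication of `C_c(X, A)` by an induced algebra. -/
def mulInd [T2Space X] {β : H →* Aut A} (x : C_c(X, A)) (f : Induced X β) : C_c(X, A) :=
  mkCc (fun p => x p * f p) (x.continuous.mul f.continuous)
    (tsupport x) (isCompact_tsupport x) (fun p hp => by rw [cc_eq_zero x hp, zero_mul])

/-- Pointwise multiplication by a real-valued function. -/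
def realMul [T2Space X] (w : C(X, ℝ)) (x : C_c(X, A)) : C_c(X, A) :=
  mkCc (fun p => w p • x p) (w.continuous.smul x.continuous)
    (tsupport x) (isCompact_tsupport x) (fun p hp => by rw [cc_eq_zero x hp, smul_zero])

@[simp] theorem indMul_apply [T2Space X] {β : H →* Aut A} (f : Induced X β) (x : C_c(X, A)) (p : X) :
    indMul f x p = f p * x p := rfl

@[simp] theorem mulInd_apply [T2Space X] {β : H →* Aut A} (f : Induced X β) (x : C_c(X, A)) (p : X) :
    mulInd x f p = x p * f p := rfl

@[simp] theorem realMul_apply [T2Space X] (w : C(X, ℝ)) (x : C_c(X, A)) (p : X) :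
    realMul w x p = w p • x p := rfl

variable [ProperSMul H X]

/-- Properness of the action enters the integrals here: the set of `h` for which `C` meets `h C'` is
the projection of a compact preimage. It provides the compact supports needed for the orbit
integrals and the compactly supported inner products. -/
theorem isCompact_returnSet {C C' : Set X} (hC : IsCompact C) (hC' : IsCompact C') :
    IsCompact {h : H | ∃ x ∈ C, h⁻¹ • x ∈ C'} := by
  have h1 := (ProperSMul.isProperMap_smul_pair (G := H) (X := X)).isCompact_preimage
    (hC.prod hC')
  convert! h1.image continuous_fst using 1
  ext h
  constructor
  · rintro ⟨x, hx, hx'⟩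
    exact ⟨(h, h⁻¹ • x), ⟨by simpa using hx, hx'⟩, rfl⟩
  · rintro ⟨⟨h, x⟩, ⟨hx, hx'⟩, rfl⟩
    exact ⟨h • x, hx, by simpa using hx'⟩

variable [IsTopologicalGroup H] [LocallyCompactSpace H] [T2Space H] [MeasurableSpace H]
  [BorelSpace H] [T2Space X] [LocallyCompactSpace X] {β : H →* Aut A}

theorem continuous_avg_integrand (hβ : ∀ a, Continuous fun h => β h a) (F : C_c(X, A)) :
    Continuous fun z : X × H => β z.2 (F (z.2⁻¹ • z.1)) :=
  continuous_aut_apply (θ := fun z : X × H => β z.2) (fun a => (hβ a).comp continuous_snd)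
    (by fun_prop)

theorem avg_integrand_eq_zero (F : C_c(X, A)) {N : Set X} {x : X} (hx : x ∈ N) {h : H}
    (hh : h ∉ {h : H | ∃ x ∈ N, h⁻¹ • x ∈ tsupport F}) : β h (F (h⁻¹ • x)) = 0 := by
  rw [cc_eq_zero F fun hm => hh ⟨x, hx, hm⟩, map_zero]

theorem integrable_avg (hβ : ∀ a, Continuous fun h => β h a) (F : C_c(X, A)) (x : X) :
    Integrable (fun h => β h (F (h⁻¹ • x))) Measure.haar :=
  integrable_of_compact ((continuous_avg_integrand hβ F).comp (Continuous.prodMk_right x))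
    (isCompact_returnSet (isCompact_singleton (x := x)) (isCompact_tsupport F))
    (fun _ hh => avg_integrand_eq_zero F (Set.mem_singleton x) hh)

/-- The average `x ↦ ∫_H β_h(F(h⁻¹ x)) dh`, an element of the induced algebra. -/
def avg (hβ : ∀ a, Continuous fun h => β h a) : C_c(X, A) →ₗ[ℂ] Induced X β where
  toFun F := mkInd β (fun x => ∫ h, β h (F (h⁻¹ • x)) ∂Measure.haar)
    (continuous_integral_of_compact (continuous_avg_integrand hβ F) fun x₀ => by
      obtain ⟨N, hN, hNx⟩ := exists_compact_mem_nhds x₀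
      exact ⟨N, hNx, _, isCompact_returnSet hN (isCompact_tsupport F), fun x hx h hh =>
        avg_integrand_eq_zero F hx hh⟩)
    (fun k x => by
      rw [← integral_mul_left_eq_self _ k, ← integral_aut]
      congr 1
      ext h
      rw [map_mul, aut_mul_apply, mul_inv_rev, mul_smul, inv_smul_smul])
    (tsupport F) (isCompact_tsupport F) (fun x hx => by
      by_contra! hne
      refine hx ?_
      rw [← integral_zero H A (μ := Measure.haar)]
      congr 1
      ext h
      rw [cc_eq_zero F (hne _), map_zero])
  map_add' F F' := Induced.ext fun x => by
    change ∫ h, β h (F (h⁻¹ • x) + F' (h⁻¹ • x)) ∂Measure.haar = _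
    simp only [map_add]
    exact integral_add (integrable_avg hβ F x) (integrable_avg hβ F' x)
  map_smul' c F := Induced.ext fun x => by
    change ∫ h, β h (c • F (h⁻¹ • x)) ∂Measure.haar = _
    simp only [map_smul]
    exact integral_smul _ _

theorem avg_apply (hβ : ∀ a, Continuous fun h => β h a) (F : C_c(X, A)) (x : X) :
    avg hβ F x = ∫ h, β h (F (h⁻¹ • x)) ∂Measure.haar := rfl

theorem avg_star (hβ : ∀ a, Continuous fun h => β h a) (F : C_c(X, A)) :
    avg hβ (star F) = star (avg hβ F) := Induced.ext fun x => by
  rw [Induced.star_apply, avg_apply, avg_apply, ← integral_star']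
  congr 1
  ext h
  exact map_star (β h) _

theorem avg_mulInd (hβ : ∀ a, Continuous fun h => β h a) (F : C_c(X, A)) (b : Induced X β) :
    avg hβ (mulInd F b) = avg hβ F * b := Induced.ext fun x => by
  rw [Induced.mul_apply, avg_apply, avg_apply,
    ← integral_mul_const_of_integrable (integrable_avg hβ F x)]
  congr 1
  ext h
  rw [mulInd_apply, map_mul, Induced.apply_smul, ← aut_mul_apply, ← map_mul]
  simp

/-- Translating inside the average is a right translation of the integration variable, hence the
modular factor. -/
theorem avg_transl (hβ : ∀ a, Continuous fun h => β h a) (F : C_c(X, A)) (k : H) :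
    avg hβ (transl β k F) = (modular k)⁻¹ • avg hβ F := Induced.ext fun x => by
  rw [Induced.real_smul_apply, avg_apply, avg_apply]
  refine Eq.trans ?_
    (integral_mul_right ((continuous_avg_integrand hβ F).comp (Continuous.prodMk_right x))
      (isCompact_returnSet (isCompact_singleton (x := x)) (isCompact_tsupport F))
      (fun _ hh => avg_integrand_eq_zero F (Set.mem_singleton x) hh) k)
  congr 1
  ext h
  simp only [Function.comp]
  rw [transl_apply, map_mul, aut_mul_apply, mul_inv_rev, mul_smul]

/-- For `x ∈ C` the integrand lives on the compact set of `h` with `C ∩ h C ≠ ∅`, whose Haar measure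
is the constant; other points are moved into `C` by equivariance or have average zero. -/
theorem exists_norm_avg_le (hβ : ∀ a, Continuous fun h => β h a) {C : Set X} (hC : IsCompact C) :
    ∃ M : ℝ, 0 ≤ M ∧ ∀ (F : C_c(X, A)) (r : ℝ), 0 ≤ r → (∀ x, x ∉ C → F x = 0) →
      (∀ x, ‖F x‖ ≤ r) → ‖avg hβ F‖ ≤ M * r := by
  let S : Set H := {h : H | ∃ x ∈ C, h⁻¹ • x ∈ C}
  have hS : IsCompact S := isCompact_returnSet hC hC
  refine ⟨Measure.haar.real S, measureReal_nonneg, fun F r hr hF hFr => ?_⟩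
  refine Induced.norm_le (by positivity) fun x => ?_
  have key : ∀ x ∈ C, ‖avg hβ F x‖ ≤ Measure.haar.real S * r := fun x hx => by
    rw [avg_apply, ← setIntegral_eq_integral_of_forall_compl_eq_zero (s := S), mul_comm]
    · refine norm_setIntegral_le_of_norm_le_const hS.measure_lt_top fun h _ => ?_
      rw [norm_aut]
      exact hFr _
    · intro h hh
      rw [hF _ fun hm => hh ⟨x, hx, hm⟩, map_zero]
  by_cases hx : ∃ h : H, h • x ∈ C
  · obtain ⟨h, hh⟩ := hx
    have := key _ hh
    rwa [Induced.apply_smul, norm_aut] at this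
  · push Not at hx
    have h0 : avg hβ F x = 0 := by
      rw [avg_apply, ← integral_zero H A (μ := Measure.haar)]
      congr 1
      ext h
      rw [hF _ (hx _), map_zero]
    rw [h0, norm_zero]
    positivity

theorem continuous_avg {M : Type*} [TopologicalSpace M] (hβ : ∀ a, Continuous fun h => β h a)
    {F : M → C_c(X, A)} (hF : Continuous fun z : M × X => F z.1 z.2) {C : Set X}
    (hC : IsCompact C) (hFC : ∀ m x, x ∉ C → F m x = 0) : Continuous fun m => avg hβ (F m) := by
  obtain ⟨M', hM', hb⟩ := exists_norm_avg_le hβ hC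
  rw [continuous_iff_continuousAt]
  intro m₀
  rw [ContinuousAt, Metric.tendsto_nhds]
  intro ε hε
  have hδ : 0 < ε / (M' + 1) := by positivity
  have h1 : ∀ᶠ m in nhds m₀, ∀ x ∈ C, ‖F m x - F m₀ x‖ < ε / (M' + 1) := by
    refine hC.eventually_forall_of_forall_eventually fun x _ => ?_
    have h2 : Continuous fun z : M × X => ‖F z.1 z.2 - F m₀ z.2‖ :=
      (hF.sub ((F m₀).continuous.comp continuous_snd)).norm
    exact h2.continuousAt.eventually (gt_mem_nhds (by simpa using hδ))
  filter_upwards [h1] with m hm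
  rw [dist_eq_norm, ← map_sub]
  refine lt_of_le_of_lt (hb (F m - F m₀) _ hδ.le (fun x hx => ?_) fun x => ?_) ?_
  · rw [CompactlySupportedContinuousMap.sub_apply, hFC m x hx, hFC m₀ x hx, sub_zero]
  · rw [CompactlySupportedContinuousMap.sub_apply]
    by_cases hx : x ∈ C
    · exact (hm x hx).le
    · rw [hFC m x hx, hFC m₀ x hx, sub_zero, norm_zero]
      exact hδ.le
  · calc M' * (ε / (M' + 1)) < (M' + 1) * (ε / (M' + 1)) := by gcongr; linarith
      _ = ε := by field_simp

theorem avg_integral {M : Type*} [TopologicalSpace M] [T2Space M] [MeasurableSpace M]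
    [OpensMeasurableSpace M] {μ : Measure M} [IsFiniteMeasureOnCompacts μ]
    (hβ : ∀ a, Continuous fun h => β h a)
    {F : M → C_c(X, A)} (hF : Continuous fun z : M × X => F z.1 z.2) {C : Set X}
    (hC : IsCompact C) (hFC : ∀ m x, x ∉ C → F m x = 0) {C' : Set M} (hC' : IsCompact C')
    (hFC' : ∀ m, m ∉ C' → ∀ x, F m x = 0) {Z : C_c(X, A)} (hZ : ∀ x, Z x = ∫ m, F m x ∂μ) :
    avg hβ Z = ∫ m, avg hβ (F m) ∂μ := Induced.ext fun x => by
  have hz : ∀ m, m ∉ C' → avg hβ (F m) = 0 := fun m hm => by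
    rw [show F m = 0 by ext x; exact hFC' m hm x, map_zero]
  rw [Induced.integral_apply (integrable_of_compact (continuous_avg hβ hF hC hFC) hC' hz)]
  simp only [avg_apply, hZ, ← integral_aut]
  refine integral_swap_of_compact (f := fun h m => β h (F m (h⁻¹ • x)))
    (C := {h : H | ∃ y ∈ ({x} : Set X), h⁻¹ • y ∈ C}) ?_
    (isCompact_returnSet isCompact_singleton hC) hC' fun h m hne => ?_
  · refine continuous_aut_apply (θ := fun z : H × M => β z.1) (fun a => (hβ a).comp continuous_fst)
      (hF.comp (continuous_snd.prodMk ?_))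
    fun_prop
  · constructor
    · refine ⟨x, rfl, ?_⟩
      by_contra hm
      exact hne (by rw [hFC _ _ hm, map_zero])
    · by_contra hm
      exact hne (by rw [hFC' _ hm, map_zero])

/-- At each point the integral is positive in `A`. The criterion `exists_star_mul_self` turns this
into a square in the induced algebra without showing that pointwise square roots are induced. -/
theorem exists_avg_eq_star_mul_self (hβ : ∀ a, Continuous fun h => β h a) (x : C_c(X, A)) :
    ∃ b, avg hβ (star x * x) = star b * b := by
  refine exists_star_mul_self ?_ fun c d hcd => ?_
  · rw [← avg_star, star_mul, star_star]
  · refine Induced.ext fun p => ?_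
    have h1 := DFunLike.congr_fun hcd p
    simp only [Induced.mul_apply, Induced.star_apply, Induced.neg_apply, avg_apply] at h1
    let _ := CStarAlgebra.spectralOrder A
    have := CStarAlgebra.spectralOrderedRing A
    have h2 : (0 : A) ≤ ∫ h, β h ((star x * x) (h⁻¹ • p)) ∂Measure.haar := by
      refine integral_nonneg fun h => ?_
      change (0 : A) ≤ β h (star (x (h⁻¹ • p)) * x (h⁻¹ • p))
      rw [map_mul, map_star]
      exact star_mul_self_nonneg _
    have h3 : (0 : A) ≤ -(star (d p) * d p) := h1 ▸ star_left_conjugate_nonneg h2 (c p)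
    have h4 : star (d p) * d p = 0 := le_antisymm (neg_nonneg.1 h3) (star_mul_self_nonneg _)
    exact CStarRing.star_mul_self_eq_zero_iff _ |>.1 h4

end Averaging

/-! ### The function-level bimodule structure on `C_c(P, A)` -/

namespace CommutingSystem

section

variable {K L P A : Type u} [Group K] [TopologicalSpace K] [Group L] [TopologicalSpace L]
  [MulAction K P] [MulAction L P] [NonUnitalCStarAlgebra A]

/-- Strong continuity of the two actions on the coefficient algebra. -/
structure IsCont (D : CommutingSystem K L P A) : Prop where
  σ : ∀ a : A, Continuous fun s => D.σ s a
  η : ∀ a : A, Continuous fun t => D.η t a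

/-- A reducible form of `CommutingSystem.swap`. -/
abbrev sw (D : CommutingSystem K L P A) : CommutingSystem L K P A where
  σ := D.η
  η := D.σ
  smul_comm t s p := (D.smul_comm s t p).symm
  commute t s := (D.commute s t).symm

theorem IsCont.sw {D : CommutingSystem K L P A} (hD : D.IsCont) : D.sw.IsCont :=
  ⟨hD.η, hD.σ⟩

theorem diag_apply [TopologicalSpace P] [ContinuousConstSMul K P] (D : CommutingSystem K L P A)
    (s : K) (f : D.Ind) (p : P) : D.diag s f p = D.σ s (f (s⁻¹ • p)) := rfl

theorem sw_diag_apply [TopologicalSpace P] [ContinuousConstSMul L P]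
    (D : CommutingSystem K L P A) (t : L) (f : D.sw.Ind) (p : P) :
    D.sw.diag t f p = D.η t (f (t⁻¹ • p)) := rfl

end

variable {K L P A : Type u}
  [Group K] [TopologicalSpace K] [IsTopologicalGroup K] [LocallyCompactSpace K] [T2Space K]
  [MeasurableSpace K] [BorelSpace K]
  [Group L] [TopologicalSpace L] [IsTopologicalGroup L] [LocallyCompactSpace L] [T2Space L]
  [MeasurableSpace L] [BorelSpace L]
  [TopologicalSpace P] [T2Space P] [LocallyCompactSpace P]
  [MulAction K P] [MulAction L P] [ProperSMul K P] [ProperSMul L P]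
  [NonUnitalCStarAlgebra A] {D : CommutingSystem K L P A}

/-- If `f` is small off the `L`-saturation of `C`, then for `s` in a compact neighbourhood `N` of
`s₀` the translates are small off the saturation of `N C`, because the two actions commute. -/
theorem continuous_diag (hD : D.IsCont) (f : D.Ind) : Continuous fun s => D.diag s f := by
  refine Induced.continuous_of_forall ?_ fun s₀ ε hε => ?_
  · exact continuous_aut_apply (θ := fun z : K × P => D.σ z.1)
      (fun a => (hD.σ a).comp continuous_fst) (by fun_prop)
  · obtain ⟨C, hC, hCf⟩ := f.exists_compact_norm_lt' (half_pos hε)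
    obtain ⟨N, hN, hNs⟩ := exists_compact_mem_nhds s₀
    refine ⟨(fun z : K × P => z.1 • z.2) '' (N ×ˢ C), (hN.prod hC).image continuous_smul, ?_⟩
    have key : ∀ s ∈ N, ∀ p, (∀ t : L, t • p ∉ (fun z : K × P => z.1 • z.2) '' (N ×ˢ C)) →
        ‖D.diag s f p‖ < ε / 2 := fun s hs p hp => by
      rw [diag_apply, norm_aut]
      refine hCf _ fun t ht => hp t ⟨(s, t • s⁻¹ • p), ⟨hs, ht⟩, ?_⟩
      simp only
      rw [D.smul_comm, smul_inv_smul]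
    filter_upwards [hNs] with s hs p hp
    have h1 := key s hs p hp
    have h2 := key s₀ (mem_of_mem_nhds hNs) p hp
    have h3 := norm_sub_le (D.diag s f p) (D.diag s₀ f p)
    linarith

theorem continuous_sw_diag (hD : D.IsCont) (f : D.sw.Ind) :
    Continuous fun t => D.sw.diag t f := continuous_diag hD.sw f

theorem transl_comm (D : CommutingSystem K L P A) (s : K) (t : L) (x : C_c(P, A)) :
    transl D.σ s (transl D.η t x) = transl D.η t (transl D.σ s x) := by
  ext p
  simp only [transl_apply]
  rw [aut_comm (D.commute s t), D.smul_comm]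

theorem diag_avg (hD : D.IsCont) (t : L) (F : C_c(P, A)) :
    D.sw.diag t (avg hD.σ F) = avg hD.σ (transl D.η t F) := Induced.ext fun p => by
  rw [sw_diag_apply, avg_apply, avg_apply, ← integral_aut]
  congr 1
  ext s
  rw [transl_apply, aut_comm (D.commute s t), D.smul_comm]

/-- The inner product `∫_K σ_s((x^* y)(s⁻¹ p)) ds` with values in `Ind_K^P σ`. -/
def yinn (hD : D.IsCont) (x y : C_c(P, A)) : D.sw.Ind := avg hD.σ (star x * y)

theorem yinn_apply (hD : D.IsCont) (x y : C_c(P, A)) (p : P) :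
    yinn hD x y p = ∫ s, D.σ s (star (x (s⁻¹ • p)) * y (s⁻¹ • p)) ∂Measure.haar := rfl

theorem yinn_add_right (hD : D.IsCont) (x y z : C_c(P, A)) :
    yinn hD x (y + z) = yinn hD x y + yinn hD x z := by
  rw [yinn, mul_add, map_add]; rfl

theorem yinn_smul_right (hD : D.IsCont) (c : ℂ) (x y : C_c(P, A)) :
    yinn hD x (c • y) = c • yinn hD x y := by
  rw [yinn, show star x * c • y = c • (star x * y) by ext p; exact mul_smul_comm _ _ _, map_smul]
  rfl

theorem star_yinn (hD : D.IsCont) (x y : C_c(P, A)) : star (yinn hD x y) = yinn hD y x := by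
  rw [yinn, ← avg_star, star_mul, star_star]; rfl

theorem yinn_add_left (hD : D.IsCont) (x y z : C_c(P, A)) :
    yinn hD (x + y) z = yinn hD x z + yinn hD y z := by
  rw [yinn, star_add, add_mul, map_add]; rfl

theorem yinn_smul_left (hD : D.IsCont) (c : ℂ) (x y : C_c(P, A)) :
    yinn hD (c • x) y = star c • yinn hD x y := by
  rw [← star_yinn, yinn_smul_right, star_smul, star_yinn]

theorem yinn_mulInd (hD : D.IsCont) (x y : C_c(P, A)) (b : D.sw.Ind) :
    yinn hD x (mulInd y b) = yinn hD x y * b := by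
  rw [yinn, yinn, show star x * mulInd y b = mulInd (star x * y) b by
    ext p; exact (mul_assoc _ _ _).symm]
  exact avg_mulInd hD.σ _ b

theorem yinn_transl (hD : D.IsCont) (t : L) (x y : C_c(P, A)) :
    yinn hD (transl D.η t x) (transl D.η t y) = D.sw.diag t (yinn hD x y) := by
  rw [yinn, yinn, diag_avg hD, transl_cc_mul, transl_star]

theorem yinn_transl_left (hD : D.IsCont) (s : K) (x y : C_c(P, A)) :
    yinn hD (transl D.σ s x) (transl D.σ s y) = (modular s)⁻¹ • yinn hD x y := by
  rw [yinn, yinn, ← transl_star, ← transl_cc_mul, avg_transl]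

theorem yinn_indMul (hD : D.IsCont) (f : D.Ind) (x y : C_c(P, A)) :
    yinn hD (indMul f x) y = yinn hD x (indMul (star f) y) := by
  rw [yinn, yinn]
  congr 1
  ext p
  change star (f p * x p) * y p = star (x p) * (star (f p) * y p)
  rw [star_mul, mul_assoc]

theorem yinn_realMul (hD : D.IsCont) (w : C(P, ℝ)) (x y : C_c(P, A)) :
    yinn hD (realMul w x) y = yinn hD x (realMul w y) := by
  rw [yinn, yinn]
  congr 1
  ext p
  change star (w p • x p) * y p = star (x p) * (w p • y p)
  rw [star_smul, star_trivial, smul_mul_assoc, mul_smul_comm]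

theorem exists_yinn_self (hD : D.IsCont) (x : C_c(P, A)) :
    ∃ b, yinn hD x x = star b * b := exists_avg_eq_star_mul_self hD.σ x

theorem continuous_yinn {M : Type*} [TopologicalSpace M] (hD : D.IsCont) {X Y : M → C_c(P, A)}
    (hX : Continuous fun z : M × P => X z.1 z.2) (hY : Continuous fun z : M × P => Y z.1 z.2)
    {C : Set P} (hC : IsCompact C) (hXC : ∀ m p, p ∉ C → X m p = 0) :
    Continuous fun m => yinn hD (X m) (Y m) := by
  refine continuous_avg hD.σ (F := fun m => star (X m) * Y m) (hX.star.mul hY) hC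
    fun m p hp => ?_
  change star (X m p) * Y m p = 0
  rw [hXC m p hp, star_zero, zero_mul]

/-- The integrand is multiplied by `x^*`, so `Y m` matters only on the support of `x`; the
hypotheses are restricted to that set so that weights without compact support in `p` may occur. -/
theorem yinn_integral {M : Type*} [TopologicalSpace M] [T2Space M] [MeasurableSpace M]
    [OpensMeasurableSpace M] {μ : Measure M} [IsFiniteMeasureOnCompacts μ] (hD : D.IsCont)
    (x : C_c(P, A)) {Y : M → C_c(P, A)} (hY : Continuous fun z : M × P => Y z.1 z.2)
    {C : Set M} (hC : IsCompact C) (hYC : ∀ m, m ∉ C → ∀ p ∈ tsupport x, Y m p = 0)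
    {z : C_c(P, A)} (hz : ∀ p ∈ tsupport x, z p = ∫ m, Y m p ∂μ) :
    yinn hD x z = ∫ m, yinn hD x (Y m) ∂μ := by
  have hx : Continuous fun z : M × P => star (x z.2) := (x.continuous.comp continuous_snd).star
  refine avg_integral hD.σ (F := fun m => star x * Y m) (hx.mul hY) (isCompact_tsupport x)
    (fun m p hp => ?_) hC (fun m hm p => ?_) fun p => ?_
  · change star (x p) * Y m p = 0
    rw [cc_eq_zero x hp, star_zero, zero_mul]
  · change star (x p) * Y m p = 0
    by_cases hp : p ∈ tsupport x
    · rw [hYC m hm p hp, mul_zero]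
    · rw [cc_eq_zero x hp, star_zero, zero_mul]
  · change star (x p) * z p = ∫ m, star (x p) * Y m p ∂μ
    by_cases hp : p ∈ tsupport x
    · rw [hz p hp, integral_const_mul_of_integrable]
      exact integrable_of_compact (hY.comp (Continuous.prodMk_left p)) hC
        fun m hm => hYC m hm p hp
    · simp [cc_eq_zero x hp]

theorem continuous_transl {M : Type*} [TopologicalSpace M] {β : L →* Aut A}
    (hβ : ∀ a, Continuous fun t => β t a) {Y : M → C_c(P, A)}
    (hY : Continuous fun z : M × P => Y z.1 z.2) {g : M → L} (hg : Continuous g) :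
    Continuous fun z : M × P => transl β (g z.1) (Y z.1) z.2 := by
  refine continuous_aut_apply (θ := fun z : M × P => β (g z.1))
    (fun a => (hβ a).comp (hg.comp continuous_fst)) ?_
  have h1 : Continuous fun z : M × P => (z.1, (g z.1)⁻¹ • z.2) := by fun_prop
  exact hY.comp h1

theorem mul_transl_eq_zero {x y : C_c(P, A)} {β : L →* Aut A} {C : Set P}
    (hC : ∀ p, p ∉ C → y p = 0) {t : L}
    (ht : t ∉ {t : L | ∃ p ∈ tsupport x, t⁻¹ • p ∈ C}) {p : P} (hp : p ∈ tsupport x) :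
    transl β t y p = 0 := by
  rw [transl_apply, hC _ fun hm => ht ⟨p, hp, hm⟩, map_zero]

theorem yinn_eq_zero (hD : D.IsCont) {x y : C_c(P, A)} (h : ∀ p ∈ tsupport x, y p = 0) :
    yinn hD x y = 0 := by
  rw [yinn, show star x * y = 0 from ?_, map_zero]
  ext p
  change star (x p) * y p = 0
  by_cases hp : p ∈ tsupport x
  · rw [h p hp, mul_zero]
  · rw [cc_eq_zero x hp, star_zero, zero_mul]

theorem continuous_yinn_transl (hD : D.IsCont) (x y : C_c(P, A)) :
    Continuous fun t => yinn hD x (transl D.η t y) :=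
  continuous_yinn hD (X := fun _ => x) (x.continuous.comp continuous_snd)
    (continuous_transl hD.η (Y := fun _ : L => y) (y.continuous.comp continuous_snd) continuous_id)
    (isCompact_tsupport x) fun _ _ hp => cc_eq_zero x hp

theorem yinn_transl_eq_zero (hD : D.IsCont) (x y : C_c(P, A)) {t : L}
    (ht : t ∉ {t : L | ∃ p ∈ tsupport x, t⁻¹ • p ∈ tsupport y}) :
    yinn hD x (transl D.η t y) = 0 :=
  yinn_eq_zero hD fun _ hp => mul_transl_eq_zero (fun _ => cc_eq_zero y) ht hp

/-- The right inner product on `C_c(P, A)`, with values in `C_c(L, Ind_K^P σ)`. -/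
def rinn (hD : D.IsCont) (x y : C_c(P, A)) : C_c(L, D.sw.Ind) :=
  mkCc (fun t => modular t ^ (-(1 / 2) : ℝ) • yinn hD x (transl D.η t y))
    ((continuous_modular_rpow _).smul (continuous_yinn_transl hD x y))
    {t : L | ∃ p ∈ tsupport x, t⁻¹ • p ∈ tsupport y}
    (isCompact_returnSet (isCompact_tsupport x) (isCompact_tsupport y))
    fun t ht => by rw [yinn_transl_eq_zero hD x y ht, smul_zero]

theorem rinn_apply (hD : D.IsCont) (x y : C_c(P, A)) (t : L) :
    rinn hD x y t = modular t ^ (-(1 / 2) : ℝ) • yinn hD x (transl D.η t y) := rfl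

theorem rinn_apply_apply (hD : D.IsCont) (x y : C_c(P, A)) (t : L) (p : P) :
    rinn hD x y t p = modular t ^ (-(1 / 2) : ℝ) •
      ∫ s, D.σ s (star (x (s⁻¹ • p)) * D.η t (y (s⁻¹ • t⁻¹ • p))) ∂Measure.haar := by
  rw [rinn_apply, Induced.real_smul_apply, yinn_apply]
  simp only [transl_apply, D.smul_comm]

theorem rinn_add_right (hD : D.IsCont) (x y z : C_c(P, A)) :
    rinn hD x (y + z) = rinn hD x y + rinn hD x z := by
  ext1 t
  simp only [rinn_apply, map_add, yinn_add_right, smul_add, CompactlySupportedContinuousMap.add_apply]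

theorem rinn_add_left (hD : D.IsCont) (x y z : C_c(P, A)) :
    rinn hD (x + y) z = rinn hD x z + rinn hD y z := by
  ext1 t
  simp only [rinn_apply, yinn_add_left, smul_add, CompactlySupportedContinuousMap.add_apply]

theorem rinn_smul_right (hD : D.IsCont) (c : ℂ) (x y : C_c(P, A)) :
    rinn hD x (c • y) = c • rinn hD x y := by
  ext1 t
  simp only [rinn_apply, map_smul, yinn_smul_right, CompactlySupportedContinuousMap.smul_apply]
  rw [SMulCommClass.smul_comm]

theorem rinn_smul_left (hD : D.IsCont) (c : ℂ) (x y : C_c(P, A)) :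
    rinn hD (c • x) y = star c • rinn hD x y := by
  ext1 t
  simp only [rinn_apply, yinn_smul_left, CompactlySupportedContinuousMap.smul_apply]
  rw [SMulCommClass.smul_comm]

/-- Symmetry fixes the exponent `-1/2` in the inner product: combining the inverted factor `Δ^{1/2}`
with the `Δ⁻¹` of the involution returns `Δ^{-1/2}`. -/
theorem ccStar_rinn (hD : D.IsCont) (x y : C_c(P, A)) :
    ccStar (continuous_sw_diag hD) (rinn hD x y) = rinn hD y x := by
  ext1 t
  rw [ccStar_apply, rinn_apply, rinn_apply, star_smul, aut_real_smul, smul_smul, star_yinn,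
    ← yinn_transl, ← transl_mul, mul_inv_cancel, transl_one, star_trivial]
  congr 1
  rw [modular_inv, Real.inv_rpow (modular_pos t).le, ← Real.rpow_neg (modular_pos t).le,
    ← Real.rpow_neg_one, ← Real.rpow_add (modular_pos t)]
  norm_num

theorem rinn_indMul (hD : D.IsCont) (f : D.Ind) (x y : C_c(P, A)) :
    rinn hD (indMul f x) y = rinn hD x (indMul (star f) y) := by
  ext1 t
  rw [rinn_apply, rinn_apply, yinn_indMul]
  congr 2
  ext p
  rw [transl_apply, indMul_apply, indMul_apply, transl_apply, map_mul, ← Induced.apply_smul,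
    smul_inv_smul]

/-- The scalar comes from right translation in `K`; it is what the factor `Δ_K^{1/2}` in `uact`
compensates to make the action of `K` isometric. -/
theorem rinn_transl (hD : D.IsCont) (s : K) (x y : C_c(P, A)) :
    rinn hD (transl D.σ s x) (transl D.σ s y) = ((modular s)⁻¹ : ℂ) • rinn hD x y := by
  ext1 t
  rw [CompactlySupportedContinuousMap.smul_apply, rinn_apply, rinn_apply, ← transl_comm,
    yinn_transl_left, ← Complex.ofReal_inv, Complex.coe_smul, SMulCommClass.smul_comm]

theorem continuous_lact_integrand (hD : D.IsCont) (c : C_c(K, D.Ind)) (x : C_c(P, A)) :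
    Continuous fun z : P × K =>
      modular z.2 ^ (1 / 2 : ℝ) • (c z.2 z.1 * D.σ z.2 (x (z.2⁻¹ • z.1))) := by
  refine ((continuous_modular_rpow _).comp continuous_snd).smul (Continuous.mul ?_ ?_)
  · exact (Induced.continuous_apply₂ c.continuous).comp continuous_swap
  · exact continuous_avg_integrand hD.σ x

theorem integrable_lact (hD : D.IsCont) (c : C_c(K, D.Ind)) (x : C_c(P, A)) (p : P) :
    Integrable (fun s => modular s ^ (1 / 2 : ℝ) • (c s p * D.σ s (x (s⁻¹ • p)))) Measure.haar := by
  have h1 := (continuous_lact_integrand hD c x).comp (Continuous.prodMk_right p)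
  simp only [Function.comp_def] at h1
  refine integrable_of_compact h1 (isCompact_tsupport c) fun s hs => ?_
  rw [cc_eq_zero c hs, Induced.zero_apply, zero_mul, smul_zero]

/-- The left action of `C_c(K, Ind_L^P η)` on `C_c(P, A)`. -/
def lact (hD : D.IsCont) : C_c(K, D.Ind) →ₗ[ℂ] C_c(P, A) →ₗ[ℂ] C_c(P, A) :=
  LinearMap.mk₂ ℂ (fun c x => mkCc
    (fun p => ∫ s, modular s ^ (1 / 2 : ℝ) • (c s p * D.σ s (x (s⁻¹ • p))) ∂Measure.haar)
    (continuous_integral_of_compact (continuous_lact_integrand hD c x) fun x₀ =>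
      ⟨Set.univ, Filter.univ_mem, tsupport c, isCompact_tsupport c, fun s _ r hr => by
        simp [cc_eq_zero c hr]⟩)
    ((fun z : K × P => z.1 • z.2) '' (tsupport c ×ˢ tsupport x))
    (((isCompact_tsupport c).prod (isCompact_tsupport x)).image continuous_smul)
    (fun p hp => by
      rw [← integral_zero K A (μ := Measure.haar)]
      congr 1
      ext s
      by_cases hs : s ∈ tsupport c
      · rw [cc_eq_zero x fun hm => hp ⟨(s, s⁻¹ • p), ⟨hs, hm⟩, smul_inv_smul s p⟩]
        simp
      · simp [cc_eq_zero c hs]))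
    (fun c c' x => by
      ext p
      refine Eq.trans ?_ (integral_add (integrable_lact hD c x p) (integrable_lact hD c' x p))
      simp only [mkCc_apply, CompactlySupportedContinuousMap.add_apply, Induced.add_apply, add_mul,
        smul_add])
    (fun a c x => by
      ext p
      refine Eq.trans ?_ (integral_smul a _)
      simp only [mkCc_apply, CompactlySupportedContinuousMap.smul_apply, Induced.smul_apply,
        smul_mul_assoc, SMulCommClass.smul_comm a])
    (fun c x y => by
      ext p
      refine Eq.trans ?_ (integral_add (integrable_lact hD c x p) (integrable_lact hD c y p))
      simp only [mkCc_apply, CompactlySupportedContinuousMap.add_apply, map_add, mul_add,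
        smul_add])
    (fun a c x => by
      ext p
      refine Eq.trans ?_ (integral_smul a _)
      simp only [mkCc_apply, CompactlySupportedContinuousMap.smul_apply, map_smul,
        mul_smul_comm, SMulCommClass.smul_comm a])

theorem lact_apply (hD : D.IsCont) (c : C_c(K, D.Ind)) (x : C_c(P, A)) (p : P) :
    lact hD c x p =
      ∫ s, modular s ^ (1 / 2 : ℝ) • (c s p * D.σ s (x (s⁻¹ • p))) ∂Measure.haar := rfl

/-- The left inner product on `C_c(P, A)`, with values in `C_c(K, Ind_L^P η)`. -/
def linn (hD : D.IsCont) (x y : C_c(P, A)) : C_c(K, D.Ind) := rinn hD.sw (star x) (star y)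

theorem linn_apply_apply (hD : D.IsCont) (x y : C_c(P, A)) (s : K) (p : P) :
    linn hD x y s p = modular s ^ (-(1 / 2) : ℝ) •
      ∫ t, D.η t (x (t⁻¹ • p) * D.σ s (star (y (s⁻¹ • t⁻¹ • p)))) ∂Measure.haar := by
  rw [linn, rinn_apply_apply]
  congr 2
  ext t
  simp only [CompactlySupportedContinuousMap.star_apply, star_star]
  rw [D.smul_comm]

/-- The right action of `C_c(L, Ind_K^P σ)` on `C_c(P, A)`. -/
def ract (hD : D.IsCont) (x : C_c(P, A)) (b : C_c(L, D.sw.Ind)) : C_c(P, A) :=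
  star (lact hD.sw (ccStar (continuous_sw_diag hD) b) (star x))

/-- Conjugation by `x ↦ x^*` turns the right structure of `D` into the left structure of the swapped
system, so each identity needs proof on one side only. The exponent is `1/2 - 1`, from the left
action and the involution. -/
theorem ract_apply (hD : D.IsCont) (x : C_c(P, A)) (b : C_c(L, D.sw.Ind)) (p : P) :
    ract hD x b p = ∫ t, modular t ^ (-(1 / 2) : ℝ) •
      D.η t (x (t⁻¹ • p) * b t⁻¹ (t⁻¹ • p)) ∂Measure.haar := by
  rw [ract, CompactlySupportedContinuousMap.star_apply, lact_apply, ← integral_star']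
  congr 1
  ext t
  rw [ccStar_apply, Induced.real_smul_apply, sw_diag_apply, smul_mul_assoc, smul_smul,
    star_smul, star_trivial, star_mul, CompactlySupportedContinuousMap.star_apply, Induced.star_apply, map_star, map_star, star_star,
    star_star, ← map_mul]
  congr 1
  rw [← Real.rpow_neg_one, ← Real.rpow_add (modular_pos t)]
  norm_num

theorem lact_ccStar (hD : D.IsCont) (x : C_c(P, A)) (c : C_c(K, D.Ind)) :
    lact hD c x = star (ract hD.sw (star x) (ccStar (continuous_diag hD) c)) := by
  rw [ract, star_star, star_star]
  exact congrArg (fun c => lact hD c x) (ccStar_ccStar (continuous_diag hD) c).symm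

/-- Left invariance moves the translation by `t` past the integral over `L`, and that integral is
then taken out of the average over `K`. -/
theorem rinn_ract (hD : D.IsCont) (x y : C_c(P, A)) (b : C_c(L, D.sw.Ind)) :
    rinn hD x (ract hD y b) = conv (continuous_sw_diag hD) (rinn hD x y) b := by
  ext1 t
  rw [conv_apply, rinn_apply]
  have hY : Continuous fun z : L × P => mulInd (transl D.η z.1 y)
      (D.sw.diag z.1 (b (z.1⁻¹ * t))) z.2 := by
    refine Continuous.mul (continuous_transl hD.η (Y := fun _ : L => y)
      (y.continuous.comp continuous_snd) continuous_id) ?_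
    exact Induced.continuous_apply₂ (continuous_aut_apply (continuous_sw_diag hD)
      (f := fun r : L => b (r⁻¹ * t)) (by fun_prop))
  have h1 := yinn_integral (μ := Measure.haar) hD x
    (Y := fun r : L => (((modular t ^ (1 / 2 : ℝ) * modular r ^ (-(1 / 2) : ℝ) : ℝ)) : ℂ) •
      mulInd (transl D.η r y) (D.sw.diag r (b (r⁻¹ * t)))) (z := transl D.η t (ract hD y b))
    (C := {t : L | ∃ p ∈ tsupport x, t⁻¹ • p ∈ tsupport y}) ?_
    (isCompact_returnSet (isCompact_tsupport x) (isCompact_tsupport y)) ?_ ?_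
  · rw [h1, ← integral_smul]
    congr 1
    ext1 r
    rw [yinn_smul_right, yinn_mulInd, rinn_apply, Complex.coe_smul, smul_smul, smul_mul_assoc,
      ← mul_assoc, ← Real.rpow_add (modular_pos t)]
    norm_num
  · refine Continuous.smul (Complex.continuous_ofReal.comp ?_) hY
    exact continuous_const.mul ((continuous_modular_rpow _).comp continuous_fst)
  · intro r hr p hp
    rw [CompactlySupportedContinuousMap.smul_apply, mulInd_apply,
      mul_transl_eq_zero (fun _ => cc_eq_zero y) hr hp, zero_mul, smul_zero]
  · intro p _
    rw [transl_apply, ract_apply, ← integral_aut, ← integral_mul_left_eq_self _ t⁻¹]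
    congr 1
    ext1 r
    rw [aut_real_smul, CompactlySupportedContinuousMap.smul_apply, mulInd_apply, transl_apply,
      sw_diag_apply, ← map_mul, Complex.coe_smul, ← aut_mul_apply, ← map_mul, modular_mul,
      modular_inv, Real.mul_rpow (inv_nonneg.2 (modular_pos t).le) (modular_pos r).le,
      Real.inv_rpow (modular_pos t).le, ← Real.rpow_neg (modular_pos t).le, neg_neg,
      mul_inv_cancel_left, mul_inv_rev, inv_inv, smul_smul,
      mul_inv_cancel_right]

/-- Both sides are iterated integrals of `η_t(x(t⁻¹p) σ_s(y(s⁻¹t⁻¹p)^*)) σ_s(z(s⁻¹p))`; the modular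
factors of action and inner product cancel on either side. -/
theorem lact_linn (hD : D.IsCont) (x y z : C_c(P, A)) :
    lact hD (linn hD x y) z = ract hD x (rinn hD y z) := by
  ext p
  rw [lact_apply, ract_apply]
  let g : K → L → A := fun s t =>
    D.η t (x (t⁻¹ • p) * D.σ s (star (y (s⁻¹ • t⁻¹ • p)))) * D.σ s (z (s⁻¹ • p))
  have hσ : ∀ {f : K × L → A}, Continuous f → Continuous fun w => D.σ w.1 (f w) :=
    continuous_aut_apply (θ := fun w : K × L => D.σ w.1) (fun a => (hD.σ a).comp continuous_fst)
  have hη : ∀ {f : K × L → A}, Continuous f → Continuous fun w => D.η w.2 (f w) :=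
    continuous_aut_apply (θ := fun w : K × L => D.η w.2) (fun a => (hD.η a).comp continuous_snd)
  have hg : Continuous fun w : K × L => g w.1 w.2 := by
    refine Continuous.mul (hη (Continuous.mul (by fun_prop) (hσ ?_))) (hσ (by fun_prop))
    exact (y.continuous.comp (by fun_prop)).star
  have hgt : ∀ s t, t ∉ {t : L | ∃ q ∈ ({p} : Set P), t⁻¹ • q ∈ tsupport x} → g s t = 0 :=
    fun s t ht => by
      simp only [g]
      rw [cc_eq_zero x fun hm => ht ⟨p, rfl, hm⟩, zero_mul, map_zero, zero_mul]
  have hgs : ∀ s t, s ∉ {s : K | ∃ q ∈ ({p} : Set P), s⁻¹ • q ∈ tsupport z} → g s t = 0 :=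
    fun s t hs => by
      simp only [g]
      rw [cc_eq_zero z fun hm => hs ⟨p, rfl, hm⟩, map_zero, mul_zero]
  have hC := isCompact_returnSet (H := L) (isCompact_singleton (x := p)) (isCompact_tsupport x)
  have hC' := isCompact_returnSet (H := K) (isCompact_singleton (x := p)) (isCompact_tsupport z)
  calc _ = ∫ s, ∫ t, g s t ∂Measure.haar ∂Measure.haar := by
        congr 1
        ext1 s
        rw [linn_apply_apply, smul_mul_assoc, smul_smul, ← Real.rpow_add (modular_pos s),
          add_neg_cancel, Real.rpow_zero, one_smul]
        refine (integral_mul_const_of_integrable ?_).symm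
        refine integrable_of_compact (μ := Measure.haar) ?_ hC fun t ht => ?_
        · refine continuous_aut_apply hD.η (Continuous.mul (by fun_prop)
            ((continuous_aut _).comp ?_))
          exact (y.continuous.comp (by fun_prop)).star
        · rw [cc_eq_zero x fun hm => ht ⟨p, rfl, hm⟩, zero_mul, map_zero]
    _ = ∫ t, ∫ s, g s t ∂Measure.haar ∂Measure.haar :=
        integral_swap_of_compact hg hC' hC fun s t hne =>
          ⟨by_contra fun h => hne (hgs s t h), by_contra fun h => hne (hgt s t h)⟩
    _ = _ := by
        congr 1
        ext1 t
        rw [rinn_apply_apply, mul_smul_comm, aut_real_smul, smul_smul, modular_inv,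
          Real.inv_rpow (modular_pos t).le, ← Real.rpow_neg (modular_pos t).le,
          ← Real.rpow_add (modular_pos t), neg_neg, neg_add_cancel, Real.rpow_zero, one_smul]
        rw [← integral_const_mul_of_integrable, ← integral_aut]
        · congr 1
          ext1 s
          simp only [g]
          rw [map_mul, map_mul, map_mul, map_mul, mul_assoc]
          congr 2
          rw [← aut_comm (D.commute s t), ← aut_mul_apply (D.η t), ← map_mul]
          simp
        · refine integrable_of_compact ?_ (isCompact_returnSet (H := K)
            (isCompact_singleton (x := t⁻¹ • p)) (isCompact_tsupport y)) fun s hs => ?_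
          · refine continuous_aut_apply hD.σ (Continuous.mul ?_ ((continuous_aut _).comp ?_))
            · exact (y.continuous.comp (by fun_prop)).star
            · exact z.continuous.comp (by fun_prop)
          · rw [cc_eq_zero y fun hm => hs ⟨_, rfl, hm⟩, star_zero, zero_mul, map_zero]

end CommutingSystem

/-! ### Cutoff functions for proper actions -/

section Cutoff

variable {H X : Type u} [Group H] [TopologicalSpace H] [TopologicalSpace X] [MulAction H X]
  [ProperSMul H X] [IsTopologicalGroup H] [LocallyCompactSpace H] [T2Space H] [MeasurableSpace H]
  [BorelSpace H] [T2Space X] [LocallyCompactSpace X]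

theorem cutoff_eq_zero (w : C_c(X, ℝ)) {N : Set X} {x : X} (hx : x ∈ N) {h : H}
    (hh : h ∉ {h : H | ∃ x ∈ N, h⁻¹ • x ∈ tsupport w}) : w (h⁻¹ • x) = 0 :=
  cc_eq_zero w fun hm => hh ⟨x, hx, hm⟩

/-- A bump equal to `1` on `C` is divided by its orbit integral, which is invariant and so comes out
of the integral. -/
theorem exists_cutoff {C : Set X} (hC : IsCompact C) : ∃ w : C_c(X, ℝ), (∀ x, 0 ≤ w x) ∧
    (∀ x, ∫ h : H, w (h⁻¹ • x) ∂Measure.haar ≤ 1) ∧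
    ∀ x ∈ C, ∫ h : H, w (h⁻¹ • x) ∂Measure.haar = 1 := by
  obtain ⟨f, hf1, -, hfc, hf01⟩ :=
    exists_continuous_one_zero_of_isCompact hC isClosed_empty (Set.disjoint_empty C)
  let w₀ : C_c(X, ℝ) := ⟨f, hfc⟩
  have hw₀ : ∀ x, 0 ≤ w₀ x := fun x => (hf01 x).1
  let W : X → ℝ := fun x => ∫ h : H, w₀ (h⁻¹ • x) ∂Measure.haar
  have hcont : Continuous fun z : X × H => w₀ (z.2⁻¹ • z.1) := by fun_prop
  have hW : Continuous W := by
    refine continuous_integral_of_compact hcont fun x₀ => ?_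
    obtain ⟨N, hN, hNx⟩ := exists_compact_mem_nhds x₀
    exact ⟨N, hNx, _, isCompact_returnSet hN (isCompact_tsupport w₀), fun x hx h hh =>
      cutoff_eq_zero w₀ hx hh⟩
  have hinv : ∀ (k : H) (x : X), W (k⁻¹ • x) = W x := fun k x => by
    simp only [W]
    rw [← integral_mul_left_eq_self _ k⁻¹]
    congr 1
    ext h
    rw [smul_smul, mul_inv_rev, inv_inv, mul_assoc, mul_inv_cancel, mul_one]
  have hpos : ∀ x ∈ C, 0 < W x := fun x hx => by
    have h1 : Continuous fun h : H => w₀ (h⁻¹ • x) := by fun_prop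
    refine h1.integral_pos_of_hasCompactSupport_nonneg_nonzero (x := 1) ?_ (fun h => hw₀ _) ?_
    · exact HasCompactSupport.intro
        (isCompact_returnSet (isCompact_singleton (x := x)) (isCompact_tsupport w₀))
        fun h hh => cutoff_eq_zero w₀ (Set.mem_singleton x) hh
    · have h2 : w₀ x = 1 := hf1 hx
      simp [h2]
  -- The orbit integral `W` can vanish away from `C`. Dividing by `max W δ` keeps the quotient
  -- continuous, changes nothing on `C`, and gives the bound `≤ 1` everywhere.
  obtain ⟨δ, hδ, hδW⟩ : ∃ δ > 0, ∀ x ∈ C, δ ≤ W x := by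
    rcases C.eq_empty_or_nonempty with rfl | hne
    · exact ⟨1, one_pos, by simp⟩
    · obtain ⟨x₀, hx₀, hmin⟩ := hC.exists_isMinOn hne hW.continuousOn
      exact ⟨W x₀, hpos x₀ hx₀, fun x hx => hmin hx⟩
  have hmax : ∀ x, 0 < max (W x) δ := fun x => hδ.trans_le (le_max_right _ _)
  refine ⟨mkCc (fun x => w₀ x / max (W x) δ)
    (w₀.continuous.div (hW.max continuous_const) fun x => (hmax x).ne') (tsupport w₀)
    (isCompact_tsupport w₀) fun x hx => by rw [cc_eq_zero w₀ hx, zero_div],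
    fun x => div_nonneg (hw₀ x) (hmax x).le, fun x => ?_, fun x hx => ?_⟩
  · simp only [mkCc_apply, hinv]
    rw [integral_div]
    exact div_le_one_of_le₀ (le_max_left _ _) (hmax x).le
  simp only [mkCc_apply, hinv]
  rw [integral_div, max_eq_left (hδW x hx)]
  exact div_self (hpos x hx).ne'

/-- Take the square root of a cutoff; inversion on `H` turns `dh` into `Δ(h)⁻¹ dh`. The square is
there because `w` will occur once in each entry of an inner product. -/
theorem exists_sq_cutoff {C : Set X} (hC : IsCompact C) : ∃ w : C_c(X, ℝ),
    ∀ x ∈ C, ∫ h : H, (modular h)⁻¹ * w (h • x) ^ 2 ∂Measure.haar = 1 := by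
  obtain ⟨w, hw0, -, hw⟩ := exists_cutoff (H := H) hC
  refine ⟨mkCc (fun x => √(w x)) (Real.continuous_sqrt.comp w.continuous) (tsupport w)
    (isCompact_tsupport w) fun x hx => by rw [cc_eq_zero w hx, Real.sqrt_zero], fun x hx => ?_⟩
  rw [← hw x hx]
  have h1 : Continuous fun h : H => w (h⁻¹ • x) := by fun_prop
  rw [← integral_inv_modular h1
    (isCompact_returnSet (isCompact_singleton (x := x)) (isCompact_tsupport w))
    fun h hh => cutoff_eq_zero w (Set.mem_singleton x) hh]
  congr 1
  ext h
  rw [mkCc_apply, Real.sq_sqrt (hw0 _), inv_inv, smul_eq_mul]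

end Cutoff

/-- The vectors to be integrated are known only through their Gram kernel, and `‖f m - f m₀‖²`
expands into inner products. -/
theorem continuous_of_inner {M E : Type*} [TopologicalSpace M] [NormedAddCommGroup E]
    [InnerProductSpace ℂ E] {f : M → E} (h1 : Continuous fun m => inner ℂ (f m) (f m))
    (h2 : ∀ m₀, Continuous fun m => inner ℂ (f m) (f m₀)) : Continuous f := by
  rw [continuous_iff_continuousAt]
  intro m₀
  rw [ContinuousAt, tendsto_iff_norm_sub_tendsto_zero]
  have h3 : Filter.Tendsto (fun m => ‖f m - f m₀‖ ^ 2) (nhds m₀) (nhds 0) := by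
    have h4 : Continuous fun m => ‖f m - f m₀‖ ^ 2 := by
      have h5 : ∀ m, ‖f m - f m₀‖ ^ 2 = (inner ℂ (f m) (f m)).re -
          2 * (inner ℂ (f m) (f m₀)).re + ‖f m₀‖ ^ 2 := fun m => by
        rw [@norm_sub_sq ℂ, @norm_sq_eq_re_inner ℂ _ _ _ _ (f m)]
        rfl
      simp only [h5]
      exact ((Complex.continuous_re.comp h1).sub
        (continuous_const.mul (Complex.continuous_re.comp (h2 m₀)))).add continuous_const
    simpa using h4.tendsto m₀
  have h6 := h3.sqrt
  simpa [Real.sqrt_sq (norm_nonneg _)] using h6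

theorem inner_integral_integral {M N E : Type*} [MeasurableSpace M] [MeasurableSpace N]
    [NormedAddCommGroup E] [InnerProductSpace ℂ E] [CompleteSpace E] {μ : Measure M}
    {ν : Measure N} {f : M → E} {g : N → E} (hf : Integrable f μ) (hg : Integrable g ν) :
    inner ℂ (∫ m, f m ∂μ) (∫ n, g n ∂ν) = ∫ m, ∫ n, inner ℂ (f m) (g n) ∂ν ∂μ := by
  simp only [integral_inner hg]
  rw [← inner_conj_symm, ← integral_inner hf, ← integral_conj]
  simp only [inner_conj_symm]

namespace CommutingSystem

variable {K L P A : Type u}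
  [Group K] [TopologicalSpace K] [IsTopologicalGroup K] [LocallyCompactSpace K] [T2Space K]
  [MeasurableSpace K] [BorelSpace K]
  [Group L] [TopologicalSpace L] [IsTopologicalGroup L] [LocallyCompactSpace L] [T2Space L]
  [MeasurableSpace L] [BorelSpace L]
  [TopologicalSpace P] [T2Space P] [LocallyCompactSpace P]
  [MulAction K P] [MulAction L P] [ProperSMul K P] [ProperSMul L P]
  [NonUnitalCStarAlgebra A] {D : CommutingSystem K L P A}

/-- The right inner product with values in the crossed product. -/
def rinnCP (hD : D.IsCont) : C_c(P, A) →ₗ⋆[ℂ] C_c(P, A) →ₗ[ℂ] CrossedProduct D.sw.diag :=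
  LinearMap.mk₂'ₛₗ _ _ (fun x y => toCP D.sw.diag (rinn hD x y))
    (fun x y z => by rw [rinn_add_left, map_add])
    (fun c x y => by rw [rinn_smul_left, map_smul]; rfl)
    (fun x y z => by rw [rinn_add_right, map_add])
    (fun c x y => by rw [rinn_smul_right, map_smul]; rfl)

theorem rinnCP_apply (hD : D.IsCont) (x y : C_c(P, A)) :
    rinnCP hD x y = toCP D.sw.diag (rinn hD x y) := rfl

theorem star_rinnCP (hD : D.IsCont) (x y : C_c(P, A)) :
    star (rinnCP hD x y) = rinnCP hD y x := by
  rw [rinnCP_apply, rinnCP_apply, ← toCP_ccStar (continuous_sw_diag hD), ccStar_rinn]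

theorem inner_rinnCP (hD : D.IsCont) (ρ : CovariantRep D.sw.diag) (x y : C_c(P, A))
    (ξ ζ : ρ.H) : inner ℂ ξ (ρ.rep (rinnCP hD x y) ζ) =
      ∫ t, ((modular t ^ (-(1 / 2) : ℝ) : ℝ) : ℂ) * inner ℂ ξ (ρ.π (yinn hD x (transl D.η t y))
        ((ρ.U t : ρ.H →L[ℂ] ρ.H) ζ)) ∂Measure.haar := by
  rw [rinnCP_apply, CovariantRep.rep_toCP, CovariantRep.integrated_apply,
    ← integral_inner (ρ.integrable_integrand _ ζ)]
  congr 1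
  ext t
  rw [rinn_apply, ← Complex.coe_smul, map_smul, smul_apply, inner_smul_right]

/-! ### Localization: the crossed-product-valued form as a Gram kernel -/

section Positivity

theorem yinn_mulInd_left (hD : D.IsCont) (x y : C_c(P, A)) (b : D.sw.Ind) :
    yinn hD (mulInd x b) y = star b * yinn hD x y := by
  rw [← star_yinn, yinn_mulInd, star_mul, star_yinn]

theorem yinn_sum {ι : Type*} [Fintype ι] (hD : D.IsCont) (x : ι → C_c(P, A)) :
    yinn hD (∑ i, x i) (∑ i, x i) = ∑ i, ∑ j, yinn hD (x i) (x j) := by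
  rw [yinn, star_sum, Finset.sum_mul_sum, map_sum]
  simp only [map_sum]
  rfl

theorem finsupp_sum_sum_eq {X V : Type*} [AddCommMonoid V] (f : X →₀ V)
    (g : X → V → X → V → ℂ) : (f.sum fun x ξ => f.sum fun y ζ => g x ξ y ζ) =
      ∑ i : f.support, ∑ j : f.support, g i (f i) j (f j) := by
  simp only [Finsupp.sum, ← Finset.sum_coe_sort f.support]

/-- The form at `∑ x_i c_i` equals `∑ c_i^* ⟨x_i, x_j⟩ c_j` and is a square, so the matrix of the
inner products is positive on columns. -/
theorem yinn_gram_nonneg (hD : D.IsCont) (ρ : CovariantRep D.sw.diag) (f : C_c(P, A) →₀ ρ.H) :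
    0 ≤ (f.sum fun x ξ => f.sum fun y ζ => inner ℂ ξ (ρ.π (yinn hD x y) ζ)).re := by
  rw [finsupp_sum_sum_eq f fun x ξ y ζ => inner ℂ ξ (ρ.π (yinn hD x y) ζ)]
  refine gram_nonneg_of_positive ρ.π (fun i j : f.support => yinn hD i.1 j.1)
    (fun i j => star_yinn hD _ _) (fun c => ?_) fun i => f i
  obtain ⟨b, hb⟩ := exists_yinn_self hD (∑ i, mulInd i.1 (c i))
  refine ⟨b, ?_⟩
  rw [← hb, yinn_sum]
  simp only [yinn_mulInd, yinn_mulInd_left]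

variable (hD : D.IsCont) (ρ : CovariantRep D.sw.diag) {E : Type*} [NormedAddCommGroup E]
  [InnerProductSpace ℂ E] [CompleteSpace E]

/-- `v` represents the kernel `π(⟨x, y⟩)` of the `Ind_K^P σ`-valued inner product. -/
def RepresentsYinn (v : C_c(P, A) → (ρ.H →L[ℂ] E)) : Prop :=
  ∀ x y ξ ζ, inner ℂ (v x ξ) (v y ζ) = inner ℂ ξ (ρ.π (yinn hD x y) ζ)

/-- The function `p ↦ Δ(r)⁻¹ w(r p)²`. -/
def sqTransl (w : C_c(P, ℝ)) (r : L) : C(P, ℝ) :=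
  ⟨fun p => (modular r)⁻¹ * w (r • p) ^ 2, continuous_const.mul (by fun_prop)⟩

theorem sqTransl_apply (w : C_c(P, ℝ)) (r : L) (p : P) :
    sqTransl w r p = (modular r)⁻¹ * w (r • p) ^ 2 := rfl

/-- The integrand of the vector representing `(x, ξ)` in a localized Hilbert space. -/
def localVec (v : C_c(P, A) → (ρ.H →L[ℂ] E)) (w : C_c(P, ℝ)) (x : C_c(P, A)) (ξ : ρ.H) (r : L) :
    E :=
  ((modular r ^ (-(1 / 2) : ℝ) : ℝ) : ℂ) •
    v (realMul w (transl D.η r x)) ((ρ.U r : ρ.H →L[ℂ] ρ.H) ξ)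

theorem continuous_realMul_transl (hD : D.IsCont) (w : C_c(P, ℝ)) (x : C_c(P, A)) :
    Continuous fun z : L × P => realMul (w : C(P, ℝ)) (transl D.η z.1 x) z.2 :=
  (w.continuous.comp continuous_snd).smul
    (continuous_transl hD.η (Y := fun _ : L => x) (x.continuous.comp continuous_snd) continuous_id)

theorem realMul_transl_eq_zero (w : C_c(P, ℝ)) (x : C_c(P, A)) (r : L) (p : P)
    (hp : p ∉ tsupport w) : realMul (w : C(P, ℝ)) (transl D.η r x) p = 0 := by
  rw [realMul_apply]
  change w p • _ = _
  rw [cc_eq_zero w hp, zero_smul]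

theorem continuous_localVec {v : C_c(P, A) → (ρ.H →L[ℂ] E)} (hv : RepresentsYinn hD ρ v)
    (w : C_c(P, ℝ)) (x : C_c(P, A)) (ξ : ρ.H) :
    Continuous (localVec ρ v w x ξ) := by
  refine (Complex.continuous_ofReal.comp (continuous_modular_rpow _)).smul
    (continuous_of_inner ?_ fun r₀ => ?_)
  · simp only [hv _ _ _ _]
    refine (ρ.continuous_U ξ).inner (ρ.continuous_π_apply ?_ (ρ.continuous_U ξ))
    exact continuous_yinn hD (continuous_realMul_transl hD w x) (continuous_realMul_transl hD w x)
      (isCompact_tsupport w) (realMul_transl_eq_zero w x)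
  · simp only [hv _ _ _ _]
    refine (ρ.continuous_U ξ).inner (ρ.continuous_π_apply ?_ continuous_const)
    refine continuous_yinn hD (continuous_realMul_transl hD w x) (Y := fun _ => _)
      ((map_continuous _).comp continuous_snd)
      (isCompact_tsupport w) (realMul_transl_eq_zero w x)

theorem localVec_eq_zero {v : C_c(P, A) → (ρ.H →L[ℂ] E)} (hv : RepresentsYinn hD ρ v)
    (w : C_c(P, ℝ)) (x : C_c(P, A)) (ξ : ρ.H) (r : L)
    (hr : r ∉ {t : L | ∃ p ∈ tsupport w, t⁻¹ • p ∈ tsupport x}) : localVec ρ v w x ξ r = 0 := by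
  have h0 : realMul (w : C(P, ℝ)) (transl D.η r x) = 0 := by
    ext p
    by_cases hp : p ∈ tsupport w
    · rw [realMul_apply, transl_apply, cc_eq_zero x fun hm => hr ⟨p, hp, hm⟩, map_zero, smul_zero]
      rfl
    · exact realMul_transl_eq_zero w x r p hp
  have h1 : ∀ ζ, v 0 ζ = 0 := fun ζ => by
    rw [← inner_self_eq_zero (𝕜 := ℂ), hv _ _ _ _, yinn_eq_zero hD (fun _ _ => rfl), map_zero]
    exact inner_zero_right _
  rw [localVec, h0, h1, smul_zero]

theorem integrable_localVec {v : C_c(P, A) → (ρ.H →L[ℂ] E)} (hv : RepresentsYinn hD ρ v)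
    (w : C_c(P, ℝ)) (x : C_c(P, A)) (ξ : ρ.H) :
    Integrable (localVec ρ v w x ξ) Measure.haar :=
  integrable_of_compact (continuous_localVec hD ρ hv w x ξ)
    (isCompact_returnSet (isCompact_tsupport w) (isCompact_tsupport x))
    (localVec_eq_zero hD ρ hv w x ξ)

/-- Covariance cancels `U_r` and the translation by `r` from both entries, leaving a translation by
`t` alone. The two cutoffs become `w(r p)²`, and the two factors `Δ(r)^{-1/2}` combine to `Δ(r)⁻¹`.
-/
theorem inner_localVec {v : C_c(P, A) → (ρ.H →L[ℂ] E)} (hv : RepresentsYinn hD ρ v)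
    (w : C_c(P, ℝ)) (x y : C_c(P, A)) (ξ ζ : ρ.H) (r t : L) :
    inner ℂ (localVec ρ v w x ξ r) (localVec ρ v w y ζ (r * t)) =
      ((modular t ^ (-(1 / 2) : ℝ) : ℝ) : ℂ) * inner ℂ ξ (ρ.π (yinn hD x
        (realMul (sqTransl w r) (transl D.η t y)))
        ((ρ.U t : ρ.H →L[ℂ] ρ.H) ζ)) := by
  rw [localVec, localVec, inner_smul_left, inner_smul_right, hv _ _ _ _, yinn_realMul, Complex.conj_ofReal,
    ρ.coe_U_mul, ρ.inner_U_left]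
  have h1 : ((modular r : ℝ) : ℂ) • realMul (sqTransl w r)
      (transl D.η t y) = transl D.η r⁻¹ (realMul (w : C(P, ℝ)) (realMul (w : C(P, ℝ))
        (transl D.η (r * t) y))) := by
    ext p
    rw [transl_apply, realMul_apply, realMul_apply, transl_mul, transl_apply,
      CompactlySupportedContinuousMap.smul_apply, realMul_apply, aut_real_smul, aut_real_smul,
      map_inv, aut_inv_apply_self, inv_inv, inv_smul_smul, Complex.coe_smul, smul_smul, smul_smul]
    congr 1
    rw [sqTransl_apply, mul_inv_cancel_left₀ (modular_pos r).ne', sq]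
    rfl
  have h2 : realMul (sqTransl w r) (transl D.η t y) =
      (((modular r)⁻¹ : ℝ) : ℂ) • transl D.η r⁻¹ (realMul (w : C(P, ℝ)) (realMul (w : C(P, ℝ))
        (transl D.η (r * t) y))) := by
    rw [← h1, smul_smul, ← Complex.ofReal_mul, inv_mul_cancel₀ (modular_pos r).ne',
      Complex.ofReal_one, one_smul]
  rw [h2, yinn_smul_right, map_smul, smul_apply, inner_smul_right]
  have h3 : ∀ Z, yinn hD x (transl D.η r⁻¹ Z) =
      D.sw.diag r⁻¹ (yinn hD (transl D.η r x) Z) := fun Z => by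
    rw [← yinn_transl, ← transl_mul, inv_mul_cancel, transl_one]
  rw [h3, ρ.π_act, inv_inv, ← mul_assoc, ← mul_assoc]
  congr 1
  rw [← Complex.ofReal_mul, ← Complex.ofReal_mul, modular_mul,
    Real.mul_rpow (modular_pos r).le (modular_pos t).le, mul_comm (modular t ^ _), ← mul_assoc,
    ← Real.rpow_add (modular_pos r)]
  rw [show (-(1 / 2) + -(1 / 2) : ℝ) = -1 by norm_num, Real.rpow_neg_one]

/-- With `r t` as second variable, `r` occurs only in the weight `Δ(r)⁻¹ w(r p)²`, whose integral is
`1` on the support of `x`. What remains is the integrated form of the right inner product, now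
visibly a Gram kernel. -/
theorem inner_integral_localVec {v : C_c(P, A) → (ρ.H →L[ℂ] E)} (hv : RepresentsYinn hD ρ v)
    {w : C_c(P, ℝ)} {x y : C_c(P, A)}
    (hw : ∀ p ∈ tsupport x, ∫ h : L, (modular h)⁻¹ * w (h • p) ^ 2 ∂Measure.haar = 1) (ξ ζ : ρ.H) :
    inner ℂ (∫ r, localVec ρ v w x ξ r ∂Measure.haar) (∫ r, localVec ρ v w y ζ r ∂Measure.haar) =
      inner ℂ ξ (ρ.rep (rinnCP hD x y) ζ) := by
  have hS := isCompact_returnSet (H := L) (isCompact_tsupport x) (isCompact_tsupport y)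
  have hT := (isCompact_returnSet (H := L) (isCompact_tsupport x) (isCompact_tsupport w)).inv
  have hT0 : ∀ p ∈ tsupport x, ∀ r : L,
      r ∉ {h : L | ∃ x_1 ∈ tsupport x, h⁻¹ • x_1 ∈ tsupport w}⁻¹ → w (r • p) = 0 :=
    fun p hp r hr => cc_eq_zero w fun hm => hr ⟨p, hp, by simpa using hm⟩
  have hY : ∀ y' : C_c(P, A), Continuous fun z : (L × L) × P =>
      realMul (sqTransl w z.1.1)
        (transl D.η z.1.2 y') z.2 := fun y' => by
    simp only [realMul_apply, sqTransl_apply]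
    have h1 : Continuous fun z : (L × L) × P => (modular z.1.1)⁻¹ :=
      continuous_modular_inv.comp (by fun_prop)
    exact (h1.mul (by fun_prop)).smul (continuous_transl hD.η (Y := fun _ : L × L => y')
      (y'.continuous.comp continuous_snd) continuous_snd)
  rw [inner_integral_integral (integrable_localVec hD ρ hv w x ξ)
    (integrable_localVec hD ρ hv w y ζ), inner_rinnCP]
  calc _ = ∫ r, ∫ t, ((modular t ^ (-(1 / 2) : ℝ) : ℝ) : ℂ) * inner ℂ ξ (ρ.π (yinn hD x
        (realMul (sqTransl w r) (transl D.η t y)))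
        ((ρ.U t : ρ.H →L[ℂ] ρ.H) ζ)) ∂Measure.haar ∂Measure.haar := by
        congr 1
        ext1 r
        rw [← integral_mul_left_eq_self _ r]
        simp only [inner_localVec hD ρ hv]
    _ = ∫ t, ∫ r, ((modular t ^ (-(1 / 2) : ℝ) : ℝ) : ℂ) * inner ℂ ξ (ρ.π (yinn hD x
        (realMul (sqTransl w r) (transl D.η t y)))
        ((ρ.U t : ρ.H →L[ℂ] ρ.H) ζ)) ∂Measure.haar ∂Measure.haar := by
        refine integral_swap_of_compact ?_ hT hS fun r t hne => ⟨?_, ?_⟩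
        · refine Continuous.mul (Complex.continuous_ofReal.comp
            ((continuous_modular_rpow _).comp continuous_snd)) (continuous_const.inner
              (ρ.continuous_π_apply ?_ ((ρ.continuous_U ζ).comp continuous_snd)))
          exact continuous_yinn hD (X := fun _ => x) (x.continuous.comp continuous_snd) (hY y)
            (isCompact_tsupport x) fun _ _ hp => cc_eq_zero x hp
        · by_contra hr
          refine hne ?_
          rw [yinn_eq_zero hD fun p hp => ?_, map_zero, zero_apply, inner_zero_right,
            mul_zero]
          rw [realMul_apply, sqTransl_apply, hT0 p hp r hr]
          simp
        · by_contra ht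
          refine hne ?_
          rw [yinn_eq_zero hD fun p hp => ?_, map_zero, zero_apply, inner_zero_right,
            mul_zero]
          rw [realMul_apply, mul_transl_eq_zero (fun _ => cc_eq_zero y) ht hp, smul_zero]
    _ = _ := by
        congr 1
        ext1 t
        rw [integral_const_mul]
        congr 1
        have hYt := (hY y).comp (f := fun z : L × P => (((z.1, t) : L × L), z.2)) (by fun_prop)
        simp only [Function.comp_def] at hYt
        have hYz : ∀ r, r ∉ {h : L | ∃ x_1 ∈ tsupport x, h⁻¹ • x_1 ∈ tsupport w}⁻¹ →
            ∀ p ∈ tsupport x, realMul (sqTransl w r)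
              (transl D.η t y) p = 0 := fun r hr p hp => by
          rw [realMul_apply, sqTransl_apply, hT0 p hp r hr]
          simp
        have hyc : Continuous fun r : L => yinn hD x
            (realMul (sqTransl w r) (transl D.η t y)) :=
          continuous_yinn hD (X := fun _ => x) (x.continuous.comp continuous_snd) hYt
            (isCompact_tsupport x) fun _ _ hp => cc_eq_zero x hp
        have hyi := integrable_of_compact (μ := Measure.haar) hyc hT fun r hr =>
          yinn_eq_zero hD (hYz r hr)
        rw [yinn_integral (μ := Measure.haar) hD x (z := transl D.η t y) hYt hT hYz fun p hp => ?_,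
          ρ.π_integral hyi, ← integral_inner]
        · exact integrable_of_compact (ρ.continuous_π_apply hyc continuous_const) hT
            fun r hr => by rw [yinn_eq_zero hD (hYz r hr), map_zero, zero_apply]
        · simp only [realMul_apply, sqTransl_apply]
          rw [integral_smul_const, hw p hp, one_smul]

end Positivity
end CommutingSystem

theorem opNorm_le_of_inner {E : Type*} [NormedAddCommGroup E] [InnerProductSpace ℂ E]
    {T : E →L[ℂ] E} {C : ℝ} (hC : 0 ≤ C) (h : ∀ ξ ζ, ‖inner ℂ ξ (T ζ)‖ ≤ C * ‖ξ‖ * ‖ζ‖) :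
    ‖T‖ ≤ C := by
  refine T.opNorm_le_bound hC fun ζ => ?_
  have h1 := h (T ζ) ζ
  rw [inner_self_eq_norm_sq_to_K] at h1
  simp only [Complex.coe_algebraMap, norm_pow, Complex.norm_real, norm_norm] at h1
  rcases (norm_nonneg (T ζ)).eq_or_lt with h0 | h0
  · rw [← h0]
    positivity
  · refine le_of_mul_le_mul_left ?_ h0
    linarith

namespace CommutingSystem

/-! ### Representations induced through `C_c(P, A)` -/

section InducedRep

variable {K L P A : Type u}
  [Group K] [TopologicalSpace K] [IsTopologicalGroup K] [LocallyCompactSpace K] [T2Space K]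
  [MeasurableSpace K] [BorelSpace K]
  [Group L] [TopologicalSpace L] [IsTopologicalGroup L] [LocallyCompactSpace L] [T2Space L]
  [MeasurableSpace L] [BorelSpace L]
  [TopologicalSpace P] [T2Space P] [LocallyCompactSpace P]
  [MulAction K P] [MulAction L P] [ProperSMul K P] [ProperSMul L P]
  [NonUnitalCStarAlgebra A] {D : CommutingSystem K L P A}

/-- Only finitely many functions occur, so one cutoff for the union of their supports represents all
the inner products by vectors of a single Hilbert space. -/
theorem rinnCP_gram_nonneg (hD : D.IsCont) (ρ : CovariantRep D.sw.diag)
    (f : C_c(P, A) →₀ ρ.H) :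
    0 ≤ (f.sum fun x ξ => f.sum fun y ζ => inner ℂ ξ (ρ.rep (rinnCP hD x y) ζ)).re := by
  obtain ⟨E, _, _, _, v, hv, -⟩ := exists_kernel_space (fun x y => ρ.π (yinn hD x y))
    (fun x y => by rw [← map_star, star_yinn]) (yinn_gram_nonneg hD ρ)
  have hv : RepresentsYinn hD ρ v := hv
  obtain ⟨w, hw⟩ := exists_sq_cutoff (H := L) (f.support.isCompact_biUnion
    fun x _ => isCompact_tsupport x)
  have h1 : (f.sum fun x ξ => f.sum fun y ζ => inner ℂ ξ (ρ.rep (rinnCP hD x y) ζ)) =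
      inner ℂ (f.sum fun x ξ => ∫ r, localVec ρ v w x ξ r ∂Measure.haar)
        (f.sum fun x ξ => ∫ r, localVec ρ v w x ξ r ∂Measure.haar) := by
    simp only [Finsupp.sum, sum_inner, inner_sum]
    rw [Finset.sum_comm]
    refine Finset.sum_congr rfl fun y _ => Finset.sum_congr rfl fun x hx => ?_
    exact (inner_integral_localVec hD ρ hv
      (fun p hp => hw p (Set.mem_biUnion hx hp)) _ _).symm
  rw [h1]
  exact inner_self_nonneg (𝕜 := ℂ)

theorem continuous_inner_rinnCP (hD : D.IsCont) (ρ : CovariantRep D.sw.diag) {M : Type*}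
    [TopologicalSpace M] (x : C_c(P, A)) {Y : M → C_c(P, A)}
    (hY : Continuous fun z : M × P => Y z.1 z.2)
    (hC : ∀ m₀, ∃ N ∈ nhds m₀, ∃ C : Set P, IsCompact C ∧ ∀ m ∈ N, ∀ p, p ∉ C → Y m p = 0)
    (ξ ζ : ρ.H) : Continuous fun m => inner ℂ ξ (ρ.rep (rinnCP hD x (Y m)) ζ) := by
  simp only [inner_rinnCP]
  refine continuous_integral_of_compact ?_ fun m₀ => ?_
  · refine Continuous.mul (Complex.continuous_ofReal.comp
      ((continuous_modular_rpow _).comp continuous_snd)) (continuous_const.inner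
      (ρ.continuous_π_apply ?_ ((ρ.continuous_U ζ).comp continuous_snd)))
    refine continuous_yinn hD (X := fun _ => x) (x.continuous.comp continuous_snd)
      (continuous_transl hD.η (M := M × L) (Y := fun m => Y m.1) ?_ continuous_snd)
      (isCompact_tsupport x) fun _ _ hp => cc_eq_zero x hp
    exact hY.comp (f := fun z : (M × L) × P => (z.1.1, z.2)) (by fun_prop)
  · obtain ⟨N, hN, C, hC, hYC⟩ := hC m₀
    refine ⟨N, hN, _, isCompact_returnSet (H := L) (isCompact_tsupport x) hC, fun m hm t ht => ?_⟩
    rw [yinn_eq_zero hD fun p hp => mul_transl_eq_zero (hYC m hm) ht hp, map_zero, zero_apply,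
      inner_zero_right, mul_zero]

theorem inner_rinnCP_integral (hD : D.IsCont) (ρ : CovariantRep D.sw.diag) {M : Type*}
    [TopologicalSpace M] [T2Space M] [MeasurableSpace M] [OpensMeasurableSpace M] {μ : Measure M}
    [IsFiniteMeasureOnCompacts μ] (x : C_c(P, A)) {Y : M → C_c(P, A)}
    (hY : Continuous fun z : M × P => Y z.1 z.2) {C : Set M} (hC : IsCompact C) {C' : Set P}
    (hC' : IsCompact C') (hYC : ∀ m p, Y m p ≠ 0 → m ∈ C ∧ p ∈ C') {z : C_c(P, A)}
    (hz : ∀ p, z p = ∫ m, Y m p ∂μ) (ξ ζ : ρ.H) :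
    inner ℂ ξ (ρ.rep (rinnCP hD x z) ζ) =
      ∫ m, inner ℂ ξ (ρ.rep (rinnCP hD x (Y m)) ζ) ∂μ := by
  simp only [inner_rinnCP]
  have hYc : Continuous fun z : (L × M) × P => transl D.η z.1.1 (Y z.1.2) z.2 := by
    refine continuous_transl hD.η (M := L × M) (Y := fun m => Y m.2) ?_ continuous_fst
    exact hY.comp (f := fun z : (L × M) × P => (z.1.2, z.2)) (by fun_prop)
  have hyc : Continuous fun z : L × M => yinn hD x (transl D.η z.1 (Y z.2)) :=
    continuous_yinn hD (X := fun _ => x) (x.continuous.comp continuous_snd) hYc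
      (isCompact_tsupport x) fun _ _ hp => cc_eq_zero x hp
  have hYm : ∀ m, m ∉ C → Y m = 0 := fun m hm => by
    ext p
    by_contra hne
    exact hm (hYC m p hne).1
  have hYm0 : ∀ t m, m ∉ C → yinn hD x (transl D.η t (Y m)) = 0 := fun t m hm => by
    rw [hYm m hm, map_zero]
    exact yinn_eq_zero hD fun _ _ => rfl
  rw [← integral_swap_of_compact (C := {t : L | ∃ p ∈ tsupport x, t⁻¹ • p ∈ C'}) (C' := C) ?_
    (isCompact_returnSet (isCompact_tsupport x) hC') hC ?_]
  · congr 1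
    ext1 t
    rw [integral_const_mul]
    congr 1
    have hyt := hyc.comp (Continuous.prodMk_right t)
    simp only [Function.comp_def] at hyt
    have h1 : yinn hD x (transl D.η t z) = ∫ m, yinn hD x (transl D.η t (Y m)) ∂μ := by
      refine yinn_integral hD x ?_ hC (fun m hm p _ => ?_) fun p _ => ?_
      · exact hYc.comp (f := fun z : M × P => (((t, z.1) : L × M), z.2)) (by fun_prop)
      · rw [hYm m hm, map_zero]
        rfl
      · simp only [transl_apply]
        rw [hz, integral_aut]
    rw [h1, ρ.π_integral (integrable_of_compact hyt hC (hYm0 t)), ← integral_inner]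
    exact integrable_of_compact (ρ.continuous_π_apply hyt continuous_const) hC
      fun m hm => by rw [hYm0 t m hm, map_zero, zero_apply]
  · exact Continuous.mul (Complex.continuous_ofReal.comp
      ((continuous_modular_rpow _).comp continuous_fst)) (continuous_const.inner
      (ρ.continuous_π_apply hyc ((ρ.continuous_U ζ).comp continuous_fst)))
  · intro t m hne
    constructor
    · by_contra ht
      refine hne ?_
      rw [yinn_eq_zero hD fun p hp => mul_transl_eq_zero (fun q hq => ?_) ht hp, map_zero,
        zero_apply, inner_zero_right, mul_zero]
      by_contra hne'
      exact hq (hYC m q hne').2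
    · by_contra hm
      exact hne (by rw [hYm0 t m hm, map_zero, zero_apply, inner_zero_right, mul_zero])

/-- The unitary action `Δ(s)^{1/2} σ_s(x(s⁻¹ p))` of `K` on `C_c(P, A)`. -/
def uact (D : CommutingSystem K L P A) (s : K) (x : C_c(P, A)) : C_c(P, A) :=
  ((modular s ^ (1 / 2 : ℝ) : ℝ) : ℂ) • transl D.σ s x

theorem uact_apply (D : CommutingSystem K L P A) (s : K) (x : C_c(P, A)) (p : P) :
    uact D s x p = modular s ^ (1 / 2 : ℝ) • D.σ s (x (s⁻¹ • p)) := by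
  rw [uact, CompactlySupportedContinuousMap.smul_apply, Complex.coe_smul, transl_apply]

theorem continuous_uact (hD : D.IsCont) (x : C_c(P, A)) :
    Continuous fun z : K × P => uact D z.1 x z.2 := by
  simp only [uact_apply]
  exact ((continuous_modular_rpow _).comp continuous_fst).smul
    ((continuous_avg_integrand hD.σ x).comp continuous_swap)

theorem uact_eq_zero (x : C_c(P, A)) {N : Set K} {s : K} (hs : s ∈ N) {p : P}
    (hp : p ∉ (fun z : K × P => z.1 • z.2) '' (N ×ˢ tsupport x)) : uact D s x p = 0 := by
  rw [uact_apply, cc_eq_zero x fun hm => hp ⟨(s, s⁻¹ • p), ⟨hs, hm⟩, smul_inv_smul s p⟩, map_zero,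
    smul_zero]

/-- This is Rieffel induction of `ρ` through `C_c(P, A)`, before any completion exists. Since `ρ'`
is a covariant representation, its norm is dominated by that of the left crossed product, and the
estimates for the right inner product are read off in it. -/
theorem exists_left_rep (hD : D.IsCont) (ρ : CovariantRep D.sw.diag) :
    ∃ (ρ' : CovariantRep D.diag) (v : C_c(P, A) → (ρ.H →L[ℂ] ρ'.H)),
      (∀ x y ξ ζ, inner ℂ (v x ξ) (v y ζ) = inner ℂ ξ (ρ.rep (rinnCP hD x y) ζ)) ∧
      ∀ c x ξ, ρ'.rep (toCP D.diag c) (v x ξ) = v (lact hD c x) ξ := by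
  let Θ : C_c(P, A) → C_c(P, A) →ₗ[ℂ] (ρ.H →L[ℂ] ρ.H) := fun x =>
    { toFun := fun y => ρ.rep (rinnCP hD x y)
      map_add' := fun y z => by rw [map_add, map_add]
      map_smul' := fun c y => by rw [map_smul, map_smul]; rfl }
  have hΘ : ∀ x y, Θ x y = ρ.rep (rinnCP hD x y) := fun _ _ => rfl
  obtain ⟨ρ', v, hv, hdense, hπ, hU⟩ := exists_induced_rep (Θ := Θ) D.diag
    (fun x y => by rw [hΘ, hΘ, ← map_star, star_rinnCP]) (rinnCP_gram_nonneg hD ρ) indMul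
    (fun a b x => by ext p; exact mul_assoc _ _ _)
    (fun b x y => by
      rw [hΘ, hΘ, rinnCP_apply, rinnCP_apply, rinn_indMul])
    (uact D) (fun x => by
      ext p
      simp [uact_apply])
    (fun s t x => by
      ext p
      rw [uact_apply, uact_apply, uact_apply, aut_real_smul, modular_mul,
        Real.mul_rpow (modular_pos s).le (modular_pos t).le, map_mul, aut_mul_apply, mul_inv_rev,
        smul_smul, smul_smul])
    (fun s x y => by
      rw [hΘ, hΘ, uact, uact, map_smul, LinearMap.map_smulₛₗ₂, rinnCP_apply, rinn_transl,
        map_smul, map_smul, map_smul, map_smul, smul_smul, smul_smul, Complex.conj_ofReal,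
        ← Complex.ofReal_inv, ← Complex.ofReal_mul, ← Complex.ofReal_mul, modular_rpow_mul_self,
        mul_inv_cancel₀ (modular_pos s).ne', Complex.ofReal_one, one_smul, rinnCP_apply])
    (fun s b x => by
      ext p
      rw [uact_apply, indMul_apply, indMul_apply, uact_apply, map_mul, mul_smul_comm, diag_apply])
    (fun x y ξ ζ => by
      refine continuous_inner_rinnCP hD ρ x (continuous_uact hD y) (fun s₀ => ?_) ξ ζ
      obtain ⟨N, hN, hNs⟩ := exists_compact_mem_nhds s₀
      exact ⟨N, hNs, _, (hN.prod (isCompact_tsupport y)).image continuous_smul,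
        fun s hs p hp => uact_eq_zero y hs hp⟩)
  refine ⟨ρ', v, hv, fun c x ξ => ?_⟩
  have hYc : Continuous fun z : K × P => indMul (c z.1) (uact D z.1 x) z.2 :=
    (Induced.continuous_apply₂ c.continuous).mul (continuous_uact hD x)
  have hint := ρ'.integrable_integrand c (v x ξ)
  rw [← sub_eq_zero]
  -- Tested against `v y ζ`, the operator integral is an integral of inner products, which
  -- `inner_rinnCP_integral` identifies with the inner product of the integrated function.
  refine dense_eq_zero hdense fun y ζ => ?_
  rw [inner_sub_right, sub_eq_zero, ρ'.rep_toCP, ρ'.integrated_apply, ← integral_inner hint, hv, hΘ]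
  simp only [hU, hπ, hv, hΘ]
  refine (inner_rinnCP_integral hD ρ y hYc (isCompact_tsupport c)
    (((isCompact_tsupport c).prod (isCompact_tsupport x)).image continuous_smul)
    (fun s p hne => ?_) (fun p => ?_) ζ ξ).symm
  · have hs : s ∈ tsupport c := by
      by_contra hs
      exact hne (by rw [indMul_apply, cc_eq_zero c hs, Induced.zero_apply, zero_mul])
    refine ⟨hs, ?_⟩
    by_contra hp
    exact hne (by rw [indMul_apply, uact_eq_zero x hs hp, mul_zero])
  · rw [lact_apply]
    congr 1
    ext1 s
    rw [indMul_apply, uact_apply, mul_smul_comm]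

theorem exists_rinnCP_self (hD : D.IsCont) (x : C_c(P, A)) :
    ∃ b, rinnCP hD x x = star b * b := by
  refine crossedProduct_exists_star_mul_self (star_rinnCP hD x x) fun ρ ξ => ?_
  obtain ⟨ρ', v, hv, -⟩ := exists_left_rep hD ρ
  rw [← hv]
  exact inner_self_nonneg (𝕜 := ℂ)

theorem norm_le_sqrt_of_inner (hD : D.IsCont) (ρ : CovariantRep D.sw.diag) {E : Type*}
    [NormedAddCommGroup E] [InnerProductSpace ℂ E] {v : C_c(P, A) → (ρ.H →L[ℂ] E)}
    (hv : ∀ x y ξ ζ, inner ℂ (v x ξ) (v y ζ) = inner ℂ ξ (ρ.rep (rinnCP hD x y) ζ))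
    (x : C_c(P, A)) (ξ : ρ.H) : ‖v x ξ‖ ≤ √‖rinnCP hD x x‖ * ‖ξ‖ := by
  refine le_of_sq_le_sq ?_ (by positivity)
  rw [mul_pow, Real.sq_sqrt (norm_nonneg _), @norm_sq_eq_re_inner ℂ, hv]
  calc _ ≤ ‖inner ℂ ξ (ρ.rep (rinnCP hD x x) ξ)‖ := RCLike.re_le_norm _
    _ ≤ ‖ξ‖ * ‖ρ.rep (rinnCP hD x x) ξ‖ := norm_inner_le_norm _ _
    _ ≤ ‖ξ‖ * (‖rinnCP hD x x‖ * ‖ξ‖) := by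
      gcongr
      exact ((ρ.rep _).le_opNorm ξ).trans (by gcongr; exact ρ.norm_rep_le _)
    _ = _ := by ring

theorem norm_rinnCP_le (hD : D.IsCont) (x y : C_c(P, A)) :
    ‖rinnCP hD x y‖ ≤ √‖rinnCP hD x x‖ * √‖rinnCP hD y y‖ := by
  refine crossedProduct_norm_le (by positivity) fun ρ => ?_
  obtain ⟨ρ', v, hv, -⟩ := exists_left_rep hD ρ
  refine opNorm_le_of_inner (by positivity) fun ξ ζ => ?_
  rw [← hv]
  calc _ ≤ ‖v x ξ‖ * ‖v y ζ‖ := norm_inner_le_norm _ _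
    _ ≤ (√‖rinnCP hD x x‖ * ‖ξ‖) * (√‖rinnCP hD y y‖ * ‖ζ‖) := by
      gcongr <;> exact norm_le_sqrt_of_inner hD ρ hv _ _
    _ = _ := by ring

theorem rinnCP_lact (hD : D.IsCont) (c : C_c(K, D.Ind)) (x y : C_c(P, A)) :
    rinnCP hD (lact hD c x) y = rinnCP hD x (lact hD (ccStar (continuous_diag hD) c) y) := by
  refine crossedProduct_ext fun ρ => ?_
  obtain ⟨ρ', v, hv, hl⟩ := exists_left_rep hD ρ
  refine ContinuousLinearMap.ext fun ζ => ext_inner_left ℂ fun ξ => ?_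
  rw [← hv, ← hv, ← hl, ← hl, toCP_ccStar, map_star, ContinuousLinearMap.star_eq_adjoint,
    ContinuousLinearMap.adjoint_inner_right]

/-- In every induced representation `c` acts by an operator of norm at most its norm in the full
crossed product. -/
theorem norm_rinnCP_lact_le (hD : D.IsCont) (c : C_c(K, D.Ind)) (x : C_c(P, A)) :
    ‖rinnCP hD (lact hD c x) (lact hD c x)‖ ≤ ‖toCP D.diag c‖ ^ 2 * ‖rinnCP hD x x‖ := by
  refine crossedProduct_norm_le (by positivity) fun ρ => ?_
  obtain ⟨ρ', v, hv, hl⟩ := exists_left_rep hD ρ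
  refine opNorm_le_of_inner (by positivity) fun ξ ζ => ?_
  rw [← hv, ← hl, ← hl]
  have h1 : ∀ ξ, ‖ρ'.rep (toCP D.diag c) (v x ξ)‖ ≤
      ‖toCP D.diag c‖ * (√‖rinnCP hD x x‖ * ‖ξ‖) := fun ξ =>
    ((ρ'.rep _).le_opNorm _).trans (mul_le_mul (ρ'.norm_rep_le _)
      (norm_le_sqrt_of_inner hD ρ hv _ _) (norm_nonneg _) (norm_nonneg _))
  calc _ ≤ _ := norm_inner_le_norm _ _
    _ ≤ (‖toCP D.diag c‖ * (√‖rinnCP hD x x‖ * ‖ξ‖)) *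
        (‖toCP D.diag c‖ * (√‖rinnCP hD x x‖ * ‖ζ‖)) := by
      gcongr <;> exact h1 _
    _ = ‖toCP D.diag c‖ ^ 2 * √‖rinnCP hD x x‖ ^ 2 * ‖ξ‖ * ‖ζ‖ := by ring
    _ = _ := by rw [Real.sq_sqrt (norm_nonneg _)]

theorem rinnCP_ract (hD : D.IsCont) (x y : C_c(P, A)) (b : C_c(L, D.sw.Ind)) :
    rinnCP hD x (ract hD y b) = rinnCP hD x y * toCP D.sw.diag b := by
  rw [rinnCP_apply, rinnCP_apply, rinn_ract, toCP_conv]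

end InducedRep
end CommutingSystem

/-! ### Approximation by submodules of vector-valued functions -/

theorem exists_mul_near_of_norm_le_one {A : Type*} [NonUnitalCStarAlgebra A] (a : A) {ε : ℝ}
    (hε : 0 < ε) : ∃ e : A, ‖e‖ ≤ 1 ∧ ‖e * a - a‖ < ε := by
  let _ := CStarAlgebra.spectralOrder A
  have := CStarAlgebra.spectralOrderedRing A
  have h1 := ((CStarAlgebra.increasingApproximateUnit A).tendsto_mul_right a).eventually
    (Metric.ball_mem_nhds a hε)
  have := (CStarAlgebra.increasingApproximateUnit A).neBot
  obtain ⟨e, he, he'⟩ := ((CStarAlgebra.increasingApproximateUnit A).eventually_norm.and h1).exists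
  exact ⟨e, he, by rwa [dist_eq_norm] at he'⟩

theorem exists_mul_near {A : Type u} [NonUnitalCStarAlgebra A] (a : A) {ε : ℝ} (hε : 0 < ε) :
    ∃ e : A, ‖e * a - a‖ < ε := by
  obtain ⟨e, -, he⟩ := exists_mul_near_of_norm_le_one a hε
  exact ⟨e, he⟩

section Approximation

variable {X A : Type u} [TopologicalSpace X] [T2Space X] [NonUnitalCStarAlgebra A]

/-- The real functions that multiply a space of vector-valued functions into itself. -/
def multipliers (M : Submodule ℂ C_c(X, A)) : Subalgebra ℝ C(X, ℝ) where
  carrier := {f | ∀ m ∈ M, realMul f m ∈ M}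
  mul_mem' {f g} hf hg m hm := by
    have h := hf _ (hg m hm)
    rwa [show realMul f (realMul g m) = realMul (f * g) m by ext p; simp [smul_smul]] at h
  add_mem' {f g} hf hg m hm := by
    have h := M.add_mem (hf m hm) (hg m hm)
    rwa [show realMul f m + realMul g m = realMul (f + g) m by ext p; simp [add_smul]] at h
  algebraMap_mem' r m hm := by
    have h := M.smul_mem (r : ℂ) hm
    rwa [show (r : ℂ) • m = realMul (algebraMap ℝ C(X, ℝ) r) m by ext p; simp] at h

/-- A Stone–Weierstrass theorem for modules: pointwise approximants are glued by a partition of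
unity, whose functions are then replaced by multipliers of `M`. -/
theorem exists_mem_near [LocallyCompactSpace X] (M : Submodule ℂ C_c(X, A))
    (hsep : (multipliers M).SeparatesPoints)
    (hloc : ∀ (z : X) (a : A) (ε : ℝ), 0 < ε → ∃ m ∈ M, ‖m z - a‖ < ε) {F : X → A}
    (hF : Continuous F) {C : Set X} (hC : IsCompact C) {ε : ℝ} (hε : 0 < ε) :
    ∃ m ∈ M, ∀ z ∈ C, ‖m z - F z‖ ≤ ε := by
  choose m hm hmz using fun z => hloc z (F z) (ε / 2) (half_pos hε)
  let U : X → Set X := fun z => {y | ‖m z y - F y‖ < ε / 2}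
  have hU : ∀ z, IsOpen (U z) := fun z =>
    isOpen_lt ((m z).continuous.sub hF).norm continuous_const
  obtain ⟨t, -, ht⟩ := hC.elim_nhds_subcover U fun z _ => (hU z).mem_nhds (hmz z)
  let e := t.equivFin
  obtain ⟨f, hfU, hf1, hf01, -⟩ := exists_continuous_sum_one_of_isOpen_isCompact
    (s := fun i => U (e.symm i)) (fun i => hU _) hC (fun z hz => by
      obtain ⟨x, hx, hzx⟩ := Set.mem_iUnion₂.1 (ht hz)
      exact Set.mem_iUnion.2 ⟨e ⟨x, hx⟩, by simpa using hzx⟩)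
  have hbd : ∀ i, ∃ B, 0 < B ∧ ∀ z ∈ C, ‖m (e.symm i) z‖ ≤ B := fun i => by
    obtain ⟨B, hB⟩ := hC.exists_bound_of_continuousOn (m (e.symm i)).continuous.continuousOn
    exact ⟨max B 1, by positivity, fun z hz => (hB z hz).trans (le_max_left _ _)⟩
  choose B hB0 hB using hbd
  -- Since `B i` bounds the `i`-th approximant on `C`, each replaced function costs at most `ε / 2 /
  -- (t.card + 1)`; the `+ 1` keeps the denominator positive when the cover is empty.
  have hδ : ∀ i, 0 < ε / 2 / ((t.card + 1) * B i) := fun i => by have := hB0 i; positivity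
  choose g hg hgf using fun i =>
    ContinuousMap.exists_mem_subalgebra_near_continuous_of_isCompact_of_separatesPoints
      hsep (f i) hC (hδ i)
  refine ⟨∑ i, realMul (g i) (m (e.symm i)), M.sum_mem fun i _ => hg i _ (hm _), fun z hz => ?_⟩
  have hsum : (∑ i, realMul (g i) (m (e.symm i))) z = ∑ i, g i z • m (e.symm i) z := by
    rw [CompactlySupportedContinuousMap.sum_apply]
    rfl
  have hf1z : ∑ i, f i z = 1 := by
    have := hf1 hz
    simpa using this
  have hdecomp : ∑ i, g i z • m (e.symm i) z - F z =
      ∑ i, ((g i z - f i z) • m (e.symm i) z + f i z • (m (e.symm i) z - F z)) := by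
    simp only [sub_smul, smul_sub, Finset.sum_add_distrib, Finset.sum_sub_distrib, ← Finset.sum_smul,
      hf1z, one_smul]
    abel
  rw [hsum, hdecomp]
  have hterm : ∀ i, ‖(g i z - f i z) • m (e.symm i) z + f i z • (m (e.symm i) z - F z)‖ ≤
      ε / 2 / (t.card + 1) + f i z * (ε / 2) := fun i => by
    refine (norm_add_le _ _).trans (add_le_add ?_ ?_)
    · rw [norm_smul]
      calc _ ≤ ε / 2 / ((t.card + 1) * B i) * B i := by
            gcongr
            · exact (hδ i).le
            · exact (hgf i z hz).le
            · exact hB i z hz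
        _ = _ := by
          have := (hB0 i).ne'
          field_simp
    · rw [norm_smul, Real.norm_of_nonneg (hf01 i z).1]
      by_cases h0 : f i z = 0
      · simp [h0]
      · exact mul_le_mul_of_nonneg_left (le_of_lt (hfU i (subset_tsupport _ h0))) (hf01 i z).1
  calc _ ≤ ∑ i, (ε / 2 / (t.card + 1) + f i z * (ε / 2)) :=
        norm_sum_le_of_le _ fun i _ => hterm i
    _ = t.card * (ε / 2 / (t.card + 1)) + ε / 2 := by
        rw [Finset.sum_add_distrib, ← Finset.sum_mul, hf1z]
        simp
    _ ≤ (t.card + 1) * (ε / 2 / (t.card + 1)) + ε / 2 := by gcongr; linarith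
    _ = ε := by field_simp; ring

end Approximation

namespace CommutingSystem

/-! ### Fullness of the inner products -/

section Fullness

variable {K L P A : Type u}
  [Group K] [TopologicalSpace K] [IsTopologicalGroup K] [LocallyCompactSpace K] [T2Space K]
  [MeasurableSpace K] [BorelSpace K]
  [Group L] [TopologicalSpace L] [IsTopologicalGroup L] [LocallyCompactSpace L] [T2Space L]
  [MeasurableSpace L] [BorelSpace L]
  [TopologicalSpace P] [T2Space P] [LocallyCompactSpace P]
  [MulAction K P] [MulAction L P] [ProperSMul K P] [ProperSMul L P]
  [NonUnitalCStarAlgebra A] {D : CommutingSystem K L P A}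

/-- The slice `F(t, ·)`. -/
def slice (t : L) : C_c(L × P, A) →ₗ[ℂ] C_c(P, A) where
  toFun F := mkCc (fun p => F (t, p)) (F.continuous.comp (Continuous.prodMk_right t))
    (Prod.snd '' tsupport F) ((isCompact_tsupport F).image continuous_snd)
    fun p hp => cc_eq_zero F fun hm => hp ⟨_, hm, rfl⟩
  map_add' _ _ := by ext; rfl
  map_smul' _ _ := by ext; rfl

theorem slice_eq_zero {F : C_c(L × P, A)} {t : L} (ht : t ∉ Prod.fst '' tsupport F) :
    slice t F = 0 := by
  ext p
  exact cc_eq_zero F fun hm => ht ⟨_, hm, rfl⟩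

/-- The map `F ↦ (t ↦ ∫_K σ_k(F(t, k⁻¹ ·)) dk)`. -/
def avgCc (hD : D.IsCont) : C_c(L × P, A) →ₗ[ℂ] C_c(L, D.sw.Ind) where
  toFun F := mkCc (fun t => avg hD.σ (slice t F))
    (continuous_avg hD.σ (F := fun t => slice t F) F.continuous
      ((isCompact_tsupport F).image continuous_snd)
      fun t p hp => cc_eq_zero F fun hm => hp ⟨_, hm, rfl⟩)
    (Prod.fst '' tsupport F) ((isCompact_tsupport F).image continuous_fst)
    fun t ht => by rw [slice_eq_zero ht, map_zero]
  map_add' F F' := by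
    ext1 t
    simp only [mkCc_apply, map_add]
    rfl
  map_smul' c F := by
    ext1 t
    simp only [mkCc_apply, map_smul]
    rfl

theorem avgCc_apply (hD : D.IsCont) (F : C_c(L × P, A)) (t : L) :
    avgCc hD F t = avg hD.σ (slice t F) := rfl

theorem norm_toCP_le_of_compact {B : Type u} [NonUnitalCStarAlgebra B] {α : L →* Aut B}
    (b : C_c(L, B)) {C : Set L} (hC : IsCompact C) (hbC : ∀ t, t ∉ C → b t = 0) {r : ℝ}
    (hr : ∀ t, ‖b t‖ ≤ r) : ‖toCP α b‖ ≤ Measure.haar.real C * r := by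
  refine (norm_toCP_le b).trans ?_
  rw [← setIntegral_eq_integral_of_forall_compl_eq_zero (s := C) fun t ht => by
    rw [hbC t ht, norm_zero]]
  calc _ ≤ ‖∫ t in C, ‖b t‖ ∂Measure.haar‖ := Real.le_norm_self _
    _ ≤ r * Measure.haar.real C := norm_setIntegral_le_of_norm_le_const hC.measure_lt_top
        fun t _ => by rw [norm_norm]; exact hr t
    _ = _ := mul_comm _ _

/-- Continuity in the inductive limit topology: for supports in a fixed compact set, uniform
approximation on `L × P` gives norm approximation in the crossed product. -/
theorem exists_norm_avgCc_le (hD : D.IsCont) {C : Set (L × P)} (hC : IsCompact C) :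
    ∃ N : ℝ, 0 ≤ N ∧ ∀ (F : C_c(L × P, A)) (r : ℝ), 0 ≤ r → (∀ z, z ∉ C → F z = 0) →
      (∀ z, ‖F z‖ ≤ r) → ‖toCP D.sw.diag (avgCc hD F)‖ ≤ N * r := by
  obtain ⟨N, hN, hb⟩ := exists_norm_avg_le hD.σ (hC.image continuous_snd)
  refine ⟨Measure.haar.real (Prod.fst '' C) * N, mul_nonneg measureReal_nonneg hN,
    fun F r hr hF hFr => ?_⟩
  rw [mul_assoc]
  refine norm_toCP_le_of_compact _ (hC.image continuous_fst) (fun t ht => ?_) fun t => ?_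
  · rw [avgCc_apply, show slice t F = 0 from ?_, map_zero]
    ext p
    exact hF _ fun hm => ht ⟨_, hm, rfl⟩
  · exact hb _ r hr (fun p hp => hF _ fun hm => hp ⟨_, hm, rfl⟩) fun p => hFr _

/-- The function on `L × P` whose average is the right inner product. -/
def rinnFun (hD : D.IsCont) (x y : C_c(P, A)) : C_c(L × P, A) :=
  mkCc (fun z => modular z.1 ^ (-(1 / 2) : ℝ) • (star (x z.2) * transl D.η z.1 y z.2))
    (((continuous_modular_rpow _).comp continuous_fst).smul
      ((x.continuous.comp continuous_snd).star.mul (continuous_transl hD.η (Y := fun _ : L => y)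
        (y.continuous.comp continuous_snd) continuous_id)))
    ({t : L | ∃ p ∈ tsupport x, t⁻¹ • p ∈ tsupport y} ×ˢ tsupport x)
    ((isCompact_returnSet (isCompact_tsupport x) (isCompact_tsupport y)).prod
      (isCompact_tsupport x)) fun z hz => by
      by_cases h1 : z.2 ∈ tsupport x
      · rw [mul_transl_eq_zero (fun _ => cc_eq_zero y) (fun h2 => hz ⟨h2, h1⟩) h1, mul_zero,
          smul_zero]
      · rw [cc_eq_zero x h1, star_zero, zero_mul, smul_zero]

theorem rinnFun_apply (hD : D.IsCont) (x y : C_c(P, A)) (t : L) (p : P) :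
    rinnFun hD x y (t, p) = modular t ^ (-(1 / 2) : ℝ) • (star (x p) * D.η t (y (t⁻¹ • p))) := rfl

theorem avgCc_rinnFun (hD : D.IsCont) (x y : C_c(P, A)) :
    avgCc hD (rinnFun hD x y) = rinn hD x y := by
  ext1 t
  rw [avgCc_apply, rinn_apply, yinn, ← Complex.coe_smul, ← map_smul]
  congr 1

/-- The span of the functions `rinnFun x y`. -/
def rinnSpan (hD : D.IsCont) : Submodule ℂ C_c(L × P, A) :=
  Submodule.span ℂ {F | ∃ x y, F = rinnFun hD x y}

theorem avgCc_mem (hD : D.IsCont) {F : C_c(L × P, A)} (hF : F ∈ rinnSpan hD) :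
    toCP D.sw.diag (avgCc hD F) ∈ Submodule.span ℂ {b | ∃ x y, b = rinnCP hD x y} := by
  induction hF using Submodule.span_induction with
  | mem F hF =>
    obtain ⟨x, y, rfl⟩ := hF
    exact Submodule.subset_span ⟨x, y, by rw [avgCc_rinnFun, rinnCP_apply]⟩
  | zero => simp
  | add F F' _ _ h h' => rw [map_add, map_add]; exact Submodule.add_mem _ h h'
  | smul c F _ h => rw [map_smul, map_smul]; exact Submodule.smul_mem _ c h

theorem mem_multipliers_of_forall (hD : D.IsCont) {f : C(L × P, ℝ)}
    (h : ∀ x y, realMul f (rinnFun hD x y) ∈ rinnSpan hD) : f ∈ multipliers (rinnSpan hD) := by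
  intro m hm
  induction hm using Submodule.span_induction with
  | mem F hF =>
    obtain ⟨x, y, rfl⟩ := hF
    exact h x y
  | zero => rw [show realMul f (0 : C_c(L × P, A)) = 0 by ext; simp]; exact Submodule.zero_mem _
  | add F F' _ _ h h' =>
    rw [show realMul f (F + F') = realMul f F + realMul f F' by ext; simp]
    exact Submodule.add_mem _ h h'
  | smul c F _ h =>
    rw [show realMul f (c • F) = c • realMul f F by ext; simp [SMulCommClass.smul_comm c]]
    exact Submodule.smul_mem _ c h

/-- The function `(t, p) ↦ u(p)`. -/
def fstFun (u : C(P, ℝ)) : C(L × P, ℝ) := u.comp ⟨Prod.snd, continuous_snd⟩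

/-- The function `(t, p) ↦ u(t⁻¹ p)`. -/
def sndFun (u : C(P, ℝ)) : C(L × P, ℝ) := u.comp ⟨fun z => z.1⁻¹ • z.2, by fun_prop⟩

/-- A real function of `p` can be absorbed into the first argument of `rinnFun`; in the same way a
function of `t⁻¹ p` goes into the second. -/
theorem fstFun_mem (hD : D.IsCont) (u : C(P, ℝ)) : fstFun u ∈ multipliers (rinnSpan hD) := by
  refine mem_multipliers_of_forall hD fun x y => Submodule.subset_span ⟨realMul u x, y, ?_⟩
  ext ⟨t, p⟩
  rw [realMul_apply, rinnFun_apply, rinnFun_apply, realMul_apply, star_smul,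
    star_trivial (u p), smul_mul_assoc, SMulCommClass.smul_comm]
  rfl

theorem sndFun_mem (hD : D.IsCont) (u : C(P, ℝ)) : sndFun u ∈ multipliers (rinnSpan hD) := by
  refine mem_multipliers_of_forall hD fun x y => Submodule.subset_span ⟨x, realMul u y, ?_⟩
  ext ⟨t, p⟩
  rw [realMul_apply, rinnFun_apply, rinnFun_apply, realMul_apply, aut_real_smul, mul_smul_comm,
    SMulCommClass.smul_comm]
  rfl

theorem exists_separating {p q : P} (h : p ≠ q) : ∃ u : C(P, ℝ), u p ≠ u q := by
  obtain ⟨f, hf1, hf0, -, -⟩ := exists_continuous_one_zero_of_isCompact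
    (isCompact_singleton (x := p)) (isClosed_singleton (x := q)) (by simpa using h)
  refine ⟨f, ?_⟩
  rw [hf1 (Set.mem_singleton p), hf0 (Set.mem_singleton q)]
  simp

/-- The multipliers contain all functions of `p` and of `t⁻¹ p`, and `(t, p) ↦ (p, t⁻¹ p)` is
injective because `L` acts freely. -/
theorem separatesPoints_multipliers [IsCancelSMul L P] (hD : D.IsCont) :
    (multipliers (rinnSpan hD)).SeparatesPoints := by
  rintro ⟨t, p⟩ ⟨t', p'⟩ hne
  by_cases hp : p = p'
  · subst hp
    have h1 : t⁻¹ • p ≠ t'⁻¹ • p := fun h => hne (by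
      rw [inv_injective (IsCancelSMul.right_cancel _ _ _ h)])
    obtain ⟨u, hu⟩ := exists_separating h1
    exact ⟨sndFun u, ⟨sndFun u, sndFun_mem hD u, rfl⟩, hu⟩
  · obtain ⟨u, hu⟩ := exists_separating hp
    exact ⟨fstFun u, ⟨fstFun u, fstFun_mem hD u, rfl⟩, hu⟩

theorem exists_cc_one {C : Set P} (hC : IsCompact C) :
    ∃ f : C_c(P, ℝ), (∀ p ∈ C, f p = 1) ∧ ∀ p, f p ∈ Set.Icc (0 : ℝ) 1 := by
  obtain ⟨f, hf1, -, hfc, hf01⟩ :=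
    exists_continuous_one_zero_of_isCompact hC isClosed_empty (Set.disjoint_empty C)
  exact ⟨⟨f, hfc⟩, fun p hp => hf1 hp, hf01⟩

/-- The function `p ↦ f(p) a`. -/
def ccConst (f : C_c(P, ℝ)) (a : A) : C_c(P, A) :=
  mkCc (fun p => f p • a) (f.continuous.smul continuous_const) (tsupport f) (isCompact_tsupport f)
    fun p hp => by rw [cc_eq_zero f hp, zero_smul]

/-- The values of `x` at `p` and of `y` at `t⁻¹ p` can be chosen independently: `e^*` and
`Δ(t)^{1/2} η_t⁻¹(a)` give `e a`, which is close to `a` for a suitable `e`. -/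
theorem rinnSpan_near (hD : D.IsCont) (z : L × P) (a : A) (ε : ℝ) (hε : 0 < ε) :
    ∃ m ∈ rinnSpan hD, ‖m z - a‖ < ε := by
  obtain ⟨t, p⟩ := z
  obtain ⟨e, he⟩ := exists_mul_near a hε
  obtain ⟨f, hf, -⟩ := exists_cc_one (isCompact_singleton (x := p))
  obtain ⟨g, hg, -⟩ := exists_cc_one (isCompact_singleton (x := t⁻¹ • p))
  refine ⟨rinnFun hD (ccConst f (star e)) (ccConst g (modular t ^ (1 / 2 : ℝ) • (D.η t)⁻¹ a)),
    Submodule.subset_span ⟨_, _, rfl⟩, ?_⟩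
  rw [rinnFun_apply, ccConst, ccConst, mkCc_apply, mkCc_apply, hf p rfl, hg _ rfl, one_smul,
    one_smul, star_star, aut_real_smul, aut_apply_inv_self, mul_smul_comm, smul_smul,
    ← Real.rpow_add (modular_pos t), neg_add_cancel, Real.rpow_zero, one_smul]
  exact he

theorem avgCc_mem_closure [IsCancelSMul L P] (hD : D.IsCont) (F : C_c(L × P, A)) :
    toCP D.sw.diag (avgCc hD F) ∈
      closure (Submodule.span ℂ {b | ∃ x y, b = rinnCP hD x y} : Set (CrossedProduct D.sw.diag)) := by
  let q : L × P → P := fun z => z.1⁻¹ • z.2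
  have hq : Continuous q := by fun_prop
  obtain ⟨u, hu, hu01⟩ := exists_cc_one ((isCompact_tsupport F).image continuous_snd)
  obtain ⟨w, hw, hw01⟩ := exists_cc_one ((isCompact_tsupport F).image hq)
  let C : Set (L × P) := {t : L | ∃ p ∈ tsupport u, t⁻¹ • p ∈ tsupport w} ×ˢ tsupport u
  have hC : IsCompact C := (isCompact_returnSet (isCompact_tsupport u)
    (isCompact_tsupport w)).prod (isCompact_tsupport u)
  have hC0 : ∀ z, z ∉ C → u z.2 * w (q z) = 0 := fun z hz => by
    by_cases h1 : z.2 ∈ tsupport u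
    · rw [cc_eq_zero w (fun h2 => hz ⟨⟨_, h1, h2⟩, h1⟩), mul_zero]
    · rw [cc_eq_zero u h1, zero_mul]
  obtain ⟨N, hN, hb⟩ := exists_norm_avgCc_le hD hC
  rw [Metric.mem_closure_iff]
  intro ε hε
  have hδ : 0 < ε / (N + 1) := by positivity
  obtain ⟨m, hm, hmF⟩ := exists_mem_near (rinnSpan hD) (separatesPoints_multipliers hD)
    (rinnSpan_near hD) F.continuous hC hδ
  -- The approximant is controlled only on `C`. The multiplier `u(p) w(t⁻¹ p)` is `1` on the support
  -- of `F` and vanishes off `C`, so it brings the support into `C` without leaving the span.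
  have hm' := (multipliers (rinnSpan hD)).mul_mem (fstFun_mem hD (u : C(P, ℝ)))
    (sndFun_mem hD (w : C(P, ℝ))) m hm
  have hval : ∀ z, realMul (fstFun (u : C(P, ℝ)) * sndFun (w : C(P, ℝ))) m z =
    (u z.2 * w (q z)) • m z := fun z => rfl
  have hFz : ∀ z, F z = (u z.2 * w (q z)) • F z := fun z => by
    by_cases hz : z ∈ tsupport F
    · rw [hu _ ⟨z, hz, rfl⟩, hw _ ⟨z, hz, rfl⟩, mul_one, one_smul]
    · rw [cc_eq_zero F hz, smul_zero]
  refine ⟨_, avgCc_mem hD hm', ?_⟩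
  rw [dist_eq_norm, ← map_sub, ← map_sub]
  refine lt_of_le_of_lt (hb _ _ hδ.le (fun z hz => ?_) fun z => ?_) ?_
  · rw [CompactlySupportedContinuousMap.sub_apply, hval, hFz, hC0 z hz, zero_smul, zero_smul,
      sub_zero]
  · rw [CompactlySupportedContinuousMap.sub_apply, hval, hFz, ← smul_sub, norm_smul]
    by_cases hz : z ∈ C
    · calc _ ≤ 1 * ‖F z - m z‖ := by
            gcongr
            rw [Real.norm_of_nonneg (mul_nonneg (hu01 _).1 (hw01 _).1)]
            exact mul_le_one₀ (hu01 _).2 (hw01 _).1 (hw01 _).2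
        _ ≤ _ := by rw [one_mul, norm_sub_rev]; exact hmF z hz
    · rw [hC0 z hz, norm_zero, zero_mul]
      exact hδ.le
  · calc N * (ε / (N + 1)) < (N + 1) * (ε / (N + 1)) := by gcongr; linarith
      _ = ε := by field_simp

theorem exists_compact_uniform_decay {B : Type u} [NonUnitalCStarAlgebra B] {β : K →* Aut B}
    (b : C_c(L, Induced P β)) {ε : ℝ} (hε : 0 < ε) :
    ∃ C : Set P, IsCompact C ∧ ∀ t p, (∀ k : K, k • p ∉ C) → ‖b t p‖ ≤ ε := by
  choose C hC hCb using fun t => (b t).exists_compact_norm_lt' (half_pos hε)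
  obtain ⟨s, -, hs⟩ := (isCompact_tsupport b).elim_nhds_subcover
    (fun t => {r | ‖b r - b t‖ < ε / 2}) fun t _ =>
      (isOpen_lt (b.continuous.sub continuous_const).norm continuous_const).mem_nhds (by
        simpa using half_pos hε)
  refine ⟨⋃ t ∈ s, C t, s.isCompact_biUnion fun t _ => hC t, fun t p hp => ?_⟩
  by_cases ht : t ∈ tsupport b
  · obtain ⟨r, hr, htr⟩ := Set.mem_iUnion₂.1 (hs ht)
    have h1 := hCb r p fun k hk => hp k (Set.mem_biUnion hr hk)
    have h2 := (b t - b r).norm_apply_le p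
    have h3 : ‖b t - b r‖ < ε / 2 := htr
    have h4 := norm_le_norm_sub_add (b t p) (b r p)
    rw [Induced.sub_apply] at h2
    linarith
  · rw [cc_eq_zero b ht, Induced.zero_apply, norm_zero]
    exact hε.le

/-- The average of `w b` is `b` times the orbit integral of `w`. With `w` a cutoff for a compact `C`
this is `b` over the saturation of `C`; elsewhere the factor lies in `[0, 1]` and `b` is uniformly
small. -/
theorem toCP_mem_closure (hD : D.IsCont) (b : C_c(L, D.sw.Ind)) :
    toCP D.sw.diag b ∈ closure (Set.range fun F => toCP D.sw.diag (avgCc hD F)) := by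
  rw [Metric.mem_closure_iff]
  intro ε hε
  let N := Measure.haar.real (tsupport b)
  have hN : 0 ≤ N := measureReal_nonneg
  have hδ : 0 < ε / (N + 1) := by positivity
  obtain ⟨C, hC, hCb⟩ := exists_compact_uniform_decay (K := K) b hδ
  obtain ⟨w, hw0, hw1, hw⟩ := exists_cutoff (H := K) hC
  let F : C_c(L × P, A) := mkCc (fun z => w z.2 • b z.1 z.2)
    ((w.continuous.comp continuous_snd).smul (Induced.continuous_apply₂ b.continuous))
    (tsupport b ×ˢ tsupport w) ((isCompact_tsupport b).prod (isCompact_tsupport w)) fun z hz => by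
      by_cases h1 : z.1 ∈ tsupport b
      · rw [cc_eq_zero w fun h2 => hz ⟨h1, h2⟩, zero_smul]
      · rw [cc_eq_zero b h1, Induced.zero_apply, smul_zero]
  have hF : ∀ t p, avgCc hD F t p = (∫ k : K, w (k⁻¹ • p) ∂Measure.haar) • b t p := fun t p => by
    rw [avgCc_apply, avg_apply, ← integral_smul_const]
    congr 1
    ext1 k
    change D.σ k (w (k⁻¹ • p) • b t (k⁻¹ • p)) = _
    rw [aut_real_smul, ← Induced.apply_smul, smul_inv_smul]
  refine ⟨_, ⟨F, rfl⟩, ?_⟩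
  rw [dist_eq_norm, ← map_sub]
  refine lt_of_le_of_lt (norm_toCP_le_of_compact (r := ε / (N + 1)) _ (isCompact_tsupport b)
    (fun t ht => ?_) fun t => ?_) ?_
  · refine Induced.ext fun p => ?_
    rw [CompactlySupportedContinuousMap.sub_apply, Induced.sub_apply, hF, cc_eq_zero b ht,
      Induced.zero_apply, smul_zero, sub_zero]
  · refine Induced.norm_le hδ.le fun p => ?_
    rw [CompactlySupportedContinuousMap.sub_apply, Induced.sub_apply, hF]
    by_cases hp : ∃ k : K, k • p ∈ C
    · obtain ⟨k, hk⟩ := hp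
      have h1 := hw _ hk
      rw [← integral_mul_left_eq_self _ k] at h1
      simp only [mul_inv_rev, mul_smul, inv_smul_smul] at h1
      rw [h1, one_smul, sub_self, norm_zero]
      exact hδ.le
    · push Not at hp
      rw [show b t p - (∫ k : K, w (k⁻¹ • p) ∂Measure.haar) • b t p =
        (1 - ∫ k : K, w (k⁻¹ • p) ∂Measure.haar) • b t p by rw [sub_smul, one_smul], norm_smul]
      have h0 : 0 ≤ ∫ k : K, w (k⁻¹ • p) ∂Measure.haar := integral_nonneg fun k => hw0 _
      calc _ ≤ 1 * ‖b t p‖ := by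
            gcongr
            rw [Real.norm_of_nonneg (by linarith [hw1 p])]
            linarith
        _ ≤ _ := by rw [one_mul]; exact hCb t p hp
  · change N * (ε / (N + 1)) < ε
    calc N * (ε / (N + 1)) < (N + 1) * (ε / (N + 1)) := by gcongr; linarith
      _ = ε := by field_simp

theorem dense_rinnCP [IsCancelSMul L P] (hD : D.IsCont) :
    Dense (Submodule.span ℂ {b | ∃ x y, b = rinnCP hD x y} : Set (CrossedProduct D.sw.diag)) := by
  have h1 : Dense (closure (Submodule.span ℂ {b | ∃ x y, b = rinnCP hD x y} :
      Set (CrossedProduct D.sw.diag))) := by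
    refine (denseRange_toCP (continuous_sw_diag hD)).mono ?_
    rintro _ ⟨b, rfl⟩
    refine (closure_minimal ?_ isClosed_closure) (toCP_mem_closure hD b)
    rintro _ ⟨F, rfl⟩
    exact avgCc_mem_closure hD F
  rwa [dense_closure] at h1

end Fullness
end CommutingSystem

/-! ### Completion of pre-imprimitivity bimodules -/

theorem exists_bilinear_extension {σ τ : ℂ →+* ℂ} [RingHomIsometric σ] [RingHomIsometric τ]
    {X Y : Type*} [AddCommGroup X] [Module ℂ X] [AddCommGroup Y] [Module ℂ Y]
    {V W Z : Type*} [NormedAddCommGroup V] [NormedSpace ℂ V] [NormedAddCommGroup W]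
    [NormedSpace ℂ W] [NormedAddCommGroup Z] [NormedSpace ℂ Z] [CompleteSpace Z]
    (e : X →ₗ[ℂ] V) (he : DenseRange e) (f : Y →ₗ[ℂ] W) (hf : DenseRange f)
    (b : X →ₛₗ[σ] Y →ₛₗ[τ] Z) (C : ℝ) (hC : 0 ≤ C) (hb : ∀ x y, ‖b x y‖ ≤ C * ‖e x‖ * ‖f y‖) :
    ∃ T : V →SL[σ] W →SL[τ] Z, ∀ x y, T (e x) (f y) = b x y := by
  have h1 : ∀ x y, (b x).extendOfNorm f (f y) = b x y := fun x y =>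
    LinearMap.extendOfNorm_eq hf ⟨_, hb x⟩ y
  let g : X →ₛₗ[σ] (W →SL[τ] Z) :=
    { toFun := fun x => (b x).extendOfNorm f
      map_add' := fun x x' => by
        refine ContinuousLinearMap.coeFn_injective (hf.equalizer (by fun_prop) (by fun_prop) ?_)
        ext y
        simp only [Function.comp, add_apply, h1]
        rw [map_add, LinearMap.add_apply]
      map_smul' := fun c x => by
        refine ContinuousLinearMap.coeFn_injective (hf.equalizer (by fun_prop) (by fun_prop) ?_)
        ext y
        simp only [Function.comp, smul_apply, h1]
        rw [map_smulₛₗ, LinearMap.smul_apply] }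
  have h2 : ∀ x, ‖g x‖ ≤ C * ‖e x‖ := fun x =>
    LinearMap.opNorm_extendOfNorm_le hf (by positivity) (hb x)
  refine ⟨g.extendOfNorm e, fun x y => ?_⟩
  rw [LinearMap.extendOfNorm_eq he ⟨C, h2⟩ x]
  exact h1 x y

/-- A continuous sesquilinear map as a sesquilinear map. -/
def forgetCont {σ τ : ℂ →+* ℂ} {V W Z : Type*} [NormedAddCommGroup V] [NormedSpace ℂ V]
    [NormedAddCommGroup W] [NormedSpace ℂ W] [NormedAddCommGroup Z] [NormedSpace ℂ Z]
    [RingHomIsometric τ]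
    (T : V →SL[σ] W →SL[τ] Z) : V →ₛₗ[σ] W →ₛₗ[τ] Z :=
  LinearMap.mk₂'ₛₗ _ _ (fun v w => T v w) (fun v v' w => by rw [map_add, add_apply])
    (fun c v w => by rw [map_smulₛₗ, smul_apply]) (fun v w w' => map_add _ _ _)
    (fun c v w => by rw [map_smulₛₗ])

theorem isClosed_setOf_exists_star_mul_self (B : Type*) [NonUnitalCStarAlgebra B] :
    IsClosed {a : B | ∃ b, a = star b * b} := by
  let _ := CStarAlgebra.spectralOrder B
  have := CStarAlgebra.spectralOrderedRing B
  simp only [← CStarAlgebra.nonneg_iff_eq_star_mul_self]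
  exact isClosed_Ici

/-- An `E₀`–`B₀` bimodule with inner products in C⋆-algebras `E` and `B` into which `E₀` and `B₀`
map densely, satisfying the algebraic relations and norm estimates of an imprimitivity
bimodule. -/
structure PreBimodule (X E₀ B₀ : Type*) (E B : Type (u + 1)) [AddCommGroup X] [Module ℂ X]
    [AddCommGroup E₀] [Module ℂ E₀] [AddCommGroup B₀] [Module ℂ B₀] [NonUnitalCStarAlgebra E]
    [NonUnitalCStarAlgebra B] where
  jE : E₀ →ₗ[ℂ] E
  jB : B₀ →ₗ[ℂ] B
  lact : E₀ →ₗ[ℂ] X →ₗ[ℂ] X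
  ract : X →ₗ[ℂ] B₀ →ₗ[ℂ] X
  linn : X →ₗ[ℂ] X →ₗ⋆[ℂ] E
  rinn : X →ₗ⋆[ℂ] X →ₗ[ℂ] B
  dense_jE : DenseRange jE
  dense_jB : DenseRange jB
  star_linn : ∀ x y, star (linn x y) = linn y x
  star_rinn : ∀ x y, star (rinn x y) = rinn y x
  linn_self : ∀ x, ∃ a, linn x x = star a * a
  rinn_self : ∀ x, ∃ b, rinn x x = star b * b
  norm_linn_le : ∀ x y, ‖linn x y‖ ≤ √‖linn x x‖ * √‖linn y y‖
  norm_rinn_le : ∀ x y, ‖rinn x y‖ ≤ √‖rinn x x‖ * √‖rinn y y‖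
  linn_lact : ∀ c x y, linn (lact c x) y = jE c * linn x y
  rinn_ract : ∀ x y b, rinn x (ract y b) = rinn x y * jB b
  norm_linn_ract_le : ∀ x b, ‖linn (ract x b) (ract x b)‖ ≤ ‖jB b‖ ^ 2 * ‖linn x x‖
  norm_rinn_lact_le : ∀ c x, ‖rinn (lact c x) (lact c x)‖ ≤ ‖jE c‖ ^ 2 * ‖rinn x x‖
  linn_adj : ∀ b, ∃ b', jB b' = star (jB b) ∧ ∀ x y, linn (ract x b) y = linn x (ract y b')
  rinn_adj : ∀ c, ∃ c', jE c' = star (jE c) ∧ ∀ x y, rinn (lact c x) y = rinn x (lact c' y)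
  lact_linn : ∀ x y z, ∃ c b, jE c = linn x y ∧ jB b = rinn y z ∧ lact c z = ract x b
  full_linn : Dense (Submodule.span ℂ {a | ∃ x y, a = linn x y} : Set E)
  full_rinn : Dense (Submodule.span ℂ {b | ∃ x y, b = rinn x y} : Set B)

namespace PreBimodule

variable {X : Type u} {E₀ B₀ : Type*} {E B : Type (u + 1)} [AddCommGroup X] [Module ℂ X]
    [AddCommGroup E₀] [Module ℂ E₀] [AddCommGroup B₀] [Module ℂ B₀] [NonUnitalCStarAlgebra E]
    [NonUnitalCStarAlgebra B] (M : PreBimodule X E₀ B₀ E B)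

/-- Write `a` for the left and `b` for the right value at `(x, x)`, so that `a x = x b`. The
C⋆-identity, Cauchy–Schwarz and the bound for the right action give `‖a‖² = ‖linn (x b) x‖ ≤ ‖b‖
‖a‖`; the reverse inequality is symmetric. -/
theorem norm_linn_self (x : X) : ‖M.linn x x‖ = ‖M.rinn x x‖ := by
  obtain ⟨c, b, hc, hb, hcb⟩ := M.lact_linn x x x
  have hE : ‖M.linn x x‖ * ‖M.linn x x‖ ≤ ‖M.rinn x x‖ * ‖M.linn x x‖ := by
    calc ‖M.linn x x‖ * ‖M.linn x x‖ = ‖star (M.linn x x) * M.linn x x‖ :=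
          CStarRing.norm_star_mul_self.symm
      _ = ‖M.linn (M.ract x b) x‖ := by rw [M.star_linn, ← hcb, M.linn_lact, hc]
      _ ≤ √‖M.linn (M.ract x b) (M.ract x b)‖ * √‖M.linn x x‖ := M.norm_linn_le _ _
      _ ≤ √(‖M.jB b‖ ^ 2 * ‖M.linn x x‖) * √‖M.linn x x‖ := by
          gcongr; exact M.norm_linn_ract_le x b
      _ = ‖M.rinn x x‖ * ‖M.linn x x‖ := by
          rw [Real.sqrt_mul (by positivity), Real.sqrt_sq (norm_nonneg _), mul_assoc,
            Real.mul_self_sqrt (norm_nonneg _), hb]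
  have hB : ‖M.rinn x x‖ * ‖M.rinn x x‖ ≤ ‖M.linn x x‖ * ‖M.rinn x x‖ := by
    calc ‖M.rinn x x‖ * ‖M.rinn x x‖ = ‖star (M.rinn x x) * M.rinn x x‖ :=
          CStarRing.norm_star_mul_self.symm
      _ = ‖M.rinn x (M.lact c x)‖ := by rw [M.star_rinn, hcb, M.rinn_ract, hb]
      _ ≤ √‖M.rinn x x‖ * √‖M.rinn (M.lact c x) (M.lact c x)‖ := M.norm_rinn_le _ _
      _ ≤ √‖M.rinn x x‖ * √(‖M.jE c‖ ^ 2 * ‖M.rinn x x‖) := by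
          gcongr; exact M.norm_rinn_lact_le c x
      _ = ‖M.linn x x‖ * ‖M.rinn x x‖ := by
          rw [Real.sqrt_mul (by positivity), Real.sqrt_sq (norm_nonneg _), mul_left_comm,
            Real.mul_self_sqrt (norm_nonneg _), hc]
  refine le_antisymm ?_ ?_
  · rcases (norm_nonneg (M.linn x x)).eq_or_lt with h | h
    · rw [← h]; exact norm_nonneg _
    · exact le_of_mul_le_mul_right hE h
  · rcases (norm_nonneg (M.rinn x x)).eq_or_lt with h | h
    · rw [← h]; exact norm_nonneg _
    · exact le_of_mul_le_mul_right hB h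

theorem sqrt_norm_add_le (x y : X) : √‖M.rinn (x + y) (x + y)‖ ≤
    √‖M.rinn x x‖ + √‖M.rinn y y‖ := by
  refine Real.sqrt_le_iff.2 ⟨by positivity, ?_⟩
  have h1 := M.norm_rinn_le x y
  have h2 := M.norm_rinn_le y x
  have h3 := Real.sq_sqrt (norm_nonneg (M.rinn x x))
  have h4 := Real.sq_sqrt (norm_nonneg (M.rinn y y))
  have h5 : ‖M.rinn (x + y) (x + y)‖ ≤
      (‖M.rinn x x‖ + ‖M.rinn x y‖) + (‖M.rinn y x‖ + ‖M.rinn y y‖) := by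
    rw [show M.rinn (x + y) = M.rinn x + M.rinn y from map_add M.rinn x y, LinearMap.add_apply,
      map_add, map_add]
    exact (norm_add_le _ _).trans (add_le_add (norm_add_le _ _) (norm_add_le _ _))
  nlinarith

theorem sqrt_norm_smul (c : ℂ) (x : X) : √‖M.rinn (c • x) (c • x)‖ = ‖c‖ * √‖M.rinn x x‖ := by
  rw [map_smul, LinearMap.map_smulₛₗ₂, norm_smul, norm_smul, RCLike.norm_conj, ← mul_assoc,
    Real.sqrt_mul (by positivity), Real.sqrt_mul_self (norm_nonneg _)]

/-- The seminorm `‖x‖ = ‖⟨x, x⟩‖^{1/2}`. -/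
def seminorm : AddGroupSeminorm X where
  toFun x := √‖M.rinn x x‖
  map_zero' := by simp
  add_le' := M.sqrt_norm_add_le
  neg' x := by simp

theorem exists_dense_normed : ∃ (W : Type u) (_ : NormedAddCommGroup W) (_ : NormedSpace ℂ W)
    (_ : CompleteSpace W) (ι : X →ₗ[ℂ] W), DenseRange ι ∧ ∀ x, ‖ι x‖ = √‖M.rinn x x‖ := by
  let _ : SeminormedAddCommGroup X := M.seminorm.toSeminormedAddCommGroup
  let _ : NormedSpace ℂ X := ⟨fun c x => (M.sqrt_norm_smul c x).le⟩
  exact ⟨UniformSpace.Completion X, inferInstance, inferInstance, inferInstance,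
    (UniformSpace.Completion.toComplₗᵢ (𝕜 := ℂ) (E := X)).toLinearMap,
    UniformSpace.Completion.denseRange_coe, fun x => UniformSpace.Completion.norm_coe x⟩

/-- Actions and inner products extend by their norm estimates, and closed relations pass from the
dense subspaces to the completions. -/
theorem exists_completion : ∃ (W : ImprimitivityBimodule.{u} E B) (ι : X →ₗ[ℂ] W.carrier),
    DenseRange ι ∧ (∀ c x, W.lsmul (M.jE c) (ι x) = ι (M.lact c x)) ∧
    (∀ x b, W.rsmul (ι x) (M.jB b) = ι (M.ract x b)) ∧
    (∀ x y, W.linner (ι x) (ι y) = M.linn x y) ∧ ∀ x y, W.rinner (ι x) (ι y) = M.rinn x y := by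
  obtain ⟨W, _, _, _, ι, hι, hn⟩ := M.exists_dense_normed
  have hn' : ∀ x, ‖ι x‖ = √‖M.linn x x‖ := fun x => by rw [hn, M.norm_linn_self]
  obtain ⟨lS, hlS⟩ := exists_bilinear_extension M.jE M.dense_jE ι hι
    (M.lact.compr₂ ι) 1 zero_le_one fun c x => by
      rw [LinearMap.compr₂_apply, hn, hn, one_mul]
      refine (Real.sqrt_le_sqrt (M.norm_rinn_lact_le c x)).trans_eq ?_
      rw [Real.sqrt_mul (by positivity), Real.sqrt_sq (norm_nonneg _)]
  obtain ⟨rS, hrS⟩ := exists_bilinear_extension ι hι M.jB M.dense_jB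
    (M.ract.compr₂ ι) 1 zero_le_one fun x b => by
      rw [LinearMap.compr₂_apply, hn', hn', one_mul]
      refine (Real.sqrt_le_sqrt (M.norm_linn_ract_le x b)).trans_eq ?_
      rw [Real.sqrt_mul (by positivity), Real.sqrt_sq (norm_nonneg _), mul_comm]
  obtain ⟨lI, hlI⟩ := exists_bilinear_extension ι hι ι hι M.linn 1 zero_le_one fun x y => by
    rw [hn', hn', one_mul]
    exact M.norm_linn_le x y
  obtain ⟨rI, hrI⟩ := exists_bilinear_extension ι hι ι hι M.rinn 1 zero_le_one fun x y => by
    rw [hn, hn, one_mul]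
    exact M.norm_rinn_le x y
  simp only [LinearMap.compr₂_apply] at hlS hrS
  have hEd := M.dense_jE
  have hBd := M.dense_jB
  have linner_lsmul : ∀ a x y, lI (lS a x) y = a * lI x y := fun a x y => by
    refine hEd.induction_on a (isClosed_eq (by fun_prop) (by fun_prop)) fun c => ?_
    refine hι.induction_on x (isClosed_eq (by fun_prop) (by fun_prop)) fun x => ?_
    refine hι.induction_on y (isClosed_eq (by fun_prop) (by fun_prop)) fun y => ?_
    rw [hlS, hlI, hlI, M.linn_lact]
  have rinner_rsmul : ∀ x y b, rI x (rS y b) = rI x y * b := fun x y b => by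
    refine hBd.induction_on b (isClosed_eq (by fun_prop) (by fun_prop)) fun b => ?_
    refine hι.induction_on x (isClosed_eq (by fun_prop) (by fun_prop)) fun x => ?_
    refine hι.induction_on y (isClosed_eq (by fun_prop) (by fun_prop)) fun y => ?_
    rw [hrS, hrI, hrI, M.rinn_ract]
  have clI : Continuous fun x => lI x x :=
    (map_continuous lI.flip).clm_apply continuous_id
  have crI : Continuous fun x => rI x x :=
    (map_continuous rI).clm_apply continuous_id
  have nl : ∀ x, ‖x‖ ^ 2 = ‖lI x x‖ := fun x => by
    refine hι.induction_on x (isClosed_eq (by fun_prop) clI.norm) fun x => ?_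
    rw [hlI, hn', Real.sq_sqrt (norm_nonneg _)]
  have nr : ∀ x, ‖x‖ ^ 2 = ‖rI x x‖ := fun x => by
    refine hι.induction_on x (isClosed_eq (by fun_prop) crI.norm) fun x => ?_
    rw [hrI, hn, Real.sq_sqrt (norm_nonneg _)]
  -- Vectors are determined by their inner products. The module laws and the commutation of the two
  -- actions, which are not among the axioms of `PreBimodule`, are derived by testing against inner
  -- products.
  have eql : ∀ x y, (∀ z, lI x z = lI y z) → x = y := fun x y h => by
    rw [← sub_eq_zero, ← norm_eq_zero, ← sq_eq_zero_iff, nl, show lI (x - y) = lI x - lI y from map_sub lI x y,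
      sub_apply, h, sub_self,
      norm_zero]
  have eqr : ∀ x y, (∀ z, rI z x = rI z y) → x = y := fun x y h => by
    rw [← sub_eq_zero, ← norm_eq_zero, ← sq_eq_zero_iff, nr, map_sub (rI (x - y)), h, sub_self,
      norm_zero]
  have rinner_lsmul : ∀ a x y, rI (lS a x) y = rI x (lS (star a) y) := fun a x y => by
    refine hEd.induction_on a (isClosed_eq (by fun_prop) (by fun_prop)) fun c => ?_
    obtain ⟨c', hc', hcc'⟩ := M.rinn_adj c
    refine hι.induction_on x (isClosed_eq (by fun_prop) (by fun_prop)) fun x => ?_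
    refine hι.induction_on y (isClosed_eq (by fun_prop) (by fun_prop)) fun y => ?_
    rw [← hc', hlS, hlS, hrI, hrI, hcc']
  let W' : ImprimitivityBimodule.{u} E B :=
    { carrier := W
      lsmul := forgetCont lS
      rsmul := forgetCont rS
      linner := forgetCont lI
      rinner := forgetCont rI
      lsmul_mul := fun a a' x => eql _ _ fun z => by
        change lI (lS (a * a') x) z = lI (lS a (lS a' x)) z
        rw [linner_lsmul, linner_lsmul, linner_lsmul, mul_assoc]
      rsmul_mul := fun x b b' => eqr _ _ fun z => by
        change rI z (rS x (b * b')) = rI z (rS (rS x b) b')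
        rw [rinner_rsmul, rinner_rsmul, rinner_rsmul, mul_assoc]
      lsmul_rsmul := fun a x b => eqr _ _ fun z => by
        change rI z (lS a (rS x b)) = rI z (rS (lS a x) b)
        have h := fun y => (rinner_lsmul (star a) z y).symm
        simp only [star_star] at h
        rw [h, rinner_rsmul, rinner_rsmul, h]
      linner_lsmul := linner_lsmul
      rinner_rsmul := rinner_rsmul
      star_linner := fun x y => by
        change star (lI x y) = lI y x
        refine hι.induction_on x (isClosed_eq (by fun_prop) (by fun_prop)) fun x => ?_
        refine hι.induction_on y (isClosed_eq (by fun_prop) (by fun_prop)) fun y => ?_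
        rw [hlI, hlI, M.star_linn]
      star_rinner := fun x y => by
        change star (rI x y) = rI y x
        refine hι.induction_on x (isClosed_eq (by fun_prop) (by fun_prop)) fun x => ?_
        refine hι.induction_on y (isClosed_eq (by fun_prop) (by fun_prop)) fun y => ?_
        rw [hrI, hrI, M.star_rinn]
      linner_nonneg := fun x => by
        change lI x x ∈ {a : E | ∃ b, a = star b * b}
        refine hι.induction_on x ((isClosed_setOf_exists_star_mul_self E).preimage
          clI) fun x => ?_
        rw [hlI]
        exact M.linn_self x
      rinner_nonneg := fun x => by
        change rI x x ∈ {a : B | ∃ b, a = star b * b}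
        refine hι.induction_on x ((isClosed_setOf_exists_star_mul_self B).preimage
          crI) fun x => ?_
        rw [hrI]
        exact M.rinn_self x
      norm_sq_eq_linner := nl
      norm_sq_eq_rinner := nr
      linner_full := M.full_linn.mono (Submodule.span_mono (by
        rintro _ ⟨x, y, rfl⟩
        exact ⟨ι x, ι y, (hlI x y).symm⟩))
      rinner_full := M.full_rinn.mono (Submodule.span_mono (by
        rintro _ ⟨x, y, rfl⟩
        exact ⟨ι x, ι y, (hrI x y).symm⟩))
      rinner_lsmul := rinner_lsmul
      linner_rsmul := fun x b y => by
        change lI (rS x b) y = lI x (rS y (star b))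
        refine hBd.induction_on b (isClosed_eq (by fun_prop) (by fun_prop)) fun b => ?_
        obtain ⟨b', hb', hbb'⟩ := M.linn_adj b
        refine hι.induction_on x (isClosed_eq (by fun_prop) (by fun_prop)) fun x => ?_
        refine hι.induction_on y (isClosed_eq (by fun_prop) (by fun_prop)) fun y => ?_
        rw [← hb', hrS, hrS, hlI, hlI, hbb']
      linner_lsmul_eq := fun x y z => by
        change lS (lI x y) z = rS x (rI y z)
        refine hι.induction_on x (isClosed_eq (by fun_prop) (by fun_prop)) fun x => ?_
        refine hι.induction_on y (isClosed_eq (by fun_prop) (by fun_prop)) fun y => ?_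
        refine hι.induction_on z (isClosed_eq (by fun_prop) (by fun_prop)) fun z => ?_
        obtain ⟨c, b, hc, hb, hcb⟩ := M.lact_linn x y z
        rw [hlI, hrI, ← hc, ← hb, hlS, hrS, hcb] }
  exact ⟨W', ι, hι, hlS, hrS, hlI, hrI⟩

end PreBimodule

/-! ### The symmetric-imprimitivity bimodule -/

theorem ccStar_add {G B : Type u} [NonUnitalCStarAlgebra B] [Group G] [TopologicalSpace G]
    [IsTopologicalGroup G] [LocallyCompactSpace G] [T2Space G] [MeasurableSpace G] [BorelSpace G]
    {α : G →* Aut B} (hα : ∀ b, Continuous fun s => α s b) (f g : C_c(G, B)) :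
    ccStar hα (f + g) = ccStar hα f + ccStar hα g := by
  ext s
  rw [ccStar_apply, CompactlySupportedContinuousMap.add_apply,
    CompactlySupportedContinuousMap.add_apply, ccStar_apply, ccStar_apply, star_add, map_add,
    smul_add]

theorem ccStar_smul {G B : Type u} [NonUnitalCStarAlgebra B] [Group G] [TopologicalSpace G]
    [IsTopologicalGroup G] [LocallyCompactSpace G] [T2Space G] [MeasurableSpace G] [BorelSpace G]
    {α : G →* Aut B} (hα : ∀ b, Continuous fun s => α s b) (c : ℂ) (f : C_c(G, B)) :
    ccStar hα (c • f) = star c • ccStar hα f := by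
  ext s
  rw [ccStar_apply, CompactlySupportedContinuousMap.smul_apply,
    CompactlySupportedContinuousMap.smul_apply, ccStar_apply, star_smul, map_smul, smul_comm]

namespace CommutingSystem

variable {K L P A : Type u}
  [Group K] [TopologicalSpace K] [IsTopologicalGroup K] [LocallyCompactSpace K] [T2Space K]
  [MeasurableSpace K] [BorelSpace K]
  [Group L] [TopologicalSpace L] [IsTopologicalGroup L] [LocallyCompactSpace L] [T2Space L]
  [MeasurableSpace L] [BorelSpace L]
  [TopologicalSpace P] [T2Space P] [LocallyCompactSpace P]
  [MulAction K P] [MulAction L P] [ProperSMul K P] [ProperSMul L P]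
  [NonUnitalCStarAlgebra A] {D : CommutingSystem K L P A}

theorem ract_def (hD : D.IsCont) (x : C_c(P, A)) (b : C_c(L, D.sw.Ind)) :
    ract hD x b = star (lact hD.sw (ccStar (continuous_sw_diag hD) b) (star x)) := rfl

/-- The right action as a bilinear map. -/
def ractₗ (hD : D.IsCont) : C_c(P, A) →ₗ[ℂ] C_c(L, D.sw.Ind) →ₗ[ℂ] C_c(P, A) :=
  LinearMap.mk₂ ℂ (ract hD)
    (fun x y b => by simp only [ract_def, star_add, map_add])
    (fun c x b => by simp only [ract_def, star_smul, map_smul, star_star])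
    (fun x b b' => by simp only [ract_def, ccStar_add, star_add, map_add, LinearMap.add_apply])
    (fun c x b => by
      simp only [ract_def, ccStar_smul, star_smul, map_smul, star_star, LinearMap.smul_apply])

/-- The left inner product with values in the crossed product. -/
def linnCP (hD : D.IsCont) : C_c(P, A) →ₗ[ℂ] C_c(P, A) →ₗ⋆[ℂ] CrossedProduct D.diag :=
  LinearMap.mk₂'ₛₗ _ _ (fun x y => rinnCP hD.sw (star x) (star y))
    (fun x y z => by rw [star_add, map_add, LinearMap.add_apply])
    (fun c x y => by
      rw [star_smul, LinearMap.map_smulₛₗ₂, starRingEnd_apply, star_star]; rfl)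
    (fun x y z => by rw [star_add, map_add])
    (fun c x y => by rw [star_smul, map_smul]; rfl)

theorem linnCP_apply (hD : D.IsCont) (x y : C_c(P, A)) :
    linnCP hD x y = rinnCP hD.sw (star x) (star y) := rfl

theorem star_linnCP (hD : D.IsCont) (x y : C_c(P, A)) :
    star (linnCP hD x y) = linnCP hD y x := by
  rw [linnCP_apply, linnCP_apply]
  exact star_rinnCP hD.sw _ _

theorem exists_linnCP_self (hD : D.IsCont) (x : C_c(P, A)) :
    ∃ a, linnCP hD x x = star a * a := by
  obtain ⟨a, ha⟩ := exists_rinnCP_self hD.sw (star x)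
  exact ⟨a, ha⟩

theorem norm_linnCP_le (hD : D.IsCont) (x y : C_c(P, A)) :
    ‖linnCP hD x y‖ ≤ √‖linnCP hD x x‖ * √‖linnCP hD y y‖ := by
  simp only [linnCP_apply]
  exact norm_rinnCP_le hD.sw _ _

theorem linnCP_lact (hD : D.IsCont) (c : C_c(K, D.Ind)) (x y : C_c(P, A)) :
    linnCP hD (lact hD c x) y = toCP D.diag c * linnCP hD x y := by
  rw [← star_star (linnCP hD (lact hD c x) y), star_linnCP, linnCP_apply, lact_ccStar, star_star]
  have h := rinnCP_ract hD.sw (star y) (star x) (ccStar (continuous_diag hD) c)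
  rw [show rinnCP hD.sw (star y) (ract hD.sw (star x) (ccStar (continuous_diag hD) c)) = _ from h]
  rw [star_mul, star_rinnCP]
  have h' := toCP_ccStar (continuous_diag hD) c
  have h2 : star (toCP D.diag (ccStar (continuous_diag hD) c)) = toCP D.diag c := by
    rw [h', star_star]
  exact congrArg (· * linnCP hD x y) h2

theorem linnCP_ract (hD : D.IsCont) (x y : C_c(P, A)) (b : C_c(L, D.sw.Ind)) :
    linnCP hD (ract hD x b) y = linnCP hD x (ract hD y (ccStar (continuous_sw_diag hD) b)) := by
  rw [linnCP_apply, linnCP_apply, ract_def, ract_def, star_star, star_star]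
  exact rinnCP_lact hD.sw _ _ _

theorem norm_linnCP_ract_le (hD : D.IsCont) (x : C_c(P, A)) (b : C_c(L, D.sw.Ind)) :
    ‖linnCP hD (ract hD x b) (ract hD x b)‖ ≤ ‖toCP D.sw.diag b‖ ^ 2 * ‖linnCP hD x x‖ := by
  rw [linnCP_apply, linnCP_apply, ract_def, star_star]
  refine (norm_rinnCP_lact_le hD.sw (ccStar (continuous_sw_diag hD) b) (star x)).trans_eq ?_
  rw [toCP_ccStar, norm_star]

theorem dense_linnCP [IsCancelSMul K P] (hD : D.IsCont) :
    Dense (Submodule.span ℂ {b | ∃ x y, b = linnCP hD x y} : Set (CrossedProduct D.diag)) := by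
  refine (dense_rinnCP hD.sw).mono (Submodule.span_mono ?_)
  rintro _ ⟨x, y, rfl⟩
  exact ⟨star x, star y, by rw [linnCP_apply, star_star, star_star]⟩

/-- Freeness serves fullness only: that of `L` for the right inner product and that of `K` for the
left one. -/
theorem exists_isW_of_isCont [IsCancelSMul K P] [IsCancelSMul L P] (hD : D.IsCont) :
    ∃ W ι, D.IsW W ι := by
  let M : PreBimodule C_c(P, A) C_c(K, D.Ind) C_c(L, D.sw.Ind) D.LeftAlg
      (CrossedProduct D.sw.diag) :=
    { jE := toCP D.diag
      jB := toCP D.sw.diag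
      lact := lact hD
      ract := ractₗ hD
      linn := linnCP hD
      rinn := rinnCP hD
      dense_jE := denseRange_toCP (continuous_diag hD)
      dense_jB := denseRange_toCP (continuous_sw_diag hD)
      star_linn := star_linnCP hD
      star_rinn := star_rinnCP hD
      linn_self := exists_linnCP_self hD
      rinn_self := exists_rinnCP_self hD
      norm_linn_le := norm_linnCP_le hD
      norm_rinn_le := norm_rinnCP_le hD
      linn_lact := linnCP_lact hD
      rinn_ract := rinnCP_ract hD
      norm_linn_ract_le := norm_linnCP_ract_le hD
      norm_rinn_lact_le := norm_rinnCP_lact_le hD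
      linn_adj := fun b => ⟨ccStar (continuous_sw_diag hD) b, toCP_ccStar _ _, fun x y => linnCP_ract hD x y b⟩
      rinn_adj := fun c => ⟨ccStar (continuous_diag hD) c, toCP_ccStar _ _,
        fun x y => rinnCP_lact hD c x y⟩
      lact_linn := fun x y z => ⟨linn hD x y, rinn hD y z, rfl, rfl, lact_linn hD x y z⟩
      full_linn := dense_linnCP hD
      full_rinn := dense_rinnCP hD }
  obtain ⟨W, ι, hι, h1, h2, h3, h4⟩ := M.exists_completion
  refine ⟨W, ι, hι, fun c x => ⟨lact hD c x, lact_apply hD c x, h1 c x⟩,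
    fun x b => ⟨ract hD x b, ract_apply hD x b, h2 x b⟩,
    fun x y => ⟨linn hD x y, linn_apply_apply hD x y, h3 x y⟩,
    fun x y => ⟨rinn hD x y, rinn_apply_apply hD x y, h4 x y⟩⟩

theorem IsSymmetricImprimitivityData.isCont (hD : D.IsSymmetricImprimitivityData) : D.IsCont :=
  ⟨hD.continuous_σ, hD.continuous_η⟩

theorem IsSymmetricImprimitivityData.exists_isW {K L P A : Type u}
    [Group K] [TopologicalSpace K] [IsTopologicalGroup K] [LocallyCompactSpace K] [T2Space K]
    [MeasurableSpace K] [BorelSpace K]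
    [Group L] [TopologicalSpace L] [IsTopologicalGroup L] [LocallyCompactSpace L] [T2Space L]
    [MeasurableSpace L] [BorelSpace L]
    [TopologicalSpace P] [MulAction K P] [MulAction L P] [ContinuousConstSMul K P]
    [ContinuousConstSMul L P]
    [NonUnitalCStarAlgebra A] {D : CommutingSystem K L P A}
    (hD : D.IsSymmetricImprimitivityData) : ∃ W ι, D.IsW W ι := by
  have := hD.t2Space
  have := hD.locallyCompactSpace
  have := hD.free_left
  have := hD.free_right
  have := hD.proper_left
  have := hD.proper_right
  exact exists_isW_of_isCont hD.isCont

section IsW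

variable {W : ImprimitivityBimodule.{u} D.LeftAlg D.RightAlg} {ι : C_c(P, A) →ₗ[ℂ] W.carrier}

/-- `IsW` asserts only that some function with the prescribed values represents the inner product;
the values determine that function. -/
theorem IsW.rinner_eq (h : D.IsW W ι) (hD : D.IsCont) (x y : C_c(P, A)) :
    W.rinner (ι x) (ι y) = toCP D.sw.diag (rinn hD x y) := by
  obtain ⟨b, hb, h⟩ := h.rinner x y
  rw [h]
  have : b = rinn hD x y := by
    refine DFunLike.ext _ _ fun t => Induced.ext fun p => ?_
    exact (hb t p).trans (rinn_apply_apply hD x y t p).symm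
  rw [this]
  rfl

theorem IsW.lsmul_eq (h : D.IsW W ι) (hD : D.IsCont) (c : C_c(K, D.Ind)) (x : C_c(P, A)) :
    W.lsmul (toCP D.diag c) (ι x) = ι (lact hD c x) := by
  obtain ⟨z, hz, h⟩ := h.lsmul c x
  have : z = lact hD c x := DFunLike.ext _ _ fun p => (hz p).trans (lact_apply hD c x p).symm
  rw [← this, ← h]
  rfl

end IsW

end CommutingSystem

/-! ### Topology of `P #_φ Q` -/

theorem isOpenQuotientMap_orb (H X : Type u) [Group H] [TopologicalSpace X] [MulAction H X]
    [ContinuousConstSMul H X] : IsOpenQuotientMap (orb H : X → OrbitSpace H X) :=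
  MulAction.isOpenQuotientMap_quotientMk

theorem continuousSMul_of_isOpenQuotientMap {K F Y : Type*} [Group K] [TopologicalSpace K]
    [TopologicalSpace F] [TopologicalSpace Y] [MulAction K Y] {π : F → Y}
    (hπ : IsOpenQuotientMap π) {a : K → F → F} (ha : Continuous fun z : K × F => a z.1 z.2)
    (haπ : ∀ k z, π (a k z) = k • π z) : ContinuousSMul K Y where
  continuous_smul := by
    have h := (IsOpenQuotientMap.id (X := K)).prodMap hπ
    rw [← h.continuous_comp_iff]
    exact (hπ.continuous.comp ha).congr fun z => haπ z.1 z.2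

/-- Compact subsets of `Y` lift to compact subsets of `F`, so the return sets can be bounded
upstairs. -/
theorem properSMul_of_isOpenQuotientMap {K F Y : Type*} [Group K] [TopologicalSpace K]
    [TopologicalSpace F] [LocallyCompactSpace F] [TopologicalSpace Y] [T2Space Y]
    [LocallyCompactSpace Y] [MulAction K Y] {π : F → Y}
    (hπ : IsOpenQuotientMap π) {a : K → F → F} (ha : Continuous fun z : K × F => a z.1 z.2)
    (haπ : ∀ k z, π (a k z) = k • π z)
    (hc : ∀ C C' : Set F, IsCompact C → IsCompact C' →
      ∃ S : Set K, IsCompact S ∧ ∀ k, ∀ z ∈ C, ∀ z' ∈ C', k • π z = π z' → k ∈ S) :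
    ProperSMul K Y := by
  have := continuousSMul_of_isOpenQuotientMap hπ ha haπ
  refine ⟨isProperMap_iff_isCompact_preimage.2 ⟨by fun_prop, fun C hC => ?_⟩⟩
  obtain ⟨C₁, hC₁, hC₁'⟩ := exists_compact_lift_of_isOpenQuotientMap hπ (hC.image continuous_fst)
  obtain ⟨C₂, hC₂, hC₂'⟩ := exists_compact_lift_of_isOpenQuotientMap hπ (hC.image continuous_snd)
  obtain ⟨S, hS, hSC⟩ := hc C₂ C₁ hC₂ hC₁
  refine (hS.prod (hC.image continuous_snd)).of_isClosed_subset
    (hC.isClosed.preimage (by fun_prop)) ?_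
  rintro ⟨k, y⟩ hy
  have hy2 : y ∈ Prod.snd '' C := ⟨_, hy, rfl⟩
  refine ⟨?_, hy2⟩
  obtain ⟨z, hz, rfl⟩ := hC₂' hy2
  obtain ⟨z', hz', h'⟩ := hC₁' ⟨_, hy, rfl⟩
  exact hSC k z hz z' hz' h'.symm

namespace EquivariantHomeo

section Basic

variable {K L G P Q : Type u} [Group K] [Group L] [Group G]
  [TopologicalSpace P] [TopologicalSpace Q] [MulAction K P] [MulAction L P] [MulAction L Q]
  [MulAction G Q] (φ : EquivariantHomeo K L G P Q)

theorem smul_val (t : L) (z : φ.FibreProduct) : (t • z).1 = (t • z.1.1, t • z.1.2) := rfl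

theorem continuous_val : Continuous fun z : φ.FibreProduct => z.1 := continuous_subtype_val

theorem continuous_left : Continuous fun z : φ.FibreProduct => z.1.1 :=
  continuous_fst.comp φ.continuous_val

theorem continuous_right : Continuous fun z : φ.FibreProduct => z.1.2 :=
  continuous_snd.comp φ.continuous_val

/-- The quotient map `P ×_φ Q → P #_φ Q`. -/
def proj (z : φ.FibreProduct) : φ.Hash := orb L z

theorem proj_eq_iff {z w : φ.FibreProduct} : φ.proj z = φ.proj w ↔ ∃ t : L, t • w = z :=
  orb_eq_iff

theorem smul_proj_left [SMulCommClass K L P] (k : K) (z : φ.FibreProduct) :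
    k • φ.proj z = φ.proj (φ.leftMap k z) := rfl

theorem smul_proj_right [SMulCommClass L G Q] (m : G) (z : φ.FibreProduct) :
    m • φ.proj z = φ.proj (φ.rightMap m z) := rfl

/-- The orbit map of `Q` is open: for `p'` near `p` the orbit `φ(K p')` meets any given
neighbourhood of `q`, so `p'` completes to a pair near `(p, q)`. -/
theorem isOpenQuotientMap_left [ContinuousConstSMul G Q] :
    IsOpenQuotientMap fun z : φ.FibreProduct => z.1.1 := by
  refine ⟨fun p => ?_, φ.continuous_left, ?_⟩
  · obtain ⟨q, hq⟩ := (isOpenQuotientMap_orb G Q).surjective (φ.toHomeo (orb K p))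
    exact ⟨⟨(p, q), hq.symm⟩, rfl⟩
  · refine isOpenMap_iff_nhds_le.2 fun z s hs => ?_
    rw [Filter.mem_map] at hs
    obtain ⟨t, ht, hts⟩ := mem_nhds_subtype _ _ _ |>.1 hs
    obtain ⟨U, hU, V, hV, hUV⟩ := mem_nhds_prod_iff.1 ht
    have h1 : orb G '' V ∈ nhds (φ.toHomeo (orb K z.1.1)) := by
      rw [z.2]
      exact (isOpenQuotientMap_orb G Q).isOpenMap.image_mem_nhds hV
    have h2 : Continuous fun p : P => φ.toHomeo (orb K p) :=
      φ.toHomeo.continuous.comp continuous_quotient_mk'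
    filter_upwards [hU, h2.continuousAt.preimage_mem_nhds h1] with p hp hp'
    obtain ⟨q, hq, hq'⟩ := hp'
    exact hts (a := ⟨(p, q), hq'.symm⟩) (hUV ⟨hp, hq⟩)

theorem isOpenQuotientMap_right [ContinuousConstSMul K P] :
    IsOpenQuotientMap fun z : φ.FibreProduct => z.1.2 := by
  refine ⟨fun q => ?_, φ.continuous_right, ?_⟩
  · obtain ⟨p, hp⟩ := (isOpenQuotientMap_orb K P).surjective (φ.toHomeo.symm (orb G q))
    exact ⟨⟨(p, q), by rw [hp, Homeomorph.apply_symm_apply]⟩, rfl⟩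
  · refine isOpenMap_iff_nhds_le.2 fun z s hs => ?_
    rw [Filter.mem_map] at hs
    obtain ⟨t, ht, hts⟩ := mem_nhds_subtype _ _ _ |>.1 hs
    obtain ⟨U, hU, V, hV, hUV⟩ := mem_nhds_prod_iff.1 ht
    have h1 : orb K '' U ∈ nhds (φ.toHomeo.symm (orb G z.1.2)) := by
      rw [← z.2, Homeomorph.symm_apply_apply]
      exact (isOpenQuotientMap_orb K P).isOpenMap.image_mem_nhds hU
    have h2 : Continuous fun q : Q => φ.toHomeo.symm (orb G q) :=
      φ.toHomeo.symm.continuous.comp continuous_quotient_mk'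
    filter_upwards [hV, h2.continuousAt.preimage_mem_nhds h1] with q hq hq'
    obtain ⟨p, hp, hp'⟩ := hq'
    have hpq : φ.toHomeo (orb K p) = orb G q := by rw [hp', Homeomorph.apply_symm_apply]
    exact hts (a := ⟨(p, q), hpq⟩) (hUV ⟨hp, hq⟩)

end Basic

variable {K L G P Q : Type u}
  [Group K] [TopologicalSpace K] [Group L] [TopologicalSpace L] [Group G] [TopologicalSpace G]
  [TopologicalSpace P] [T2Space P] [LocallyCompactSpace P]
  [TopologicalSpace Q] [T2Space Q] [LocallyCompactSpace Q]
  [MulAction K P] [MulAction L P] [MulAction L Q] [MulAction G Q]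
  [ProperSMul K P] [ProperSMul L P] [ProperSMul L Q] [ProperSMul G Q]
  (φ : EquivariantHomeo K L G P Q)

instance : T2Space φ.FibreProduct := inferInstanceAs (T2Space (Subtype _))

/-- The fibre product is closed because `Q / G` is Hausdorff, the action of `G` being proper. -/
theorem isClosedEmbedding_val : Topology.IsClosedEmbedding fun z : φ.FibreProduct => z.1 :=
  Topology.IsClosedEmbedding.subtypeVal (isClosed_eq
    (φ.toHomeo.continuous.comp (continuous_quotient_mk'.comp continuous_fst))
    (continuous_quotient_mk'.comp continuous_snd))

instance : LocallyCompactSpace φ.FibreProduct := φ.isClosedEmbedding_val.locallyCompactSpace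

/-- Properness on `P` suffices: along an ultrafilter the group elements already converge by looking
at first coordinates. -/
instance : ProperSMul L φ.FibreProduct := by
  rw [properSMul_iff_continuousSMul_ultrafilter_tendsto_t2]
  refine ⟨⟨?_⟩, fun 𝒰 z₁ z₂ h => ?_⟩
  · refine Continuous.subtype_mk ?_ _
    have h1 := φ.continuous_left
    have h2 := φ.continuous_right
    fun_prop
  · have h' := (properSMul_iff_continuousSMul_ultrafilter_tendsto_t2 (G := L) (X := P)).1
      inferInstance
    have hc := φ.continuous_left
    obtain ⟨t, ht⟩ := h'.2 (𝒰.map (Prod.map id fun z : φ.FibreProduct => z.1.1)) z₁.1.1 z₂.1.1 (by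
      rw [Ultrafilter.coe_map, Filter.tendsto_map'_iff]
      exact ((hc.prodMap hc).tendsto (z₁, z₂)).comp h)
    rw [Ultrafilter.coe_map, Filter.tendsto_map'_iff] at ht
    exact ⟨t, ht⟩

theorem isOpenQuotientMap_proj : IsOpenQuotientMap φ.proj :=
  isOpenQuotientMap_orb L φ.FibreProduct

instance : T2Space φ.Hash := inferInstanceAs (T2Space (OrbitSpace L φ.FibreProduct))

instance : LocallyCompactSpace φ.Hash :=
  φ.isOpenQuotientMap_proj.locallyCompactSpace

variable [SMulCommClass K L P] [SMulCommClass L G Q]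

/-- If `k z = t z'` in the fibre product, the second coordinates confine `t` to a compact set by
properness of `L` on `Q`, after which the first coordinates confine `k`. -/
instance : ProperSMul K φ.Hash := by
  have h1 := φ.continuous_left
  have h2 := φ.continuous_right
  refine properSMul_of_isOpenQuotientMap φ.isOpenQuotientMap_proj (a := φ.leftMap)
    (Continuous.subtype_mk (by fun_prop) _) (fun _ _ => rfl) fun C C' hC hC' => ?_
  have hT := isCompact_returnSet (H := L) (hC.image h2) (hC'.image h2)
  refine ⟨_, isCompact_returnSet (H := K)
    ((hT.prod (hC'.image h1)).image continuous_smul) (hC.image h1), ?_⟩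
  rintro k z hz z' hz' h
  rw [smul_proj_left, proj_eq_iff] at h
  obtain ⟨t, ht⟩ := h
  have e1 : t • z'.1.1 = k • z.1.1 := congrArg (fun w => w.1.1) ht
  have e2 : t • z'.1.2 = z.1.2 := congrArg (fun w => w.1.2) ht
  refine ⟨k • z.1.1, ⟨(t, z'.1.1), ⟨⟨z.1.2, ⟨z, hz, rfl⟩, z', hz', ?_⟩, z', hz', rfl⟩, e1⟩,
    z, hz, by rw [inv_smul_smul]⟩
  rw [← e2, inv_smul_smul]

instance : ProperSMul G φ.Hash := by
  have h1 := φ.continuous_left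
  have h2 := φ.continuous_right
  refine properSMul_of_isOpenQuotientMap φ.isOpenQuotientMap_proj (a := φ.rightMap)
    (Continuous.subtype_mk (by fun_prop) _) (fun _ _ => rfl) fun C C' hC hC' => ?_
  have hT := isCompact_returnSet (H := L) (hC.image h1) (hC'.image h1)
  refine ⟨_, isCompact_returnSet (H := G)
    ((hT.prod (hC'.image h2)).image continuous_smul) (hC.image h2), ?_⟩
  rintro k z hz z' hz' h
  rw [smul_proj_right, proj_eq_iff] at h
  obtain ⟨t, ht⟩ := h
  have e1 : t • z'.1.2 = k • z.1.2 := congrArg (fun w => w.1.2) ht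
  have e2 : t • z'.1.1 = z.1.1 := congrArg (fun w => w.1.1) ht
  refine ⟨k • z.1.2, ⟨(t, z'.1.2), ⟨⟨z.1.1, ⟨z, hz, rfl⟩, z', hz', ?_⟩, z', hz', rfl⟩, e1⟩,
    z, hz, by rw [inv_smul_smul]⟩
  rw [← e2, inv_smul_smul]

/-- The identification takes place through some `t ∈ L` fixing the second coordinate, hence `t = 1`;
the first coordinate then gives equality in `K`. -/
theorem isCancelSMul_left [IsCancelSMul K P] [IsCancelSMul L Q] : IsCancelSMul K φ.Hash where
  right_cancel' k k' z h := by
    obtain ⟨z, rfl⟩ := φ.isOpenQuotientMap_proj.surjective z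
    rw [smul_proj_left, smul_proj_left, proj_eq_iff] at h
    obtain ⟨t, ht⟩ := h
    have e1 : t • k' • z.1.1 = k • z.1.1 := congrArg (fun w => w.1.1) ht
    have e2 : t • z.1.2 = z.1.2 := congrArg (fun w => w.1.2) ht
    have : t = 1 := IsCancelSMul.right_cancel _ _ z.1.2 (e2.trans (one_smul L _).symm)
    rw [this, one_smul] at e1
    exact (IsCancelSMul.right_cancel _ _ _ e1).symm

theorem isCancelSMul_right [IsCancelSMul G Q] [IsCancelSMul L P] : IsCancelSMul G φ.Hash where
  right_cancel' k k' z h := by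
    obtain ⟨z, rfl⟩ := φ.isOpenQuotientMap_proj.surjective z
    rw [smul_proj_right, smul_proj_right, proj_eq_iff] at h
    obtain ⟨t, ht⟩ := h
    have e1 : t • k' • z.1.2 = k • z.1.2 := congrArg (fun w => w.1.2) ht
    have e2 : t • z.1.1 = z.1.1 := congrArg (fun w => w.1.1) ht
    have : t = 1 := IsCancelSMul.right_cancel _ _ z.1.1 (e2.trans (one_smul L _).symm)
    rw [this, one_smul] at e1
    exact (IsCancelSMul.right_cancel _ _ _ e1).symm

end EquivariantHomeo

theorem CommutingSystem.IsSymmetricImprimitivityData.hash {K L G P Q A : Type u}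
    [Group K] [TopologicalSpace K] [Group L] [TopologicalSpace L] [Group G] [TopologicalSpace G]
    [TopologicalSpace P] [MulAction K P] [MulAction L P] [SMulCommClass K L P]
    [TopologicalSpace Q] [MulAction L Q] [MulAction G Q] [SMulCommClass L G Q]
    [NonUnitalCStarAlgebra A]
    {D : CommutingSystem K L P A} (hD : D.IsSymmetricImprimitivityData)
    {E : CommutingSystem L G Q A} (hE : E.IsSymmetricImprimitivityData)
    (φ : EquivariantHomeo K L G P Q) (hστ : ∀ (k : K) (m : G), Commute (D.σ k) (E.η m)) :
    (D.hash E φ hστ).IsSymmetricImprimitivityData := by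
  have := hD.t2Space
  have := hD.locallyCompactSpace
  have := hD.free_left
  have := hD.free_right
  have := hD.proper_left
  have := hD.proper_right
  have := hE.t2Space
  have := hE.locallyCompactSpace
  have := hE.free_left
  have := hE.free_right
  have := hE.proper_left
  have := hE.proper_right
  exact ⟨inferInstance, inferInstance, inferInstance, inferInstance, φ.isCancelSMul_left,
    φ.isCancelSMul_right, inferInstance, inferInstance, hD.continuous_σ, hE.continuous_η⟩

/-! ### Isomorphisms of induced algebras -/

section Correspondence

variable {F H H' X X' A : Type u} [TopologicalSpace F] [Group H] [Group H']
  [TopologicalSpace X] [TopologicalSpace X'] [MulAction H X] [MulAction H' X']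
  [NonUnitalCStarAlgebra A]

/-- A space `F` over `X` and `X'` identifying the orbits of `H` in `X` with those of `H'` in `X'`,
and a family `θ` of automorphisms over `F` intertwining the actions `β` and `β'` on `A`. -/
structure IndCorrespondence (a : F → X) (b : F → X') (β : H →* Aut A) (β' : H' →* Aut A)
    (θ : F → Aut A) : Prop where
  left : IsOpenQuotientMap a
  right : IsOpenQuotientMap b
  continuous : ∀ c, Continuous fun z => θ z c
  of_right : ∀ z z' h', b z = h' • b z' → ∃ h : H, a z = h • a z' ∧ θ z * β' h' = β h * θ z'
  of_left : ∀ z z' h, a z = h • a z' → ∃ h' : H', b z = h' • b z' ∧ θ z * β' h' = β h * θ z'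

variable {a : F → X} {b : F → X'} {β : H →* Aut A} {β' : H' →* Aut A} {θ : F → Aut A}

namespace IndCorrespondence

theorem symm (c : IndCorrespondence a b β β' θ) :
    IndCorrespondence b a β' β fun z => (θ z)⁻¹ where
  left := c.right
  right := c.left
  continuous := continuous_aut_inv c.continuous
  of_right z z' h hz := by
    obtain ⟨h', h1, h2⟩ := c.of_left z z' h hz
    refine ⟨h', h1, ?_⟩
    rw [inv_mul_eq_iff_eq_mul, ← mul_assoc, h2, mul_inv_cancel_right]
  of_left z z' h hz := by
    obtain ⟨h', h1, h2⟩ := c.of_right z z' h hz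
    refine ⟨h', h1, ?_⟩
    rw [inv_mul_eq_iff_eq_mul, ← mul_assoc, h2, mul_inv_cancel_right]

theorem inv_apply_eq (c : IndCorrespondence a b β β' θ) (f : Induced X β) {z z' : F} {h' : H'}
    (hz : b z = h' • b z') : (θ z)⁻¹ (f (a z)) = β' h' ((θ z')⁻¹ (f (a z'))) := by
  obtain ⟨h, h1, h2⟩ := c.of_right z z' h' hz
  rw [h1, f.apply_smul]
  have h3 : β h = θ z * β' h' * (θ z')⁻¹ := by rw [h2, mul_inv_cancel_right]
  rw [h3, aut_mul_apply, aut_mul_apply, aut_inv_apply_self]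

/-- The value over `x` does not depend on the point of `F` chosen above it, so continuity descends
along the quotient map `b`. Norms are preserved, and compact sets of orbits are transferred by
lifting them to `F`. -/
theorem exists_map [LocallyCompactSpace F] [ContinuousConstSMul H X]
    (c : IndCorrespondence a b β β' θ) (f : Induced X β) :
    ∃ g : Induced X' β', ∀ z, g (b z) = (θ z)⁻¹ (f (a z)) := by
  choose s hs using c.right.surjective
  let g : X' → A := fun x => (θ (s x))⁻¹ (f (a (s x)))
  have hg : ∀ z, g (b z) = (θ z)⁻¹ (f (a z)) := fun z => by
    have := c.inv_apply_eq f (z := s (b z)) (z' := z) (h' := 1) (by rw [hs, one_smul])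
    rw [map_one] at this
    exact this
  have hc : Continuous g := by
    rw [← c.right.continuous_comp_iff]
    have h1 := continuous_aut_apply (continuous_aut_inv c.continuous)
      (f.continuous.comp c.left.continuous)
    exact h1.congr fun z => (hg z).symm
  refine ⟨(⟨BoundedContinuousFunction.ofNormedAddCommGroup g hc ‖f‖ fun x => ?_,
    isInduced_iff.2 ⟨fun h' x => ?_, fun ε hε => ?_⟩⟩ : inducedSubalgebra X' β'), hg⟩
  · rw [norm_aut]
    exact f.norm_apply_le _
  · exact c.inv_apply_eq f (by rw [hs, hs])
  · obtain ⟨C, hC, hCf⟩ := f.exists_compact_norm_lt hε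
    obtain ⟨S, hS, hCS⟩ := exists_compact_lift_of_isOpenQuotientMap
      ((isOpenQuotientMap_orb H X).comp c.left) hC
    refine ⟨(fun z => orb H' (b z)) '' S,
      hS.image (continuous_quotient_mk'.comp c.right.continuous), fun x hx => ?_⟩
    change ‖(θ (s x))⁻¹ (f (a (s x)))‖ < ε
    rw [norm_aut]
    refine hCf _ fun hmem => hx ?_
    obtain ⟨z, hz, hz'⟩ := hCS hmem
    obtain ⟨h, hh⟩ := orb_eq_iff.1 hz'.symm
    obtain ⟨h', h1, -⟩ := c.of_left _ _ _ hh.symm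
    exact ⟨z, hz, (orb_eq_iff.2 ⟨h', by rw [← h1, hs]⟩).symm⟩

theorem exists_equiv [LocallyCompactSpace F] [ContinuousConstSMul H X] [ContinuousConstSMul H' X']
    (c : IndCorrespondence a b β β' θ) :
    ∃ T : Induced X β ≃⋆ₐ[ℂ] Induced X' β', ∀ f z, T f (b z) = (θ z)⁻¹ (f (a z)) := by
  choose T hT using c.exists_map
  choose S hS using c.symm.exists_map
  have hext : ∀ {f g : Induced X' β'}, (∀ z, f (b z) = g (b z)) → f = g := fun h =>
    Induced.ext fun x => by
      obtain ⟨z, rfl⟩ := c.right.surjective x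
      exact h z
  have hext' : ∀ {f g : Induced X β}, (∀ z, f (a z) = g (a z)) → f = g := fun h =>
    Induced.ext fun x => by
      obtain ⟨z, rfl⟩ := c.left.surjective x
      exact h z
  exact ⟨{ toFun := T
           invFun := S
           left_inv := fun f => hext' fun z => by
            rw [hS, hT, inv_inv, aut_apply_inv_self]
           right_inv := fun f => hext fun z => by
            rw [hT, hS, inv_inv, aut_inv_apply_self]
           map_mul' := fun f g => hext fun z => by
            simp only [hT, Induced.mul_apply, map_mul]
           map_add' := fun f g => hext fun z => by
            simp only [hT, Induced.add_apply, map_add]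
           map_star' := fun f => hext fun z => by
            simp only [hT, Induced.star_apply, map_star]
           map_smul' := fun r f => hext fun z => by
            simp only [hT, Induced.smul_apply, map_smul] }, hT⟩

end IndCorrespondence

end Correspondence

/-- The data intertwining two systems `(_K P_L, A, σ, η)` and `(_L Q_G, A, ζ, τ)` along an
equivariant homeomorphism of `K \ P` onto `Q / G`. -/
structure Linking {K L G P Q A : Type u} [Group K] [Group L] [Group G]
    [TopologicalSpace P] [TopologicalSpace Q] [MulAction K P] [MulAction L P] [MulAction L Q]
    [MulAction G Q] [NonUnitalCStarAlgebra A] (D : CommutingSystem K L P A)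
    (E : CommutingSystem L G Q A) (φ : EquivariantHomeo K L G P Q) (σ' : P → Aut A)
    (τ' : Q → Aut A) : Prop where
  continuous_σ' : ∀ a, Continuous fun p => σ' p a
  continuous_τ' : ∀ a, Continuous fun q => τ' q a
  σ'_smul : ∀ (k : K) (p : P) (t : L), σ' (k • t⁻¹ • p) = D.σ k * σ' p * E.σ t
  τ'_smul : ∀ (t : L) (q : Q) (m : G), τ' (t • m⁻¹ • q) = D.η t * τ' q * E.η m
  ζη : ∀ t r : L, Commute (E.σ t) (D.η r)
  ζτ' : ∀ (t : L) (q : Q), Commute (E.σ t) (τ' q)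
  στ' : ∀ (k : K) (q : Q), Commute (D.σ k) (τ' q)
  στ : ∀ (k : K) (m : G), Commute (D.σ k) (E.η m)
  σ'η : ∀ (p : P) (t : L), Commute (σ' p) (D.η t)
  σ'τ' : ∀ (p : P) (q : Q), Commute (σ' p) (τ' q)
  σ'τ : ∀ (p : P) (m : G), Commute (σ' p) (E.η m)

/-! ### The correspondences giving `T`, `φ_σ` and `φ_τ` -/

namespace Linking

section Algebra

variable {K L G P Q A : Type u} [Group K] [Group L] [Group G]
    [TopologicalSpace P] [TopologicalSpace Q] [MulAction K P] [MulAction L P] [MulAction L Q]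
    [MulAction G Q] [NonUnitalCStarAlgebra A] {D : CommutingSystem K L P A}
    {E : CommutingSystem L G Q A} {φ : EquivariantHomeo K L G P Q} {σ' : P → Aut A}
    {τ' : Q → Aut A}

theorem σ'_smul_left (ℓ : Linking D E φ σ' τ') (k : K) (p : P) : σ' (k • p) = D.σ k * σ' p := by
  have := ℓ.σ'_smul k p 1
  rwa [inv_one, one_smul, map_one, mul_one] at this

theorem σ'_smul_right (ℓ : Linking D E φ σ' τ') (t : L) (p : P) :
    σ' (t • p) = σ' p * (E.σ t)⁻¹ := by
  have := ℓ.σ'_smul 1 p t⁻¹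
  rwa [inv_inv, one_smul, map_one, one_mul, map_inv] at this

theorem τ'_smul_left (ℓ : Linking D E φ σ' τ') (t : L) (q : Q) : τ' (t • q) = D.η t * τ' q := by
  have := ℓ.τ'_smul t q 1
  rwa [inv_one, one_smul, map_one, mul_one] at this

theorem τ'_smul_right (ℓ : Linking D E φ σ' τ') (m : G) (q : Q) :
    τ' (m • q) = τ' q * (E.η m)⁻¹ := by
  have := ℓ.τ'_smul 1 q m⁻¹
  rwa [inv_inv, one_smul, map_one, one_mul, map_inv] at this

/-- Moving `p` in its `K`-orbit multiplies `σ'_p τ'_q` on the left by `σ_k`, and moving `q` in its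
`G`-orbit multiplies it on the right by the inverse of `τ_m`. The bijection `φ` makes these moves
occur together, which yields `T`. -/
theorem correspondence [ContinuousConstSMul K P] [ContinuousConstSMul G Q]
    (ℓ : Linking D E φ σ' τ') :
    IndCorrespondence (fun z : φ.FibreProduct => z.1.1) (fun z : φ.FibreProduct => z.1.2)
      D.σ E.η fun z => σ' z.1.1 * τ' z.1.2 where
  left := φ.isOpenQuotientMap_left
  right := φ.isOpenQuotientMap_right
  continuous c := continuous_aut_apply (θ := fun z : φ.FibreProduct => σ' z.1.1)
    (fun a => (ℓ.continuous_σ' a).comp φ.continuous_left)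
    ((ℓ.continuous_τ' c).comp φ.continuous_right)
  of_right z z' m hz := by
    have h1 : orb K z.1.1 = orb K z'.1.1 := φ.toHomeo.injective (by
      rw [z.2, z'.2, hz, orb_smul])
    obtain ⟨k, hk⟩ := orb_eq_iff.1 h1
    refine ⟨k, hk.symm, ?_⟩
    simp only [hz, ← hk]
    rw [ℓ.σ'_smul_left, ℓ.τ'_smul_right, mul_assoc, mul_assoc,
      inv_mul_cancel_right]
  of_left z z' k hz := by
    have h1 : orb G z.1.2 = orb G z'.1.2 := by rw [← z.2, ← z'.2, hz, orb_smul]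
    obtain ⟨m, hm⟩ := orb_eq_iff.1 h1
    refine ⟨m, hm.symm, ?_⟩
    simp only [hz, ← hm]
    rw [ℓ.σ'_smul_left, ℓ.τ'_smul_right, mul_assoc, mul_assoc,
      inv_mul_cancel_right]

theorem proj_isOpenQuotientMap [ContinuousConstSMul L P] [ContinuousConstSMul L Q] :
    IsOpenQuotientMap φ.proj := by
  have : ContinuousConstSMul L φ.FibreProduct := ⟨fun t => by
    refine Continuous.subtype_mk ?_ _
    have h1 := φ.continuous_left
    have h2 := φ.continuous_right
    fun_prop⟩
  exact isOpenQuotientMap_orb L φ.FibreProduct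

theorem correspondence_σ [ContinuousConstSMul K P] [ContinuousConstSMul L P]
    [ContinuousConstSMul L Q] [SMulCommClass K L P] (ℓ : Linking D E φ σ' τ') :
    IndCorrespondence φ.proj (fun z : φ.FibreProduct => z.1.2) D.σ E.σ fun z => σ' z.1.1 where
  left := proj_isOpenQuotientMap
  right := φ.isOpenQuotientMap_right
  continuous c := (ℓ.continuous_σ' c).comp φ.continuous_left
  of_right z z' t hz := by
    have h1 : orb K z.1.1 = orb K (t • z'.1.1) := φ.toHomeo.injective (by
      rw [z.2, φ.equivariant t _ _ z'.2, hz])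
    obtain ⟨k, hk⟩ := orb_eq_iff.1 h1
    refine ⟨k, φ.proj_eq_iff.2 ⟨t, Subtype.ext (Prod.ext ?_ hz.symm)⟩, ?_⟩
    · exact (smul_comm k t z'.1.1).symm.trans hk
    · simp only [← hk]
      rw [ℓ.σ'_smul_left, ℓ.σ'_smul_right, mul_assoc, mul_assoc, inv_mul_cancel, mul_one]
  of_left z z' k hz := by
    rw [φ.smul_proj_left, φ.proj_eq_iff] at hz
    obtain ⟨t, rfl⟩ := hz
    refine ⟨t, rfl, ?_⟩
    change σ' (t • k • z'.1.1) * E.σ t = _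
    rw [ℓ.σ'_smul_right, ℓ.σ'_smul_left, inv_mul_cancel_right]

theorem correspondence_τ [ContinuousConstSMul G Q] [ContinuousConstSMul L P]
    [ContinuousConstSMul L Q] [SMulCommClass L G Q] (ℓ : Linking D E φ σ' τ') :
    IndCorrespondence φ.proj (fun z : φ.FibreProduct => z.1.1) E.η D.η
      fun z => (τ' z.1.2)⁻¹ where
  left := proj_isOpenQuotientMap
  right := φ.isOpenQuotientMap_left
  continuous c := (continuous_aut_inv ℓ.continuous_τ' c).comp φ.continuous_right
  of_right z z' t hz := by
    have h1 : orb G z.1.2 = orb G (t • z'.1.2) := by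
      rw [← z.2, ← φ.equivariant t _ _ z'.2, hz]
    obtain ⟨m, hm⟩ := orb_eq_iff.1 h1
    refine ⟨m, φ.proj_eq_iff.2 ⟨t, Subtype.ext (Prod.ext hz.symm ?_)⟩, ?_⟩
    · exact (smul_comm t m z'.1.2).trans hm
    · simp only [← hm]
      rw [ℓ.τ'_smul_right, ℓ.τ'_smul_left, mul_inv_rev, mul_inv_rev, inv_inv, mul_assoc,
        mul_assoc, inv_mul_cancel, mul_one]
  of_left z z' m hz := by
    rw [φ.smul_proj_right, φ.proj_eq_iff] at hz
    obtain ⟨t, rfl⟩ := hz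
    refine ⟨t, rfl, ?_⟩
    change (τ' (t • m • z'.1.2))⁻¹ * D.η t = _
    rw [ℓ.τ'_smul_left, ℓ.τ'_smul_right, mul_inv_rev, mul_inv_rev, inv_inv,
      inv_mul_cancel_right]

end Algebra

variable {K L G P Q A : Type u}
  [Group K] [TopologicalSpace K] [Group L] [TopologicalSpace L] [Group G] [TopologicalSpace G]
  [TopologicalSpace P] [T2Space P] [LocallyCompactSpace P]
  [TopologicalSpace Q] [T2Space Q] [LocallyCompactSpace Q]
  [MulAction K P] [MulAction L P] [MulAction L Q] [MulAction G Q]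
  [ProperSMul K P] [ProperSMul L P] [ProperSMul L Q] [ProperSMul G Q]
  [SMulCommClass K L P] [SMulCommClass L G Q]
  [NonUnitalCStarAlgebra A] {D : CommutingSystem K L P A}
  {E : CommutingSystem L G Q A} {φ : EquivariantHomeo K L G P Q} {σ' : P → Aut A}
  {τ' : Q → Aut A}

theorem exists_T (ℓ : Linking D E φ σ' τ') : ∃ T : D.sw.Ind ≃⋆ₐ[ℂ] E.Ind,
    (∀ f (z : φ.FibreProduct), T f z.1.2 = (τ' z.1.2)⁻¹ ((σ' z.1.1)⁻¹ (f z.1.1))) ∧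
    ∀ t f, T (D.sw.diag t f) = E.diag t (T f) := by
  obtain ⟨T, hT⟩ := ℓ.correspondence.exists_equiv
  have hT' : ∀ f (z : φ.FibreProduct), T f z.1.2 = (τ' z.1.2)⁻¹ ((σ' z.1.1)⁻¹ (f z.1.1)) :=
    fun f z => by rw [hT, mul_inv_rev, aut_mul_apply]
  refine ⟨T, hT', fun t f => Induced.ext fun q => ?_⟩
  obtain ⟨z, rfl⟩ := φ.isOpenQuotientMap_right.surjective q
  have h1 := hT' f (t⁻¹ • z)
  simp only [φ.smul_val] at h1
  -- Here `σ'_{t⁻¹p}⁻¹ = ζ_t⁻¹ σ'_p⁻¹` and `τ'_{t⁻¹q}⁻¹ = τ'_q⁻¹ η_t`. Since `ζ` commutes with `η`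
  -- and `τ'`, the factor `ζ_t⁻¹` meets the outer `ζ_t` and cancels; `η_t` then commutes past
  -- `σ'_p⁻¹`.
  rw [hT', CommutingSystem.sw_diag_apply, CommutingSystem.diag_apply, h1, ℓ.σ'_smul_right,
    ℓ.τ'_smul_left, mul_inv_rev, mul_inv_rev, inv_inv, map_inv, map_inv, inv_inv, aut_mul_apply,
    aut_mul_apply, aut_comm (ℓ.ζτ' t _).inv_right, aut_comm (ℓ.ζη t t), aut_apply_inv_self,
    aut_comm (ℓ.σ'η _ t).inv_left]

theorem exists_φσ (ℓ : Linking D E φ σ' τ') :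
    ∃ T : (D.hash E φ ℓ.στ).sw.Ind ≃⋆ₐ[ℂ] E.sw.Ind,
    (∀ f (z : φ.FibreProduct), T f z.1.2 = (σ' z.1.1)⁻¹ (f (φ.proj z))) ∧
    ∀ t f, T ((D.hash E φ ℓ.στ).sw.diag t f) = E.sw.diag t (T f) := by
  obtain ⟨T, hT⟩ := ℓ.correspondence_σ.exists_equiv
  refine ⟨T, hT, fun m f => Induced.ext fun q => ?_⟩
  obtain ⟨z, rfl⟩ := φ.isOpenQuotientMap_right.surjective q
  have h1 := hT f (φ.rightMap m⁻¹ z)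
  rw [CommutingSystem.sw_diag_apply]
  refine (hT _ z).trans ?_
  refine Eq.trans ?_ (congrArg (E.η m) h1).symm
  change (σ' z.1.1)⁻¹ (E.η m (f (φ.proj (φ.rightMap m⁻¹ z)))) = _
  rw [aut_comm (ℓ.σ'τ _ m).inv_left]
  rfl

theorem exists_φτ (ℓ : Linking D E φ σ' τ') :
    ∃ T : (D.hash E φ ℓ.στ).Ind ≃⋆ₐ[ℂ] D.Ind,
    (∀ f (z : φ.FibreProduct), T f z.1.1 = τ' z.1.2 (f (φ.proj z))) ∧
    ∀ k f, T ((D.hash E φ ℓ.στ).diag k f) = D.diag k (T f) := by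
  obtain ⟨T, hT⟩ := ℓ.correspondence_τ.exists_equiv
  simp only [inv_inv] at hT
  refine ⟨T, hT, fun k f => Induced.ext fun p => ?_⟩
  obtain ⟨z, rfl⟩ := φ.isOpenQuotientMap_left.surjective p
  have h1 := hT f (φ.leftMap k⁻¹ z)
  rw [CommutingSystem.diag_apply]
  refine (hT _ z).trans ?_
  refine Eq.trans ?_ (congrArg (D.σ k) h1).symm
  change τ' z.1.2 (D.σ k (f (φ.proj (φ.leftMap k⁻¹ z)))) = _
  rw [← aut_comm (ℓ.στ' k _)]
  rfl

end Linking

/-! ### The pairing of `C_c(P, A)` and `C_c(Q, A)` into `C_c(P #_φ Q, A)` -/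

namespace Linking

variable {K L G P Q A : Type u}
  [Group K] [TopologicalSpace K] [IsTopologicalGroup K] [LocallyCompactSpace K] [T2Space K]
  [MeasurableSpace K] [BorelSpace K]
  [Group L] [TopologicalSpace L] [IsTopologicalGroup L] [LocallyCompactSpace L] [T2Space L]
  [MeasurableSpace L] [BorelSpace L]
  [Group G] [TopologicalSpace G] [IsTopologicalGroup G] [LocallyCompactSpace G] [T2Space G]
  [MeasurableSpace G] [BorelSpace G]
  [TopologicalSpace P] [T2Space P] [LocallyCompactSpace P]
  [TopologicalSpace Q] [T2Space Q] [LocallyCompactSpace Q]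
  [MulAction K P] [MulAction L P] [MulAction L Q] [MulAction G Q]
  [ProperSMul K P] [ProperSMul L P] [ProperSMul L Q] [ProperSMul G Q]
  [NonUnitalCStarAlgebra A] {D : CommutingSystem K L P A}
  {E : CommutingSystem L G Q A} {φ : EquivariantHomeo K L G P Q} {σ' : P → Aut A}
  {τ' : Q → Aut A}

/-- Integration over the orbits of `L`, `C_c(P ×_φ Q, A) → C_c(P #_φ Q, A)`. -/
def push (φ : EquivariantHomeo K L G P Q) (f : C_c(φ.FibreProduct, A)) : C_c(φ.Hash, A) :=
  -- Averaging against the trivial action on `A` gives an `L`-invariant function, which descends to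
  -- the quotient.
  let g : Induced φ.FibreProduct (1 : L →* Aut A) := avg (fun _ => continuous_const) f
  mkCc (Quotient.lift g (by
      rintro _ z ⟨t, rfl⟩
      exact g.apply_smul t z))
    (g.continuous.quotient_lift _) (φ.proj '' tsupport f)
    ((isCompact_tsupport f).image φ.isOpenQuotientMap_proj.continuous) (fun w hw => by
      obtain ⟨z, rfl⟩ := φ.isOpenQuotientMap_proj.surjective w
      change ∫ t : L, (1 : L →* Aut A) t (f (t⁻¹ • z)) ∂Measure.haar = 0
      rw [← integral_zero L A (μ := Measure.haar)]
      congr 1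
      ext t
      rw [cc_eq_zero f fun hm => hw ⟨_, hm, φ.proj_eq_iff.2 ⟨t⁻¹, rfl⟩⟩, map_zero])

theorem push_proj (f : C_c(φ.FibreProduct, A)) (z : φ.FibreProduct) :
    push φ f (φ.proj z) = ∫ t : L, f (t⁻¹ • z) ∂Measure.haar := rfl

theorem integrable_push (f : C_c(φ.FibreProduct, A)) (z : φ.FibreProduct) :
    Integrable (fun t : L => f (t⁻¹ • z)) Measure.haar :=
  integrable_avg (β := (1 : L →* Aut A)) (fun _ => continuous_const) f z

theorem cc_hash_ext {x y : C_c(φ.Hash, A)} (h : ∀ z, x (φ.proj z) = y (φ.proj z)) : x = y :=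
  DFunLike.ext _ _ fun w => by
    obtain ⟨z, rfl⟩ := φ.isOpenQuotientMap_proj.surjective w
    exact h z

/-- The function `(p, q) ↦ τ'_q⁻¹(x(p)) σ'_p(y(q))` on `P ×_φ Q`. -/
def fibreFun (ℓ : Linking D E φ σ' τ') (x : C_c(P, A)) (y : C_c(Q, A)) :
    C_c(φ.FibreProduct, A) :=
  mkCc (fun z => (τ' z.1.2)⁻¹ (x z.1.1) * σ' z.1.1 (y z.1.2))
    ((continuous_aut_apply (θ := fun z : φ.FibreProduct => (τ' z.1.2)⁻¹)
        (fun a => (continuous_aut_inv ℓ.continuous_τ' a).comp φ.continuous_right)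
        (x.continuous.comp φ.continuous_left)).mul
      (continuous_aut_apply (θ := fun z : φ.FibreProduct => σ' z.1.1)
        (fun a => (ℓ.continuous_σ' a).comp φ.continuous_left)
        (y.continuous.comp φ.continuous_right)))
    ((fun z : φ.FibreProduct => z.1) ⁻¹' (tsupport x ×ˢ tsupport y))
    (φ.isClosedEmbedding_val.isCompact_preimage
      ((isCompact_tsupport x).prod (isCompact_tsupport y))) (fun z hz => by
      by_cases h : z.1.1 ∈ tsupport x
      · rw [cc_eq_zero y fun hm => hz ⟨h, hm⟩, map_zero, mul_zero]
      · rw [cc_eq_zero x h, map_zero, zero_mul])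

theorem fibreFun_apply (ℓ : Linking D E φ σ' τ') (x : C_c(P, A)) (y : C_c(Q, A))
    (z : φ.FibreProduct) :
    ℓ.fibreFun x y z = (τ' z.1.2)⁻¹ (x z.1.1) * σ' z.1.1 (y z.1.2) := rfl

/-- The pairing `(x, y) ↦ ([p, q] ↦ ∫_L τ'_{t⁻¹q}⁻¹(x(t⁻¹p)) σ'_{t⁻¹p}(y(t⁻¹q)) dt)`. -/
def pairing (ℓ : Linking D E φ σ' τ') : C_c(P, A) →ₗ[ℂ] C_c(Q, A) →ₗ[ℂ] C_c(φ.Hash, A) :=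
  LinearMap.mk₂ ℂ (fun x y => push φ (ℓ.fibreFun x y))
    (fun x x' y => cc_hash_ext fun z => by
      refine Eq.trans ?_ (integral_add (integrable_push (ℓ.fibreFun x y) z)
        (integrable_push (ℓ.fibreFun x' y) z))
      simp only [push_proj, fibreFun_apply, CompactlySupportedContinuousMap.add_apply, map_add,
        add_mul]
      rfl)
    (fun c x y => cc_hash_ext fun z => by
      refine Eq.trans ?_ (integral_smul c _)
      simp only [push_proj, fibreFun_apply, CompactlySupportedContinuousMap.smul_apply, map_smul,
        smul_mul_assoc]
      rfl)
    (fun x y y' => cc_hash_ext fun z => by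
      refine Eq.trans ?_ (integral_add (integrable_push (ℓ.fibreFun x y) z)
        (integrable_push (ℓ.fibreFun x y') z))
      simp only [push_proj, fibreFun_apply, CompactlySupportedContinuousMap.add_apply, map_add,
        mul_add]
      rfl)
    (fun c x y => cc_hash_ext fun z => by
      refine Eq.trans ?_ (integral_smul c _)
      simp only [push_proj, fibreFun_apply, CompactlySupportedContinuousMap.smul_apply, map_smul,
        mul_smul_comm]
      rfl)

theorem pairing_apply (ℓ : Linking D E φ σ' τ') (x : C_c(P, A)) (y : C_c(Q, A))
    (z : φ.FibreProduct) : ℓ.pairing x y (φ.proj z) =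
      ∫ t : L, (τ' (t⁻¹ • z.1.2))⁻¹ (x (t⁻¹ • z.1.1)) *
        σ' (t⁻¹ • z.1.1) (y (t⁻¹ • z.1.2)) ∂Measure.haar := rfl

theorem integrable_pairing (ℓ : Linking D E φ σ' τ') (x : C_c(P, A)) (y : C_c(Q, A))
    (z : φ.FibreProduct) : Integrable (fun t : L => (τ' (t⁻¹ • z.1.2))⁻¹ (x (t⁻¹ • z.1.1)) *
        σ' (t⁻¹ • z.1.1) (y (t⁻¹ • z.1.2))) Measure.haar :=
  integrable_push (ℓ.fibreFun x y) z

variable [SMulCommClass K L P] [SMulCommClass L G Q]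

/-- The group `G` moves only `q`, and `τ'_{m⁻¹q} = τ'_q τ_m` cancels the coefficient action on the
factor from `x`; all of the action therefore falls on `y`. -/
theorem transl_pairing (ℓ : Linking D E φ σ' τ') (m : G) (x : C_c(P, A)) (y : C_c(Q, A)) :
    transl E.η m (ℓ.pairing x y) = ℓ.pairing x (transl E.η m y) := cc_hash_ext fun z => by
  rw [transl_apply, φ.smul_proj_right, pairing_apply, pairing_apply, ← integral_aut]
  congr 1
  ext t
  change E.η m ((τ' (t⁻¹ • m⁻¹ • z.1.2))⁻¹ (x (t⁻¹ • z.1.1)) *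
        σ' (t⁻¹ • z.1.1) (y (t⁻¹ • m⁻¹ • z.1.2))) = _
  rw [transl_apply, smul_comm t⁻¹ m⁻¹, ℓ.τ'_smul_right m⁻¹, map_mul, mul_inv_rev, inv_inv, map_inv,
    aut_mul_apply, aut_apply_inv_self, aut_comm (ℓ.σ'τ _ m)]

/-- Fubini over `L × K`, once the coefficient `c` has been taken out of the orbit integral. -/
theorem pairing_lact (ℓ : Linking D E φ σ' τ') (hD : D.IsCont) (hR : (D.hash E φ ℓ.στ).IsCont)
    (c : C_c(K, D.Ind)) (c' : C_c(K, (D.hash E φ ℓ.στ).Ind))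
    (hc : ∀ k (z : φ.FibreProduct), c k z.1.1 = τ' z.1.2 (c' k (φ.proj z)))
    (x : C_c(P, A)) (y : C_c(Q, A)) :
    ℓ.pairing (CommutingSystem.lact hD c x) y =
      CommutingSystem.lact hR c' (ℓ.pairing x y) := cc_hash_ext fun z => by
  have hT := isCompact_returnSet (H := L) (isCompact_singleton (x := z.1.2)) (isCompact_tsupport y)
  let f : L → K → A := fun t k => modular k ^ (1 / 2 : ℝ) • ((τ' z.1.2)⁻¹ (c k z.1.1) *
    ((τ' (t⁻¹ • z.1.2))⁻¹ (D.σ k (x (k⁻¹ • t⁻¹ • z.1.1))) * σ' (t⁻¹ • z.1.1) (y (t⁻¹ • z.1.2))))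
  have hf : Continuous fun w : L × K => f w.1 w.2 := by
    have h1 : Continuous fun k => c k z.1.1 :=
      (Induced.continuous_apply₂ c.continuous).comp (Continuous.prodMk_left z.1.1)
    refine ((continuous_modular_rpow _).comp continuous_snd).smul
      (Continuous.mul ?_ (Continuous.mul ?_ ?_))
    · exact (continuous_aut _).comp (h1.comp continuous_snd)
    · refine continuous_aut_apply (θ := fun w : L × K => (τ' (w.1⁻¹ • z.1.2))⁻¹)
        (fun a => (continuous_aut_inv ℓ.continuous_τ' a).comp (by fun_prop)) ?_
      exact continuous_aut_apply (θ := fun w : L × K => D.σ w.2)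
        (fun a => (hD.σ a).comp continuous_snd) (by fun_prop)
    · exact continuous_aut_apply (θ := fun w : L × K => σ' (w.1⁻¹ • z.1.1))
        (fun a => (ℓ.continuous_σ' a).comp (by fun_prop)) (by fun_prop)
  have hl : ℓ.pairing (CommutingSystem.lact hD c x) y (φ.proj z) =
      ∫ t, ∫ k, f t k ∂Measure.haar ∂Measure.haar := by
    rw [pairing_apply]
    congr 1
    ext t
    rw [CommutingSystem.lact_apply, ← integral_aut, ← integral_mul_const_of_integrable]
    · congr 1
      ext k
      simp only [f]
      -- Equivariance of `c k` under `η` cancels that of `τ'`, so this factor is constant along the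
      -- `L`-orbit; it is the value of `c'` at `[p, q]`.
      have h1 : (τ' (t⁻¹ • z.1.2))⁻¹ (c k (t⁻¹ • z.1.1)) = (τ' z.1.2)⁻¹ (c k z.1.1) := by
        rw [ℓ.τ'_smul_left, (c k).apply_smul, mul_inv_rev, aut_mul_apply, aut_inv_apply_self]
      rw [aut_real_smul, map_mul, h1, smul_mul_assoc, mul_assoc]
    · exact (autCLE (τ' (t⁻¹ • z.1.2))⁻¹).toContinuousLinearMap.integrable_comp
        (CommutingSystem.integrable_lact hD c x _)
  have hr : CommutingSystem.lact hR c' (ℓ.pairing x y) (φ.proj z) =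
      ∫ k, ∫ t, f t k ∂Measure.haar ∂Measure.haar := by
    rw [CommutingSystem.lact_apply]
    congr 1
    ext k
    have h0 : c' k (φ.proj z) = (τ' z.1.2)⁻¹ (c k z.1.1) := by rw [hc, aut_inv_apply_self]
    rw [φ.smul_proj_left, pairing_apply, h0]
    change _ • (_ * D.σ k _) = _
    rw [← integral_aut, ← integral_const_mul_of_integrable, ← integral_smul]
    · congr 1
      ext t
      simp only [f]
      change _ • (_ * D.σ k ((τ' (t⁻¹ • z.1.2))⁻¹ (x (t⁻¹ • k⁻¹ • z.1.1)) *
        σ' (t⁻¹ • k⁻¹ • z.1.1) (y (t⁻¹ • z.1.2)))) = _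
      rw [← smul_comm k⁻¹ t⁻¹, ℓ.σ'_smul_left k⁻¹, map_mul, map_inv, aut_mul_apply,
        aut_apply_inv_self, aut_comm (ℓ.στ' k _).inv_right]
    · exact (autCLE (D.σ k)).toContinuousLinearMap.integrable_comp
        (ℓ.integrable_pairing x y (φ.leftMap k⁻¹ z))
  rw [hl, hr]
  refine integral_swap_of_compact hf hT (isCompact_tsupport c) fun t k h => ⟨⟨_, rfl, cc_mem y ?_⟩, ?_⟩
  · contrapose! h
    simp only [f, h, map_zero, mul_zero, smul_zero]
  · by_contra hk
    exact h (by simp only [f, cc_eq_zero c hk, Induced.zero_apply, map_zero, zero_mul, smul_zero])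

/-- The central computation. Both sides unfold to the integral of `J t k * S t k s` over `k ∈ K` and
`t, s ∈ L`, where `J` collects the contributions of `x`, `y` and `S` those of `x'`, `y'`. The
commutation hypotheses let the twists `σ'`, `τ'` pass the actions and cancel. -/
theorem yinn_pairing (ℓ : Linking D E φ σ' τ') (hD : D.IsCont) (hE : E.IsCont)
    (hR : (D.hash E φ ℓ.στ).IsCont) (x x' : C_c(P, A)) (y y' : C_c(Q, A)) (c : C_c(L, E.Ind))
    (hc : ∀ t (z : φ.FibreProduct), c t z.1.2 =
      (τ' z.1.2)⁻¹ ((σ' z.1.1)⁻¹ (CommutingSystem.rinn hD x x' t z.1.1)))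
    (z : φ.FibreProduct) :
    (σ' z.1.1)⁻¹ (CommutingSystem.yinn hR (ℓ.pairing x y) (ℓ.pairing x' y') (φ.proj z)) =
      CommutingSystem.yinn hE y (CommutingSystem.lact hE c y') z.1.2 := by
  let p := z.1.1
  let q := z.1.2
  let J : L → K → A := fun t k => E.σ t (star (y (t⁻¹ • q))) *
    (τ' (t⁻¹ • q))⁻¹ ((σ' p)⁻¹ (D.σ k (star (x (k⁻¹ • t⁻¹ • p)))))
  let S : L → K → L → A := fun t k s =>
    (τ' (t⁻¹ • q))⁻¹ ((σ' p)⁻¹ (D.σ k (D.η s (x' (k⁻¹ • s⁻¹ • t⁻¹ • p))))) *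
      E.σ t (E.σ s (y' (s⁻¹ • t⁻¹ • q)))
  let N : K → A := fun k => (σ' p)⁻¹ (D.σ k (ℓ.pairing x' y' (k⁻¹ • φ.proj z)))
  have hJc : Continuous fun w : K × L => J w.2 w.1 := by
    refine Continuous.mul ?_ ?_
    · exact continuous_aut_apply (θ := fun w : K × L => E.σ w.2)
        (fun a => (hE.σ a).comp continuous_snd) (by fun_prop)
    · refine continuous_aut_apply (θ := fun w : K × L => (τ' (w.2⁻¹ • q))⁻¹)
        (fun a => (continuous_aut_inv ℓ.continuous_τ' a).comp (by fun_prop))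
        ((continuous_aut _).comp ?_)
      exact continuous_aut_apply (θ := fun w : K × L => D.σ w.1)
        (fun a => (hD.σ a).comp continuous_fst) (by fun_prop)
  have hSc : ∀ t, Continuous fun w : K × L => S t w.1 w.2 := fun t => by
    refine Continuous.mul ((continuous_aut _).comp ((continuous_aut _).comp ?_))
      ((continuous_aut _).comp ?_)
    · refine continuous_aut_apply (θ := fun w : K × L => D.σ w.1)
        (fun a => (hD.σ a).comp continuous_fst) ?_
      exact continuous_aut_apply (θ := fun w : K × L => D.η w.2)
        (fun a => (hD.η a).comp continuous_snd) (by fun_prop)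
    · exact continuous_aut_apply (θ := fun w : K × L => E.σ w.2)
        (fun a => (hE.σ a).comp continuous_snd) (by fun_prop)
  have hNc : Continuous N := (continuous_aut _).comp (continuous_aut_apply (θ := fun k => D.σ k)
    hD.σ (by fun_prop))
  have hJx : ∀ t k, J t k ≠ 0 → k⁻¹ • t⁻¹ • p ∈ tsupport x := fun t k h => cc_mem x fun h0 => h (by
    simp only [J, h0, star_zero, map_zero, mul_zero])
  have hJy : ∀ t k, J t k ≠ 0 → t⁻¹ • q ∈ tsupport y := fun t k h => cc_mem y fun h0 => h (by
    simp only [J, h0, star_zero, map_zero, zero_mul])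
  have hSy : ∀ t k s, S t k s ≠ 0 → s⁻¹ • t⁻¹ • q ∈ tsupport y' := fun t k s h =>
    cc_mem y' fun h0 => h (by simp only [S, h0, map_zero, mul_zero])
  have hT := isCompact_returnSet (H := L) (isCompact_singleton (x := q)) (isCompact_tsupport y)
  have hJ : ∀ t k, (σ' p)⁻¹ (D.σ k (star ((τ' (t⁻¹ • q))⁻¹ (x (t⁻¹ • k⁻¹ • p)) *
      σ' (t⁻¹ • k⁻¹ • p) (y (t⁻¹ • q))))) = J t k := fun t k => by
    simp only [J]
    rw [star_mul, ← map_star (σ' _), ← map_star (τ' _)⁻¹, map_mul, map_mul, ← smul_comm k⁻¹ t⁻¹,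
      ℓ.σ'_smul_left k⁻¹, ℓ.σ'_smul_right t⁻¹, map_inv, map_inv, inv_inv, aut_mul_apply,
      aut_mul_apply, aut_apply_inv_self, aut_inv_apply_self,
      aut_comm (ℓ.στ' k _).inv_right, aut_comm (ℓ.σ'τ' _ _).inv_inv]
  have hS : ∀ t k s, (σ' p)⁻¹ (D.σ k ((τ' (s⁻¹ • t⁻¹ • q))⁻¹ (x' (s⁻¹ • t⁻¹ • k⁻¹ • p)) *
      σ' (s⁻¹ • t⁻¹ • k⁻¹ • p) (y' (s⁻¹ • t⁻¹ • q)))) = S t k s := fun t k s => by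
    simp only [S]
    rw [map_mul, map_mul, ← smul_comm k⁻¹ t⁻¹, ← smul_comm k⁻¹ s⁻¹,
      ℓ.σ'_smul_left k⁻¹, ℓ.σ'_smul_right s⁻¹, ℓ.σ'_smul_right t⁻¹, ℓ.τ'_smul_left s⁻¹, map_inv,
      map_inv, map_inv, map_inv, inv_inv, inv_inv, mul_inv_rev, inv_inv, aut_mul_apply,
      aut_mul_apply, aut_mul_apply, aut_mul_apply, aut_apply_inv_self, aut_inv_apply_self,
      aut_comm (ℓ.στ' k _).inv_right, aut_comm (ℓ.σ'τ' _ _).inv_inv]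
  -- The orbit integral in the pairing may start at any point of the orbit. Starting the one for
  -- `x'`, `y'` at `t⁻¹ z` gives the nested variables of the right-hand side.
  have hN : ∀ t k, N k = ∫ s, S t k s ∂Measure.haar := fun t k => by
    simp only [N]
    rw [φ.smul_proj_left, pairing_apply, ← integral_aut, ← integral_aut,
      ← integral_mul_left_eq_self _ t]
    congr 1
    ext s
    rw [← hS, mul_inv_rev, mul_smul, mul_smul]
    rfl
  have hSi : ∀ t k, Integrable (S t k) Measure.haar := fun t k =>
    integrable_of_compact ((hSc t).comp (Continuous.prodMk_right k))
      (isCompact_returnSet (H := L) (isCompact_singleton (x := t⁻¹ • q)) (isCompact_tsupport y'))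
      fun s hs => by
        by_contra h
        exact hs ⟨_, rfl, hSy t k s h⟩
  have hJi : ∀ k, Integrable (fun t => J t k) Measure.haar := fun k =>
    integrable_of_compact (hJc.comp (Continuous.prodMk_right k)) hT fun t ht => by
      by_contra h
      exact ht ⟨_, rfl, hJy t k h⟩
  have hl : (σ' p)⁻¹ (CommutingSystem.yinn hR (ℓ.pairing x y) (ℓ.pairing x' y') (φ.proj z)) =
      ∫ k, ∫ t, J t k * N k ∂Measure.haar ∂Measure.haar := by
    rw [CommutingSystem.yinn_apply, ← integral_aut]
    congr 1
    ext k
    rw [integral_mul_const_of_integrable (hJi k)]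
    change (σ' p)⁻¹ (D.σ k (star (ℓ.pairing x y (k⁻¹ • φ.proj z)) *
      ℓ.pairing x' y' (k⁻¹ • φ.proj z))) = _
    rw [map_mul, map_mul]
    congr 1
    rw [φ.smul_proj_left, pairing_apply, ← integral_star', ← integral_aut, ← integral_aut]
    congr 1
    ext t
    exact hJ t k
  have hr : CommutingSystem.yinn hE y (CommutingSystem.lact hE c y') q =
      ∫ t, ∫ s, ∫ k, J t k * S t k s ∂Measure.haar ∂Measure.haar ∂Measure.haar := by
    rw [CommutingSystem.yinn_apply]
    congr 1
    ext t
    rw [CommutingSystem.lact_apply, map_mul, ← integral_aut, ← integral_const_mul_of_integrable]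
    · congr 1
      ext s
      have h1 := hc s (t⁻¹ • z)
      simp only [φ.smul_val] at h1
      have hi : Integrable (fun k => D.σ k (star (x (k⁻¹ • t⁻¹ • p)) *
          D.η s (x' (k⁻¹ • s⁻¹ • t⁻¹ • p)))) Measure.haar := by
        refine (integrable_avg hD.σ (star x * transl D.η s x') (t⁻¹ • p)).congr
          (Filter.Eventually.of_forall fun k => ?_)
        change D.σ k (star (x (k⁻¹ • t⁻¹ • p)) * D.η s (x' (s⁻¹ • k⁻¹ • t⁻¹ • p))) = _
        rw [← smul_comm k⁻¹ s⁻¹]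
      have h2 : ∀ k, J t k * S t k s = E.σ t (star (y (t⁻¹ • q))) * ((τ' (t⁻¹ • q))⁻¹ ((σ' p)⁻¹
          (D.σ k (star (x (k⁻¹ • t⁻¹ • p)) * D.η s (x' (k⁻¹ • s⁻¹ • t⁻¹ • p))))) *
          E.σ t (E.σ s (y' (s⁻¹ • t⁻¹ • q)))) := fun k => by
        simp only [J, S, map_mul, mul_assoc]
      have hi' : Integrable (fun k => (τ' (t⁻¹ • q))⁻¹ ((σ' p)⁻¹
          (D.σ k (star (x (k⁻¹ • t⁻¹ • p)) * D.η s (x' (k⁻¹ • s⁻¹ • t⁻¹ • p))))))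
          Measure.haar := (autCLE (τ' (t⁻¹ • q))⁻¹).toContinuousLinearMap.integrable_comp
        ((autCLE (σ' p)⁻¹).toContinuousLinearMap.integrable_comp hi)
      simp only [h2]
      have hi'' : Integrable (fun k => (τ' (t⁻¹ • q))⁻¹ ((σ' p)⁻¹
          (D.σ k (star (x (k⁻¹ • t⁻¹ • p)) * D.η s (x' (k⁻¹ • s⁻¹ • t⁻¹ • p))))) *
          E.σ t (E.σ s (y' (s⁻¹ • t⁻¹ • q)))) Measure.haar :=
        ((ContinuousLinearMap.mul ℂ A).flip _).integrable_comp hi'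
      -- The factor `Δ_L(s)^{-1/2}` of the inner product on `P` cancels the `Δ_L(s)^{1/2}` of the
      -- left action on `C_c(Q, A)`.
      rw [integral_const_mul_of_integrable hi'', integral_mul_const_of_integrable hi', integral_aut, integral_aut, h1,
        CommutingSystem.rinn_apply_apply, ℓ.σ'_smul_right t⁻¹, map_inv, inv_inv, mul_inv_rev,
        aut_mul_apply, aut_real_smul, aut_real_smul, aut_real_smul, aut_real_smul,
        smul_mul_assoc, aut_real_smul, smul_smul,
        ← Real.rpow_add (modular_pos s), add_neg_cancel, Real.rpow_zero, one_smul, map_mul,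
        aut_comm (ℓ.ζτ' t _).inv_right, aut_apply_inv_self]
    · exact (autCLE (E.σ t)).toContinuousLinearMap.integrable_comp
        (CommutingSystem.integrable_lact hE c y' _)
  rw [hl, hr]
  rw [integral_swap_of_compact (f := fun k t => J t k * N k)
    (hJc.mul (hNc.comp continuous_fst)) (isCompact_returnSet (H := K)
      (hT.image (continuous_inv.smul continuous_const : Continuous fun t : L => t⁻¹ • p))
      (isCompact_tsupport x)) hT]
  · congr 1
    ext t
    have h1 : ∀ k, J t k * N k = ∫ s, J t k * S t k s ∂Measure.haar := fun k => by
      rw [hN t k, integral_const_mul_of_integrable (hSi t k)]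
    simp only [h1]
    refine integral_swap_of_compact (f := fun k s => J t k * S t k s)
      (Continuous.mul ?_ (hSc t)) (isCompact_returnSet (H := K)
        (isCompact_singleton (x := t⁻¹ • p)) (isCompact_tsupport x))
      (isCompact_returnSet (H := L) (isCompact_singleton (x := t⁻¹ • q)) (isCompact_tsupport y'))
      fun k s h => ⟨⟨_, rfl, hJx t k (left_ne_zero_of_mul h)⟩, _, rfl,
        hSy t k s (right_ne_zero_of_mul h)⟩
    exact hJc.comp (continuous_fst.prodMk continuous_const)
  · intro k t h
    have h0 := left_ne_zero_of_mul h
    have ht : t ∈ {h : L | ∃ x ∈ ({q} : Set Q), h⁻¹ • x ∈ tsupport y} := ⟨_, rfl, hJy t k h0⟩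
    exact ⟨⟨_, ⟨t, ht, rfl⟩, hJx t k h0⟩, ht⟩

end Linking

/-! ### Imprimitivity bimodules and balanced tensor products -/

theorem norm_starAlgEquiv {E E' : Type*} [NonUnitalCStarAlgebra E] [NonUnitalCStarAlgebra E']
    (θ : E ≃⋆ₐ[ℂ] E') (a : E) : ‖θ a‖ = ‖a‖ :=
  NonUnitalStarAlgHom.norm_map θ θ.injective a

theorem isometry_starAlgEquiv {E E' : Type*} [NonUnitalCStarAlgebra E]
    [NonUnitalCStarAlgebra E'] (θ : E ≃⋆ₐ[ℂ] E') : Isometry θ :=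
  AddMonoidHomClass.isometry_of_norm θ (norm_starAlgEquiv θ)

theorem dense_span_image {E E' : Type*} [NonUnitalCStarAlgebra E] [NonUnitalCStarAlgebra E']
    (θ : E ≃⋆ₐ[ℂ] E') {S : Set E} (hS : Dense (Submodule.span ℂ S : Set E)) :
    Dense (Submodule.span ℂ (θ '' S) : Set E') := by
  have h := (θ.surjective.denseRange.dense_image (isometry_starAlgEquiv θ).continuous hS)
  refine h.mono ?_
  rintro _ ⟨a, ha, rfl⟩
  refine Submodule.span_induction (p := fun a _ => θ a ∈ Submodule.span ℂ (θ '' S))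
    (fun a ha => Submodule.subset_span ⟨a, ha, rfl⟩) (by rw [map_zero]; exact Submodule.zero_mem _)
    (fun a b _ _ ha hb => by rw [map_add]; exact Submodule.add_mem _ ha hb)
    (fun c a _ ha => by rw [map_smul]; exact Submodule.smul_mem _ c ha) ha

/-- A continuous linear map that sends a set with dense span into a closed submodule has range in
that submodule. -/
theorem map_mem_of_dense_span {V W : Type*} [NormedAddCommGroup V] [NormedSpace ℂ V]
    [NormedAddCommGroup W] [NormedSpace ℂ W] (f : V →ₗ[ℂ] W) (hf : Continuous f) {S : Set V}
    (hS : Dense (Submodule.span ℂ S : Set V)) {N : Submodule ℂ W} (hN : IsClosed (N : Set W))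
    (h : ∀ v ∈ S, f v ∈ N) (v : V) : f v ∈ N := by
  have h1 : Submodule.span ℂ S ≤ N.comap f := Submodule.span_le.2 h
  exact (hS.closure_eq ▸ closure_minimal h1 (hN.preimage hf) : (Set.univ : Set V) ⊆ _)
    (Set.mem_univ v)

namespace ImprimitivityBimodule

section Bounds

variable {E B : Type (u + 1)} [NonUnitalCStarAlgebra E] [NonUnitalCStarAlgebra B]
  (X : ImprimitivityBimodule.{u} E B)

theorem linner_lsmul_right (a : E) (x y : X.carrier) :
    X.linner x (X.lsmul a y) = X.linner x y * star a := by
  rw [← X.star_linner, X.linner_lsmul, star_mul, X.star_linner]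

theorem rinner_rsmul_left (x y : X.carrier) (b : B) :
    X.rinner (X.rsmul x b) y = star b * X.rinner x y := by
  rw [← X.star_rinner, X.rinner_rsmul, star_mul, X.star_rinner]

theorem norm_lsmul_le (a : E) (x : X.carrier) : ‖X.lsmul a x‖ ≤ ‖a‖ * ‖x‖ := by
  refine le_of_sq_le_sq ?_ (by positivity)
  rw [X.norm_sq_eq_linner, X.linner_lsmul, linner_lsmul_right, mul_pow, X.norm_sq_eq_linner]
  refine (norm_mul_le _ _).trans ((mul_le_mul_of_nonneg_left (norm_mul_le _ _)
    (norm_nonneg _)).trans_eq ?_)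
  rw [norm_star]; ring

theorem norm_rsmul_le (x : X.carrier) (b : B) : ‖X.rsmul x b‖ ≤ ‖x‖ * ‖b‖ := by
  refine le_of_sq_le_sq ?_ (by positivity)
  rw [X.norm_sq_eq_rinner, X.rinner_rsmul, rinner_rsmul_left, mul_pow, X.norm_sq_eq_rinner]
  refine (norm_mul_le _ _).trans ((mul_le_mul_of_nonneg_right (norm_mul_le _ _)
    (norm_nonneg _)).trans_eq ?_)
  rw [norm_star]; ring

/-- Polarization with `c = 1` and `c = i`. The constant is `4 + 1 + 1`; a crude bound is enough, as
it only provides continuity. -/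
theorem norm_rinner_le_aux (x y : X.carrier) (hx : ‖x‖ ≤ 1) (hy : ‖y‖ ≤ 1) :
    ‖X.rinner x y‖ ≤ 6 := by
  have h : ∀ c : ℂ, ‖c‖ = 1 → ‖c • X.rinner x y + star c • X.rinner y x‖ ≤ 6 := fun c hc => by
    have h1 : c • X.rinner x y + star c • X.rinner y x =
        X.rinner (x + c • y) (x + c • y) - X.rinner x x - X.rinner y y := by
      have hcc : starRingEnd ℂ c * c = 1 := by
        rw [mul_comm, Complex.mul_conj, Complex.normSq_eq_norm_sq, hc]; norm_num
      rw [show X.rinner (x + c • y) = X.rinner x + starRingEnd ℂ c • X.rinner y by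
        rw [map_add, map_smulₛₗ], LinearMap.add_apply, LinearMap.smul_apply, map_add, map_add,
        map_smul, map_smul, smul_add, smul_smul, hcc, one_smul, starRingEnd_apply]
      abel
    have h2 : ‖x + c • y‖ ≤ 2 := (norm_add_le _ _).trans (by rw [norm_smul, hc]; linarith)
    have h3 : ‖X.rinner (x + c • y) (x + c • y)‖ ≤ 4 := by
      rw [← X.norm_sq_eq_rinner]; nlinarith [norm_nonneg (x + c • y)]
    have h4 : ‖X.rinner x x‖ ≤ 1 := by
      rw [← X.norm_sq_eq_rinner]; nlinarith [norm_nonneg x]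
    have h5 : ‖X.rinner y y‖ ≤ 1 := by
      rw [← X.norm_sq_eq_rinner]; nlinarith [norm_nonneg y]
    rw [h1]
    have h6 := norm_sub_le (X.rinner (x + c • y) (x + c • y) - X.rinner x x) (X.rinner y y)
    have h7 := norm_sub_le (X.rinner (x + c • y) (x + c • y)) (X.rinner x x)
    linarith
  have h1 := h 1 (by simp)
  have h2 := h Complex.I (by simp)
  have h3 : (2 : ℂ) • X.rinner x y = ((1 : ℂ) • X.rinner x y + star (1 : ℂ) • X.rinner y x) -
      Complex.I • (Complex.I • X.rinner x y + star Complex.I • X.rinner y x) := by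
    rw [smul_add, smul_smul, smul_smul, Complex.I_mul_I, star_one, Complex.star_def,
      Complex.conj_I, mul_neg, Complex.I_mul_I, two_smul, one_smul, one_smul, neg_neg, one_smul,
      neg_one_smul]
    abel
  have h4 := norm_sub_le ((1 : ℂ) • X.rinner x y + star (1 : ℂ) • X.rinner y x)
    (Complex.I • (Complex.I • X.rinner x y + star Complex.I • X.rinner y x))
  rw [← h3, norm_smul, norm_smul, Complex.norm_I, one_mul] at h4
  norm_num at h4 h1 h2 ⊢
  linarith

theorem norm_rinner_le (x y : X.carrier) : ‖X.rinner x y‖ ≤ 6 * ‖x‖ * ‖y‖ := by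
  rcases eq_or_ne x 0 with rfl | hx
  · simp
  rcases eq_or_ne y 0 with rfl | hy
  · simp
  have hx' : 0 < ‖x‖ := norm_pos_iff.2 hx
  have hy' : 0 < ‖y‖ := norm_pos_iff.2 hy
  have hn : ∀ v : X.carrier, v ≠ 0 → ‖((‖v‖⁻¹ : ℝ) : ℂ) • v‖ ≤ 1 := fun v hv => by
    rw [norm_smul, Complex.norm_real, norm_inv, norm_norm,
      inv_mul_cancel₀ (norm_ne_zero_iff.2 hv)]
  have h := X.norm_rinner_le_aux _ _ (hn x hx) (hn y hy)
  rw [map_smul, LinearMap.map_smulₛₗ₂, norm_smul, norm_smul, RCLike.norm_conj, Complex.norm_real,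
    Complex.norm_real, norm_inv, norm_inv, norm_norm, norm_norm] at h
  calc ‖X.rinner x y‖ = ‖x‖ * ‖y‖ * (‖y‖⁻¹ * (‖x‖⁻¹ * ‖X.rinner x y‖)) := by field_simp
    _ ≤ ‖x‖ * ‖y‖ * 6 := by gcongr
    _ = _ := by ring

/-- The left action as a continuous bilinear map. -/
def lsmulL : E →L[ℂ] X.carrier →L[ℂ] X.carrier :=
  LinearMap.mkContinuous₂ X.lsmul 1 fun a x => by rw [one_mul]; exact X.norm_lsmul_le a x

/-- The right action as a continuous bilinear map. -/
def rsmulL : X.carrier →L[ℂ] B →L[ℂ] X.carrier :=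
  LinearMap.mkContinuous₂ X.rsmul 1 fun x b => by rw [one_mul]; exact X.norm_rsmul_le x b

/-- The right inner product as a continuous sesquilinear map. -/
def rinnerL : X.carrier →L⋆[ℂ] X.carrier →L[ℂ] B :=
  LinearMap.mkContinuous₂ X.rinner 6 X.norm_rinner_le

theorem lsmulL_apply (a : E) (x : X.carrier) : X.lsmulL a x = X.lsmul a x := rfl

theorem rinnerL_apply (x y : X.carrier) : X.rinnerL x y = X.rinner x y := rfl

/-- With `a = ⟨x, x⟩` and `‖e‖ ≤ 1`, `‖x e^* - x‖² = ‖(e a - a) e^* - (e a - a)‖ ≤ 2 ‖e a - a‖`, so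
`e` is chosen with `‖e a - a‖ < ε² / 2`. -/
theorem exists_rsmul_near (x : X.carrier) {ε : ℝ} (hε : 0 < ε) :
    ∃ b, ‖X.rsmul x b - x‖ < ε := by
  obtain ⟨e, he, he'⟩ := exists_mul_near_of_norm_le_one (X.rinner x x)
    (show 0 < ε ^ 2 / 2 by positivity)
  refine ⟨star e, lt_of_pow_lt_pow_left₀ 2 hε.le ?_⟩
  have h : X.rinner (X.rsmul x (star e) - x) (X.rsmul x (star e) - x) =
      (e * X.rinner x x - X.rinner x x) * star e - (e * X.rinner x x - X.rinner x x) := by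
    rw [show X.rinner (X.rsmul x (star e) - x) = X.rinner (X.rsmul x (star e)) - X.rinner x from
      map_sub _ _ _, LinearMap.sub_apply, map_sub, map_sub, rinner_rsmul_left, X.rinner_rsmul,
      rinner_rsmul_left, star_star, sub_mul, mul_assoc]
    abel
  rw [X.norm_sq_eq_rinner, h]
  have h1 := norm_sub_le ((e * X.rinner x x - X.rinner x x) * star e)
    (e * X.rinner x x - X.rinner x x)
  have h2 := norm_mul_le (e * X.rinner x x - X.rinner x x) (star e)
  rw [norm_star] at h2
  nlinarith [norm_nonneg (e * X.rinner x x - X.rinner x x)]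

theorem exists_lsmul_near (x : X.carrier) {ε : ℝ} (hε : 0 < ε) :
    ∃ a, ‖X.lsmul a x - x‖ < ε := by
  obtain ⟨e, he, he'⟩ := exists_mul_near_of_norm_le_one (X.linner x x)
    (show 0 < ε ^ 2 / 2 by positivity)
  refine ⟨e, lt_of_pow_lt_pow_left₀ 2 hε.le ?_⟩
  have h : X.linner (X.lsmul e x - x) (X.lsmul e x - x) =
      (e * X.linner x x - X.linner x x) * star e - (e * X.linner x x - X.linner x x) := by
    rw [show X.linner (X.lsmul e x - x) = X.linner (X.lsmul e x) - X.linner x from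
      map_sub _ _ _, LinearMap.sub_apply, map_sub, map_sub, linner_lsmul_right, X.linner_lsmul,
      linner_lsmul_right, sub_mul]
    abel
  rw [X.norm_sq_eq_linner, h]
  have h1 := norm_sub_le ((e * X.linner x x - X.linner x x) * star e)
    (e * X.linner x x - X.linner x x)
  have h2 := norm_mul_le (e * X.linner x x - X.linner x x) (star e)
  rw [norm_star] at h2
  nlinarith [norm_nonneg (e * X.linner x x - X.linner x x)]

theorem eq_zero_of_rinner_self {x : X.carrier} (h : X.rinner x x = 0) : x = 0 := by
  have h1 := X.norm_sq_eq_rinner x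
  rw [h, norm_zero, sq_eq_zero_iff, norm_eq_zero] at h1
  exact h1

/-- The difference annihilates all left inner products, which span a dense subspace by fullness,
hence annihilates its own adjoint. -/
theorem eq_of_lsmul_eq {a a' : E} (h : ∀ z, X.lsmul a z = X.lsmul a' z) : a = a' := by
  have h1 : ∀ e : E, (a - a') * e = 0 := fun e => by
    have := map_mem_of_dense_span (LinearMap.mulLeft ℂ (a - a')) (continuous_const.mul continuous_id)
      X.linner_full (N := ⊥) (by simp) (by
        rintro _ ⟨x, y, rfl⟩
        rw [Submodule.mem_bot, LinearMap.mulLeft_apply, ← X.linner_lsmul, map_sub,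
          LinearMap.sub_apply, h, sub_self, map_zero, LinearMap.zero_apply]) e
    simpa using this
  have h2 : ‖a - a'‖ * ‖a - a'‖ = 0 := by
    rw [← CStarRing.norm_self_mul_star, h1, norm_zero]
  rw [← sub_eq_zero, ← norm_eq_zero]
  exact mul_self_eq_zero.1 h2

theorem eq_zero_of_rinner_eq_zero {S : Set X.carrier}
    (hS : Dense (Submodule.span ℂ S : Set X.carrier)) {x : X.carrier}
    (h : ∀ s ∈ S, X.rinner x s = 0) : x = 0 := by
  have := map_mem_of_dense_span (X.rinner x) (X.rinnerL x).continuous hS (N := ⊥) (by simp)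
    (fun s hs => by rw [Submodule.mem_bot, h s hs]) x
  exact X.eq_zero_of_rinner_self (by simpa using this)

end Bounds

section Transport

variable {E E' B B' : Type (u + 1)} [NonUnitalCStarAlgebra E] [NonUnitalCStarAlgebra E']
  [NonUnitalCStarAlgebra B] [NonUnitalCStarAlgebra B']

/-- Transport of a bimodule along isomorphisms of the coefficient algebras. -/
def transport (θ : E ≃⋆ₐ[ℂ] E') (ψ : B ≃⋆ₐ[ℂ] B') (X : ImprimitivityBimodule.{u} E B) :
    ImprimitivityBimodule.{u} E' B' where
  carrier := X.carrier
  lsmul := LinearMap.mk₂ ℂ (fun a x => X.lsmul (θ.symm a) x)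
    (fun a a' x => by rw [map_add, map_add, LinearMap.add_apply])
    (fun c a x => by rw [map_smul, map_smul, LinearMap.smul_apply])
    (fun a x y => map_add _ _ _) (fun c a x => map_smul _ _ _)
  rsmul := LinearMap.mk₂ ℂ (fun x b => X.rsmul x (ψ.symm b))
    (fun x y b => by rw [map_add, LinearMap.add_apply])
    (fun c x b => by rw [map_smul, LinearMap.smul_apply])
    (fun x b b' => by rw [map_add, map_add]) (fun c x b => by rw [map_smul, map_smul])
  linner := LinearMap.mk₂'ₛₗ _ _ (fun x y => θ (X.linner x y))
    (fun x x' y => by rw [map_add, LinearMap.add_apply, map_add])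
    (fun c x y => by rw [map_smul, LinearMap.smul_apply, map_smul]; rfl)
    (fun x y y' => by rw [map_add, map_add])
    (fun c x y => by rw [map_smulₛₗ, map_smul])
  rinner := LinearMap.mk₂'ₛₗ _ _ (fun x y => ψ (X.rinner x y))
    (fun x x' y => by rw [map_add, LinearMap.add_apply, map_add])
    (fun c x y => by rw [map_smulₛₗ, LinearMap.smul_apply, map_smul])
    (fun x y y' => by rw [map_add, map_add])
    (fun c x y => by rw [map_smul, map_smul]; rfl)
  lsmul_mul a a' x := by simp [map_mul, X.lsmul_mul]
  rsmul_mul x b b' := by simp [map_mul, X.rsmul_mul]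
  lsmul_rsmul a x b := by simp [X.lsmul_rsmul]
  linner_lsmul a x y := by simp [X.linner_lsmul]
  rinner_rsmul x y b := by simp [X.rinner_rsmul]
  star_linner x y := by
    change star (θ (X.linner x y)) = θ (X.linner y x)
    rw [← map_star, X.star_linner]
  star_rinner x y := by
    change star (ψ (X.rinner x y)) = ψ (X.rinner y x)
    rw [← map_star, X.star_rinner]
  linner_nonneg x := by
    obtain ⟨a, ha⟩ := X.linner_nonneg x
    exact ⟨θ a, by change θ (X.linner x x) = _; rw [ha, map_mul, map_star]⟩
  rinner_nonneg x := by
    obtain ⟨a, ha⟩ := X.rinner_nonneg x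
    exact ⟨ψ a, by change ψ (X.rinner x x) = _; rw [ha, map_mul, map_star]⟩
  norm_sq_eq_linner x := (X.norm_sq_eq_linner x).trans (norm_starAlgEquiv θ _).symm
  norm_sq_eq_rinner x := (X.norm_sq_eq_rinner x).trans (norm_starAlgEquiv ψ _).symm
  linner_full := (dense_span_image θ X.linner_full).mono (Submodule.span_mono (by
    rintro _ ⟨_, ⟨x, y, rfl⟩, rfl⟩
    exact ⟨x, y, rfl⟩))
  rinner_full := (dense_span_image ψ X.rinner_full).mono (Submodule.span_mono (by
    rintro _ ⟨_, ⟨x, y, rfl⟩, rfl⟩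
    exact ⟨x, y, rfl⟩))
  rinner_lsmul a x y := by simp [X.rinner_lsmul, map_star]
  linner_rsmul x b y := by simp [X.linner_rsmul, map_star]
  linner_lsmul_eq x y z := by simp [X.linner_lsmul_eq]

end Transport

end ImprimitivityBimodule

namespace ImprimitivityBimodule

/-! ### Balanced tensor products: recognition, extension and uniqueness -/

section Tensor

variable {E B C B' : Type (u + 1)} [NonUnitalCStarAlgebra E] [NonUnitalCStarAlgebra B]
  [NonUnitalCStarAlgebra C] [NonUnitalCStarAlgebra B'] {Φ : B ≃⋆ₐ[ℂ] C}
  {X : ImprimitivityBimodule.{u} E B} {Y : ImprimitivityBimodule.{u} C B'}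
  {Z : ImprimitivityBimodule.{u} E B'} {m : X.carrier →ₗ[ℂ] Y.carrier →ₗ[ℂ] Z.carrier}

/-- The closed span `N` is a left submodule, so `z ⟨m, m'⟩ = ⟨z, m⟩ m'` lies in `N` for every `z`.
Fullness and approximate units enlarge the right inner products of values of `m` to all of `B'`, and
`Z B'` is dense in `Z`. No approximation of functions is needed. -/
theorem dense_span_of_rinner
    (ha : ∀ x y x' y', Z.rinner (m x y) (m x' y') = Y.rinner y (Y.lsmul (Φ (X.rinner x x')) y'))
    (hb : ∀ a x y, Z.lsmul a (m x y) = m (X.lsmul a x) y) :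
    Dense (Submodule.span ℂ {z | ∃ x y, z = m x y} : Set Z.carrier) := by
  let N := (Submodule.span ℂ {z | ∃ x y, z = m x y}).topologicalClosure
  have hN : IsClosed (N : Set Z.carrier) := Submodule.isClosed_topologicalClosure _
  have hmN : ∀ x y, m x y ∈ N := fun x y =>
    Submodule.le_topologicalClosure _ (Submodule.subset_span ⟨x, y, rfl⟩)
  have h1 : ∀ z x y x' y', Z.rsmul z (Z.rinner (m x y) (m x' y')) ∈ N := fun z x y x' y' => by
    rw [← Z.linner_lsmul_eq, hb]
    exact hmN _ _
  -- Fullness of `X`, carried over by `Φ`, replaces `Φ(⟨x, x'⟩)` by an arbitrary element of `C`.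
  have h2 : ∀ z y c y', Z.rsmul z (Y.rinner y (Y.lsmul c y')) ∈ N := fun z y c y' => by
    refine map_mem_of_dense_span
      ((Z.rsmul z).comp ((Y.rinner y).comp (Y.lsmul.flip y')))
      ((Z.rsmulL z).continuous.comp ((Y.rinnerL y).continuous.comp (Y.lsmulL.flip y').continuous))
      (dense_span_image Φ X.rinner_full) hN ?_ c
    rintro _ ⟨_, ⟨x, x', rfl⟩, rfl⟩
    simp only [LinearMap.comp_apply, LinearMap.flip_apply]
    rw [← ha]
    exact h1 _ _ _ _ _
  -- Elements `c` with `c y'` close to `y'` remove the coefficient.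
  have h3 : ∀ z y y', Z.rsmul z (Y.rinner y y') ∈ N := fun z y y' => by
    have hc : Continuous fun v => Z.rsmul z (Y.rinner y v) :=
      (Z.rsmulL z).continuous.comp (Y.rinnerL y).continuous
    have hy : y' ∈ closure (Set.range fun c => Y.lsmul c y') := Metric.mem_closure_iff.2
      fun ε hε => by
        obtain ⟨c, hc⟩ := Y.exists_lsmul_near y' hε
        exact ⟨_, ⟨c, rfl⟩, by rwa [dist_comm, dist_eq_norm]⟩
    have h4 : closure (Set.range fun c => Y.lsmul c y') ⊆
        (fun v => Z.rsmul z (Y.rinner y v)) ⁻¹' (N : Set Z.carrier) :=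
      closure_minimal (by rintro _ ⟨c, rfl⟩; exact h2 z y c y') (hN.preimage hc)
    exact h4 hy
  have h4 : ∀ z b, Z.rsmul z b ∈ N := fun z b =>
    map_mem_of_dense_span (Z.rsmul z) (Z.rsmulL z).continuous Y.rinner_full hN
      (by rintro _ ⟨y, y', rfl⟩; exact h3 z y y') b
  refine fun z => Metric.mem_closure_iff.2 fun ε hε => ?_
  obtain ⟨b, hb'⟩ := Z.exists_rsmul_near z (half_pos hε)
  obtain ⟨w, hw, hw'⟩ := Metric.mem_closure_iff.1 (h4 z b) (ε / 2) (half_pos hε)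
  refine ⟨w, hw, ?_⟩
  have h5 := dist_triangle z (Z.rsmul z b) w
  rw [dist_comm z (Z.rsmul z b), dist_eq_norm (Z.rsmul z b) z] at h5
  linarith

/-- Once the span is dense, balancing and the right action are tested by right inner products, and
the left inner product is determined by its action through `⟨u, v⟩ w = u ⟨v, w⟩`. -/
theorem isBalancedTensorProduct_of_rinner
    (ha : ∀ x y x' y', Z.rinner (m x y) (m x' y') = Y.rinner y (Y.lsmul (Φ (X.rinner x x')) y'))
    (hb : ∀ a x y, Z.lsmul a (m x y) = m (X.lsmul a x) y) :
    IsBalancedTensorProduct Φ X Y Z m := by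
  have hd := dense_span_of_rinner ha hb
  have hbal : ∀ x b y, m (X.rsmul x b) y = m x (Y.lsmul (Φ b) y) := fun x b y => by
    rw [← sub_eq_zero]
    refine Z.eq_zero_of_rinner_eq_zero hd ?_
    rintro _ ⟨x', y', rfl⟩
    rw [map_sub, LinearMap.sub_apply, ha, ha, rinner_rsmul_left, map_mul, Y.lsmul_mul, map_star,
      Y.rinner_lsmul, sub_self]
  have hr : ∀ x y b, Z.rsmul (m x y) b = m x (Y.rsmul y b) := fun x y b => by
    rw [← sub_eq_zero]
    refine Z.eq_zero_of_rinner_eq_zero hd ?_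
    rintro _ ⟨x', y', rfl⟩
    rw [map_sub, LinearMap.sub_apply, rinner_rsmul_left, ha, ha, rinner_rsmul_left, sub_self]
  refine ⟨hd, hbal, hb, hr, fun x y x' y' => Z.eq_of_lsmul_eq fun z => ?_, ha⟩
  rw [← sub_eq_zero, ← LinearMap.sub_apply, ← map_sub]
  have := map_mem_of_dense_span (Z.lsmul (Z.linner (m x y) (m x' y') -
    X.linner (X.rsmul x (Φ.symm (Y.linner y y'))) x')) (Z.lsmulL _).continuous hd (N := ⊥)
    (by simp) (by
      rintro _ ⟨x'', y'', rfl⟩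
      rw [Submodule.mem_bot, map_sub, LinearMap.sub_apply, Z.linner_lsmul_eq, ha, hb,
        X.linner_lsmul_eq, hbal, hr, ← Y.linner_lsmul_eq, hbal, StarAlgEquiv.apply_symm_apply,
        sub_self]) z
  simpa using this

theorem exists_isBalancedTensorProduct_of_dense {X₀ Y₀ E₀ : Type*} [AddCommGroup X₀]
    [Module ℂ X₀] [AddCommGroup Y₀] [Module ℂ Y₀] {ιX : X₀ →ₗ[ℂ] X.carrier} (hιX : DenseRange ιX)
    {ιY : Y₀ →ₗ[ℂ] Y.carrier} (hιY : DenseRange ιY) {j : E₀ → E} (hj : DenseRange j)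
    (m₀ : X₀ →ₗ[ℂ] Y₀ →ₗ[ℂ] Z.carrier)
    (ha : ∀ x y x' y', Z.rinner (m₀ x y) (m₀ x' y') =
      Y.rinner (ιY y) (Y.lsmul (Φ (X.rinner (ιX x) (ιX x'))) (ιY y')))
    (hb : ∀ c x, ∃ x', ιX x' = X.lsmul (j c) (ιX x) ∧ ∀ y, Z.lsmul (j c) (m₀ x y) = m₀ x' y) :
    ∃ m, IsBalancedTensorProduct Φ X Y Z m := by
  -- By `ha`, `‖m₀ x y‖² ≤ 6 ‖x‖² ‖y‖²`, which is weaker than needed for the sharp bound but at most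
  -- `(6 ‖x‖ ‖y‖)²`.
  obtain ⟨T, hT⟩ := exists_bilinear_extension ιX hιX ιY hιY m₀ 6 (by norm_num) fun x y => by
    refine le_of_sq_le_sq ?_ (by positivity)
    rw [Z.norm_sq_eq_rinner, ha]
    have h1 := Y.norm_rinner_le (ιY y) (Y.lsmul (Φ (X.rinner (ιX x) (ιX x))) (ιY y))
    have h2 := Y.norm_lsmul_le (Φ (X.rinner (ιX x) (ιX x))) (ιY y)
    rw [norm_starAlgEquiv, ← X.norm_sq_eq_rinner] at h2
    refine h1.trans ((mul_le_mul_of_nonneg_left h2 (by positivity)).trans ?_)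
    have h3 : 0 ≤ ‖ιX x‖ ^ 2 * ‖ιY y‖ ^ 2 := by positivity
    nlinarith
  refine ⟨forgetCont T, isBalancedTensorProduct_of_rinner (fun x y x' y' => ?_) fun a x y => ?_⟩
  · change Z.rinner (T x y) (T x' y') = _
    have hΦ := (isometry_starAlgEquiv Φ).continuous
    simp only [← rinnerL_apply, ← lsmulL_apply]
    refine hιX.induction_on x (isClosed_eq (by fun_prop) (by fun_prop)) fun x => ?_
    refine hιX.induction_on x' (isClosed_eq (by fun_prop) (by fun_prop)) fun x' => ?_
    refine hιY.induction_on y (isClosed_eq (by fun_prop) (by fun_prop)) fun y => ?_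
    refine hιY.induction_on y' (isClosed_eq (by fun_prop) (by fun_prop)) fun y' => ?_
    rw [hT, hT]
    exact ha x y x' y'
  · change Z.lsmul a (T x y) = T (X.lsmul a x) y
    simp only [← lsmulL_apply]
    refine hj.induction_on a (isClosed_eq (by fun_prop) (by fun_prop)) fun c => ?_
    refine hιX.induction_on x (isClosed_eq (by fun_prop) (by fun_prop)) fun x => ?_
    refine hιY.induction_on y (isClosed_eq (by fun_prop) (by fun_prop)) fun y => ?_
    obtain ⟨x', hx', h⟩ := hb c x
    rw [hT, lsmulL_apply, lsmulL_apply, ← hx', hT, h]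

theorem rinner_lift (h : IsBalancedTensorProduct Φ X Y Z m) {Z' : ImprimitivityBimodule.{u} E B'}
    {m' : X.carrier →ₗ[ℂ] Y.carrier →ₗ[ℂ] Z'.carrier} (h' : IsBalancedTensorProduct Φ X Y Z' m')
    (v w : TensorProduct ℂ X.carrier Y.carrier) :
    Z'.rinner (TensorProduct.lift m' v) (TensorProduct.lift m' w) =
      Z.rinner (TensorProduct.lift m v) (TensorProduct.lift m w) := by
  induction v with
  | zero => simp
  | add v v' hv hv' =>
    rw [map_add, map_add, map_add, map_add, LinearMap.add_apply, LinearMap.add_apply, hv, hv']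
  | tmul x y =>
    induction w with
    | zero => simp
    | add w w' hw hw' => rw [map_add, map_add, map_add, map_add, hw, hw']
    | tmul x' y' => simp only [TensorProduct.lift.tmul]; rw [h.rinner, h'.rinner]

theorem IsBalancedTensorProduct.denseRange_lift (h : IsBalancedTensorProduct Φ X Y Z m) :
    DenseRange (TensorProduct.lift m) := by
  refine h.dense.mono ?_
  have : Submodule.span ℂ {z | ∃ x y, z = m x y} ≤ LinearMap.range (TensorProduct.lift m) :=
    Submodule.span_le.2 (by
      rintro _ ⟨x, y, rfl⟩
      exact ⟨x ⊗ₜ[ℂ] y, TensorProduct.lift.tmul x y⟩)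
  exact this

/-- Both maps out of the algebraic tensor product induce the same right inner product, so one
factors isometrically through the completion given by the other. -/
theorem IsBalancedTensorProduct.exists_map (h : IsBalancedTensorProduct Φ X Y Z m)
    {Z' : ImprimitivityBimodule.{u} E B'} {m' : X.carrier →ₗ[ℂ] Y.carrier →ₗ[ℂ] Z'.carrier}
    (h' : IsBalancedTensorProduct Φ X Y Z' m') :
    ∃ U : Z.carrier →L[ℂ] Z'.carrier, ∀ v, U (TensorProduct.lift m v) = TensorProduct.lift m' v := by
  refine ⟨(TensorProduct.lift m').extendOfNorm (TensorProduct.lift m), fun v =>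
    LinearMap.extendOfNorm_eq h.denseRange_lift ⟨1, fun v => ?_⟩ v⟩
  rw [one_mul]
  refine le_of_sq_le_sq (le_of_eq ?_) (norm_nonneg _)
  rw [Z.norm_sq_eq_rinner, Z'.norm_sq_eq_rinner, rinner_lift h h']

theorem IsBalancedTensorProduct.nonempty_iso (h : IsBalancedTensorProduct Φ X Y Z m)
    {Z' : ImprimitivityBimodule.{u} E B'} {m' : X.carrier →ₗ[ℂ] Y.carrier →ₗ[ℂ] Z'.carrier}
    (h' : IsBalancedTensorProduct Φ X Y Z' m') :
    Nonempty (Iso (StarAlgEquiv.refl (R := ℂ) (A := E)) (StarAlgEquiv.refl (R := ℂ) (A := B'))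
      Z Z') := by
  obtain ⟨U, hU⟩ := h.exists_map h'
  obtain ⟨V, hV⟩ := h'.exists_map h
  have hd := h.denseRange_lift
  have hd' := h'.denseRange_lift
  have hUm : ∀ x y, U (m x y) = m' x y := fun x y => by simpa using hU (x ⊗ₜ[ℂ] y)
  have hr : ∀ x y, Z'.rinner (U x) (U y) = Z.rinner x y := fun x y => by
    simp only [← rinnerL_apply]
    refine hd.induction_on x (isClosed_eq (by fun_prop) (by fun_prop)) fun x => ?_
    refine hd.induction_on y (isClosed_eq (by fun_prop) (by fun_prop)) fun y => ?_
    rw [hU, hU]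
    exact rinner_lift h h' x y
  have hls : ∀ a x, U (Z.lsmul a x) = Z'.lsmul a (U x) := fun a x => by
    rw [← sub_eq_zero]
    have := map_mem_of_dense_span (U.toLinearMap.comp (Z.lsmul a) - (Z'.lsmul a).comp U.toLinearMap)
      ((U.continuous.comp (Z.lsmulL a).continuous).sub
        ((Z'.lsmulL a).continuous.comp U.continuous)) h.dense (N := ⊥) (by simp) (by
        rintro _ ⟨x, y, rfl⟩
        change U (Z.lsmul a (m x y)) - Z'.lsmul a (U (m x y)) = 0
        rw [h.lsmul, hUm, hUm, h'.lsmul, sub_self]) x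
    exact this
  have hrs : ∀ x b, U (Z.rsmul x b) = Z'.rsmul (U x) b := fun x b => by
    rw [← sub_eq_zero]
    have := map_mem_of_dense_span (U.toLinearMap.comp (Z.rsmul.flip b) -
        (Z'.rsmul.flip b).comp U.toLinearMap)
      ((U.continuous.comp (Z.rsmulL.flip b).continuous).sub
        ((Z'.rsmulL.flip b).continuous.comp U.continuous)) h.dense (N := ⊥) (by simp) (by
        rintro _ ⟨x, y, rfl⟩
        change U (Z.rsmul (m x y) b) - Z'.rsmul (U (m x y)) b = 0
        rw [h.rsmul, hUm, hUm, h'.rsmul, sub_self]) x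
    exact this
  have hUV : ∀ z, U (V z) = z := fun z =>
    hd'.induction_on z (isClosed_eq (by fun_prop) (by fun_prop)) fun v => by rw [hV, hU]
  have hVU : ∀ z, V (U z) = z := fun z =>
    hd.induction_on z (isClosed_eq (by fun_prop) (by fun_prop)) fun v => by rw [hU, hV]
  -- The left inner product is recovered from the right one, since an element of `E` is determined
  -- by its action on `Z'`.
  have hl : ∀ x y, Z'.linner (U x) (U y) = Z.linner x y := fun x y => Z'.eq_of_lsmul_eq fun z => by
    rw [← hUV z, Z'.linner_lsmul_eq, hr, ← hrs, ← hls, Z.linner_lsmul_eq]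
  exact ⟨⟨LinearEquiv.ofLinearMap U.toLinearMap V.toLinearMap (LinearMap.ext hUV)
    (LinearMap.ext hVU), hls, hrs, hl, hr⟩⟩

end Tensor

end ImprimitivityBimodule

/-! ### The isomorphism of `W(P #_φ Q)` with the balanced tensor product -/

namespace Linking

open CommutingSystem ImprimitivityBimodule

variable {K L G P Q A : Type u}
  [Group K] [TopologicalSpace K] [IsTopologicalGroup K] [LocallyCompactSpace K] [T2Space K]
  [MeasurableSpace K] [BorelSpace K]
  [Group L] [TopologicalSpace L] [IsTopologicalGroup L] [LocallyCompactSpace L] [T2Space L]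
  [MeasurableSpace L] [BorelSpace L]
  [Group G] [TopologicalSpace G] [IsTopologicalGroup G] [LocallyCompactSpace G] [T2Space G]
  [MeasurableSpace G] [BorelSpace G]
  [TopologicalSpace P] [T2Space P] [LocallyCompactSpace P]
  [TopologicalSpace Q] [T2Space Q] [LocallyCompactSpace Q]
  [MulAction K P] [MulAction L P] [MulAction L Q] [MulAction G Q]
  [ProperSMul K P] [ProperSMul L P] [ProperSMul L Q] [ProperSMul G Q]
  [SMulCommClass K L P] [SMulCommClass L G Q]
  [NonUnitalCStarAlgebra A] {D : CommutingSystem K L P A}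
  {E : CommutingSystem L G Q A} {φ : EquivariantHomeo K L G P Q} {σ' : P → Aut A}
  {τ' : Q → Aut A}

theorem transl_lact (hE : E.IsCont) (m : G) (c : C_c(L, E.Ind)) (y : C_c(Q, A)) :
    transl E.η m (lact hE c y) = lact hE c (transl E.η m y) := by
  ext q
  rw [transl_apply, lact_apply, lact_apply, ← integral_aut]
  congr 1
  ext t
  rw [aut_real_smul, map_mul, transl_apply, ← (c t).apply_smul, smul_inv_smul,
    SMulCommClass.smul_comm t⁻¹ m⁻¹ q, aut_comm (E.commute t m)]

theorem rinn_pairing (ℓ : Linking D E φ σ' τ') (hD : D.IsCont) (hE : E.IsCont)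
    (hR : (D.hash E φ ℓ.στ).IsCont) (x x' : C_c(P, A)) (y y' : C_c(Q, A)) (c : C_c(L, E.Ind))
    (hc : ∀ t (z : φ.FibreProduct), c t z.1.2 =
      (τ' z.1.2)⁻¹ ((σ' z.1.1)⁻¹ (rinn hD x x' t z.1.1)))
    (m : G) (z : φ.FibreProduct) :
    (σ' z.1.1)⁻¹ (rinn hR (ℓ.pairing x y) (ℓ.pairing x' y') m (φ.proj z)) =
      rinn hE y (lact hE c y') m z.1.2 := by
  have h := ℓ.transl_pairing m x' y'
  rw [rinn_apply, rinn_apply, Induced.real_smul_apply, Induced.real_smul_apply, aut_real_smul,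
    transl_lact, ← ℓ.yinn_pairing hD hE hR x x' y (transl E.η m y') c hc z, ← h]
  rfl

/-- The transported `W(P # Q)` is itself the tensor product, with the pairing as tensor map. After
the reduction to dense subspaces, what remains is `rinn_pairing` and `pairing_lact`, with `T`, `φσ`,
`φτ` supplying the coefficient functions. -/
theorem exists_isBalancedTensorProduct (ℓ : Linking D E φ σ' τ') (hD : D.IsCont) (hE : E.IsCont)
    (hR : (D.hash E φ ℓ.στ).IsCont) {Φ : D.RightAlg ≃⋆ₐ[ℂ] E.LeftAlg}
    {Φσ : (D.hash E φ ℓ.στ).RightAlg ≃⋆ₐ[ℂ] E.RightAlg}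
    {Φτ : (D.hash E φ ℓ.στ).LeftAlg ≃⋆ₐ[ℂ] D.LeftAlg}
    {T : D.swap.Ind ≃⋆ₐ[ℂ] E.Ind} (hΦ : IsCrossedIso T Φ)
    (hT : ∀ f (z : φ.FibreProduct), T f z.1.2 = (τ' z.1.2)⁻¹ ((σ' z.1.1)⁻¹ (f z.1.1)))
    {φσ : (D.hash E φ ℓ.στ).swap.Ind ≃⋆ₐ[ℂ] E.swap.Ind} (hΦσ : IsCrossedIso φσ Φσ)
    (hφσ : ∀ f (z : φ.FibreProduct), φσ f z.1.2 = (σ' z.1.1)⁻¹ (f (φ.proj z)))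
    {φτ : (D.hash E φ ℓ.στ).Ind ≃⋆ₐ[ℂ] D.Ind} (hΦτ : IsCrossedIso φτ Φτ)
    (hφτ : ∀ f (z : φ.FibreProduct), φτ f z.1.1 = τ' z.1.2 (f (φ.proj z)))
    {WP : ImprimitivityBimodule.{u} D.LeftAlg D.RightAlg} {ιP : C_c(P, A) →ₗ[ℂ] WP.carrier}
    (hP : D.IsW WP ιP)
    {WQ : ImprimitivityBimodule.{u} E.LeftAlg E.RightAlg} {ιQ : C_c(Q, A) →ₗ[ℂ] WQ.carrier}
    (hQ : E.IsW WQ ιQ)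
    {WR : ImprimitivityBimodule.{u} (D.hash E φ ℓ.στ).LeftAlg (D.hash E φ ℓ.στ).RightAlg}
    {ιR : C_c(φ.Hash, A) →ₗ[ℂ] WR.carrier} (hW : (D.hash E φ ℓ.στ).IsW WR ιR) :
    ∃ m, IsBalancedTensorProduct Φ WP WQ (WR.transport Φτ Φσ) m := by
  refine exists_isBalancedTensorProduct_of_dense hP.denseRange hQ.denseRange
    (j := fun c => Φτ (toCP (D.hash E φ ℓ.στ).diag c))
    (Φτ.surjective.denseRange.comp (denseRange_toCP (continuous_diag hR))
      (isometry_starAlgEquiv Φτ).continuous)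
    (ℓ.pairing.compr₂ ιR) (fun x y x' y' => ?_) fun c x => ?_
  · change Φσ (WR.rinner (ιR (ℓ.pairing x y)) (ιR (ℓ.pairing x' y'))) = _
    obtain ⟨c, hc, hc'⟩ := hΦ.2 (rinn hD x x')
    obtain ⟨b, hb, hb'⟩ := hΦσ.2 (rinn hR (ℓ.pairing x y) (ℓ.pairing x' y'))
    rw [hW.rinner_eq hR, hP.rinner_eq hD]
    refine hb'.trans ?_
    have h1 : Φ (toCP D.sw.diag (rinn hD x x')) = toCP E.diag c := hc'
    have h2 : b = rinn hE y (lact hE c y') := by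
      refine DFunLike.ext _ _ fun m => Induced.ext fun q => ?_
      obtain ⟨z, rfl⟩ := φ.isOpenQuotientMap_right.surjective q
      rw [hb]
      refine (hφσ _ z).trans (ℓ.rinn_pairing hD hE hR x x' y y' c (fun t z => ?_) m z)
      rw [hc]
      exact hT _ z
    rw [show WQ.lsmul (Φ (toCP D.sw.diag (rinn hD x x'))) (ιQ y') = ιQ (lact hE c y') by
      rw [h1, hQ.lsmul_eq hE], hQ.rinner_eq hE, h2]
    rfl
  · obtain ⟨c', hc, hc'⟩ := hΦτ.2 c
    refine ⟨lact hD c' x, ?_, fun y => ?_⟩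
    · rw [← hP.lsmul_eq hD]
      exact congrArg (fun a => WP.lsmul a (ιP x)) hc'.symm
    · change WR.lsmul (Φτ.symm (Φτ (toCP (D.hash E φ ℓ.στ).diag c))) (ιR (ℓ.pairing x y)) =
        ιR (ℓ.pairing (lact hD c' x) y)
      rw [StarAlgEquiv.symm_apply_apply, hW.lsmul_eq hR,
        ℓ.pairing_lact hD hR c' c (fun k z => by rw [hc, hφτ])]

end Linking

theorem ImprimitivityBimodule.Iso.of_transport {E E' B B' : Type (u + 1)}
    [NonUnitalCStarAlgebra E] [NonUnitalCStarAlgebra E'] [NonUnitalCStarAlgebra B]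
    [NonUnitalCStarAlgebra B'] {θ : E ≃⋆ₐ[ℂ] E'} {ψ : B ≃⋆ₐ[ℂ] B'}
    {X : ImprimitivityBimodule.{u} E B} {Z : ImprimitivityBimodule.{u} E' B'}
    (h : Nonempty (Iso (StarAlgEquiv.refl (R := ℂ) (A := E'))
      (StarAlgEquiv.refl (R := ℂ) (A := B')) (X.transport θ ψ) Z)) : Nonempty (Iso θ ψ X Z) := by
  obtain ⟨U⟩ := h
  refine ⟨⟨U.toEquiv, fun a x => ?_, fun x b => ?_, U.map_linner, U.map_rinner⟩⟩
  · refine Eq.trans ?_ (U.map_lsmul (θ a) x)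
    change U.toEquiv (X.lsmul a x) = U.toEquiv (X.lsmul (θ.symm (θ a)) x)
    rw [StarAlgEquiv.symm_apply_apply]
  · refine Eq.trans ?_ (U.map_rsmul x (ψ b))
    change U.toEquiv (X.rsmul x b) = U.toEquiv (X.rsmul x (ψ.symm (ψ b)))
    rw [StarAlgEquiv.symm_apply_apply]

end SymImp

end

/-- `D` is `(_K P_L, A, σ, η)` and `E` is `(_L Q_G, A, ζ, τ)`, so `σ = D.σ`, `η = D.η`, `ζ = E.σ`,
`τ = E.η`.  Right actions are recorded by left ones: `p · t` is `t⁻¹ • p`. -/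
theorem mainTheorem3 {K L G P Q A : Type u}
    [Group K] [TopologicalSpace K] [IsTopologicalGroup K] [LocallyCompactSpace K] [T2Space K]
    [MeasurableSpace K] [BorelSpace K]
    [Group L] [TopologicalSpace L] [IsTopologicalGroup L] [LocallyCompactSpace L] [T2Space L]
    [MeasurableSpace L] [BorelSpace L]
    [Group G] [TopologicalSpace G] [IsTopologicalGroup G] [LocallyCompactSpace G] [T2Space G]
    [MeasurableSpace G] [BorelSpace G]
    [TopologicalSpace P] [MulAction K P] [MulAction L P] [SMulCommClass K L P]
    [ContinuousSMul K P] [ContinuousSMul L P]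
    [TopologicalSpace Q] [MulAction L Q] [MulAction G Q] [SMulCommClass L G Q]
    [ContinuousSMul L Q] [ContinuousSMul G Q]
    [NonUnitalCStarAlgebra A]
    (D : CommutingSystem K L P A) (hD : D.IsSymmetricImprimitivityData)
    (E : CommutingSystem L G Q A) (hE : E.IsSymmetricImprimitivityData)
    (φ : EquivariantHomeo K L G P Q)
    (σ' : P → Aut A) (hσ'_cont : ∀ a, Continuous fun p => σ' p a)
    (τ' : Q → Aut A) (hτ'_cont : ∀ a, Continuous fun q => τ' q a)
    (hσ' : ∀ (k : K) (p : P) (t : L), σ' (k • t⁻¹ • p) = D.σ k * σ' p * E.σ t)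
    (hτ' : ∀ (t : L) (q : Q) (m : G), τ' (t • m⁻¹ • q) = D.η t * τ' q * E.η m)
    (hζη : ∀ t r : L, Commute (E.σ t) (D.η r))
    (hζτ' : ∀ (t : L) (q : Q), Commute (E.σ t) (τ' q))
    (hστ' : ∀ (k : K) (q : Q), Commute (D.σ k) (τ' q))
    (hστ : ∀ (k : K) (m : G), Commute (D.σ k) (E.η m))
    (hσ'η : ∀ (p : P) (t : L), Commute (σ' p) (D.η t))
    (hσ'τ' : ∀ (p : P) (q : Q), Commute (σ' p) (τ' q))
    (hσ'τ : ∀ (p : P) (m : G), Commute (σ' p) (E.η m)) :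
    -- `P #_φ Q` with its actions of `K` and `G` is again symmetric imprimitivity data
    (D.hash E φ hστ).IsSymmetricImprimitivityData ∧
    -- the bimodules `W(P)`, `W(Q)` and `W(P # Q)` exist
    (∃ W ι, D.IsW W ι) ∧ (∃ W ι, E.IsW W ι) ∧ (∃ W ι, (D.hash E φ hστ).IsW W ι) ∧
    -- the isomorphisms `Φ`, `Φ_σ`, `Φ_τ` of the coefficient algebras
    ∃ (Φ : D.RightAlg ≃⋆ₐ[ℂ] E.LeftAlg)
      (Φσ : (D.hash E φ hστ).RightAlg ≃⋆ₐ[ℂ] E.RightAlg)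
      (Φτ : (D.hash E φ hστ).LeftAlg ≃⋆ₐ[ℂ] D.LeftAlg),
      (∃ T : D.swap.Ind ≃⋆ₐ[ℂ] E.Ind, IsCrossedIso T Φ ∧
        ∀ f p q, φ.toHomeo (orb K p) = orb G q →
          T f q = (τ' q)⁻¹ ((σ' p)⁻¹ (f p))) ∧
      (∃ φσ : (D.hash E φ hστ).swap.Ind ≃⋆ₐ[ℂ] E.swap.Ind, IsCrossedIso φσ Φσ ∧
        ∀ f p q (h : φ.toHomeo (orb K p) = orb G q),
          φσ f q = (σ' p)⁻¹ (f (φ.cls p q h))) ∧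
      (∃ φτ : (D.hash E φ hστ).Ind ≃⋆ₐ[ℂ] D.Ind, IsCrossedIso φτ Φτ ∧
        ∀ f p q (h : φ.toHomeo (orb K p) = orb G q),
          φτ f p = τ' q (f (φ.cls p q h))) ∧
      -- `W(P # Q) ≅ W(P) ⊗_Φ W(Q)` over `Φ_τ` and `Φ_σ`
      ∀ WP ιP, D.IsW WP ιP → ∀ WQ ιQ, E.IsW WQ ιQ → ∀ WR ιR, (D.hash E φ hστ).IsW WR ιR →
        (∃ Z m, IsBalancedTensorProduct Φ WP WQ Z m) ∧
        ∀ Z m, IsBalancedTensorProduct Φ WP WQ Z m → Nonempty (Iso Φτ Φσ WR Z) := by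
  have := hD.t2Space
  have := hD.locallyCompactSpace
  have := hD.proper_left
  have := hD.proper_right
  have := hE.t2Space
  have := hE.locallyCompactSpace
  have := hE.proper_left
  have := hE.proper_right
  have hR := hD.hash hE φ hστ
  have ℓ : Linking D E φ σ' τ' := ⟨hσ'_cont, hτ'_cont, hσ', hτ', hζη, hζτ', hστ', hστ, hσ'η,
    hσ'τ', hσ'τ⟩
  obtain ⟨T, hT, hTe⟩ := ℓ.exists_T
  obtain ⟨φσ, hφσ, hφσe⟩ := ℓ.exists_φσ
  obtain ⟨φτ, hφτ, hφτe⟩ := ℓ.exists_φτ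
  have hΦ := isCrossedIso_crossedIso (CommutingSystem.continuous_sw_diag hD.isCont)
    (CommutingSystem.continuous_diag hE.isCont) T hTe
  have hΦσ := isCrossedIso_crossedIso (CommutingSystem.continuous_sw_diag hR.isCont)
    (CommutingSystem.continuous_sw_diag hE.isCont) φσ hφσe
  have hΦτ := isCrossedIso_crossedIso (CommutingSystem.continuous_diag hR.isCont)
    (CommutingSystem.continuous_diag hD.isCont) φτ hφτe
  refine ⟨hR, hD.exists_isW, hE.exists_isW, hR.exists_isW, _, _, _,
    ⟨T, hΦ, fun f p q h => hT f ⟨(p, q), h⟩⟩, ⟨φσ, hΦσ, fun f p q h => hφσ f ⟨(p, q), h⟩⟩,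
    ⟨φτ, hΦτ, fun f p q h => hφτ f ⟨(p, q), h⟩⟩, fun WP ιP hP WQ ιQ hQ WR ιR hW => ?_⟩
  obtain ⟨m, hm⟩ := ℓ.exists_isBalancedTensorProduct hD.isCont hE.isCont hR.isCont hΦ hT hΦσ hφσ
    hΦτ hφτ hP hQ hW
  -- The transported `W(P # Q)` gives existence of the tensor product; uniqueness carries the
  -- isomorphism to any other model, and undoing the transport restores `Φτ` and `Φσ`.
  exact ⟨⟨_, m, hm⟩, fun Z m' hm' => Iso.of_transport (hm.nonempty_iso hm')⟩
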